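/- For a positive integer $N$ and an integer $x$ let $|x|_N$ denote the residue of $x$ or $-x$ modulo $N$ that lies in $[0,N/2]$. For a finite set $D$ of positive integers let $$\chi_r(N,D)=\min\{k\ge 1:\ \exists \lambda\in\mathbb Z_N \text{ with } |\lambda d|_N\ge N/k \text{ for each } d\in D\}$$ if $D$ contains no multiple of $N$, and $\chi_r(N,D)=\infty$ otherwise; the regular chromatic number of $D$ is $\chi_r(D)=\liminf_{N\to\infty}\chi_r(N,D)$. Let $\nu_7(d)$ denote the exponent of $7$ in $d$. Theorem. Let $D$ be a set of exactly six positive integers with $\gcd(D)=1$, and let $m=\max_{d\in D}\nu_7(d)$. Then: 1. $\chi_r(D)\le 7$. 2. Unless $m=1$ and exactly five elements of $D$ are not divisible by $7$, there is, with $N=7^{m+1}$, an invertible $\lambda\in\mathbb Z_N$ such that $|\lambda d|_N\ge N/7$ for every $d\in D$. 3. If $m=1$, there is $\lambda\in\mathbb Z_{98}$ such that $|\lambda d|_{98}\ge 98/7$ for every $d\in D$. -/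

import Mathlib

open Filter

noncomputable section

namespace LonelyRunner

/-- `|x|_N`: the residue of `x` or `-x` modulo `N` that lies in `[0, N/2]`. -/
def absMod (N : ℕ) (x : ZMod N) : ℕ := x.valMinAbs.natAbs

/-- `χ_r(N, D)`: the least `k ≥ 1` such that some `l ∈ ℤ_N` satisfies `|l d|_N ≥ N / k` for each
`d ∈ D`, if `D` contains no multiple of `N`; and `∞` otherwise. -/
def regularChromaticMod (N : ℕ) (D : Finset ℕ) : ℕ∞ :=
  open Classical in
  if ∃ d ∈ D, N ∣ d then ⊤
  else ⨅ k ∈ {k : ℕ | 0 < k ∧ ∃ l : ZMod N, ∀ d ∈ D,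
      (N : ℝ) / (k : ℝ) ≤ (absMod N (l * (d : ZMod N)) : ℝ)}, (k : ℕ∞)

/-- `χ_r(D) = liminf_{N → ∞} χ_r(N, D)`. -/
def regularChromatic (D : Finset ℕ) : ℕ∞ :=
  liminf (fun N : ℕ => regularChromaticMod N D) atTop

/-- `max ν_p(D)`, the largest `p`-adic valuation of an element of `D`. -/
def maxVal (p : ℕ) (D : Finset ℕ) : ℕ := D.sup (padicValNat p)

/-- The `p`-level `D_p(i) = {d ∈ D : ν_p(d) = i}`. -/
def level (p : ℕ) (D : Finset ℕ) (i : ℕ) : Finset ℕ := {d ∈ D | padicValNat p d = i}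

end LonelyRunner

end

/-!
The residue `|l d|_N` is at least `N / 7` as soon as the leading base-`7` digit of `l d` modulo
`N = 7 ^ (m + 1)` is neither `0` nor `6`. Multiplication by `1 + 7 ^ (m - k) t` shifts the leading
digits of the elements of valuation `k` at speeds prime to `7` and fixes the elements of higher
valuation (`step_dig`, `step_frozen`). On a level with at most three elements each element forbids
two of the seven shifts, so that some shift makes all of them safe. Processing the levels from the
top down, such levels are no obstacle, and elements of valuation `m` are always safe
(`exists_mid_step`, `Lev.mid`). As there are six elements, one of them of valuation `m` and,
because of the greatest common divisor, one of valuation `0`, at most one level below `m` has four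
or five elements. After division by the power of `7` one has to treat four or five units, and in
the case of four perhaps one more number of intermediate valuation (`exists_mid_of_four_le`).

Up to sign the units belong to the classes `1`, `2`, `3` modulo `7`. The members of one class move
at the same speed under the multipliers `1 + 7 ^ m t`, so that a class lying on a short arc stays
on a short arc. The plan is to gather the members of each class on arcs of few sevenths of the
circle by means of the finer steps, which act on their differences level by level (`gather_four`,
`gather_five`, `gather_three_two`), and then to rotate all classes away from `0` at once; that the
last rotation exists is a matter of finitely many digit patterns (`Solvable.of_arc_three` and the
lemmas around it). The classes may have the sizes `4`, `3 + 1`, `2 + 2`, `2 + 1 + 1`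
(`Solvable.four_units`), or `5`, `4 + 1`, `3 + 2`, `3 + 1 + 1`, `2 + 2 + 1`
(`Solvable.five_units`). If the differences within a class are multiples of `7 ^ m`, gathering is
limited to scaling; then the two leading digits, as positions modulo `49`, have more room, and the
remaining finite statements about positions are decided by computation (`Solvable.of_arc_pos`,
`Solvable.of_pairOk`).

If `m = 1` and five elements are prime to `7`, the modulus `98` takes the place of `49`. When the
element divisible by `7` and some unit have different parity, scaling brings these two to a
standard form, and a search shows that four further units cannot exclude all multipliers
(`exists_mid`). Otherwise all elements are odd and the multiplier `49` works.

The bound for the regular chromatic number follows, because a multiplier modulo `N` gives one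
modulo every multiple of `N` (`regularChromatic_le`).
-/

namespace LonelyRunner

/-! ### Leading digits in base `7` -/

instance fact_prime_seven : Fact (Nat.Prime 7) := ⟨by norm_num⟩

/-- The leading base-`7` digit of `x` modulo `7 ^ (m + 1)`. -/
def dig (m : ℕ) (x : ℤ) : ZMod 7 := ((x / 7 ^ m : ℤ) : ZMod 7)

/-- The leading digit is neither `0` nor `6`; this forces `|x| ≥ 7 ^ m` modulo `7 ^ (m + 1)`. -/
def Safe (m : ℕ) (x : ℤ) : Prop := dig m x ≠ 0 ∧ dig m x ≠ 6

/-- Some multiplier prime to `7` makes every element of the list safe. -/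
def Solvable (m : ℕ) (l : List ℤ) : Prop :=
  ∃ μ : ℤ, ¬ (7 : ℤ) ∣ μ ∧ ∀ x ∈ l, Safe m (μ * x)

theorem zmod_seven_eq_zero (x : ℤ) : ((x : ℤ) : ZMod 7) = 0 ↔ (7 : ℤ) ∣ x := by
  exact_mod_cast ZMod.intCast_zmod_eq_zero_iff_dvd x 7

theorem zmod_seven_ne_zero {x : ℤ} : ((x : ℤ) : ZMod 7) ≠ 0 ↔ ¬ (7 : ℤ) ∣ x :=
  not_congr (zmod_seven_eq_zero x)

theorem not_seven_dvd_mul {a b : ℤ} (ha : ¬ (7 : ℤ) ∣ a) (hb : ¬ (7 : ℤ) ∣ b) :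
    ¬ (7 : ℤ) ∣ a * b := by
  intro h
  rcases (Int.Prime.dvd_mul' (by norm_num : Nat.Prime 7) (by exact_mod_cast h)) with h | h
  · exact ha (by exact_mod_cast h)
  · exact hb (by exact_mod_cast h)

theorem dig_add_mul (m : ℕ) (x k : ℤ) : dig m (x + 7 ^ m * k) = dig m x + k := by
  unfold dig
  rw [Int.add_mul_ediv_left _ _ (by positivity)]
  push_cast; rfl

theorem dig_congr {m : ℕ} {x y : ℤ} (h : x ≡ y [ZMOD 7 ^ (m + 1)]) : dig m x = dig m y := by
  obtain ⟨k, hk⟩ := h.dvd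
  have : y = x + 7 ^ m * (7 * k) := by rw [pow_succ] at hk; linarith
  rw [this, dig_add_mul]
  push_cast
  rw [show (7 : ZMod 7) = 0 from rfl]; ring

theorem dig_mul_pow (m : ℕ) (k : ℤ) : dig m (7 ^ m * k) = k := by
  simp [dig]

/-- Adding two numbers adds their leading digits up to a carry. -/
theorem dig_add (m : ℕ) (x y : ℤ) : dig m (x + y) =
    dig m x + dig m y + if 7 ^ m ≤ x % 7 ^ m + y % 7 ^ m then 1 else 0 := by
  have hr : (0 : ℤ) < 7 ^ m := by positivity
  have h1 : x + y = (x % 7 ^ m + y % 7 ^ m) + 7 ^ m * (x / 7 ^ m + y / 7 ^ m) := by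
    have := Int.mul_ediv_add_emod x (7 ^ m)
    have := Int.mul_ediv_add_emod y (7 ^ m)
    linarith
  have a1 := Int.emod_nonneg x hr.ne'
  have a2 := Int.emod_nonneg y hr.ne'
  have b1 := Int.emod_lt_of_pos x hr
  have b2 := Int.emod_lt_of_pos y hr
  rw [h1, dig_add_mul]
  have h2 : dig m (x % 7 ^ m + y % 7 ^ m) =
      if 7 ^ m ≤ x % 7 ^ m + y % 7 ^ m then 1 else 0 := by
    unfold dig
    split_ifs with h
    · have : (x % 7 ^ m + y % 7 ^ m) / 7 ^ m = 1 := by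
        rw [Int.ediv_eq_iff_of_pos hr]; constructor <;> linarith
      rw [this]; rfl
    · rw [Int.ediv_eq_zero_of_lt (by linarith) (by linarith)]; rfl
  rw [h2]
  unfold dig
  push_cast; ring

theorem emod_eq_dig (m : ℕ) (x : ℤ) :
    x % 7 ^ (m + 1) = 7 ^ m * (dig m x).val + x % 7 ^ m := by
  have h : ((dig m x).val : ℤ) = x / 7 ^ m % 7 := by
    unfold dig; rw [ZMod.val_intCast]; rfl
  have h1 := Int.mul_ediv_add_emod x (7 ^ m)
  have h2 := Int.mul_ediv_add_emod (x / 7 ^ m) 7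
  have hr : (0 : ℤ) < 7 ^ m := by positivity
  have a1 := Int.emod_nonneg x hr.ne'
  have b1 := Int.emod_lt_of_pos x hr
  have a2 := Int.emod_nonneg (x / 7 ^ m) (by norm_num : (7 : ℤ) ≠ 0)
  have b2 := Int.emod_lt_of_pos (x / 7 ^ m) (by norm_num : (0 : ℤ) < 7)
  have e : x = (7 ^ m * (x / 7 ^ m % 7) + x % 7 ^ m) + 7 ^ (m + 1) * (x / 7 ^ m / 7) := by
    calc x = 7 ^ m * (x / 7 ^ m) + x % 7 ^ m := h1.symm
      _ = 7 ^ m * (7 * (x / 7 ^ m / 7) + x / 7 ^ m % 7) + x % 7 ^ m := by rw [h2]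
      _ = _ := by ring
  conv_lhs => rw [e]
  rw [h, Int.add_mul_emod_self_left, Int.emod_eq_of_lt (by positivity)]
  rw [pow_succ]; nlinarith

theorem Safe.bounds {m : ℕ} {x : ℤ} (h : Safe m x) :
    7 ^ m ≤ x % 7 ^ (m + 1) ∧ x % 7 ^ (m + 1) ≤ 6 * 7 ^ m := by
  have hr : (0 : ℤ) < 7 ^ m := by positivity
  have a1 := Int.emod_nonneg x hr.ne'
  have b1 := Int.emod_lt_of_pos x hr
  have e := emod_eq_dig m x
  obtain ⟨h0, h6⟩ := h
  have key : ∀ d : ZMod 7, d ≠ 0 → d ≠ 6 → 1 ≤ d.val ∧ d.val ≤ 5 := by decide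
  obtain ⟨c1, c2⟩ := key _ h0 h6
  have c1' : (1 : ℤ) ≤ (dig m x).val := by exact_mod_cast c1
  have c2' : ((dig m x).val : ℤ) ≤ 5 := by exact_mod_cast c2
  constructor <;> nlinarith

/-- The exclusion of the digit `6` as well as `0` makes safety symmetric: negation maps the digit
`d` to `6 - d`, since the lower part is not zero. -/
theorem Safe.neg {m : ℕ} {x : ℤ} (hx : ¬ (7 : ℤ) ^ m ∣ x) (h : Safe m (-x)) : Safe m x := by
  have hr : (0 : ℤ) < 7 ^ m := by positivity
  have hc := dig_add m x (-x)
  have a1 := Int.emod_nonneg x hr.ne'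
  have a2 : x % 7 ^ m ≠ 0 := fun h => hx (Int.dvd_of_emod_eq_zero h)
  have hs : (-x) % 7 ^ m = 7 ^ m - x % 7 ^ m := by
    have b1 := Int.emod_lt_of_pos x hr
    have a1' : 0 < x % 7 ^ m := lt_of_le_of_ne a1 (Ne.symm a2)
    have : -x = (7 ^ m - x % 7 ^ m) + 7 ^ m * (-(x / 7 ^ m) - 1) := by
      have := Int.mul_ediv_add_emod x (7 ^ m)
      linarith
    rw [this, Int.add_mul_emod_self_left, Int.emod_eq_of_lt (by linarith) (by linarith)]
  rw [hs, if_pos (by linarith)] at hc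
  have h0 : dig m (x + -x) = 0 := by simp [dig]
  rw [h0] at hc
  obtain ⟨h0, h6⟩ := h
  have key : ∀ a b : ZMod 7, 0 = a + b + 1 → b ≠ 0 → b ≠ 6 → a ≠ 0 ∧ a ≠ 6 := by decide
  exact key _ _ hc h0 h6

theorem Solvable.smul {m : ℕ} {l : List ℤ} {μ : ℤ} (hμ : ¬ (7 : ℤ) ∣ μ)
    (h : Solvable m (l.map (μ * ·))) : Solvable m l := by
  obtain ⟨ν, hν, h⟩ := h
  refine ⟨ν * μ, not_seven_dvd_mul hν hμ, fun x hx => ?_⟩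
  rw [mul_assoc]
  exact h _ (List.mem_map_of_mem hx)

theorem Solvable.mono {m : ℕ} {l l' : List ℤ} (hl : ∀ x ∈ l, x ∈ l') (h : Solvable m l') :
    Solvable m l := by
  obtain ⟨ν, hν, h⟩ := h
  exact ⟨ν, hν, fun x hx => h x (hl x hx)⟩

theorem not_pow_dvd_mul {n : ℕ} {μ x : ℤ} (hμ : ¬ (7 : ℤ) ∣ μ) (hx : ¬ (7 : ℤ) ^ n ∣ x) :
    ¬ (7 : ℤ) ^ n ∣ μ * x := by
  have hp : Prime (7 : ℤ) := Nat.prime_iff_prime_int.mp (by norm_num)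
  have hc : IsCoprime ((7 : ℤ) ^ n) μ := ((hp.coprime_iff_not_dvd).2 hμ).pow_left
  exact fun h => hx (hc.dvd_of_dvd_mul_left h)

/-- Elements may be replaced by their negatives. -/
theorem Solvable.of_sign {m : ℕ} {l l' : List ℤ} (hd : ∀ x ∈ l, ¬ (7 : ℤ) ^ m ∣ x)
    (hl : ∀ x ∈ l, x ∈ l' ∨ -x ∈ l') (h : Solvable m l') : Solvable m l := by
  obtain ⟨ν, hν, h⟩ := h
  refine ⟨ν, hν, fun x hx => ?_⟩
  rcases hl x hx with h1 | h1
  · exact h x h1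
  · apply Safe.neg (not_pow_dvd_mul hν (hd x hx))
    rw [← mul_neg]; exact h _ h1

/-- The multiplier `1 + 7 ^ (m - v) k`. For `v < m` it fixes multiples of `7 ^ (v + 1)` modulo
`7 ^ (m + 1)` and moves only the leading digit of numbers of valuation `v`. -/
def step (m v : ℕ) (k : ℤ) : ℤ := 1 + 7 ^ (m - v) * k

theorem step_unit {m v : ℕ} (h : v < m) (k : ℤ) : ¬ (7 : ℤ) ∣ step m v k := by
  intro hd
  have : (7 : ℤ) ∣ 7 ^ (m - v) * k := Dvd.dvd.mul_right (dvd_pow_self _ (by omega)) _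
  have h1 : (7 : ℤ) ∣ 1 := by
    unfold step at hd
    exact (Int.dvd_add_left this).1 hd
  norm_num at h1

theorem step_frozen {m v : ℕ} (h : v ≤ m) (k : ℤ) {q : ℤ} (hq : (7 : ℤ) ^ (v + 1) ∣ q) :
    step m v k * q ≡ q [ZMOD 7 ^ (m + 1)] := by
  obtain ⟨g, rfl⟩ := hq
  refine (Int.modEq_iff_dvd.2 ⟨-(k * g), ?_⟩)
  unfold step
  have : (7 : ℤ) ^ (m + 1) = 7 ^ (m - v) * 7 ^ (v + 1) := by
    rw [← pow_add]; congr 1; omega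
  rw [this]; ring

theorem step_mul {m v : ℕ} (h : v ≤ m) (k g : ℤ) :
    step m v k * (7 ^ v * g) = 7 ^ v * g + 7 ^ m * (k * g) := by
  unfold step
  have : (7 : ℤ) ^ m = 7 ^ (m - v) * 7 ^ v := by rw [← pow_add]; congr 1; omega
  rw [this]; ring

theorem step_dig {m v : ℕ} (h : v ≤ m) (k g : ℤ) :
    dig m (step m v k * (7 ^ v * g)) = dig m (7 ^ v * g) + k * g := by
  rw [step_mul h, dig_add_mul]; push_cast; rfl

theorem step_low {m v : ℕ} (h : v ≤ m) (k g : ℤ) :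
    (step m v k * (7 ^ v * g)) % 7 ^ m = (7 ^ v * g) % 7 ^ m := by
  rw [step_mul h, Int.add_mul_emod_self_left]

/-- `|q| ≤ w 7 ^ m` modulo `7 ^ (m + 1)`: the residue of `q` or of `-q` in `[0, 7 ^ (m + 1))` is at
most `w 7 ^ m`. -/
def Near (m : ℕ) (w : ℤ) (q : ℤ) : Prop :=
  q % 7 ^ (m + 1) ≤ w * 7 ^ m ∨ (-q) % 7 ^ (m + 1) ≤ w * 7 ^ m

/-- The residues of the list lie on an arc of length `w 7 ^ m` of `ℤ / 7 ^ (m + 1)` which starts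
at a member of the list. -/
def Arc (m : ℕ) (w : ℤ) (l : List ℤ) : Prop :=
  ∃ c ∈ l, ∀ x ∈ l, (x - c) % 7 ^ (m + 1) ≤ w * 7 ^ m

theorem Arc.mono {m : ℕ} {w w' : ℤ} {l : List ℤ} (hw : w ≤ w') (h : Arc m w l) : Arc m w' l := by
  obtain ⟨c, hc, h⟩ := h
  refine ⟨c, hc, fun x hx => (h x hx).trans ?_⟩
  have hr : (0 : ℤ) < 7 ^ m := by positivity
  nlinarith

theorem Arc.perm {m : ℕ} {w : ℤ} {l l' : List ℤ} (hl : ∀ x, x ∈ l' ↔ x ∈ l)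
    (h : Arc m w l) : Arc m w l' := by
  obtain ⟨c, hc, h⟩ := h
  exact ⟨c, (hl c).2 hc, fun x hx => h x ((hl x).1 hx)⟩

theorem emod_add_le (a b : ℤ) {N : ℤ} (hN : 0 < N) : (a + b) % N ≤ a % N + b % N := by
  rw [Int.add_emod]
  have a1 := Int.emod_nonneg a hN.ne'
  have a2 := Int.emod_nonneg b hN.ne'
  have h := Int.mul_ediv_add_emod (a % N + b % N) N
  have : 0 ≤ (a % N + b % N) / N := Int.ediv_nonneg (by linarith) hN.le
  nlinarith

theorem Near.congr {m : ℕ} {w q q' : ℤ} (hq : q' ≡ q [ZMOD 7 ^ (m + 1)]) (h : Near m w q) :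
    Near m w q' := by
  have h2 : (-q') % 7 ^ (m + 1) = (-q) % 7 ^ (m + 1) := hq.neg
  unfold Near
  rw [hq, h2]; exact h

theorem Near.mono {m : ℕ} {w w' q : ℤ} (hw : w ≤ w') (h : Near m w q) : Near m w' q := by
  have hr : (0 : ℤ) < 7 ^ m := by positivity
  have : w * 7 ^ m ≤ w' * 7 ^ m := by nlinarith
  exact h.imp (fun h => h.trans this) (fun h => h.trans this)

theorem Near.neg {m : ℕ} {w q : ℤ} (h : Near m w q) : Near m w (-q) := by
  unfold Near; rw [neg_neg]; exact h.symm

theorem Near.arc {m : ℕ} {w x y : ℤ} (hw : 0 ≤ w) (h : Near m w (x - y)) : Arc m w [x, y] := by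
  have hr : (0 : ℤ) < 7 ^ m := by positivity
  rcases h with h | h
  · exact ⟨y, by simp, by simpa using ⟨h, hw⟩⟩
  · rw [neg_sub] at h
    exact ⟨x, by simp, by simpa using ⟨hw, h⟩⟩

theorem emod_lt_of_dig {m : ℕ} {q : ℤ} {w : ℕ} (h : (dig m q).val < w) :
    q % 7 ^ (m + 1) < w * 7 ^ m := by
  have hr : (0 : ℤ) < 7 ^ m := by positivity
  have b1 := Int.emod_lt_of_pos q hr
  rw [emod_eq_dig]
  have : ((dig m q).val : ℤ) + 1 ≤ w := by exact_mod_cast h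
  nlinarith

theorem neg_emod (a : ℤ) {N : ℤ} (hN : 0 < N) (h : a % N ≠ 0) : (-a) % N = N - a % N := by
  have a1 := Int.emod_nonneg a hN.ne'
  have : -a = (N - a % N) + N * (-(a / N) - 1) := by
    have := Int.mul_ediv_add_emod a N
    linarith
  have a2 : 0 < a % N := lt_of_le_of_ne a1 (Ne.symm h)
  rw [this, Int.add_mul_emod_self_left, Int.emod_eq_of_lt]
  · have := Int.emod_lt_of_pos a hN; linarith
  · linarith

theorem neg_emod_le_of_dig {m : ℕ} {q : ℤ} {w : ℕ} (h : 7 ≤ (dig m q).val + w) :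
    (-q) % 7 ^ (m + 1) ≤ w * 7 ^ m := by
  have hr : (0 : ℤ) < 7 ^ m := by positivity
  have hN : (0 : ℤ) < 7 ^ (m + 1) := by positivity
  have a1 := Int.emod_nonneg q hr.ne'
  have e := emod_eq_dig m q
  have h' : (7 : ℤ) ≤ (dig m q).val + w := by exact_mod_cast h
  by_cases h0 : q % 7 ^ (m + 1) = 0
  · rw [Int.emod_eq_zero_of_dvd ((Int.dvd_neg).2 (Int.dvd_of_emod_eq_zero h0))]
    positivity
  · rw [neg_emod _ hN h0, e, pow_succ]
    nlinarith

theorem Near.of_dig {m : ℕ} {q : ℤ} {w : ℕ} (h : (dig m q).val < w ∨ 7 ≤ (dig m q).val + w) :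
    Near m w q :=
  h.imp (fun h => (emod_lt_of_dig h).le) neg_emod_le_of_dig

/-- Points on an arc of length `w 7 ^ m` have leading digits in `w + 1` consecutive classes. -/
theorem Arc.digits {m : ℕ} {w : ℕ} {l : List ℤ} (h : Arc m w l) :
    ∃ t : ZMod 7, ∀ x ∈ l, ∃ s : ℕ, s ≤ w ∧ dig m x = t + s := by
  obtain ⟨c, -, h⟩ := h
  have hr : (0 : ℤ) < 7 ^ m := by positivity
  refine ⟨dig m c, fun x hx => ?_⟩
  have h1 := h x hx
  set y := (x - c) % 7 ^ (m + 1) with hy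
  have hy0 : 0 ≤ y := Int.emod_nonneg _ (by positivity)
  have h2 : dig m x = dig m (c + y) := by
    apply dig_congr
    have := (Int.mod_modEq (x - c) (7 ^ (m + 1))).add_left c
    rw [← hy] at this
    have e : c + (x - c) = x := by ring
    rw [e] at this
    exact this.symm
  have h3 : c / 7 ^ m ≤ (c + y) / 7 ^ m := Int.ediv_le_ediv hr (by linarith)
  have h4 : (c + y) / 7 ^ m ≤ c / 7 ^ m + w := by
    rw [← Int.add_mul_ediv_right _ _ hr.ne']
    exact Int.ediv_le_ediv hr (by linarith)
  refine ⟨((c + y) / 7 ^ m - c / 7 ^ m).toNat, by omega, ?_⟩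
  rw [h2]
  unfold dig
  have : ((((c + y) / 7 ^ m - c / 7 ^ m).toNat : ℕ) : ℤ) = (c + y) / 7 ^ m - c / 7 ^ m :=
    Int.toNat_of_nonneg (by linarith)
  have h5 : ((((c + y) / 7 ^ m - c / 7 ^ m).toNat : ℕ) : ZMod 7)
    = (((((c + y) / 7 ^ m - c / 7 ^ m).toNat : ℕ) : ℤ) : ZMod 7) := by push_cast; rfl
  rw [h5, this]; push_cast; ring

/-- Multipliers `1 + 7 ^ m k` shift the leading digit of `x` by `k x`. -/
theorem Solvable.of_shift {m : ℕ} (hm : 0 < m) {l : List ℤ} (k : ZMod 7)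
    (h : ∀ x ∈ l, dig m x + k * x ≠ 0 ∧ dig m x + k * x ≠ 6) : Solvable m l := by
  refine ⟨step m 0 k.val, step_unit hm _, fun x hx => ?_⟩
  have := step_dig (Nat.zero_le m) k.val x
  rw [pow_zero, one_mul] at this
  unfold Safe
  rw [this]
  simpa using h x hx

theorem exists_inverse (m : ℕ) {u : ℤ} (hu : ¬ (7 : ℤ) ∣ u) :
    ∃ μ : ℤ, ¬ (7 : ℤ) ∣ μ ∧ μ * u ≡ 1 [ZMOD 7 ^ (m + 1)] := by
  have hp : Prime (7 : ℤ) := Nat.prime_iff_prime_int.mp (by norm_num)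
  have hc : IsCoprime ((7 : ℤ) ^ (m + 1)) u := ((hp.coprime_iff_not_dvd).2 hu).pow_left
  obtain ⟨a, b, hab⟩ := hc
  refine ⟨b, fun h => ?_, ?_⟩
  · have : (7 : ℤ) ∣ 1 := by
      rw [← hab]
      exact dvd_add (Dvd.dvd.mul_left (dvd_pow_self _ (by omega)) _) (Dvd.dvd.mul_right h _)
    norm_num at this
  · exact Int.modEq_iff_dvd.2 ⟨a, by linarith⟩

/-- `q` has valuation `v` at `7`. -/
def Lev (v : ℕ) (q : ℤ) : Prop := ∃ g : ℤ, ¬ (7 : ℤ) ∣ g ∧ q = 7 ^ v * g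

theorem Lev.mul {v : ℕ} {q μ : ℤ} (hμ : ¬ (7 : ℤ) ∣ μ) (h : Lev v q) : Lev v (μ * q) := by
  obtain ⟨g, hg, rfl⟩ := h
  exact ⟨μ * g, not_seven_dvd_mul hμ hg, by ring⟩

theorem Lev.neg {v : ℕ} {q : ℤ} (h : Lev v q) : Lev v (-q) := by
  obtain ⟨g, hg, rfl⟩ := h
  exact ⟨-g, by rwa [Int.dvd_neg], by ring⟩

theorem Lev.sub_comm {v : ℕ} {x y : ℤ} (h : Lev v (x - y)) : Lev v (y - x) := by
  simpa using h.neg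

theorem Lev.mul_sub {v : ℕ} {x y μ : ℤ} (hμ : ¬ (7 : ℤ) ∣ μ) (h : Lev v (x - y)) :
    Lev v (μ * x - μ * y) := by
  rw [← _root_.mul_sub]; exact h.mul hμ

theorem Lev.dvd {v w : ℕ} {q : ℤ} (h : Lev v q) (hw : w ≤ v) : (7 : ℤ) ^ w ∣ q := by
  obtain ⟨g, -, rfl⟩ := h
  exact Dvd.dvd.mul_right (pow_dvd_pow _ hw) _

theorem Lev.not_dvd {v : ℕ} {q : ℤ} (h : Lev v q) : ¬ (7 : ℤ) ^ (v + 1) ∣ q := by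
  obtain ⟨g, hg, rfl⟩ := h
  rw [pow_succ]
  intro h
  exact hg (Int.dvd_of_mul_dvd_mul_left (by positivity) h)

theorem Lev.of_dvd {v : ℕ} {q : ℤ} (h : (7 : ℤ) ^ v ∣ q) (h' : ¬ (7 : ℤ) ^ (v + 1) ∣ q) :
    Lev v q := by
  obtain ⟨g, rfl⟩ := h
  refine ⟨g, fun hg => h' ?_, rfl⟩
  rw [pow_succ]; exact mul_dvd_mul_left _ hg

theorem exists_lev {m : ℕ} {q : ℤ} (h : ¬ (7 : ℤ) ^ (m + 1) ∣ q) : ∃ v ≤ m, Lev v q := by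
  induction m with
  | zero => exact ⟨0, le_rfl, Lev.of_dvd (by simp) h⟩
  | succ m ih =>
    by_cases h' : (7 : ℤ) ^ (m + 1) ∣ q
    · exact ⟨m + 1, le_rfl, Lev.of_dvd h' h⟩
    · obtain ⟨v, hv, hl⟩ := ih h'
      exact ⟨v, hv.trans (Nat.le_succ m), hl⟩

theorem Lev.unique {v w : ℕ} {q : ℤ} (h : Lev v q) (h' : Lev w q) : v = w := by
  by_contra hne
  rcases Nat.lt_or_gt_of_ne hne with h1 | h1
  · exact h.not_dvd (h'.dvd h1)
  · exact h'.not_dvd (h.dvd h1)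

/-- Moving the multiplier shifts the digits of several numbers of valuation `v` at once, and
fewer than seven forbidden digits in all can be avoided simultaneously. -/
theorem exists_shift_avoid (l : List (ZMod 7 × ZMod 7 × Finset (ZMod 7)))
    (hg : ∀ p ∈ l, p.2.1 ≠ 0) (h : (l.map fun p => p.2.2.card).sum < 7) :
    ∃ k : ZMod 7, ∀ p ∈ l, p.1 + k * p.2.1 ∉ p.2.2 := by
  classical
  have key : ∀ l : List (ZMod 7 × ZMod 7 × Finset (ZMod 7)), (∀ p ∈ l, p.2.1 ≠ 0) →
      (Finset.univ.filter fun k : ZMod 7 => ∃ p ∈ l, p.1 + k * p.2.1 ∈ p.2.2).card ≤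
        (l.map fun p => p.2.2.card).sum := by
    intro l
    induction l with
    | nil => intro _; simp
    | cons p l ih =>
      intro hg
      have h1 := ih (fun q hq => hg q (List.mem_cons_of_mem _ hq))
      have hp := hg p List.mem_cons_self
      have h2 : (Finset.univ.filter fun k : ZMod 7 => p.1 + k * p.2.1 ∈ p.2.2).card ≤
          p.2.2.card := by
        apply Finset.card_le_card_of_injOn (fun k => p.1 + k * p.2.1)
        · intro k hk; simpa using hk
        · intro a _ b _ hab
          exact mul_right_cancel₀ hp (add_left_cancel hab)
      simp only [List.map_cons, List.sum_cons]
      refine le_trans (Finset.card_le_card ?_) ((Finset.card_union_le _ _).trans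
        (Nat.add_le_add h2 h1))
      intro k hk
      simp only [List.mem_cons, exists_eq_or_imp, Finset.mem_filter, Finset.mem_univ, true_and,
        Finset.mem_union] at hk ⊢
      exact hk
  by_contra hcon
  push Not at hcon
  have h1 := key l hg
  have : (Finset.univ.filter fun k : ZMod 7 => ∃ p ∈ l, p.1 + k * p.2.1 ∈ p.2.2) =
      Finset.univ := by
    ext k; simpa using hcon k
  rw [this] at h1
  have : (Finset.univ : Finset (ZMod 7)).card = 7 := rfl
  omega

theorem step_dig_zmod {m v : ℕ} (h : v ≤ m) (k : ZMod 7) (g : ℤ) :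
    dig m (step m v k.val * (7 ^ v * g)) = dig m (7 ^ v * g) + k * g := by
  rw [step_dig h]; simp

/-- Digits of numbers of valuation `v < m` can be moved simultaneously so as to avoid fewer than
seven forbidden values in all. -/
theorem exists_step_avoid {m v : ℕ} (hv : v < m) (l : List (ℤ × Finset (ZMod 7)))
    (hl : ∀ p ∈ l, Lev v p.1) (h : (l.map fun p => p.2.card).sum < 7) :
    ∃ k : ℤ, ∀ p ∈ l, dig m (step m v k * p.1) ∉ p.2 := by
  obtain ⟨k, hk⟩ := exists_shift_avoid
    (l.map fun p => (dig m p.1, ((p.1 / 7 ^ v : ℤ) : ZMod 7), p.2)) (by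
      intro p hp
      obtain ⟨q, hq, rfl⟩ := List.mem_map.1 hp
      obtain ⟨g, hg, hq⟩ := hl q hq
      simp only [hq]
      rw [Int.mul_ediv_cancel_left _ (by positivity)]
      exact zmod_seven_ne_zero.2 hg) (by simpa [List.map_map, Function.comp_def] using h)
  refine ⟨k.val, fun p hp => ?_⟩
  have := hk _ (List.mem_map_of_mem hp)
  obtain ⟨g, hg, hq⟩ := hl p hp
  simp only [hq] at this
  rw [Int.mul_ediv_cancel_left _ (by positivity)] at this
  rw [hq, step_dig_zmod hv.le]
  exact this

/-- The digit of a number of valuation `v < m` can be prescribed. -/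
theorem exists_step_dig {m v : ℕ} (hv : v < m) {q : ℤ} (hq : Lev v q) (t : ZMod 7) :
    ∃ k : ℤ, dig m (step m v k * q) = t := by
  obtain ⟨k, hk⟩ := exists_step_avoid hv [(q, {t}ᶜ)] (by simpa using hq) (by
    simp [Finset.card_compl])
  exact ⟨k, by simpa using hk⟩

/-- Multiples of `7 ^ m` are called exact: their residue modulo `7 ^ (m + 1)` is given by the
leading digit alone. -/
theorem exact_emod (m : ℕ) (g : ℤ) :
    (7 ^ m * g) % 7 ^ (m + 1) = 7 ^ m * ((g : ZMod 7).val : ℤ) := by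
  rw [emod_eq_dig, dig_mul_pow]; simp

/-! ### Rotating arcs of unit classes -/

/-- A leading digit different from `0` and `6`. -/
abbrev Ok (x : ZMod 7) : Prop := x ≠ 0 ∧ x ≠ 6

/-- Five consecutive digits can be rotated to `1, …, 5`. In the lemmas that follow, a second class
of numbers rotates `ρ` times as fast as the first one. -/
theorem window_five : ∀ t : ZMod 7, ∃ k, ∀ s < 5, Ok (t + (s : ℕ) + k) := by
  decide +kernel

theorem window_four_one : ∀ ρ t u : ZMod 7, ρ ≠ 0 → ρ ≠ 1 → ρ ≠ 6 →
    ∃ k, (∀ s < 4, Ok (t + (s : ℕ) + k)) ∧ Ok (u + k * ρ) := by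
  decide +kernel

set_option synthInstance.maxHeartbeats 200000 in
set_option synthInstance.maxSize 1000 in
theorem window_three_free : ∀ t u u' : ZMod 7, (∃ k, (∀ s < 3, Ok (t + (s : ℕ) + k)) ∧
      Ok (u + k * 2) ∧ Ok (u' + k * 2)) ∧
    ∃ k, (∀ s < 3, Ok (t + (s : ℕ) + k)) ∧ Ok (u + k * 5) ∧ Ok (u' + k * 5) := by
  decide +kernel

theorem window_three_three : ∀ ρ t u : ZMod 7, ρ ≠ 0 → ρ ≠ 1 → ρ ≠ 6 →
    ∃ k, (∀ s < 3, Ok (t + (s : ℕ) + k)) ∧ ∀ s < 3, Ok (u + (s : ℕ) + k * ρ) := by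
  decide +kernel

theorem window_four_two : ∀ ρ t u : ZMod 7, ρ = 3 ∨ ρ = 4 →
    ∃ k, (∀ s < 4, Ok (t + (s : ℕ) + k)) ∧ ∀ s < 2, Ok (u + (s : ℕ) + k * ρ) := by
  decide +kernel

set_option synthInstance.maxHeartbeats 200000 in
set_option synthInstance.maxSize 1000 in
theorem window_two_two_one : ∀ ρ ∈ ({2, 3, 4, 5} : Finset (ZMod 7)),
    ∀ σ ∈ ({2, 3, 4, 5} : Finset (ZMod 7)), σ ≠ ρ → σ ≠ -ρ → ∀ t u v : ZMod 7,
    ∃ k, (∀ s < 2, Ok (t + (s : ℕ) + k)) ∧ (∀ s < 2, Ok (u + (s : ℕ) + k * ρ)) ∧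
      Ok (v + k * σ) := by
  decide +kernel

/-- Numbers divisible by `7` which are already safe. Multipliers `1 + 7 ^ m k` do not move them. -/
def Frozen (m : ℕ) (x : ℤ) : Prop := (7 : ℤ) ∣ x ∧ Safe m x

/-- `Solvable.of_shift` with the speeds measured relative to the class `c`. -/
theorem Solvable.of_rel_shift {m : ℕ} (hm : 0 < m) {c : ZMod 7} {L : List ℤ} (k : ZMod 7)
    (h : ∀ x ∈ L, Frozen m x ∨ Ok (dig m x + k * ((x : ZMod 7) / c))) : Solvable m L := by
  refine Solvable.of_shift hm (k / c) fun x hx => ?_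
  rcases h x hx with ⟨h1, h2⟩ | h1
  · rw [(zmod_seven_eq_zero x).2 h1]; simpa [Safe] using h2
  · rwa [div_mul_eq_mul_div, mul_div_assoc]

/-- The leading digits of the list occupy at most `w + 1` consecutive values. -/
def Window (m w : ℕ) (l : List ℤ) : Prop :=
  ∃ t : ZMod 7, ∀ x ∈ l, ∃ s : ℕ, s ≤ w ∧ dig m x = t + s

theorem Window.ok {m w : ℕ} {l : List ℤ} (h : Window m w l) : ∃ t : ZMod 7, ∀ (k ρ : ZMod 7),
    (∀ s < w + 1, Ok (t + (s : ℕ) + k * ρ)) → ∀ x ∈ l, Ok (dig m x + k * ρ) := by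
  obtain ⟨t, ht⟩ := h
  refine ⟨t, fun k ρ hs x hx => ?_⟩
  obtain ⟨s, hs', e⟩ := ht x hx
  rw [e]; exact hs s (by omega)

theorem Arc.window {m w : ℕ} {l : List ℤ} (h : Arc m w l) : Window m w l := h.digits

theorem zmod_div_ne {c d : ZMod 7} (hc : c ≠ 0) (hd : d ≠ 0) (h1 : d ≠ c) (h2 : d ≠ -c) :
    d / c ≠ 0 ∧ d / c ≠ 1 ∧ d / c ≠ 6 := by
  revert c d; decide +kernel

variable {m : ℕ} {c d : ZMod 7} {L A B : List ℤ}

/-- One class on an arc of length `4 / 7`. -/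
theorem Solvable.of_arc_four (hm : 0 < m) (hc : c ≠ 0) (hA : Arc m 4 A)
    (hcA : ∀ x ∈ A, (x : ZMod 7) = c) (hL : ∀ x ∈ L, Frozen m x ∨ x ∈ A) : Solvable m L := by
  obtain ⟨t, ht⟩ := Window.ok (Arc.window (w := 4) hA)
  obtain ⟨k, hk⟩ := window_five t
  refine Solvable.of_rel_shift hm (c := c) k fun x hx => (hL x hx).imp_right fun h => ?_
  rw [hcA x h, div_self hc]
  exact ht k 1 (by simpa using hk) x h

/-- One class on an arc of length `3 / 7` and one number of another class. -/
theorem Solvable.of_arc_three (hm : 0 < m) (hc : c ≠ 0) (hd : d ≠ 0) (h1 : d ≠ c) (h2 : d ≠ -c)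
    (hA : Arc m 3 A) (hcA : ∀ x ∈ A, (x : ZMod 7) = c) {b : ℤ} (hb : (b : ZMod 7) = d)
    (hL : ∀ x ∈ L, Frozen m x ∨ x ∈ A ∨ x = b) : Solvable m L := by
  obtain ⟨t, ht⟩ := Window.ok (Arc.window (w := 3) hA)
  obtain ⟨e0, e1, e6⟩ := zmod_div_ne hc hd h1 h2
  obtain ⟨k, hk, hk'⟩ := window_four_one (d / c) t (dig m b) e0 e1 e6
  refine Solvable.of_rel_shift hm (c := c) k fun x hx => (hL x hx).imp_right fun h => ?_
  rcases h with h | rfl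
  · rw [hcA x h, div_self hc]
    exact ht k 1 (by simpa using hk) x h
  · rwa [hb]

/-- If the second class is `± 2` times the first one, its two digits may be arbitrary. -/
theorem Solvable.of_arc_two_free (hm : 0 < m) (hc : c ≠ 0) (hd : d = 2 * c ∨ d = 5 * c)
    (hA : Arc m 2 A) (hcA : ∀ x ∈ A, (x : ZMod 7) = c) {b b' : ℤ} (hb : (b : ZMod 7) = d)
    (hb' : (b' : ZMod 7) = d)
    (hL : ∀ x ∈ L, Frozen m x ∨ x ∈ A ∨ x = b ∨ x = b') : Solvable m L := by
  obtain ⟨t, ht⟩ := Window.ok (Arc.window (w := 2) hA)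
  obtain ⟨⟨k, hk, h2, h3⟩, ⟨k', hk', h2', h3'⟩⟩ := window_three_free t (dig m b) (dig m b')
  rcases hd with rfl | rfl
  · refine Solvable.of_rel_shift hm (c := c) k fun x hx => (hL x hx).imp_right fun h => ?_
    rcases h with h | rfl | rfl
    · rw [hcA x h, div_self hc]
      exact ht k 1 (by simpa using hk) x h
    · rwa [hb, mul_div_cancel_right₀ _ hc]
    · rwa [hb', mul_div_cancel_right₀ _ hc]
  · refine Solvable.of_rel_shift hm (c := c) k' fun x hx => (hL x hx).imp_right fun h => ?_
    rcases h with h | rfl | rfl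
    · rw [hcA x h, div_self hc]
      exact ht k' 1 (by simpa using hk') x h
    · rwa [hb, mul_div_cancel_right₀ _ hc]
    · rwa [hb', mul_div_cancel_right₀ _ hc]

/-- Two classes, each on an arc of length `2 / 7`. -/
theorem Solvable.of_arc_two_two (hm : 0 < m) (hc : c ≠ 0) (hd : d ≠ 0) (h1 : d ≠ c) (h2 : d ≠ -c)
    (hA : Arc m 2 A) (hcA : ∀ x ∈ A, (x : ZMod 7) = c)
    (hB : Arc m 2 B) (hcB : ∀ x ∈ B, (x : ZMod 7) = d)
    (hL : ∀ x ∈ L, Frozen m x ∨ x ∈ A ∨ x ∈ B) : Solvable m L := by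
  obtain ⟨t, ht⟩ := Window.ok (Arc.window (w := 2) hA)
  obtain ⟨u, hu⟩ := Window.ok (Arc.window (w := 2) hB)
  obtain ⟨e0, e1, e6⟩ := zmod_div_ne hc hd h1 h2
  obtain ⟨k, hk, hk'⟩ := window_three_three (d / c) t u e0 e1 e6
  refine Solvable.of_rel_shift hm (c := c) k fun x hx => (hL x hx).imp_right fun h => ?_
  rcases h with h | h
  · rw [hcA x h, div_self hc]
    exact ht k 1 (by simpa using hk) x h
  · rw [hcB x h]
    exact hu k _ hk' x h

/-- Two classes with speeds in ratio `± 3`, on arcs of lengths `3 / 7` and `1 / 7`. -/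
theorem Solvable.of_arc_three_one (hm : 0 < m) (hc : c ≠ 0) (hd : d = 3 * c ∨ d = 4 * c)
    (hA : Arc m 3 A) (hcA : ∀ x ∈ A, (x : ZMod 7) = c)
    (hB : Arc m 1 B) (hcB : ∀ x ∈ B, (x : ZMod 7) = d)
    (hL : ∀ x ∈ L, Frozen m x ∨ x ∈ A ∨ x ∈ B) : Solvable m L := by
  obtain ⟨t, ht⟩ := Window.ok (Arc.window (w := 3) hA)
  obtain ⟨u, hu⟩ := Window.ok (Arc.window (w := 1) hB)
  have hr : d / c = 3 ∨ d / c = 4 := by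
    rcases hd with rfl | rfl
    · left; exact mul_div_cancel_right₀ _ hc
    · right; exact mul_div_cancel_right₀ _ hc
  obtain ⟨k, hk, hk'⟩ := window_four_two (d / c) t u hr
  refine Solvable.of_rel_shift hm (c := c) k fun x hx => (hL x hx).imp_right fun h => ?_
  rcases h with h | h
  · rw [hcA x h, div_self hc]
    exact ht k 1 (by simpa using hk) x h
  · rw [hcB x h]
    exact hu k _ hk' x h

/-- Three classes: one with adjacent digits, one on an arc of length `1 / 7` and a single number.
-/
theorem Solvable.of_arc_one_one (hm : 0 < m) {e : ZMod 7} (hc : c ≠ 0) (hd : d ≠ 0) (he : e ≠ 0)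
    (h1 : d ≠ c) (h2 : d ≠ -c) (h3 : e ≠ c) (h4 : e ≠ -c) (h5 : e ≠ d) (h6 : e ≠ -d)
    (hA : Window m 1 A) (hcA : ∀ x ∈ A, (x : ZMod 7) = c)
    (hB : Arc m 1 B) (hcB : ∀ x ∈ B, (x : ZMod 7) = d) {y : ℤ} (hy : (y : ZMod 7) = e)
    (hL : ∀ x ∈ L, Frozen m x ∨ x ∈ A ∨ x ∈ B ∨ x = y) : Solvable m L := by
  obtain ⟨t, ht⟩ := hA.ok
  obtain ⟨u, hu⟩ := Window.ok (Arc.window (w := 1) hB)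
  obtain ⟨e0, e1, e6⟩ := zmod_div_ne hc hd h1 h2
  obtain ⟨f0, f1, f6⟩ := zmod_div_ne hc he h3 h4
  have key : ∀ x : ZMod 7, x ≠ 0 → x ≠ 1 → x ≠ 6 → x ∈ ({2, 3, 4, 5} : Finset (ZMod 7)) := by
    decide
  have g1 : e / c ≠ d / c := fun h => h5 (by field_simp at h; exact h)
  have g2 : e / c ≠ -(d / c) := fun h => h6 (by rw [← neg_div] at h; field_simp at h; exact h)
  obtain ⟨k, hk, hk', hk''⟩ := window_two_two_one (d / c) (key _ e0 e1 e6) (e / c)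
    (key _ f0 f1 f6) g1 g2 t u (dig m y)
  refine Solvable.of_rel_shift hm (c := c) k fun x hx => (hL x hx).imp_right fun h => ?_
  rcases h with h | h | rfl
  · rw [hcA x h, div_self hc]
    exact ht k 1 (by simpa using hk) x h
  · rw [hcB x h]
    exact hu k _ hk' x h
  · rwa [hy]

/-! ### Several points moved by one step -/

/-- More than `b` members of the list satisfy `p`. -/
def moreThan (p : ℕ → Bool) : ℕ → List ℕ → Bool
  | _, [] => false
  | 0, k :: l => p k || moreThan p 0 l
  | b + 1, k :: l => if p k then moreThan p b l else moreThan p (b + 1) l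

/-- The use of `moreThan`: a set `K` of at most `b` values cannot contain all solutions of `p`. -/
theorem moreThan_spec {p : ℕ → Bool} : ∀ (l : List ℕ) {b : ℕ}, moreThan p b l = true → l.Nodup →
    ∀ K : Finset ℕ, K.card ≤ b → ∃ k ∈ l, k ∉ K ∧ p k = true
  | [], b, h, _, _, _ => by cases b <;> simp [moreThan] at h
  | k :: l, 0, h, hn, K, hK => by
    have hK0 : K = ∅ := Finset.card_eq_zero.1 (Nat.le_zero.1 hK)
    simp only [moreThan, Bool.or_eq_true] at h
    rcases h with h | h
    · exact ⟨k, List.mem_cons_self, by simp [hK0], h⟩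
    · obtain ⟨k', h1, h2⟩ := moreThan_spec l h (List.nodup_cons.1 hn).2 K hK
      exact ⟨k', List.mem_cons_of_mem _ h1, h2⟩
  | k :: l, b + 1, h, hn, K, hK => by
    have hn' := List.nodup_cons.1 hn
    simp only [moreThan] at h
    split_ifs at h with hp
    · by_cases hk : k ∈ K
      · obtain ⟨k', h1, h2, h3⟩ := moreThan_spec l h hn'.2 (K.erase k)
          (by rw [Finset.card_erase_of_mem hk]; omega)
        refine ⟨k', List.mem_cons_of_mem _ h1, fun h4 => h2 (Finset.mem_erase.2 ⟨?_, h4⟩), h3⟩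
        rintro rfl; exact hn'.1 h1
      · exact ⟨k, List.mem_cons_self, hk, hp⟩
    · obtain ⟨k', h1, h2⟩ := moreThan_spec l h hn'.2 K hK
      exact ⟨k', List.mem_cons_of_mem _ h1, h2⟩

/-- A condition on the digits of `n` points holds for more than `b` shifts, whatever the initial
digits `t` and the distinct speeds `g`. -/
def Robust (n b : ℕ) (P : (Fin n → ZMod 7) → Prop) : Prop :=
  ∀ t g : Fin n → ZMod 7, Function.Injective g → ∀ K : Finset (ZMod 7), K.card ≤ b →
    ∃ k ∉ K, P fun i => t i + k * g i

/-- Up to an affine change of the shift and a rotation, two of the points may be taken to have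
digits `0` and speeds `0` and `1`. -/
theorem robust_of_normalized {n b : ℕ} {P : (Fin (n + 2) → ZMod 7) → Prop}
    (hP : ∀ t a, P t → P fun i => t i + a)
    (h : ∀ t g : Fin (n + 2) → ZMod 7, Function.Injective g → t 0 = 0 → t 1 = 0 → g 0 = 0 →
      g 1 = 1 → ∀ K : Finset (ZMod 7), K.card ≤ b → ∃ k ∉ K, P fun i => t i + k * g i) :
    Robust (n + 2) b P := by
  intro t g hg K hK
  have hd : g 1 - g 0 ≠ 0 := sub_ne_zero.2 fun h => by simpa using hg h
  have hi : Function.Injective fun i => (g i - g 0) / (g 1 - g 0) := by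
    intro i j hij
    simp only at hij
    exact hg (by simpa using (div_left_inj' hd).1 hij)
  obtain ⟨k, hk, h1⟩ := h (fun i => t i - t 0 - (t 1 - t 0) * ((g i - g 0) / (g 1 - g 0)))
    (fun i => (g i - g 0) / (g 1 - g 0)) hi (by simp) (by simp [div_self hd]) (by simp)
    (by simp [div_self hd]) (K.image fun k => (t 1 - t 0) + k * (g 1 - g 0))
    (Finset.card_image_le.trans hK)
  refine ⟨(k - (t 1 - t 0)) / (g 1 - g 0), fun hk' => hk (Finset.mem_image.2 ⟨_, hk', ?_⟩), ?_⟩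
  · field_simp; ring
  · have := hP _ (t 0 + (k - (t 1 - t 0)) / (g 1 - g 0) * g 0) h1
    convert this using 2 with i
    field_simp; ring

/-- The point of rank `i` lies within `w` units after the point of rank `j`, if `δ` is the
difference of their digits. Points are ranked by their lower parts, so that a difference `δ` of the
digits means a distance in `[δ, δ + 1)` units for `j < i` and in `(δ - 1, δ]` units for `i < j`. -/
def okArc (w j i δ : ℕ) : Bool :=
  Nat.beq i j || (Nat.blt j i && Nat.blt δ w) || (Nat.blt i j && (Nat.ble 1 δ && Nat.ble δ w))

/-- Boolean form of `ArcPattern` for the list of digits. -/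
def arcTest (w : ℕ) (l : List ℕ) : Bool :=
  l.zipIdx.any fun p => l.zipIdx.all fun q => okArc w p.2 q.2 ((q.1 + (7 - p.1)) % 7)

/-- Some point sees all others within `w` units; points are listed by increasing lower part. -/
def ArcPattern (n w : ℕ) (t : Fin n → ZMod 7) : Prop :=
  ∃ j : Fin n, ∀ i : Fin n, okArc w j i (t i - t j).val = true

theorem zmod_val_sub (a b : ZMod 7) : (a.val + (7 - b.val)) % 7 = (a - b).val := by
  revert a b; decide

theorem arcPattern_of_test {n w : ℕ} {t : Fin n → ZMod 7}
    (h : arcTest w (List.ofFn fun i => (t i).val) = true) : ArcPattern n w t := by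
  unfold arcTest at h
  obtain ⟨⟨d, j⟩, hp, h⟩ := List.any_eq_true.1 h
  have h := List.all_eq_true.1 h
  have hp := List.mem_zipIdx_iff_getElem?.1 hp
  rw [List.getElem?_ofFn] at hp
  simp only [Option.dite_none_right_eq_some, Option.some.injEq] at hp
  obtain ⟨hj, hd⟩ := hp
  refine ⟨⟨j, hj⟩, fun i => ?_⟩
  have := h ((t i).val, i) (List.mem_zipIdx_iff_getElem?.2 (by simp))
  simp only at this hd
  rwa [← hd, zmod_val_sub] at this

theorem ArcPattern.shift {n w : ℕ} {t : Fin n → ZMod 7} (a : ZMod 7) (h : ArcPattern n w t) :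
    ArcPattern n w fun i => t i + a := by
  obtain ⟨j, hj⟩ := h
  exact ⟨j, fun i => by simpa using hj i⟩

/-- All digit patterns of the points, whatever the carries caused by a common translation, leave
two adjacent digits free. -/
def GapPattern (n : ℕ) (t : Fin n → ZMod 7) : Prop :=
  ∀ a ≤ n, ∃ u : ZMod 7, ∀ i : Fin n,
    t i + (if a ≤ i then 1 else 0) ≠ u ∧ t i + (if a ≤ i then 1 else 0) ≠ u + 1

/-- Boolean form of `GapPattern` for the list of digits. -/
def gapTest (n : ℕ) (l : List ℕ) : Bool :=
  (List.range (n + 1)).all fun a => (List.range 7).any fun u => l.zipIdx.all fun q =>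
    let d := if Nat.ble a q.2 then (q.1 + 1) % 7 else q.1
    !(Nat.beq d u) && !(Nat.beq d ((u + 1) % 7))

theorem gapPattern_of_test {n : ℕ} {t : Fin n → ZMod 7}
    (h : gapTest n (List.ofFn fun i => (t i).val) = true) : GapPattern n t := by
  intro a ha
  have h := List.all_eq_true.1 h a (List.mem_range.2 (by omega))
  obtain ⟨u, hu, h⟩ := List.any_eq_true.1 h
  refine ⟨(u : ZMod 7), fun i => ?_⟩
  have := List.all_eq_true.1 h ((t i).val, i) (List.mem_zipIdx_iff_getElem?.2 (by simp))
  have hu7 := List.mem_range.1 hu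
  have key : ∀ x : ZMod 7, ∀ u < 7, ∀ b : Bool,
      (!(Nat.beq (if b then (x.val + 1) % 7 else x.val) u) &&
        !(Nat.beq (if b then (x.val + 1) % 7 else x.val) ((u + 1) % 7))) = true →
      x + (if b then 1 else 0) ≠ (u : ZMod 7) ∧ x + (if b then 1 else 0) ≠ (u : ZMod 7) + 1 := by
    decide +kernel
  have h2 := key (t i) u hu7 (Nat.ble a i) this
  have h3 : (if Nat.ble a (i : ℕ) = true then (1 : ZMod 7) else 0) = if a ≤ (i : ℕ) then 1 else 0 := by
    simp only [Nat.ble_eq]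
  rwa [h3] at h2

theorem GapPattern.shift {n : ℕ} {t : Fin n → ZMod 7} (c : ZMod 7) (h : GapPattern n t) :
    GapPattern n fun i => t i + c := by
  intro a ha
  obtain ⟨u, hu⟩ := h a ha
  refine ⟨u + c, fun i => ⟨fun e => (hu i).1 ?_, fun e => (hu i).2 ?_⟩⟩
  · rw [add_right_comm] at e; exact add_right_cancel e
  · rw [add_right_comm, add_right_comm u] at e; exact add_right_cancel e

/-- Evaluation of `Robust 3 b` on the normalized data of `robust_of_normalized`. -/
def check₃ (b : ℕ) (f : List ℕ → Bool) : Bool :=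
  [2, 3, 4, 5, 6].all fun g => (List.range 7).all fun t =>
    moreThan (fun k => f [0, k, (t + k * g) % 7]) b (List.range 7)

/-- Evaluation of `Robust 4 b` on normalized data. -/
def check₄ (b : ℕ) (f : List ℕ → Bool) : Bool :=
  [2, 3, 4, 5, 6].all fun g => [2, 3, 4, 5, 6].all fun g' => Nat.beq g g' ||
    (List.range 7).all fun t => (List.range 7).all fun t' =>
      moreThan (fun k => f [0, k, (t + k * g) % 7, (t' + k * g') % 7]) b (List.range 7)

/-- Evaluation of `Robust 5 b` on normalized data. -/
def check₅ (b : ℕ) (f : List ℕ → Bool) : Bool :=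
  [2, 3, 4, 5, 6].all fun g => [2, 3, 4, 5, 6].all fun g' => Nat.beq g g' ||
    [2, 3, 4, 5, 6].all fun g'' => Nat.beq g g'' || (Nat.beq g' g'' ||
    (List.range 7).all fun t => (List.range 7).all fun t' => (List.range 7).all fun t'' =>
      moreThan (fun k => f [0, k, (t + k * g) % 7, (t' + k * g') % 7, (t'' + k * g'') % 7]) b
        (List.range 7))

theorem zmod_val_mem {x : ZMod 7} (h0 : x ≠ 0) (h1 : x ≠ 1) : x.val ∈ [2, 3, 4, 5, 6] := by
  revert x; decide

theorem zmod_val_lt (x : ZMod 7) : x.val ∈ List.range 7 := List.mem_range.2 (ZMod.val_lt x)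

theorem zmod_val_add_mul (t k g : ZMod 7) : (t.val + k.val * g.val) % 7 = (t + k * g).val := by
  rw [ZMod.val_add, ZMod.val_mul]; simp

theorem beq_val {x y : ZMod 7} (h : x ≠ y) : Nat.beq x.val y.val = false := by
  have : x.val ≠ y.val := fun e => h (ZMod.val_injective 7 e)
  exact Bool.eq_false_iff.2 fun e => this (Nat.eq_of_beq_eq_true e)

/-- Turning an avoided set of residues into an avoided set of natural numbers. -/
theorem exists_of_moreThan {p : ℕ → Bool} {b : ℕ} (h : moreThan p b (List.range 7) = true)
    (K : Finset (ZMod 7)) (hK : K.card ≤ b) : ∃ k ∉ K, p (ZMod.val k) = true := by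
  obtain ⟨k, hk, h1, h2⟩ := moreThan_spec _ h List.nodup_range (K.image ZMod.val)
    (Finset.card_image_le.trans hK)
  have hk7 := List.mem_range.1 hk
  have e : ((k : ZMod 7)).val = k := ZMod.val_natCast_of_lt hk7
  refine ⟨(k : ZMod 7), fun h => h1 (Finset.mem_image.2 ⟨_, h, e⟩), by rwa [e]⟩

theorem robust_three {b : ℕ} {f : List ℕ → Bool} {P : (Fin 3 → ZMod 7) → Prop}
    (hP : ∀ t a, P t → P fun i => t i + a)
    (hf : ∀ t, f (List.ofFn fun i => (t i).val) = true → P t) (h : check₃ b f = true) :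
    Robust 3 b P := by
  refine robust_of_normalized hP fun t g hg t0 t1 g0 g1 K hK => ?_
  have a2 : g 2 ≠ 0 := g0 ▸ hg.ne (by decide)
  have b2 : g 2 ≠ 1 := g1 ▸ hg.ne (by decide)
  have h := List.all_eq_true.1 h _ (zmod_val_mem a2 b2)
  have h := List.all_eq_true.1 h _ (zmod_val_lt (t 2))
  obtain ⟨k, hk, h⟩ := exists_of_moreThan h K hK
  refine ⟨k, hk, hf _ ?_⟩
  rw [zmod_val_add_mul] at h
  simpa [List.ofFn_succ, t0, t1, g0, g1] using h

theorem robust_four {b : ℕ} {f : List ℕ → Bool} {P : (Fin 4 → ZMod 7) → Prop}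
    (hP : ∀ t a, P t → P fun i => t i + a)
    (hf : ∀ t, f (List.ofFn fun i => (t i).val) = true → P t) (h : check₄ b f = true) :
    Robust 4 b P := by
  refine robust_of_normalized hP fun t g hg t0 t1 g0 g1 K hK => ?_
  have a2 : g 2 ≠ 0 := g0 ▸ hg.ne (by decide)
  have b2 : g 2 ≠ 1 := g1 ▸ hg.ne (by decide)
  have a3 : g 3 ≠ 0 := g0 ▸ hg.ne (by decide)
  have b3 : g 3 ≠ 1 := g1 ▸ hg.ne (by decide)
  have h := List.all_eq_true.1 h _ (zmod_val_mem a2 b2)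
  have h := List.all_eq_true.1 h _ (zmod_val_mem a3 b3)
  rw [beq_val (hg.ne (by decide)), Bool.false_or] at h
  have h := List.all_eq_true.1 h _ (zmod_val_lt (t 2))
  have h := List.all_eq_true.1 h _ (zmod_val_lt (t 3))
  obtain ⟨k, hk, h⟩ := exists_of_moreThan h K hK
  refine ⟨k, hk, hf _ ?_⟩
  rw [zmod_val_add_mul, zmod_val_add_mul] at h
  simpa [List.ofFn_succ, t0, t1, g0, g1] using h

theorem robust_five {b : ℕ} {f : List ℕ → Bool} {P : (Fin 5 → ZMod 7) → Prop}
    (hP : ∀ t a, P t → P fun i => t i + a)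
    (hf : ∀ t, f (List.ofFn fun i => (t i).val) = true → P t) (h : check₅ b f = true) :
    Robust 5 b P := by
  refine robust_of_normalized hP fun t g hg t0 t1 g0 g1 K hK => ?_
  have a2 : g 2 ≠ 0 := g0 ▸ hg.ne (by decide)
  have b2 : g 2 ≠ 1 := g1 ▸ hg.ne (by decide)
  have a3 : g 3 ≠ 0 := g0 ▸ hg.ne (by decide)
  have b3 : g 3 ≠ 1 := g1 ▸ hg.ne (by decide)
  have a4 : g 4 ≠ 0 := g0 ▸ hg.ne (by decide)
  have b4 : g 4 ≠ 1 := g1 ▸ hg.ne (by decide)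
  have h := List.all_eq_true.1 h _ (zmod_val_mem a2 b2)
  have h := List.all_eq_true.1 h _ (zmod_val_mem a3 b3)
  rw [beq_val (hg.ne (by decide)), Bool.false_or] at h
  have h := List.all_eq_true.1 h _ (zmod_val_mem a4 b4)
  rw [beq_val (hg.ne (by decide)), Bool.false_or, beq_val (hg.ne (by decide)),
    Bool.false_or] at h
  have h := List.all_eq_true.1 h _ (zmod_val_lt (t 2))
  have h := List.all_eq_true.1 h _ (zmod_val_lt (t 3))
  have h := List.all_eq_true.1 h _ (zmod_val_lt (t 4))
  obtain ⟨k, hk, h⟩ := exists_of_moreThan h K hK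
  refine ⟨k, hk, hf _ ?_⟩
  rw [zmod_val_add_mul, zmod_val_add_mul, zmod_val_add_mul] at h
  simpa [List.ofFn_succ, t0, t1, g0, g1] using h

theorem robust_arc_three_two : Robust 3 0 (ArcPattern 3 2) :=
  robust_three (fun _ a h => h.shift a) (fun _ => arcPattern_of_test)
    (by decide +kernel : check₃ 0 (arcTest 2) = true)

theorem robust_arc_three_three : Robust 3 2 (ArcPattern 3 3) :=
  robust_three (fun _ a h => h.shift a) (fun _ => arcPattern_of_test)
    (by decide +kernel : check₃ 2 (arcTest 3) = true)

theorem robust_arc_four_three : Robust 4 0 (ArcPattern 4 3) :=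
  robust_four (fun _ a h => h.shift a) (fun _ => arcPattern_of_test)
    (by decide +kernel : check₄ 0 (arcTest 3) = true)

theorem robust_gap_four : Robust 4 2 (GapPattern 4) :=
  robust_four (fun _ a h => h.shift a) (fun _ => gapPattern_of_test)
    (by decide +kernel : check₄ 2 (gapTest 4) = true)

theorem robust_arc_five_four : Robust 5 0 (ArcPattern 5 4) :=
  robust_five (fun _ a h => h.shift a) (fun _ => arcPattern_of_test)
    (by decide +kernel : check₅ 0 (arcTest 4) = true)

theorem dig_sub_of_le {m : ℕ} {a b : ℤ} (h : b % 7 ^ m ≤ a % 7 ^ m) :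
    dig m (a - b) = dig m a - dig m b := by
  have hr : (0 : ℤ) < 7 ^ m := by positivity
  have := dig_add m (a - b) b
  have e : (a - b) % 7 ^ m = a % 7 ^ m - b % 7 ^ m := by
    rw [Int.sub_emod, Int.emod_eq_of_lt (by linarith)]
    have := Int.emod_lt_of_pos a hr
    have := Int.emod_nonneg b hr.ne'
    linarith
  rw [e, if_neg (by have := Int.emod_lt_of_pos a hr; linarith), sub_add_cancel, add_zero] at this
  rw [this]; ring

theorem sub_emod_le_of_ge {m w : ℕ} {a b : ℤ} (h : a % 7 ^ m ≤ b % 7 ^ m)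
    (h1 : 1 ≤ (dig m a - dig m b).val) (h2 : (dig m a - dig m b).val ≤ w) :
    (a - b) % 7 ^ (m + 1) ≤ w * 7 ^ m := by
  have hr : (0 : ℤ) < 7 ^ m := by positivity
  set s := dig m a - dig m b
  have hs7 := ZMod.val_lt s
  have e : (a - b) ≡ 7 ^ m * (s.val : ℤ) - (b % 7 ^ m - a % 7 ^ m) [ZMOD 7 ^ (m + 1)] := by
    have h3 : a - b + (b % 7 ^ m - a % 7 ^ m) = 7 ^ m * (a / 7 ^ m - b / 7 ^ m) := by
      have := Int.mul_ediv_add_emod a (7 ^ m)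
      have := Int.mul_ediv_add_emod b (7 ^ m)
      linarith
    have h4 : ((a / 7 ^ m - b / 7 ^ m : ℤ) : ZMod 7) = s := by
      push_cast; rfl
    have h5 := exact_emod m (a / 7 ^ m - b / 7 ^ m)
    rw [← h3, h4] at h5
    have h6 := (Int.mod_modEq (a - b + (b % 7 ^ m - a % 7 ^ m)) (7 ^ (m + 1))).symm
    rw [h5] at h6
    have := h6.sub_right (b % 7 ^ m - a % 7 ^ m)
    rwa [add_sub_cancel_right] at this
  have a1 := Int.emod_nonneg a hr.ne'
  have b1 := Int.emod_lt_of_pos b hr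
  have h1' : (1 : ℤ) ≤ s.val := by exact_mod_cast h1
  have h2' : (s.val : ℤ) ≤ w := by exact_mod_cast h2
  have h7' : (s.val : ℤ) + 1 ≤ 7 := by exact_mod_cast hs7
  rw [e, Int.emod_eq_of_lt (by nlinarith) (by rw [pow_succ]; nlinarith)]
  nlinarith

theorem sub_emod_le_of_okArc {m w i j : ℕ} {a b : ℤ}
    (hij : j ≤ i → b % 7 ^ m ≤ a % 7 ^ m) (hji : i ≤ j → a % 7 ^ m ≤ b % 7 ^ m)
    (he : i = j → a = b) (h : okArc w j i (dig m a - dig m b).val = true) :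
    (a - b) % 7 ^ (m + 1) ≤ w * 7 ^ m := by
  unfold okArc at h
  simp only [Bool.or_eq_true, Bool.and_eq_true, Nat.beq_eq, Nat.blt_eq, Nat.ble_eq] at h
  rcases h with (h | ⟨h, h'⟩) | ⟨h, h', h''⟩
  · rw [he h, sub_self, Int.zero_emod]; positivity
  · rw [← dig_sub_of_le (hij h.le)] at h'
    exact (emod_lt_of_dig h').le
  · exact sub_emod_le_of_ge (hji h.le) h' h''

section points

variable {m v n : ℕ} {x : Fin (n + 1) → ℤ}

/-- Points at pairwise distance of valuation `v`, listed by increasing lower part of the distance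
from a base point, after an arbitrary step. -/
theorem exists_sorted_step (hv : v < m) (hx : ∀ i j, i ≠ j → Lev v (x i - x j)) :
    ∃ (σ : Equiv.Perm (Fin (n + 1))) (t g : Fin (n + 1) → ZMod 7), Function.Injective g ∧
      (∀ (k : ZMod 7) i, dig m (step m v k.val * (x (σ i) - x 0)) = t i + k * g i) ∧
      ∀ (k : ZMod 7) i j, i ≤ j → (step m v k.val * (x (σ i) - x 0)) % 7 ^ m ≤
        (step m v k.val * (x (σ j) - x 0)) % 7 ^ m := by
  have hg : ∀ i, ∃ g, x i - x 0 = 7 ^ v * g := by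
    intro i
    by_cases h : i = 0
    · exact ⟨0, by simp [h]⟩
    · obtain ⟨g, -, hg⟩ := hx i 0 h
      exact ⟨g, hg⟩
  choose g hg using hg
  have hmono := Tuple.monotone_sort fun i => (x i - x 0) % 7 ^ m
  set σ := Tuple.sort fun i => (x i - x 0) % 7 ^ m
  refine ⟨σ, fun i => dig m (x (σ i) - x 0), fun i => (g (σ i) : ZMod 7), ?_, ?_, ?_⟩
  · intro i j hij
    by_contra hne
    obtain ⟨u, hu, hu'⟩ := hx (σ i) (σ j) (fun h => hne (σ.injective h))
    apply hu
    rw [← zmod_seven_eq_zero]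
    have : (7 : ℤ) ^ v * u = 7 ^ v * (g (σ i) - g (σ j)) := by
      rw [← hu', mul_sub, ← hg, ← hg]; ring
    have := mul_left_cancel₀ (by positivity) this
    rw [this]; push_cast; simpa using sub_eq_zero.2 hij
  · intro k i
    simp only [hg]
    exact step_dig_zmod hv.le _ _
  · intro k i j hij
    have := hmono hij
    simp only [Function.comp, hg] at this ⊢
    rwa [step_low hv.le, step_low hv.le]

theorem arc_of_sorted {w : ℕ} {σ : Equiv.Perm (Fin (n + 1))} {t g : Fin (n + 1) → ZMod 7}
    {k : ZMod 7} (hd : ∀ i, dig m (step m v k.val * (x (σ i) - x 0)) = t i + k * g i)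
    (hl : ∀ i j, i ≤ j → (step m v k.val * (x (σ i) - x 0)) % 7 ^ m ≤
      (step m v k.val * (x (σ j) - x 0)) % 7 ^ m)
    (h : ArcPattern (n + 1) w fun i => t i + k * g i) :
    Arc m w (List.ofFn fun i => step m v k.val * x i) := by
  obtain ⟨j, hj⟩ := h
  refine ⟨step m v k.val * x (σ j), (List.mem_ofFn' _ _).2 ⟨_, rfl⟩, fun y hy => ?_⟩
  obtain ⟨i', rfl⟩ := (List.mem_ofFn' _ _).1 hy
  obtain ⟨i, rfl⟩ := σ.surjective i'
  have e : step m v k.val * x (σ i) - step m v k.val * x (σ j) =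
      step m v k.val * (x (σ i) - x 0) - step m v k.val * (x (σ j) - x 0) := by ring
  simp only
  rw [e]
  refine sub_emod_le_of_okArc (i := i) (j := j) (fun h => hl _ _ h) (fun h => hl _ _ h)
    (fun h => by rw [Fin.ext h]) ?_
  rw [hd, hd]
  exact hj i

/-- Points at pairwise distance of valuation `v < m` are moved onto an arc by a step outside a
small set `K` of excluded ones. -/
theorem exists_step_arc_fn {w b : ℕ} (hR : Robust (n + 1) b (ArcPattern (n + 1) w)) (hv : v < m)
    (hx : ∀ i j, i ≠ j → Lev v (x i - x j)) (K : Finset (ZMod 7)) (hK : K.card ≤ b) :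
    ∃ k ∉ K, Arc m w (List.ofFn fun i => step m v k.val * x i) := by
  obtain ⟨σ, t, g, hg, hd, hl⟩ := exists_sorted_step hv hx
  obtain ⟨k, hk, h⟩ := hR t g hg K hK
  exact ⟨k, hk, arc_of_sorted (hd k) (hl k) h⟩

theorem exists_threshold {f : Fin n → ℤ} (hf : Monotone f) (s : ℤ) :
    ∃ a ≤ n, ∀ i : Fin n, s ≤ f i ↔ a ≤ (i : ℕ) := by
  classical
  have hex : ∃ a : ℕ, ∀ i : Fin n, a ≤ (i : ℕ) → s ≤ f i := ⟨n, fun i hi => absurd i.2 (by omega)⟩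
  refine ⟨Nat.find hex, Nat.find_min' hex fun i hi => absurd i.2 (by omega), fun i =>
    ⟨fun h => ?_, fun h => Nat.find_spec hex i h⟩⟩
  exact Nat.find_min' hex fun j hj => h.trans (hf hj)

/-- Points at pairwise distance of valuation `v < m` are moved so that two adjacent digits become
free. The carries caused by adding the base point occur from some rank on. -/
theorem exists_step_gap_fn {b : ℕ} (hR : Robust (n + 1) b (GapPattern (n + 1))) (hv : v < m)
    (hx : ∀ i j, i ≠ j → Lev v (x i - x j)) (K : Finset (ZMod 7)) (hK : K.card ≤ b) :
    ∃ k ∉ K, ∃ u : ZMod 7, ∀ i, dig m (step m v k.val * x i) ≠ u ∧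
      dig m (step m v k.val * x i) ≠ u + 1 := by
  obtain ⟨σ, t, g, hg, hd, hl⟩ := exists_sorted_step hv hx
  obtain ⟨k, hk, hP⟩ := hR t g hg K hK
  set c := step m v k.val * x 0 with hc
  obtain ⟨a, ha, hs⟩ := exists_threshold (f := fun i => (step m v k.val * (x (σ i) - x 0)) % 7 ^ m)
    (fun i j hij => hl k i j hij) (7 ^ m - c % 7 ^ m)
  obtain ⟨u, hu⟩ := hP a ha
  refine ⟨k, hk, u + dig m c, fun i' => ?_⟩
  obtain ⟨i, rfl⟩ := σ.surjective i'
  have e : step m v k.val * x (σ i) = step m v k.val * (x (σ i) - x 0) + c := by rw [hc]; ring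
  have h1 := dig_add m (step m v k.val * (x (σ i) - x 0)) c
  rw [← e, hd k i] at h1
  have h2 : (7 ^ m ≤ (step m v k.val * (x (σ i) - x 0)) % 7 ^ m + c % 7 ^ m) ↔ a ≤ (i : ℕ) := by
    rw [← hs i]; constructor <;> intro h <;> linarith
  simp only [h2] at h1
  rw [h1]
  refine ⟨fun h => (hu i).1 ?_, fun h => (hu i).2 ?_⟩
  · rw [add_right_comm] at h; exact add_right_cancel h
  · rw [add_right_comm, add_right_comm u] at h; exact add_right_cancel h

end points

variable {m v : ℕ}

theorem exists_step_arc_three {w b : ℕ} (hR : Robust 3 b (ArcPattern 3 w)) (hv : v < m)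
    {x y z : ℤ} (h1 : Lev v (x - y)) (h2 : Lev v (x - z)) (h3 : Lev v (y - z))
    (K : Finset (ZMod 7)) (hK : K.card ≤ b) :
    ∃ k ∉ K, Arc m w [step m v k.val * x, step m v k.val * y, step m v k.val * z] := by
  obtain ⟨k, hk, h⟩ := exists_step_arc_fn (x := ![x, y, z]) hR hv (by
    intro i j hij
    fin_cases i <;> fin_cases j <;>
      first | exact absurd rfl hij | assumption | (apply Lev.sub_comm; assumption)) K hK
  exact ⟨k, hk, by simpa [List.ofFn_succ] using h⟩

theorem exists_step_arc_four {w b : ℕ} (hR : Robust 4 b (ArcPattern 4 w)) (hv : v < m)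
    {x y z s : ℤ} (h1 : Lev v (x - y)) (h2 : Lev v (x - z)) (h3 : Lev v (y - z))
    (h4 : Lev v (x - s)) (h5 : Lev v (y - s)) (h6 : Lev v (z - s))
    (K : Finset (ZMod 7)) (hK : K.card ≤ b) :
    ∃ k ∉ K, Arc m w [step m v k.val * x, step m v k.val * y, step m v k.val * z,
      step m v k.val * s] := by
  obtain ⟨k, hk, h⟩ := exists_step_arc_fn (x := ![x, y, z, s]) hR hv (by
    intro i j hij
    fin_cases i <;> fin_cases j <;>
      first | exact absurd rfl hij | assumption | (apply Lev.sub_comm; assumption)) K hK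
  exact ⟨k, hk, by simpa [List.ofFn_succ] using h⟩

theorem exists_step_arc_five {w b : ℕ} (hR : Robust 5 b (ArcPattern 5 w)) (hv : v < m)
    {x y z s t : ℤ} (h1 : Lev v (x - y)) (h2 : Lev v (x - z)) (h3 : Lev v (y - z))
    (h4 : Lev v (x - s)) (h5 : Lev v (y - s)) (h6 : Lev v (z - s))
    (h7 : Lev v (x - t)) (h8 : Lev v (y - t)) (h9 : Lev v (z - t)) (h10 : Lev v (s - t))
    (K : Finset (ZMod 7)) (hK : K.card ≤ b) :
    ∃ k ∉ K, Arc m w [step m v k.val * x, step m v k.val * y, step m v k.val * z,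
      step m v k.val * s, step m v k.val * t] := by
  obtain ⟨k, hk, h⟩ := exists_step_arc_fn (x := ![x, y, z, s, t]) hR hv (by
    intro i j hij
    fin_cases i <;> fin_cases j <;>
      first | exact absurd rfl hij | assumption | (apply Lev.sub_comm; assumption)) K hK
  exact ⟨k, hk, by simpa [List.ofFn_succ] using h⟩

theorem exists_step_gap_four (hv : v < m)
    {x y z s : ℤ} (h1 : Lev v (x - y)) (h2 : Lev v (x - z)) (h3 : Lev v (y - z))
    (h4 : Lev v (x - s)) (h5 : Lev v (y - s)) (h6 : Lev v (z - s))
    (K : Finset (ZMod 7)) (hK : K.card ≤ 2) :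
    ∃ k ∉ K, ∃ u : ZMod 7, ∀ p ∈ [x, y, z, s], dig m (step m v k.val * p) ≠ u ∧
      dig m (step m v k.val * p) ≠ u + 1 := by
  obtain ⟨k, hk, u, h⟩ := exists_step_gap_fn (x := ![x, y, z, s]) robust_gap_four hv (by
    intro i j hij
    fin_cases i <;> fin_cases j <;>
      first | exact absurd rfl hij | assumption | (apply Lev.sub_comm; assumption)) K hK
  refine ⟨k, hk, u, ?_⟩
  simp only [List.mem_cons, List.not_mem_nil, or_false, forall_eq_or_imp, forall_eq]
  exact ⟨h 0, h 1, h 2, h 3⟩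

/-- A class that leaves two adjacent digits free can be rotated so that these become `6` and `0`.
-/
theorem Solvable.of_gap (hm : 0 < m) {c : ZMod 7} (hc : c ≠ 0) {L A : List ℤ}
    (hcA : ∀ x ∈ A, (x : ZMod 7) = c) {u : ZMod 7}
    (hA : ∀ x ∈ A, dig m x ≠ u ∧ dig m x ≠ u + 1)
    (hL : ∀ x ∈ L, Frozen m x ∨ x ∈ A) : Solvable m L := by
  refine Solvable.of_rel_shift hm (c := c) (6 - u) fun x hx => (hL x hx).imp_right fun h => ?_
  rw [hcA x h, div_self hc]
  have key : ∀ d u : ZMod 7, d ≠ u ∧ d ≠ u + 1 → Ok (d + (6 - u) * 1) := by decide +kernel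
  exact key _ _ (hA x h)

/-- Digit conditions on numbers of valuation below `h ≤ m` can be met simultaneously if at each
valuation fewer than seven digits are forbidden in all. The multiplier fixes multiples of `7 ^ h`
modulo `7 ^ (m + 1)`. -/
theorem exists_avoid {m h : ℕ} (hh : h ≤ m) (l : List (ℕ × ℤ × Finset (ZMod 7)))
    (hl : ∀ p ∈ l, p.1 < h ∧ Lev p.1 p.2.1)
    (hs : ∀ v, ((l.filter fun p => p.1 = v).map fun p => p.2.2.card).sum < 7) :
    ∃ μ : ℤ, ¬ (7 : ℤ) ∣ μ ∧ (∀ p ∈ l, dig m (μ * p.2.1) ∉ p.2.2) ∧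
      ∀ q : ℤ, (7 : ℤ) ^ h ∣ q → μ * q ≡ q [ZMOD 7 ^ (m + 1)] := by
  induction h generalizing l with
  | zero =>
    refine ⟨1, by norm_num, fun p hp => absurd (hl p hp).1 (Nat.not_lt_zero _), fun q _ => ?_⟩
    rw [one_mul]
  | succ h ih =>
    obtain ⟨k, hk⟩ := exists_step_avoid (v := h) hh ((l.filter fun p => p.1 = h).map Prod.snd) (by
      intro p hp
      obtain ⟨q, hq, rfl⟩ := List.mem_map.1 hp
      obtain ⟨hq1, hq2⟩ := List.mem_filter.1 hq
      have := (hl q hq1).2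
      rwa [of_decide_eq_true hq2] at this) (by
      have := hs h
      rwa [List.map_map])
    have hu := step_unit (show h < m from hh) k
    obtain ⟨μ, hμ, hd, hf⟩ := ih (by omega)
      ((l.filter fun p => ¬ p.1 = h).map fun p => (p.1, step m h k * p.2.1, p.2.2)) (by
        intro p hp
        obtain ⟨q, hq, rfl⟩ := List.mem_map.1 hp
        obtain ⟨hq1, hq2⟩ := List.mem_filter.1 hq
        have h1 := of_decide_eq_true hq2
        obtain ⟨h2, h3⟩ := hl q hq1
        exact ⟨by simp only; omega, h3.mul hu⟩) (by
        intro v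
        refine lt_of_le_of_lt ?_ (hs v)
        rw [List.filter_map, List.map_map]
        refine List.Sublist.sum_le_sum ?_ (by simp)
        refine List.Sublist.map _ ?_
        simp only [Function.comp_def]
        rw [List.filter_filter]
        apply List.monotone_filter_right
        intro p; simp +contextual)
    refine ⟨μ * step m h k, not_seven_dvd_mul hμ hu, fun p hp => ?_, fun q hq => ?_⟩
    · by_cases hph : p.1 = h
      · have h1 := hf (step m h k * p.2.1) (Dvd.dvd.mul_left ((hl p hp).2.dvd hph.ge) _)
        rw [mul_assoc, dig_congr h1]
        exact hk p.2 (List.mem_map.2 ⟨p, List.mem_filter.2 ⟨hp, by simpa using hph⟩, rfl⟩)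
      · have := hd _ (List.mem_map.2 ⟨p, List.mem_filter.2 ⟨hp, by simpa using hph⟩, rfl⟩)
        rwa [mul_assoc]
    · rw [mul_assoc]
      have h1 : (7 : ℤ) ^ h ∣ q := (pow_dvd_pow _ (Nat.le_succ h)).trans hq
      exact (hf _ (Dvd.dvd.mul_left h1 _)).trans (step_frozen (by omega) k hq)

theorem exists_avoid_one {m h v : ℕ} (hh : h ≤ m) (hv : v < h) {q : ℤ} (hq : Lev v q)
    (B : Finset (ZMod 7)) (hB : B.card < 7) :
    ∃ μ : ℤ, ¬ (7 : ℤ) ∣ μ ∧ dig m (μ * q) ∉ B ∧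
      ∀ q : ℤ, (7 : ℤ) ^ h ∣ q → μ * q ≡ q [ZMOD 7 ^ (m + 1)] := by
  obtain ⟨μ, h1, h2, h3⟩ := exists_avoid hh [(v, q, B)] (by simp [hv, hq]) (by
    intro w
    by_cases hw : v = w <;> simp [hw, hB])
  exact ⟨μ, h1, by simpa using h2, h3⟩

theorem exists_avoid_two {m h v v' : ℕ} (hh : h ≤ m) (hv : v < h) (hv' : v' < h) {q q' : ℤ}
    (hq : Lev v q) (hq' : Lev v' q') (B B' : Finset (ZMod 7)) (hB : B.card < 7)
    (hB' : B'.card < 7) (hs : v = v' → B.card + B'.card < 7) :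
    ∃ μ : ℤ, ¬ (7 : ℤ) ∣ μ ∧ dig m (μ * q) ∉ B ∧ dig m (μ * q') ∉ B' ∧
      ∀ q : ℤ, (7 : ℤ) ^ h ∣ q → μ * q ≡ q [ZMOD 7 ^ (m + 1)] := by
  obtain ⟨μ, h1, h2, h3⟩ := exists_avoid hh [(v, q, B), (v', q', B')] (by simp [hv, hq, hv', hq'])
    (by
      intro w
      by_cases hw : v = w <;> by_cases hw' : v' = w
      · simpa [hw, hw'] using hs (hw.trans hw'.symm)
      all_goals simp [hw, hw', hB, hB'])
  simp only [List.mem_cons, List.not_mem_nil, or_false, forall_eq_or_imp, forall_eq] at h2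
  exact ⟨μ, h1, h2.1, h2.2, h3⟩

/-- Digit conditions become excluded shifts. -/
theorem exists_bad_shifts {m v : ℕ} (hv : v < m) {e : ℤ} (he : Lev v e) (B : Finset (ZMod 7)) :
    ∃ K : Finset (ZMod 7), K.card ≤ B.card ∧ ∀ k ∉ K, dig m (step m v k.val * e) ∉ B := by
  obtain ⟨g, hg, rfl⟩ := he
  have hg' := zmod_seven_ne_zero.2 hg
  refine ⟨B.image fun b => (b - dig m (7 ^ v * g)) / g, Finset.card_image_le, fun k hk hb => hk ?_⟩
  rw [step_dig_zmod hv.le] at hb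
  refine Finset.mem_image.2 ⟨_, hb, ?_⟩
  field_simp; ring

/-! ### Exact quantities -/

theorem Near.of_exact {m w : ℕ} {q : ℤ} (hq : (7 : ℤ) ^ m ∣ q)
    (h : (dig m q).val ≤ w ∨ 7 ≤ (dig m q).val + w) : Near m w q := by
  refine h.imp (fun h => ?_) neg_emod_le_of_dig
  obtain ⟨g, rfl⟩ := hq
  rw [dig_mul_pow] at h
  rw [exact_emod]
  have : (((g : ZMod 7).val : ℕ) : ℤ) ≤ w := by exact_mod_cast h
  nlinarith [show (0 : ℤ) < 7 ^ m by positivity]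

theorem Near.three_of_exact {m : ℕ} {q : ℤ} (hq : (7 : ℤ) ^ m ∣ q) : Near m 3 q :=
  Near.of_exact (w := 3) hq (by omega)

/-- An exact quantity can be scaled to any nonzero leading digit. -/
theorem exists_scale {m : ℕ} {q : ℤ} (hq : Lev m q) {t : ZMod 7} (ht : t ≠ 0) :
    ∃ μ : ℤ, ¬ (7 : ℤ) ∣ μ ∧ dig m (μ * q) = t := by
  obtain ⟨g, hg, rfl⟩ := hq
  have hg' := zmod_seven_ne_zero.2 hg
  have e : (((t / g).val : ℤ) : ZMod 7) = t / g := by simp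
  refine ⟨((t / g).val : ℤ), ?_, ?_⟩
  · rw [← zmod_seven_ne_zero, e]; exact div_ne_zero ht hg'
  · rw [mul_left_comm, dig_mul_pow]
    push_cast at e ⊢
    rw [e]; field_simp

theorem dig_exact_mul {m : ℕ} {q : ℤ} (hq : (7 : ℤ) ^ m ∣ q) (μ : ℤ) :
    dig m (μ * q) = μ * dig m q := by
  obtain ⟨g, rfl⟩ := hq
  rw [mul_left_comm, dig_mul_pow, dig_mul_pow]; push_cast; rfl

theorem emod_of_exact {m : ℕ} {q : ℤ} (hq : (7 : ℤ) ^ m ∣ q) :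
    q % 7 ^ (m + 1) = 7 ^ m * ((dig m q).val : ℤ) := by
  obtain ⟨g, rfl⟩ := hq
  rw [dig_mul_pow, exact_emod]

theorem dig_exact_ne_zero {m : ℕ} {q : ℤ} (hq : Lev m q) : dig m q ≠ 0 := by
  obtain ⟨g, hg, rfl⟩ := hq
  rw [dig_mul_pow]; exact zmod_seven_ne_zero.2 hg

/-- Any distance of the class can be made at most one unit. -/
theorem exists_near {m v : ℕ} (hv : v ≤ m) {q : ℤ} (hq : Lev v q) :
    ∃ μ : ℤ, ¬ (7 : ℤ) ∣ μ ∧ (μ * q) % 7 ^ (m + 1) ≤ 7 ^ m := by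
  rcases hv.lt_or_eq with hv | rfl
  · obtain ⟨k, hk⟩ := exists_step_dig hv hq 0
    refine ⟨_, step_unit hv k, ?_⟩
    have := emod_lt_of_dig (w := 1) (m := m) (q := step m v k * q) (by rw [hk]; decide)
    push_cast at this; linarith
  · obtain ⟨μ, h1, h2⟩ := exists_scale hq (t := 1) (by decide)
    refine ⟨μ, h1, ?_⟩
    rw [emod_of_exact (Dvd.dvd.mul_left (hq.dvd le_rfl) _), h2]
    simp [ZMod.val_one]

/-- Scaling puts up to five exact points on an arc of four units. -/
theorem exists_scale_digits_four : ∀ S : Finset (ZMod 7), S.card ≤ 5 → S.Nonempty →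
    ∃ l : ZMod 7, l ≠ 0 ∧ ∃ t ∈ S, ∀ s ∈ S, (l * (s - t)).val ≤ 4 := by
  decide +kernel

/-- Scaling puts up to three exact points on an arc of three units. -/
theorem exists_scale_digits_three : ∀ S : Finset (ZMod 7), S.card ≤ 3 → S.Nonempty →
    ∃ l : ZMod 7, l ≠ 0 ∧ ∃ t ∈ S, ∀ s ∈ S, (l * (s - t)).val ≤ 3 := by
  decide +kernel

/-- Exact points scale like their digits. -/
theorem exists_arc_of_exact_digits {m w : ℕ} {l : List ℤ} {x₀ : ℤ}
    (hx : ∀ x ∈ l, (7 : ℤ) ^ m ∣ x - x₀)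
    (hw : ∃ a : ZMod 7, a ≠ 0 ∧ ∃ t ∈ l.map (fun x => dig m (x - x₀)),
      ∀ s ∈ l.map (fun x => dig m (x - x₀)), (a * (s - t)).val ≤ w) :
    ∃ μ : ℤ, ¬ (7 : ℤ) ∣ μ ∧ Arc m w (l.map (μ * ·)) := by
  obtain ⟨a, ha, t, ht, h⟩ := hw
  obtain ⟨y, hy, hyt⟩ := List.mem_map.1 ht
  have e : ((a.val : ℤ) : ZMod 7) = a := by simp
  refine ⟨a.val, by rwa [← zmod_seven_ne_zero, e], _, List.mem_map_of_mem hy, fun z hz => ?_⟩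
  obtain ⟨x, hx', rfl⟩ := List.mem_map.1 hz
  have h1 := h _ (List.mem_map_of_mem hx')
  have hxy : (7 : ℤ) ^ m ∣ x - y := by
    have := dvd_sub (hx x hx') (hx y hy)
    rwa [sub_sub_sub_cancel_right] at this
  have h2 : dig m (x - y) = dig m (x - x₀) - t := by
    obtain ⟨p, hp⟩ := hx x hx'
    obtain ⟨q, hq⟩ := hx y hy
    have : x - y = 7 ^ m * (p - q) := by rw [mul_sub, ← hp, ← hq]; ring
    rw [← hyt, this, hp, hq, dig_mul_pow, dig_mul_pow, dig_mul_pow]; push_cast; rfl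
  rw [← mul_sub, emod_of_exact (Dvd.dvd.mul_left hxy _), dig_exact_mul hxy, e, h2]
  have : (((a * (dig m (x - x₀) - t)).val : ℕ) : ℤ) ≤ w := by exact_mod_cast h1
  nlinarith [show (0 : ℤ) < 7 ^ m by positivity]

theorem exists_arc_of_exact {m w : ℕ} {l : List ℤ} {x₀ : ℤ} (hx₀ : x₀ ∈ l)
    (hx : ∀ x ∈ l, (7 : ℤ) ^ m ∣ x - x₀)
    (hw : ∀ S : Finset (ZMod 7), S.card ≤ l.length → S.Nonempty →
      ∃ l : ZMod 7, l ≠ 0 ∧ ∃ t ∈ S, ∀ s ∈ S, (l * (s - t)).val ≤ w) :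
    ∃ μ : ℤ, ¬ (7 : ℤ) ∣ μ ∧ Arc m w (l.map (μ * ·)) := by
  classical
  obtain ⟨a, ha, t, ht, h⟩ := hw ((l.map fun x => dig m (x - x₀)).toFinset)
    ((List.toFinset_card_le _).trans (by simp)) ⟨_, List.mem_toFinset.2 (List.mem_map_of_mem hx₀)⟩
  exact exists_arc_of_exact_digits hx ⟨a, ha, t, List.mem_toFinset.1 ht,
    fun s hs => h s (List.mem_toFinset.2 hs)⟩

theorem Lev.sub_of_lt {a b : ℕ} {p q : ℤ} (hp : Lev a p) (hq : Lev b q) (h : a < b) :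
    Lev a (p - q) := by
  refine Lev.of_dvd (dvd_sub (hp.dvd le_rfl) (hq.dvd h.le)) fun hd => hp.not_dvd ?_
  have := dvd_add hd (hq.dvd h)
  rwa [sub_add_cancel] at this

theorem mem_rotate {x y z p : ℤ} : p ∈ [y, z, x] ↔ p ∈ [x, y, z] :=
  (List.perm_append_comm (l₁ := [y, z]) (l₂ := [x])).mem_iff

theorem mem_swap {x y z p : ℤ} : p ∈ [x, z, y] ↔ p ∈ [x, y, z] :=
  ((List.Perm.swap y z []).cons x).mem_iff

/-- Ultrametric triangles are isosceles. -/
theorem exists_isosceles {m : ℕ} {x y z : ℤ} (h1 : ¬ (7 : ℤ) ^ (m + 1) ∣ x - y)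
    (h2 : ¬ (7 : ℤ) ^ (m + 1) ∣ x - z) (h3 : ¬ (7 : ℤ) ^ (m + 1) ∣ y - z) :
    ∃ a b c v v', v ≤ v' ∧ v' ≤ m ∧ Lev v' (a - b) ∧ Lev v (a - c) ∧ Lev v (b - c) ∧
      ∀ p : ℤ, p ∈ [a, b, c] ↔ p ∈ [x, y, z] := by
  obtain ⟨α, hα, l1⟩ := exists_lev h1
  obtain ⟨β, hβ, l2⟩ := exists_lev h2
  obtain ⟨γ, hγ, l3⟩ := exists_lev h3
  have e1 : β < γ → α = β := fun h => l1.unique (by simpa using l2.sub_of_lt l3 h)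
  have e2 : γ < β → α = γ := fun h => l1.unique (by simpa using (l3.sub_of_lt l2 h).neg)
  have e3 : α < γ → β = α := fun h => l2.unique (by simpa using l1.sub_of_lt l3.neg (by omega))
  have e4 : α < β → γ = α := fun h => l3.unique (by
    have := (l1.sub_of_lt l2 h).neg
    simpa using this)
  rcases le_total β α with h | h
  · rcases le_total γ α with h' | h'
    · have : β = γ := by omega
      subst this
      exact ⟨x, y, z, β, α, h, hα, l1, l2, l3, fun p => Iff.rfl⟩
    · have : α = β := by omega
      subst this
      exact ⟨y, z, x, α, γ, by omega, hγ, l3, l1.sub_comm, l2.sub_comm, fun _ => mem_rotate⟩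
  · rcases le_total γ β with h' | h'
    · have : α = γ := by omega
      subst this
      exact ⟨x, z, y, α, β, h, hβ, l2, l1, l3.sub_comm, fun _ => mem_swap⟩
    · have : α = β := by omega
      subst this
      exact ⟨y, z, x, α, γ, by omega, hγ, l3, l1.sub_comm, l2.sub_comm, fun _ => mem_rotate⟩

theorem pow_pos_seven (m : ℕ) : (0 : ℤ) < 7 ^ m := by positivity

/-- Adding a point whose distance from the base of a pair is at most `s` units. -/
theorem arc_of_base {m : ℕ} {w : ℤ} {c y z : ℤ} (hw : 0 ≤ w)
    (hy : (y - c) % 7 ^ (m + 1) ≤ w * 7 ^ m) (hz : (z - c) % 7 ^ (m + 1) ≤ w * 7 ^ m) :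
    Arc m w [y, c, z] := by
  have := pow_pos_seven m
  refine ⟨c, by simp, ?_⟩
  simp only [List.mem_cons, List.not_mem_nil, or_false, forall_eq_or_imp, forall_eq, sub_self,
    Int.zero_emod]
  exact ⟨hy, by positivity, hz⟩

theorem arc_of_base' {m : ℕ} {w w' : ℤ} {c y z : ℤ} (hw : 0 ≤ w) (hw' : 0 ≤ w')
    (hy : (y - c) % 7 ^ (m + 1) ≤ w * 7 ^ m) (hz : (c - z) % 7 ^ (m + 1) ≤ w' * 7 ^ m) :
    Arc m (w + w') [y, c, z] := by
  have := pow_pos_seven m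
  refine ⟨z, by simp, ?_⟩
  simp only [List.mem_cons, List.not_mem_nil, or_false, forall_eq_or_imp, forall_eq, sub_self,
    Int.zero_emod]
  refine ⟨?_, by nlinarith, by positivity⟩
  have := emod_add_le (y - c) (c - z) (pow_pos_seven (m + 1))
  rw [sub_add_sub_cancel] at this
  nlinarith

theorem emod_congr_mul {m : ℕ} {μ x y : ℤ} (h : μ * (x - y) ≡ x - y [ZMOD 7 ^ (m + 1)]) :
    (μ * x - μ * y) % 7 ^ (m + 1) = (x - y) % 7 ^ (m + 1) := by
  rw [← mul_sub]; exact h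

theorem dig_zero_emod {m : ℕ} {q : ℤ} (h : dig m q = 0) : q % 7 ^ (m + 1) < 7 ^ m := by
  have := emod_lt_of_dig (w := 1) (m := m) (q := q) (by rw [h]; decide)
  push_cast at this; linarith

/-- The second alternative of `Near` swaps the two points. -/
theorem Near.exists_base {m : ℕ} {w x y : ℤ} (h : Near m w (x - y)) :
    ∃ a c, (a - c) % 7 ^ (m + 1) ≤ w * 7 ^ m ∧ (a = x ∧ c = y ∨ a = y ∧ c = x) := by
  rcases h with h | h
  · exact ⟨x, y, h, Or.inl ⟨rfl, rfl⟩⟩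
  · exact ⟨y, x, by rwa [neg_sub] at h, Or.inr ⟨rfl, rfl⟩⟩

/-- Arcs survive multipliers that fix all differences. -/
theorem Arc.fixed {μ w : ℤ} {l : List ℤ} (h : Arc m w l)
    (hf : ∀ x ∈ l, ∀ y ∈ l, μ * (x - y) ≡ x - y [ZMOD 7 ^ (m + 1)]) :
    Arc m w (l.map (μ * ·)) := by
  obtain ⟨c, hc, h⟩ := h
  refine ⟨_, List.mem_map_of_mem hc, fun y hy => ?_⟩
  obtain ⟨x, hx, rfl⟩ := List.mem_map.1 hy
  rw [emod_congr_mul (hf x hx c hc)]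
  exact h x hx

theorem dvd_sub_of_three {d x y z : ℤ} (h1 : d ∣ x - y) (h2 : d ∣ x - z) :
    ∀ p ∈ [x, y, z], ∀ q ∈ [x, y, z], d ∣ p - q := by
  have h3 : d ∣ y - z := by simpa using dvd_sub h2 h1
  simp only [List.mem_cons, List.not_mem_nil, or_false, forall_eq_or_imp, forall_eq, sub_self,
    dvd_zero, true_and, and_true]
  exact ⟨⟨h1, h2⟩, ⟨(dvd_sub_comm).1 h1, h3⟩, (dvd_sub_comm).1 h2, (dvd_sub_comm).1 h3⟩

/-- Equilateral triples on an arc of three units. -/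
theorem exists_triple_arc_equilateral {x y z e : ℤ} {v j : ℕ} (hv : v ≤ m)
    (hxy : Lev v (x - y)) (hxz : Lev v (x - z)) (hyz : Lev v (y - z)) (hj : j < m) (he : Lev j e)
    {K : Finset (ZMod 7)} (hK : K.card ≤ 2) :
    ∃ μ : ℤ, ¬ (7 : ℤ) ∣ μ ∧ Arc m 3 [μ * x, μ * y, μ * z] ∧ dig m (μ * e) ∉ K := by
  have below : ∀ μ : ℤ, ¬ (7 : ℤ) ∣ μ → Arc m 3 [μ * x, μ * y, μ * z] → j < v →
      ∃ μ : ℤ, ¬ (7 : ℤ) ∣ μ ∧ Arc m 3 [μ * x, μ * y, μ * z] ∧ dig m (μ * e) ∉ K := by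
    intro μ hμ hA hjv
    obtain ⟨ν, h1, h2, h4⟩ := exists_avoid_one (m := m) (h := v) hv hjv (he.mul hμ) K (by omega)
    refine ⟨ν * μ, not_seven_dvd_mul h1 hμ, ?_, by rwa [mul_assoc]⟩
    have := hA.fixed fun p hp q hq => h4 _ (dvd_sub_of_three ((hxy.mul_sub hμ).dvd le_rfl)
      ((hxz.mul_sub hμ).dvd le_rfl) p hp q hq)
    simpa only [List.map_cons, List.map_nil, mul_assoc] using this
  rcases hv.lt_or_eq with hvm | rfl
  · rcases lt_trichotomy j v with hjv | rfl | hjv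
    · obtain ⟨k, -, hA⟩ := exists_step_arc_three robust_arc_three_three hvm hxy hxz hyz ∅ (by simp)
      exact below _ (step_unit hvm _) hA hjv
    · obtain ⟨K', hK', hb⟩ := exists_bad_shifts hj he K
      obtain ⟨k, hk, hA⟩ := exists_step_arc_three robust_arc_three_three hvm hxy hxz hyz K'
        (by omega)
      exact ⟨_, step_unit hvm _, hA, hb k hk⟩
    · obtain ⟨k, hk⟩ := exists_step_avoid hj [(e, K)] (by simpa using he) (by simp; omega)
      have hu := step_unit hj k
      obtain ⟨k', -, hA⟩ := exists_step_arc_three robust_arc_three_three hvm (hxy.mul_sub hu)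
        (hxz.mul_sub hu) (hyz.mul_sub hu) ∅ (by simp)
      refine ⟨step m v k'.val * step m j k, not_seven_dvd_mul (step_unit hvm _) hu, ?_, ?_⟩
      · simp only [mul_assoc]; exact hA
      · rw [mul_assoc, dig_congr (step_frozen hvm.le _ ((he.mul hu).dvd hjv))]
        simpa using hk
  · obtain ⟨μ, h1, hA⟩ := exists_arc_of_exact (m := v) (w := 3) (l := [x, y, z]) (x₀ := z) (by simp)
      (by
        simp only [List.mem_cons, List.not_mem_nil, or_false, forall_eq_or_imp, forall_eq]
        exact ⟨hxz.dvd le_rfl, hyz.dvd le_rfl, by simp⟩) exists_scale_digits_three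
    exact below μ h1 hA hj

/-- The third point of an isosceles triple is moved next to the two closest ones. -/
theorem exists_third_arc {a c z e : ℤ} {v j : ℕ} {w : ℤ} (hvm : v < m)
    (hac : (a - c) % 7 ^ (m + 1) ≤ w * 7 ^ m) (hw : w ≤ 3) (hwj : j = v → w ≤ 1)
    (hcz : Lev v (c - z)) (hd : (7 : ℤ) ^ (v + 1) ∣ a - c) (he : Lev j e)
    {K : Finset (ZMod 7)} (hK : K.card ≤ 2) (heK : v < j → dig m e ∉ K) :
    ∃ μ : ℤ, ¬ (7 : ℤ) ∣ μ ∧ Arc m 3 [μ * a, μ * c, μ * z] ∧ dig m (μ * e) ∉ K := by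
  have hr := pow_pos_seven m
  rcases lt_trichotomy j v with hjv | rfl | hjv
  · obtain ⟨μ, h1, h2, h3, h4⟩ := exists_avoid_two (m := m) (h := v + 1) hvm (Nat.lt_succ_self v)
      (by omega) hcz.sub_comm he {0}ᶜ K (by decide) (by omega) (by omega)
    refine ⟨μ, h1, arc_of_base (by norm_num) ?_ ?_, h3⟩
    · rw [emod_congr_mul (h4 _ hd)]; nlinarith
    · rw [← mul_sub]
      linarith [dig_zero_emod (m := m) (by simpa using h2)]
  · obtain ⟨μ, h1, h2, h3, h4⟩ := exists_avoid_two (m := m) (h := j + 1) hvm (Nat.lt_succ_self j)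
      (Nat.lt_succ_self j) hcz.sub_comm he {3, 4} K (by decide) (by omega) (fun _ => by
        have : ({3, 4} : Finset (ZMod 7)).card = 2 := by decide
        omega)
    have key : ∀ d : ZMod 7, d ∉ ({3, 4} : Finset (ZMod 7)) → d.val < 3 ∨ 7 ≤ d.val + 2 := by
      decide
    refine ⟨μ, h1, ?_, h3⟩
    have e1 := emod_congr_mul (h4 _ hd)
    have hw1 := hwj rfl
    rcases key _ h2 with h | h
    · refine arc_of_base (by norm_num) (by rw [e1]; nlinarith) ?_
      rw [← mul_sub]; exact (emod_lt_of_dig h).le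
    · have := arc_of_base' (m := m) (w := 1) (w' := 2) (y := μ * a) (c := μ * c)
        (z := μ * z) (by norm_num) (by norm_num) (by rw [e1]; nlinarith) (by
          have := neg_emod_le_of_dig h
          rwa [← mul_neg, neg_sub, mul_sub] at this)
      exact this
  · obtain ⟨μ, h1, h2, h4⟩ := exists_avoid_one (m := m) (h := v + 1) hvm (Nat.lt_succ_self v)
      hcz.sub_comm {0}ᶜ (by decide)
    refine ⟨μ, h1, arc_of_base (by norm_num) ?_ ?_, ?_⟩
    · rw [emod_congr_mul (h4 _ hd)]
      nlinarith
    · rw [← mul_sub]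
      linarith [dig_zero_emod (m := m) (by simpa using h2)]
    · rw [dig_congr (h4 _ (he.dvd hjv))]; exact heK hjv

/-- A distance of the class becomes at most two units while a further number avoids two digits;
if the valuations differ, one unit is possible. -/
theorem exists_near_avoid {q e : ℤ} {v j : ℕ} (hv : v ≤ m) (hq : Lev v q) (hj : j < m)
    (he : Lev j e) {K : Finset (ZMod 7)} (hK : K.card ≤ 2) :
    ∃ μ : ℤ, ¬ (7 : ℤ) ∣ μ ∧ Near m (if j = v then 2 else 1) (μ * q) ∧ dig m (μ * e) ∉ K := by
  rcases hv.lt_or_eq with hvm | rfl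
  · by_cases hjv : j = v
    · subst hjv
      obtain ⟨μ, h1, h2, h3, -⟩ := exists_avoid_two (h := m) le_rfl hvm hj hq he {2, 3, 4} K
        (by decide) (by omega) (fun _ => by
          have : ({2, 3, 4} : Finset (ZMod 7)).card = 3 := by decide
          omega)
      refine ⟨μ, h1, ?_, h3⟩
      rw [if_pos rfl]
      have key : ∀ d : ZMod 7, d ∉ ({2, 3, 4} : Finset (ZMod 7)) → d.val < 2 ∨ 7 ≤ d.val + 2 := by
        decide
      exact Near.of_dig (w := 2) (key _ h2)
    · obtain ⟨μ, h1, h2, h3, -⟩ := exists_avoid_two (h := m) le_rfl hvm hj hq he {0}ᶜ K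
        (by decide) (by omega) (fun h => absurd h.symm hjv)
      refine ⟨μ, h1, ?_, h3⟩
      rw [if_neg hjv]
      exact Or.inl (by rw [one_mul]; exact (dig_zero_emod (by simpa using h2)).le)
  · obtain ⟨μ, h1, h2⟩ := exists_near le_rfl hq
    rw [if_neg hj.ne]
    obtain ⟨ν, h3, h4, h5⟩ := exists_avoid_one (h := v) le_rfl hj (he.mul h1) K (by omega)
    refine ⟨ν * μ, not_seven_dvd_mul h3 h1, Or.inl ?_, by rwa [mul_assoc]⟩
    rw [mul_assoc, h5 _ ((hq.mul h1).dvd le_rfl), one_mul]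
    exact h2

/-- A triple of the class can be put on an arc of three units while a further number of
valuation below `m` avoids two digits. -/
theorem exists_triple_arc_isosceles {x y z e : ℤ} {v v' j : ℕ} (hvv : v ≤ v') (hv' : v' ≤ m)
    (hxy : Lev v' (x - y)) (hxz : Lev v (x - z)) (hyz : Lev v (y - z)) (hj : j < m) (he : Lev j e)
    {K : Finset (ZMod 7)} (hK : K.card ≤ 2) :
    ∃ μ : ℤ, ¬ (7 : ℤ) ∣ μ ∧ Arc m 3 [μ * x, μ * y, μ * z] ∧ dig m (μ * e) ∉ K := by
  rcases hvv.lt_or_eq with hlt | rfl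
  · obtain ⟨μ₁, hμ₁, hn, he₁⟩ := exists_near_avoid hv' hxy hj he hK
    rw [mul_sub] at hn
    obtain ⟨a, c, hac, hor⟩ := hn.exists_base
    have hcz : Lev v (c - μ₁ * z) := by
      rcases hor with ⟨-, rfl⟩ | ⟨-, rfl⟩
      · exact hyz.mul_sub hμ₁
      · exact hxz.mul_sub hμ₁
    have hac' : Lev v' (a - c) := by
      rcases hor with ⟨rfl, rfl⟩ | ⟨rfl, rfl⟩
      · exact hxy.mul_sub hμ₁
      · exact (hxy.mul_sub hμ₁).sub_comm
    obtain ⟨μ, hμ, hA, hd⟩ := exists_third_arc (lt_of_lt_of_le hlt hv') hac (by split_ifs <;> norm_num)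
      (fun h => by rw [if_neg (by omega)]) hcz (hac'.dvd hlt) (he.mul hμ₁) hK (fun _ => he₁)
    refine ⟨μ * μ₁, not_seven_dvd_mul hμ hμ₁, ?_, by rwa [mul_assoc]⟩
    simp only [mul_assoc]
    rcases hor with ⟨rfl, rfl⟩ | ⟨rfl, rfl⟩
    · exact hA
    · exact hA.perm (fun p => by
        simp only [List.mem_cons, List.not_mem_nil, or_false]; tauto)
  · exact exists_triple_arc_equilateral hv' hxy hxz hyz hj he hK

theorem exists_triple_arc {x y z e : ℤ} {j : ℕ} (h1 : ¬ (7 : ℤ) ^ (m + 1) ∣ x - y)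
    (h2 : ¬ (7 : ℤ) ^ (m + 1) ∣ x - z) (h3 : ¬ (7 : ℤ) ^ (m + 1) ∣ y - z) (hj : j < m)
    (he : Lev j e) {K : Finset (ZMod 7)} (hK : K.card ≤ 2) :
    ∃ μ : ℤ, ¬ (7 : ℤ) ∣ μ ∧ Arc m 3 [μ * x, μ * y, μ * z] ∧ dig m (μ * e) ∉ K := by
  obtain ⟨a, b, c, v, v', hvv, hv', l1, l2, l3, hp⟩ := exists_isosceles h1 h2 h3
  obtain ⟨μ, hμ, hA, hd⟩ := exists_triple_arc_isosceles hvv hv' l1 l2 l3 hj he hK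
  refine ⟨μ, hμ, ?_, hd⟩
  have : Arc m 3 ([a, b, c].map (μ * ·)) := hA
  exact this.perm fun p => by
    have e1 : [μ * x, μ * y, μ * z] = [x, y, z].map (μ * ·) := rfl
    rw [e1, List.mem_map, List.mem_map]
    simp only [hp]

/-! ### Moving the two leading digits -/

/-- The two leading base-`7` digits of `x` modulo `7 ^ (n + 2)`, as one number modulo `49`. -/
def pos (n : ℕ) (x : ℤ) : ZMod 49 := ((x / 7 ^ n : ℤ) : ZMod 49)

/-- A position modulo `49` whose leading digit is neither `0` nor `6`. -/
def good (p : ℕ) : Bool := Nat.ble 7 p && Nat.blt p 42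

theorem dig_eq_pos (n : ℕ) (x : ℤ) : dig (n + 1) x = (((pos n x).val / 7 : ℕ) : ZMod 7) := by
  have h : ((pos n x).val : ℤ) = x / 7 ^ n % 49 := by
    unfold pos; rw [ZMod.val_intCast]; rfl
  have h1 : (((pos n x).val / 7 : ℕ) : ℤ) = x / 7 ^ n / 7 % 7 := by
    push_cast; rw [h]; omega
  have h2 : (((pos n x).val / 7 : ℕ) : ZMod 7) = ((((pos n x).val / 7 : ℕ) : ℤ) : ZMod 7) := by
    push_cast; rfl
  rw [h2, h1]
  unfold dig
  rw [pow_succ, ← Int.ediv_ediv_of_nonneg (by positivity)]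
  exact_mod_cast (ZMod.intCast_mod (x / 7 ^ n / 7) 7).symm

theorem safe_of_good {n : ℕ} {x : ℤ} (h : good (pos n x).val = true) : Safe (n + 1) x := by
  unfold Safe
  rw [dig_eq_pos]
  have := ZMod.val_lt (pos n x)
  revert this h
  generalize (pos n x).val = p
  intro h hp
  have key : ∀ p < 49, good p = true →
      ((p / 7 : ℕ) : ZMod 7) ≠ 0 ∧ ((p / 7 : ℕ) : ZMod 7) ≠ 6 := by decide +kernel
  exact key p hp h

theorem pos_mul (n : ℕ) (k : ZMod 49) (x : ℤ) :
    pos n ((1 + 7 ^ n * k.val) * x) = pos n x + k * x := by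
  have e : (1 + 7 ^ n * (k.val : ℤ)) * x = x + 7 ^ n * (k.val * x) := by ring
  unfold pos
  rw [e, Int.add_mul_ediv_left _ _ (by positivity)]
  push_cast
  simp

theorem Solvable.of_pos_shift {n : ℕ} (hn : 0 < n) {L : List ℤ} (k : ZMod 49)
    (h : ∀ x ∈ L, ((49 : ℤ) ∣ x ∧ Safe (n + 1) x) ∨ good (pos n x + k * x).val = true) :
    Solvable (n + 1) L := by
  refine ⟨1 + 7 ^ n * k.val, fun hd => ?_, fun x hx => ?_⟩
  · have h1 : (7 : ℤ) ∣ 7 ^ n * k.val := Dvd.dvd.mul_right (dvd_pow_self _ hn.ne') _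
    have := (Int.dvd_add_left h1).1 hd
    norm_num at this
  · rcases h x hx with ⟨⟨y, rfl⟩, h2⟩ | h1
    · have : dig (n + 1) ((1 + 7 ^ n * k.val) * (49 * y)) = dig (n + 1) (49 * y) :=
        dig_congr (Int.modEq_iff_dvd.2 ⟨-(k.val * y), by ring⟩)
      unfold Safe at h2 ⊢
      rwa [this]
    · apply safe_of_good
      rwa [pos_mul]

/-- Points on an arc of `w` units occupy `7 w + 1` consecutive positions. -/
theorem Arc.positions {n w : ℕ} {l : List ℤ} (h : Arc (n + 1) w l) :
    ∃ t : ZMod 49, ∀ x ∈ l, ∃ s : ℕ, s ≤ 7 * w ∧ pos n x = t + s := by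
  obtain ⟨c, -, h⟩ := h
  have hr : (0 : ℤ) < 7 ^ n := by positivity
  refine ⟨pos n c, fun x hx => ?_⟩
  have h1 := h x hx
  set y := (x - c) % 7 ^ (n + 1 + 1) with hy
  have hy0 : 0 ≤ y := Int.emod_nonneg _ (by positivity)
  have h2 : pos n x = pos n (c + y) := by
    have h3 := Int.mul_ediv_add_emod (x - c) (7 ^ (n + 1 + 1))
    have : x = c + y + 7 ^ n * (49 * ((x - c) / 7 ^ (n + 1 + 1))) := by
      have e : (7 : ℤ) ^ (n + 1 + 1) = 7 ^ n * 49 := by ring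
      rw [← hy] at h3
      rw [e] at h3 ⊢
      linarith
    unfold pos
    conv_lhs => rw [this]
    rw [Int.add_mul_ediv_left _ _ hr.ne']
    push_cast
    rw [show (49 : ZMod 49) = 0 from rfl]; ring
  have h3 : c / 7 ^ n ≤ (c + y) / 7 ^ n := Int.ediv_le_ediv hr (by linarith)
  have h4 : (c + y) / 7 ^ n ≤ c / 7 ^ n + 7 * w := by
    rw [← Int.add_mul_ediv_right _ _ hr.ne']
    refine Int.ediv_le_ediv hr ?_
    rw [pow_succ] at h1
    linarith
  refine ⟨((c + y) / 7 ^ n - c / 7 ^ n).toNat, by omega, ?_⟩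
  rw [h2]
  unfold pos
  have : ((((c + y) / 7 ^ n - c / 7 ^ n).toNat : ℕ) : ℤ) = (c + y) / 7 ^ n - c / 7 ^ n :=
    Int.toNat_of_nonneg (by linarith)
  have h5 : ((((c + y) / 7 ^ n - c / 7 ^ n).toNat : ℕ) : ZMod 49)
    = (((((c + y) / 7 ^ n - c / 7 ^ n).toNat : ℕ) : ℤ) : ZMod 49) := by push_cast; rfl
  rw [h5, this]; push_cast; ring

theorem zmod_fortynine_val_mod (x : ℤ) : (x : ZMod 49).val % 7 = (x : ZMod 7).val := by
  have h1 : ((x : ZMod 49).val : ℤ) = x % 49 := by rw [ZMod.val_intCast]; rfl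
  have h2 : ((x : ZMod 7).val : ℤ) = x % 7 := by rw [ZMod.val_intCast]; rfl
  omega

theorem zmod_fortynine_eq {x y : ℤ} : (x : ZMod 49) = y ↔ (49 : ℤ) ∣ x - y := by
  rw [← sub_eq_zero, ← Int.cast_sub]
  exact_mod_cast ZMod.intCast_zmod_eq_zero_iff_dvd (x - y) 49

/-- Ratios modulo `49`. -/
theorem exists_ratio {a : ℤ} (ha : ¬ (7 : ℤ) ∣ a) :
    ∃ a' : ℤ, ((a' : ℤ) : ZMod 49) * a = 1 ∧ ((a' : ℤ) : ZMod 7) = 1 / (a : ZMod 7) := by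
  obtain ⟨a', -, h⟩ := exists_inverse 1 ha
  have h1 : ((a' * a : ℤ) : ZMod 49) = ((1 : ℤ) : ZMod 49) :=
    zmod_fortynine_eq.2 (by have := h.symm.dvd; simpa using this)
  have h2 : ((a' * a : ℤ) : ZMod 7) = ((1 : ℤ) : ZMod 7) := by
    rw [← sub_eq_zero, ← Int.cast_sub, zmod_seven_eq_zero]
    exact (Dvd.intro _ (by norm_num : (7 : ℤ) * 7 = 7 ^ (1 + 1))).trans h.symm.dvd
  push_cast at h1 h2
  refine ⟨a', h1, ?_⟩
  rw [eq_div_iff (zmod_seven_ne_zero.2 ha)]; exact h2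

/-- An arc of `w ≤ 4` units of points congruent to `a` modulo `49`, together with further numbers:
it suffices to find a good position for the further numbers among the `35 - 7 w` shifts which are
good for the arc. -/
theorem Solvable.of_arc_pos {n w : ℕ} (hn : 0 < n) {A L : List ℤ} {a : ℤ} (ha : ¬ (7 : ℤ) ∣ a)
    (hA : Arc (n + 1) w A) (hA' : ∀ x ∈ A, (49 : ℤ) ∣ x - a) {P : ℤ → Prop}
    (h : ∀ t a' : ZMod 49, a' * a = 1 → ∃ i < 35 - 7 * w, ∀ x, P x →
      good (pos n x + (t + ((7 + i : ℕ) : ZMod 49)) * (a' * x)).val = true)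
    (hL : ∀ x ∈ L, ((49 : ℤ) ∣ x ∧ Safe (n + 1) x) ∨ x ∈ A ∨ P x) : Solvable (n + 1) L := by
  obtain ⟨t, ht⟩ := hA.positions
  obtain ⟨a', ha', -⟩ := exists_ratio ha
  obtain ⟨i, hi, h⟩ := h (-t) a' ha'
  refine Solvable.of_pos_shift hn ((-t + ((7 + i : ℕ) : ZMod 49)) * a') fun x hx =>
    (hL x hx).imp_right fun hx => ?_
  rcases hx with hx | hx
  · obtain ⟨s, hs, e⟩ := ht x hx
    have hxa : (x : ZMod 49) = a := zmod_fortynine_eq.2 (hA' x hx)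
    have e2 : pos n x + (-t + ((7 + i : ℕ) : ZMod 49)) * a' * x = ((7 + i + s : ℕ) : ZMod 49) := by
      rw [hxa, mul_assoc, ha', e]; push_cast; ring
    rw [e2, ZMod.val_natCast_of_lt (by omega)]
    unfold good
    simp only [Bool.and_eq_true, Nat.ble_eq, Nat.blt_eq]
    omega
  · have := h x hx
    rwa [← mul_assoc] at this

/-- The number of bad positions among `len` consecutive shifts of speed `b`. -/
def badCount (len b p : ℕ) : ℕ := (List.range len).countP fun i => !good ((p + i * b) % 49)

theorem exists_of_badCount {len b c p q : ℕ} (h : badCount len b p + badCount len c q < len) :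
    ∃ i < len, good ((p + i * b) % 49) = true ∧ good ((q + i * c) % 49) = true := by
  by_contra hcon
  push Not at hcon
  have key : ∀ l : List ℕ, (∀ i ∈ l, i < len) →
      l.length ≤ (l.countP fun i => !good ((p + i * b) % 49)) +
        l.countP fun i => !good ((q + i * c) % 49) := by
    intro l
    induction l with
    | nil => simp
    | cons i l ih =>
      intro hl
      have h1 := ih fun j hj => hl j (List.mem_cons_of_mem _ hj)
      have h2 := hcon i (hl i List.mem_cons_self)
      simp only [List.length_cons, List.countP_cons]
      cases hg : good ((p + i * b) % 49)
      · simp only [Bool.not_false, if_true]; omega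
      · have := h2 hg
        simp only [Bool.not_eq_true] at this
        simp only [this, Bool.not_false, if_true]; omega
  have := key (List.range len) (by simp)
  rw [List.length_range] at this
  unfold badCount at h
  omega

theorem zmod_val_add_mul' (p b : ZMod 49) (i : ℕ) :
    (p + (i : ZMod 49) * b).val = (p.val + i * b.val) % 49 := by
  rw [ZMod.val_add, ZMod.val_mul, ZMod.val_natCast]
  simp [Nat.add_mod, Nat.mul_mod]

theorem allRange {n : ℕ} {f : ℕ → Bool} (h : (List.range n).all f = true) {i : ℕ} (hi : i < n) :
    f i = true := List.all_eq_true.1 h i (List.mem_range.2 hi)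

/-- Two further numbers next to an arc, decided by counting bad shifts. -/
theorem Solvable.of_arc_badCount {n w : ℕ} (hn : 0 < n) {A L : List ℤ} {a b c : ℤ}
    (ha : ¬ (7 : ℤ) ∣ a) (hA : Arc (n + 1) w A) (hA' : ∀ x ∈ A, (49 : ℤ) ∣ x - a)
    (h : ∀ a' : ℤ, (a' : ZMod 49) * a = 1 → ∀ p < 49, ∀ q < 49,
      badCount (35 - 7 * w) ((a' * b : ℤ) : ZMod 49).val p +
        badCount (35 - 7 * w) ((a' * c : ℤ) : ZMod 49).val q < 35 - 7 * w)
    (hL : ∀ x ∈ L, ((49 : ℤ) ∣ x ∧ Safe (n + 1) x) ∨ x ∈ A ∨ x = b ∨ x = c) :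
    Solvable (n + 1) L := by
  refine Solvable.of_arc_pos (P := fun x => x = b ∨ x = c) hn ha hA hA' (fun t a' ha' => ?_) hL
  have e : (((a'.val : ℕ) : ℤ) : ZMod 49) = a' := by simp
  have h := h a'.val (by rw [e]; exact ha')
  obtain ⟨i, hi, h1, h2⟩ := exists_of_badCount (h (pos n b + (t + 7) * (a' * b)).val (ZMod.val_lt _)
    (pos n c + (t + 7) * (a' * c)).val (ZMod.val_lt _))
  rw [← zmod_val_add_mul'] at h1 h2
  push_cast at h1 h2
  simp only [ZMod.natCast_val, ZMod.cast_id', id_eq] at h1 h2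
  refine ⟨i, hi, ?_⟩
  rintro x (rfl | rfl)
  · convert h1 using 3; push_cast; ring
  · convert h2 using 3; push_cast; ring

/-- The residue classes of `a` and `b` modulo `7` differ even up to sign. -/
def Sep (a b : ℤ) : Prop := ¬ (7 : ℤ) ∣ b - a ∧ ¬ (7 : ℤ) ∣ b + a

theorem Sep.mul {a b μ : ℤ} (hμ : ¬ (7 : ℤ) ∣ μ) (h : Sep a b) : Sep (μ * a) (μ * b) := by
  unfold Sep
  rw [← mul_sub, ← mul_add]
  exact ⟨not_seven_dvd_mul hμ h.1, not_seven_dvd_mul hμ h.2⟩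

theorem Sep.cast {a b : ℤ} (h : Sep a b) : (b : ZMod 7) ≠ a ∧ (b : ZMod 7) ≠ -(a : ZMod 7) := by
  refine ⟨fun e => h.1 ?_, fun e => h.2 ?_⟩
  · rw [← zmod_seven_eq_zero]; push_cast; rw [e, sub_self]
  · rw [← zmod_seven_eq_zero]; push_cast; rw [e]; ring

theorem Sep.symm {a b : ℤ} (h : Sep a b) : Sep b a :=
  ⟨fun e => h.1 ((dvd_sub_comm).1 e), fun e => h.2 (by rwa [add_comm] at e)⟩

theorem cast_eq_of_dvd {a a' : ℤ} (h : (7 : ℤ) ∣ a' - a) : (a' : ZMod 7) = a := by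
  rw [← sub_eq_zero, ← Int.cast_sub]; exact (zmod_seven_eq_zero _).2 h

theorem dvd_mul_sub {d μ x y : ℤ} (h : d ∣ x - y) : d ∣ μ * x - μ * y := by
  rw [← mul_sub]; exact Dvd.dvd.mul_left h μ

theorem Safe.of_not_mem {m : ℕ} {x : ℤ} (h : dig m x ∉ ({0, 6} : Finset (ZMod 7))) : Safe m x := by
  simpa [Safe, not_or] using h

/-- It suffices to give the pair adjacent digits while `e` is safe. -/
theorem Solvable.of_two_one_one (hm : 0 < m) {e a a' b c μ : ℤ} (he : (7 : ℤ) ∣ e)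
    (ha : ¬ (7 : ℤ) ∣ a) (hb : ¬ (7 : ℤ) ∣ b) (hc : ¬ (7 : ℤ) ∣ c) (haa : (7 : ℤ) ∣ a' - a)
    (hab : Sep a b) (hac : Sep a c) (hbc : Sep b c) (hμ : ¬ (7 : ℤ) ∣ μ)
    (hA : Window m 1 [μ * a, μ * a']) (hs : Safe m (μ * e)) : Solvable m [e, a, a', b, c] := by
  refine Solvable.smul hμ ?_
  have u := zmod_seven_ne_zero.2 (not_seven_dvd_mul hμ ha)
  obtain ⟨h1, h2⟩ := (hab.mul hμ).cast
  obtain ⟨h3, h4⟩ := (hac.mul hμ).cast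
  obtain ⟨h5, h6⟩ := (hbc.mul hμ).cast
  refine Solvable.of_arc_one_one (B := [μ * b]) (y := μ * c) hm u
    (zmod_seven_ne_zero.2 (not_seven_dvd_mul hμ hb))
    (zmod_seven_ne_zero.2 (not_seven_dvd_mul hμ hc)) h1 h2 h3 h4 h5 h6 hA ?_ ?_ ?_ rfl ?_
  · have : ((μ * a' : ℤ) : ZMod 7) = ((μ * a : ℤ) : ZMod 7) := cast_eq_of_dvd (dvd_mul_sub haa)
    simp [this]
  · exact ⟨μ * b, by simp, by simp⟩
  · simp
  · simp only [List.map_cons, List.map_nil, List.mem_cons, List.not_mem_nil, or_false,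
      forall_eq_or_imp, forall_eq]
    exact ⟨Or.inl ⟨Dvd.dvd.mul_left he μ, hs⟩, by simp, by simp, by simp, by simp⟩

/-- Bounds for the bad positions among `21` consecutive shifts, by the class of the speed. -/
def boundTwentyone : ℕ → ℕ
  | 2 => 7
  | 5 => 7
  | 3 => 11
  | 4 => 11
  | _ => 21

theorem badCount_twentyone {b : ℕ} (hb : b < 49) {p : ℕ} (hp : p < 49) :
    badCount 21 b p ≤ boundTwentyone (b % 7) := by
  have h : ((List.range 49).all fun b => (List.range 49).all fun p =>
      Nat.ble (badCount 21 b p) (boundTwentyone (b % 7))) = true := by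
    decide +kernel
  exact Nat.le_of_ble_eq_true (allRange (allRange h hb) hp)

theorem ratio_mod_seven {a b a' : ℤ} (h : (a' : ZMod 49) * a = 1) :
    ((a' * b : ℤ) : ZMod 49).val % 7 = ((b : ZMod 7) / a).val := by
  rw [zmod_fortynine_val_mod]
  congr 1
  have h1 : ((a' * a : ℤ) : ZMod 49) = ((1 : ℤ) : ZMod 49) := by push_cast; exact h
  have h2 : ((a' * a : ℤ) : ZMod 7) = ((1 : ℤ) : ZMod 7) := by
    rw [← sub_eq_zero, ← Int.cast_sub, zmod_seven_eq_zero]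
    exact (by norm_num : (7 : ℤ) ∣ 49).trans (zmod_fortynine_eq.1 h1)
  push_cast at h2 ⊢
  have ha : (a : ZMod 7) ≠ 0 := fun h0 => by rw [h0, mul_zero] at h2; exact absurd h2 (by decide)
  rw [eq_div_iff ha, mul_right_comm, h2, one_mul]

/-- An arc of two units whose points agree modulo `49`, and two further classes. -/
theorem Solvable.of_arc_two_pos (hm : 2 ≤ m) {e a a' b c : ℤ} (he : (49 : ℤ) ∣ e) (hs : Safe m e)
    (ha : ¬ (7 : ℤ) ∣ a) (hb : ¬ (7 : ℤ) ∣ b) (hc : ¬ (7 : ℤ) ∣ c)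
    (haa : (49 : ℤ) ∣ a' - a) (hab : Sep a b) (hac : Sep a c) (hbc : Sep b c)
    (hA : Arc m 2 [a, a']) : Solvable m [e, a, a', b, c] := by
  obtain ⟨n, rfl⟩ : ∃ n, m = n + 1 := ⟨m - 1, by omega⟩
  have hA : Arc (n + 1) (2 : ℕ) [a, a'] := hA
  refine Solvable.of_arc_badCount (w := 2) (A := [a, a']) (a := a) (b := b) (c := c) (by omega) ha hA
    (by simp [haa]) (fun u hu p hp q hq => ?_) ?_
  · have e1 := ratio_mod_seven (b := b) hu
    have e2 := ratio_mod_seven (b := c) hu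
    have hA := zmod_seven_ne_zero.2 ha
    have k1 := zmod_div_ne hA (zmod_seven_ne_zero.2 hb) hab.cast.1 hab.cast.2
    have k2 := zmod_div_ne hA (zmod_seven_ne_zero.2 hc) hac.cast.1 hac.cast.2
    have g1 : (c : ZMod 7) / a ≠ b / a := fun h => hbc.cast.1 (by field_simp at h; exact h)
    have g2 : (c : ZMod 7) / a ≠ -(b / a) := fun h => hbc.cast.2 (by
      rw [← neg_div] at h; field_simp at h; exact h)
    have key : ∀ x y : ZMod 7, x ≠ 0 ∧ x ≠ 1 ∧ x ≠ 6 → y ≠ 0 ∧ y ≠ 1 ∧ y ≠ 6 → y ≠ x → y ≠ -x →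
      ((x.val = 2 ∨ x.val = 5) ∧ (y.val = 3 ∨ y.val = 4)) ∨
      ((y.val = 2 ∨ y.val = 5) ∧ (x.val = 3 ∨ x.val = 4)) := by decide
    have h1 := badCount_twentyone (ZMod.val_lt ((u * b : ℤ) : ZMod 49)) hp
    have h2 := badCount_twentyone (ZMod.val_lt ((u * c : ℤ) : ZMod 49)) hq
    rw [e1] at h1
    rw [e2] at h2
    have key := key _ _ k1 k2 g1 g2
    refine lt_of_le_of_lt (Nat.add_le_add h1 h2) ?_
    rcases key with ⟨h3 | h3, h4 | h4⟩ | ⟨h3 | h3, h4 | h4⟩ <;> rw [h3, h4] <;> decide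
  · simp only [List.mem_cons, List.not_mem_nil, or_false, forall_eq_or_imp, forall_eq]
    exact ⟨Or.inl ⟨he, hs⟩, by simp, by simp, by simp, by simp⟩

theorem zmod_adjacent {d d' : ZMod 7} (h : d' = d ∨ d' = d + 1 ∨ d = d' + 1) :
    ∃ t : ZMod 7, (∃ s : ℕ, s ≤ 1 ∧ d = t + s) ∧ ∃ s : ℕ, s ≤ 1 ∧ d' = t + s := by
  rcases h with rfl | rfl | rfl
  · exact ⟨d', ⟨0, by simp⟩, ⟨0, by simp⟩⟩
  · exact ⟨d, ⟨0, by simp⟩, ⟨1, by simp⟩⟩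
  · exact ⟨d', ⟨1, by simp⟩, ⟨0, by simp⟩⟩

theorem window_pair {x y : ℤ} (h : dig m y = dig m x ∨ dig m y = dig m x + 1 ∨
    dig m x = dig m y + 1) : Window m 1 [x, y] := by
  obtain ⟨t, h1, h2⟩ := zmod_adjacent h
  exact ⟨t, by simp only [List.mem_cons, List.not_mem_nil, or_false, forall_eq_or_imp, forall_eq]
               exact ⟨h1, h2⟩⟩

theorem dig_natCast (m n : ℕ) : dig m (n : ℤ) = ((n / 7 ^ m : ℕ) : ZMod 7) := by
  unfold dig
  have : ((n : ℤ) / 7 ^ m) = ((n / 7 ^ m : ℕ) : ℤ) := by push_cast; rfl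
  rw [this, Int.cast_natCast]

/-- The pair `1`, `1 + 7 u` modulo `343`. -/
theorem exists_window_pair_two {u : ℤ} (hu : ¬ (7 : ℤ) ∣ u) : ∃ μ : ℤ, ¬ (7 : ℤ) ∣ μ ∧
    Window 2 1 [μ * 1, μ * (1 + 7 * u)] ∧ Safe 2 (μ * (7 * u)) := by
  have h : ∀ u < 49, u % 7 ≠ 0 → ∃ l < 343, l % 7 ≠ 0 ∧
      ((((l * (7 * u) / 49 : ℕ) : ZMod 7) ≠ 0 ∧ ((l * (7 * u) / 49 : ℕ) : ZMod 7) ≠ 6) ∧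
      (((l * (1 + 7 * u) / 49 : ℕ) : ZMod 7) = (l / 49 : ℕ) ∨
        ((l * (1 + 7 * u) / 49 : ℕ) : ZMod 7) = (l / 49 : ℕ) + 1 ∨
        ((l / 49 : ℕ) : ZMod 7) = (l * (1 + 7 * u) / 49 : ℕ) + 1)) := by
    decide +kernel
  obtain ⟨w, hw, hw49⟩ : ∃ w : ℕ, (w : ℤ) ≡ u [ZMOD 49] ∧ w < 49 :=
    ⟨(u % 49).toNat, by
      rw [Int.toNat_of_nonneg (Int.emod_nonneg _ (by norm_num))]; exact Int.mod_modEq _ _, by omega⟩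
  have hd := hw.dvd
  obtain ⟨l, -, hl, hs, hwin⟩ := h w hw49 (by omega)
  obtain ⟨t, ht⟩ := hd
  have e1 : dig 2 ((l : ℤ) * 1) = ((l / 49 : ℕ) : ZMod 7) := by
    rw [mul_one]; exact dig_natCast 2 l
  have e2 : dig 2 ((l : ℤ) * (1 + 7 * u)) = ((l * (1 + 7 * w) / 49 : ℕ) : ZMod 7) := by
    rw [show (49 : ℕ) = 7 ^ 2 by norm_num, ← dig_natCast]
    apply dig_congr
    refine Int.modEq_iff_dvd.2 ⟨-(l * t), ?_⟩
    push_cast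
    linear_combination (-7 * (l : ℤ)) * ht
  have e3 : dig 2 ((l : ℤ) * (7 * u)) = ((l * (7 * w) / 49 : ℕ) : ZMod 7) := by
    rw [show (49 : ℕ) = 7 ^ 2 by norm_num, ← dig_natCast]
    apply dig_congr
    refine Int.modEq_iff_dvd.2 ⟨-(l * t), ?_⟩
    push_cast
    linear_combination (-7 * (l : ℤ)) * ht
  refine ⟨l, by omega, window_pair ?_, ?_⟩
  · rw [e1, e2]; exact hwin
  · unfold Safe; rw [e3]; exact hs

/-- If a number equals the difference of a pair and has valuation `1`, it can be moved to the
bottom of the leading digit `1`; the pair then has adjacent leading digits unless a carry occurs,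
and a carry cannot occur for both of the two lowest choices. -/
theorem exists_window_pair_of_three_le (hm : 3 ≤ m) {u : ℤ} (hu : ¬ (7 : ℤ) ∣ u) :
    ∃ μ : ℤ, ¬ (7 : ℤ) ∣ μ ∧
      Window m 1 [μ * 1, μ * (1 + 7 * u)] ∧ Safe m (μ * (7 * u)) := by
  obtain ⟨n, rfl⟩ : ∃ n, m = n + 1 := ⟨m - 1, by omega⟩
  obtain ⟨c, hc, hcu⟩ := exists_inverse (n + 1) hu
  have hρ : (49 : ℤ) ≤ 7 ^ n := by
    calc (49 : ℤ) = 7 ^ 2 := by norm_num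
      _ ≤ 7 ^ n := pow_le_pow_right₀ (by norm_num) (by omega)
  have hρ7 : (7 : ℤ) ∣ 7 ^ n := dvd_pow_self _ (by omega)
  have hr : (7 : ℤ) ^ (n + 1) = 7 * 7 ^ n := by ring
  set ρ : ℤ := 7 ^ n with hρdef
  have main : ∀ t : ℤ, (t = 1 ∨ t = 2) → (c * (ρ + t)) % (7 * ρ) + 7 * t < 7 * ρ →
      ∃ μ : ℤ, ¬ (7 : ℤ) ∣ μ ∧
        Window (n + 1) 1 [μ * 1, μ * (1 + 7 * u)] ∧ Safe (n + 1) (μ * (7 * u)) := by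
    intro t ht hlow
    have hμ : ¬ (7 : ℤ) ∣ c * (ρ + t) := not_seven_dvd_mul hc (by omega)
    have he : c * (ρ + t) * (7 * u) ≡ 7 * t + 7 ^ (n + 1) * 1 [ZMOD 7 ^ (n + 1 + 1)] := by
      have := hcu.mul_right (7 * (ρ + t))
      have e1 : c * u * (7 * (ρ + t)) = c * (ρ + t) * (7 * u) := by ring
      have e2 : 1 * (7 * (ρ + t)) = 7 * t + 7 ^ (n + 1) * 1 := by rw [hr]; ring
      rwa [e1, e2] at this
    have hd1 : dig (n + 1) (c * (ρ + t) * (7 * u)) = 1 := by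
      rw [dig_congr he, dig_add_mul]
      unfold dig
      rw [Int.ediv_eq_zero_of_lt (by omega) (by rw [hr]; omega)]
      norm_num
    have hl : (c * (ρ + t) * (7 * u)) % 7 ^ (n + 1) = 7 * t := by
      have h1 := he.of_dvd (pow_dvd_pow 7 (Nat.le_succ (n + 1)))
      rw [h1, Int.add_mul_emod_self_left, Int.emod_eq_of_lt (by omega) (by rw [hr]; omega)]
    refine ⟨c * (ρ + t), hμ, window_pair (Or.inr (Or.inl ?_)), ?_⟩
    · have e : c * (ρ + t) * (1 + 7 * u) = c * (ρ + t) * 1 + c * (ρ + t) * (7 * u) := by ring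
      rw [e, dig_add, hd1, hl, mul_one, hr, if_neg (by linarith), add_zero]
    · unfold Safe; rw [hd1]; decide
  by_contra hcon
  have h1 : ¬ (c * (ρ + 1)) % (7 * ρ) + 7 * 1 < 7 * ρ := fun h => hcon (main 1 (Or.inl rfl) h)
  have h2 : ¬ (c * (ρ + 2)) % (7 * ρ) + 7 * 2 < 7 * ρ := fun h => hcon (main 2 (Or.inr rfl) h)
  have p1 := Int.mul_ediv_add_emod (c * (ρ + 1)) (7 * ρ)
  have p2 := Int.mul_ediv_add_emod (c * (ρ + 2)) (7 * ρ)
  have q1 := Int.emod_lt_of_pos (c * (ρ + 1)) (by linarith : (0 : ℤ) < 7 * ρ)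
  have q2 := Int.emod_lt_of_pos (c * (ρ + 2)) (by linarith : (0 : ℤ) < 7 * ρ)
  set A := (c * (ρ + 1)) / (7 * ρ)
  set B := (c * (ρ + 2)) / (7 * ρ)
  -- `ρ (c - 14 A + 7 B + 7)` is bounded by `13` in absolute value, hence zero
  set z := c - 14 * A + 7 * B - 7 with hz
  have e : ρ * z = 2 * ((c * (ρ + 1)) % (7 * ρ)) - (c * (ρ + 2)) % (7 * ρ) - 7 * ρ := by
    rw [hz]; linear_combination (-2) * p1 + p2
  have hz7 : z ≠ 0 := fun h0 => hc (by omega)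
  rcases lt_or_gt_of_ne hz7 with h | h
  · have : ρ * z ≤ -ρ := by nlinarith
    linarith
  · have : ρ ≤ ρ * z := by nlinarith
    linarith

/-! ### Four numbers and a number divisible by seven -/

/-- Any nonzero residue can be given leading digit `2`. -/
theorem exists_dig_two {d : ℕ} (hd : d ≤ m) {q : ℤ} (hq : Lev d q) :
    ∃ μ : ℤ, ¬ (7 : ℤ) ∣ μ ∧ dig m (μ * q) = 2 := by
  rcases hd.lt_or_eq with hd | rfl
  · obtain ⟨k, hk⟩ := exists_step_dig hd hq 2
    exact ⟨_, step_unit hd k, hk⟩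
  · exact exists_scale hq (by decide)

theorem Near.window {x y : ℤ} (h : Near m 1 (y - x)) : Window m 1 [x, y] := by
  have h1 : Arc m (1 : ℕ) [y, x] := h.arc (by norm_num)
  exact (h1.perm (l' := [x, y]) (fun p => (List.Perm.swap y x []).mem_iff)).window

set_option synthInstance.maxHeartbeats 200000 in
set_option synthInstance.maxSize 1000 in
theorem exists_near_or_safe_shift : ∀ g f : ZMod 7, g ≠ 0 → f ≠ 0 → f ≠ g → f ≠ -g →
    ∀ s t : ZMod 7, ∃ k : ZMod 7, (s + k * g = 0 ∨ s + k * g = 6) ∧ Ok (t + k * f) := by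
  decide +kernel

theorem near_one_of_dig {q : ℤ} (h : dig m q = 0 ∨ dig m q = 6) : Near m 1 q :=
  Near.of_dig (w := 1) (by rcases h with h | h <;> rw [h] <;> decide)

/-- The pair and `e` have valuation `1` and `e` agrees with the distance of the pair modulo
`49`. -/
theorem Solvable.two_one_one_of_congr (hm : 2 ≤ m) {e a a' b c : ℤ}
    (ha : ¬ (7 : ℤ) ∣ a) (hb : ¬ (7 : ℤ) ∣ b) (hc : ¬ (7 : ℤ) ∣ c) (hq : Lev 1 (a' - a))
    (hab : Sep a b) (hac : Sep a c) (hbc : Sep b c) (he : (7 : ℤ) ^ 2 ∣ e - (a' - a)) :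
    Solvable m [e, a, a', b, c] := by
  have h7e : (7 : ℤ) ∣ e := by
    have := dvd_add ((dvd_pow_self (7 : ℤ) two_ne_zero).trans he) (by simpa using hq.dvd le_rfl)
    rwa [sub_add_cancel] at this
  have haa : (7 : ℤ) ∣ a' - a := by simpa using hq.dvd le_rfl
  by_cases hD : (7 : ℤ) ^ (m + 1) ∣ e - (a' - a)
  · obtain ⟨g, hg, hqg⟩ := hq
    obtain ⟨μ, hμ, hμa⟩ := exists_inverse m ha
    obtain ⟨ν, hν, hw, hs⟩ : ∃ ν : ℤ, ¬ (7 : ℤ) ∣ ν ∧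
        Window m 1 [ν * 1, ν * (1 + 7 * (μ * g))] ∧ Safe m (ν * (7 * (μ * g))) := by
      rcases hm.lt_or_eq with hm | rfl
      · exact exists_window_pair_of_three_le hm (not_seven_dvd_mul hμ hg)
      · exact exists_window_pair_two (not_seven_dvd_mul hμ hg)
    have e1 : dig m (ν * μ * a) = dig m (ν * 1) := dig_congr (by
      rw [mul_assoc]; exact hμa.mul_left ν)
    have e2 : dig m (ν * μ * a') = dig m (ν * (1 + 7 * (μ * g))) := dig_congr (by
      rw [mul_assoc]
      refine Int.ModEq.mul_left ν ?_
      have h1 : μ * a' = μ * a + 7 * (μ * g) := by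
        rw [show a' = a + (a' - a) by ring, hqg]; ring
      rw [h1]; exact hμa.add_right _)
    have e3 : dig m (ν * μ * e) = dig m (ν * (7 * (μ * g))) := dig_congr (by
      rw [mul_assoc]
      refine Int.ModEq.mul_left ν ?_
      have h1 : 7 * (μ * g) = μ * (a' - a) := by rw [hqg]; ring
      rw [h1]
      exact (Int.modEq_iff_dvd.2 hD).symm.mul_left μ)
    refine Solvable.of_two_one_one (by omega) h7e ha hb hc haa hab hac hbc
      (not_seven_dvd_mul hν hμ) ?_ ?_
    · unfold Window at hw ⊢
      simp only [List.mem_cons, List.not_mem_nil, or_false, forall_eq_or_imp, forall_eq] at hw ⊢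
      rwa [e1, e2]
    · unfold Safe at hs ⊢; rwa [e3]
  · obtain ⟨d, hd, hdl⟩ := exists_lev hD
    have hd2 : 2 ≤ d := by
      by_contra hlt
      exact hdl.not_dvd ((pow_dvd_pow 7 (by omega)).trans he)
    obtain ⟨μ, hμ, hdig⟩ := exists_dig_two hd hdl
    obtain ⟨k, hk⟩ := exists_step_dig (m := m) (by omega) (hq.mul hμ) 0
    have hu := step_unit (m := m) (v := 1) (by omega) k
    have hD2 : dig m (step m 1 k * (μ * (e - (a' - a)))) = 2 := by
      rw [dig_congr (step_frozen (by omega) k ((hdl.mul hμ).dvd hd2)), hdig]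
    refine Solvable.of_two_one_one (by omega) h7e ha hb hc haa hab hac hbc
      (not_seven_dvd_mul hu hμ) ?_ ?_
    · refine Near.window ?_
      rw [← mul_sub, mul_assoc]
      exact near_one_of_dig (Or.inl hk)
    · have e1 : step m 1 k * μ * e = step m 1 k * (μ * (a' - a)) +
          step m 1 k * (μ * (e - (a' - a))) := by ring
      unfold Safe
      rw [e1, dig_add, hk, hD2]
      split_ifs <;> decide

/-- Classes of two, one and one next to a number `e` divisible by `7`. The pair and `e` can be
treated separately unless `e` and the distance of the pair have the same valuation and move at the
same speed. -/
theorem Solvable.two_one_one {e a a' b c : ℤ} {j : ℕ} (hj1 : 1 ≤ j) (hj : j < m) (he : Lev j e)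
    (ha : ¬ (7 : ℤ) ∣ a) (hb : ¬ (7 : ℤ) ∣ b) (hc : ¬ (7 : ℤ) ∣ c) (haa : (7 : ℤ) ∣ a' - a)
    (hne : ¬ (7 : ℤ) ^ (m + 1) ∣ a' - a) (hab : Sep a b) (hac : Sep a c) (hbc : Sep b c) :
    Solvable m [e, a, a', b, c] := by
  have h7e : (7 : ℤ) ∣ e := by
    have := he.dvd hj1
    rwa [pow_one] at this
  obtain ⟨v, hv, hq⟩ := exists_lev hne
  have hv1 : 1 ≤ v := by
    by_contra hlt
    have : v = 0 := by omega
    subst this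
    exact hq.not_dvd (by simpa using haa)
  have hK : ({0, 6} : Finset (ZMod 7)).card ≤ 2 := by decide
  obtain ⟨μ, hμ, hn, hs⟩ := exists_near_avoid hv hq hj he hK
  by_cases hjv : j = v
  · subst hjv
    rw [if_pos rfl] at hn
    obtain ⟨g, hg, hqg⟩ := id hq
    obtain ⟨f, hf, hef⟩ := id he
    by_cases h1 : (7 : ℤ) ∣ f - g ∨ (7 : ℤ) ∣ f + g
    · rcases (show j = 1 ∨ 2 ≤ j by omega) with rfl | hj2
      · have ha' : ¬ (7 : ℤ) ∣ a' := fun h => ha (by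
          have := dvd_sub h haa
          rwa [sub_sub_cancel] at this)
        rcases h1 with ⟨t, ht⟩ | ⟨t, ht⟩
        · refine Solvable.two_one_one_of_congr (by omega) ha hb hc hq hab hac hbc ⟨t, ?_⟩
          rw [hef, hqg, ← mul_sub, ht]; ring
        · have hs : ∀ x, Sep a x → Sep a' x := by
            intro x hx
            obtain ⟨t, ht⟩ := haa
            exact ⟨fun h => hx.1 (by
              have := dvd_add h (Dvd.intro t ht.symm)
              rwa [sub_add_sub_cancel] at this), fun h => hx.2 (by
              have := dvd_sub h (Dvd.intro t ht.symm)
              have e : x + a' - (a' - a) = x + a := by ring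
              rwa [e] at this)⟩
          have := Solvable.two_one_one_of_congr (m := m) (e := e) (by omega) ha' hb hc
            hq.sub_comm (hs _ hab) (hs _ hac) hbc ⟨t, by
              rw [← neg_sub a' a, hef, hqg, sub_neg_eq_add, ← mul_add, ht]; ring⟩
          exact this.mono (by simp)
      · have h49 : (49 : ℤ) ∣ a' - a := by
          have := hq.dvd hj2
          norm_num at this; exact this
        have h49e : (49 : ℤ) ∣ e := by
          have := he.dvd hj2
          norm_num at this; exact this
        refine Solvable.smul hμ ?_
        have hA : Arc m 2 [μ * a', μ * a] := Near.arc (by norm_num) (by rwa [← mul_sub])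
        exact Solvable.of_arc_two_pos (by omega) (Dvd.dvd.mul_left h49e μ) (Safe.of_not_mem hs)
          (not_seven_dvd_mul hμ ha) (not_seven_dvd_mul hμ hb) (not_seven_dvd_mul hμ hc)
          (dvd_mul_sub h49) (hab.mul hμ) (hac.mul hμ) (hbc.mul hμ)
          (hA.perm fun p => (List.Perm.swap _ _ []).mem_iff)
    · push Not at h1
      have h2 : (f : ZMod 7) ≠ g := fun h => h1.1 (by
        rw [← zmod_seven_eq_zero]; push_cast; rw [h, sub_self])
      have h3 : (f : ZMod 7) ≠ -(g : ZMod 7) := fun h => h1.2 (by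
        rw [← zmod_seven_eq_zero]; push_cast; rw [h, neg_add_cancel])
      obtain ⟨k, hk, hk'⟩ := exists_near_or_safe_shift g f (zmod_seven_ne_zero.2 hg)
        (zmod_seven_ne_zero.2 hf) h2 h3 (dig m (a' - a)) (dig m e)
      have hu := step_unit hj k.val
      refine Solvable.of_two_one_one (by omega) h7e ha hb hc haa hab hac hbc hu
        (Near.window ?_) ?_
      · rw [← mul_sub]
        apply near_one_of_dig
        rw [hqg] at hk ⊢
        rwa [step_dig_zmod hv]
      · unfold Safe
        rw [hef] at hk' ⊢
        rwa [step_dig_zmod hv]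
  · rw [if_neg hjv] at hn
    exact Solvable.of_two_one_one (by omega) h7e ha hb hc haa hab hac hbc hμ
      (Near.window (by rwa [← mul_sub])) (Safe.of_not_mem hs)

/-- Two classes of two: it suffices to bring the pair of the right class together. -/
theorem Solvable.two_two {e a a' b b' : ℤ} {j : ℕ} (hj1 : 1 ≤ j) (hj : j < m) (he : Lev j e)
    (ha : ¬ (7 : ℤ) ∣ a) (hb : ¬ (7 : ℤ) ∣ b) (haa : (7 : ℤ) ∣ a' - a)
    (hbb : (7 : ℤ) ∣ b' - b) (hne : ¬ (7 : ℤ) ^ (m + 1) ∣ a' - a)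
    (hne' : ¬ (7 : ℤ) ^ (m + 1) ∣ b' - b) (hab : Sep a b) : Solvable m [e, a, a', b, b'] := by
  have main : ∀ {a a' b b' : ℤ}, ¬ (7 : ℤ) ∣ a → (7 : ℤ) ∣ a' - a → (7 : ℤ) ∣ b' - b →
      ¬ (7 : ℤ) ^ (m + 1) ∣ a' - a → ((b : ZMod 7) = 2 * a ∨ (b : ZMod 7) = 5 * a) →
      Solvable m [e, a, a', b, b'] := by
    intro a a' b b' ha haa hbb hne hab
    obtain ⟨v, hv, hq⟩ := exists_lev hne
    obtain ⟨μ, hμ, hn, hs⟩ := exists_near_avoid hv hq hj he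
      (by decide : ({0, 6} : Finset (ZMod 7)).card ≤ 2)
    refine Solvable.smul hμ ?_
    have hA : Arc m 2 [μ * a', μ * a] := Near.arc (by norm_num) (by
      rw [← mul_sub]; exact hn.mono (by split_ifs <;> norm_num))
    have e1 : ((μ * a' : ℤ) : ZMod 7) = ((μ * a : ℤ) : ZMod 7) := cast_eq_of_dvd (dvd_mul_sub haa)
    have e2 : ((μ * b' : ℤ) : ZMod 7) = ((μ * b : ℤ) : ZMod 7) := cast_eq_of_dvd (dvd_mul_sub hbb)
    refine Solvable.of_arc_two_free (c := ((μ * a : ℤ) : ZMod 7)) (d := ((μ * b : ℤ) : ZMod 7))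
      (by omega) (zmod_seven_ne_zero.2 (not_seven_dvd_mul hμ ha)) ?_ hA ?_ rfl e2 ?_
    · push_cast
      rcases hab with h | h <;> rw [h]
      · left; ring
      · right; ring
    · simp [e1]
    · simp only [List.map_cons, List.map_nil, List.mem_cons, List.not_mem_nil, or_false,
        forall_eq_or_imp, forall_eq]
      exact ⟨Or.inl ⟨Dvd.dvd.mul_left (by simpa using he.dvd hj1) μ, Safe.of_not_mem hs⟩,
        by simp, by simp, by simp, by simp⟩
  have key : ∀ x y : ZMod 7, x ≠ 0 → y ≠ 0 → y ≠ x → y ≠ -x →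
      (y = 2 * x ∨ y = 5 * x) ∨ (x = 2 * y ∨ x = 5 * y) := by decide
  rcases key a b (zmod_seven_ne_zero.2 ha) (zmod_seven_ne_zero.2 hb) hab.cast.1 hab.cast.2
    with h | h
  · exact main ha haa hbb hne h
  · exact (main hb hbb haa hne' h).mono (by simp)

/-- Classes of three and one next to a number divisible by `7`. -/
theorem Solvable.three_one {e a a' a'' b : ℤ} {j : ℕ} (hj1 : 1 ≤ j) (hj : j < m) (he : Lev j e)
    (ha : ¬ (7 : ℤ) ∣ a) (hb : ¬ (7 : ℤ) ∣ b) (haa : (7 : ℤ) ∣ a' - a) (haa' : (7 : ℤ) ∣ a'' - a)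
    (h1 : ¬ (7 : ℤ) ^ (m + 1) ∣ a - a') (h2 : ¬ (7 : ℤ) ^ (m + 1) ∣ a - a'')
    (h3 : ¬ (7 : ℤ) ^ (m + 1) ∣ a' - a'') (hab : Sep a b) : Solvable m [e, a, a', a'', b] := by
  obtain ⟨μ, hμ, hA, hs⟩ := exists_triple_arc h1 h2 h3 hj he
    (by decide : ({0, 6} : Finset (ZMod 7)).card ≤ 2)
  refine Solvable.smul hμ ?_
  have e1 : ((μ * a' : ℤ) : ZMod 7) = ((μ * a : ℤ) : ZMod 7) := cast_eq_of_dvd (dvd_mul_sub haa)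
  have e2 : ((μ * a'' : ℤ) : ZMod 7) = ((μ * a : ℤ) : ZMod 7) := cast_eq_of_dvd (dvd_mul_sub haa')
  obtain ⟨g1, g2⟩ := (hab.mul hμ).cast
  refine Solvable.of_arc_three (c := ((μ * a : ℤ) : ZMod 7)) (d := ((μ * b : ℤ) : ZMod 7)) (by omega)
    (zmod_seven_ne_zero.2 (not_seven_dvd_mul hμ ha))
    (zmod_seven_ne_zero.2 (not_seven_dvd_mul hμ hb)) g1 g2 hA ?_ rfl ?_
  · simp [e1, e2]
  · simp only [List.map_cons, List.map_nil, List.mem_cons, List.not_mem_nil, or_false,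
      forall_eq_or_imp, forall_eq]
    exact ⟨Or.inl ⟨Dvd.dvd.mul_left (by simpa using he.dvd hj1) μ, Safe.of_not_mem hs⟩,
      by simp, by simp, by simp, by simp⟩

/-! ### Joining arcs -/

theorem perm_of_count {α : Type*} [DecidableEq α] {l l' : List α}
    (h : ∀ p, l.count p = l'.count p) :
    l.Perm l' := List.perm_iff_count.2 h

theorem pattern_three {α β : Type*} (f : α → β) (x y z : α) : ∃ a b c, [a, b, c].Perm [x, y, z] ∧
    ((f a ≠ f b ∧ f a ≠ f c ∧ f b ≠ f c) ∨ (f a = f b ∧ f a ≠ f c) ∨ (f a = f b ∧ f a = f c)) := by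
  classical
  by_cases h1 : f x = f y
  · by_cases h2 : f x = f z
    · exact ⟨x, y, z, .refl _, .inr (.inr ⟨h1, h2⟩)⟩
    · exact ⟨x, y, z, .refl _, .inr (.inl ⟨h1, h2⟩)⟩
  · by_cases h2 : f x = f z
    · exact ⟨x, z, y, .cons _ (.swap _ _ _), .inr (.inl ⟨h2, h1⟩)⟩
    · by_cases h3 : f y = f z
      · exact ⟨y, z, x, perm_of_count (by intro p; simp only [List.count_cons]; ring),
          .inr (.inl ⟨h3, fun h => h1 h.symm⟩)⟩
      · exact ⟨x, y, z, .refl _, .inl ⟨h1, h2, h3⟩⟩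

/-- Up to order, four objects are distributed over the values of `f` according to one of the five
partitions of `4`. -/
theorem pattern_four {α β : Type*} (f : α → β) (x y z s : α) :
    ∃ a b c d, [a, b, c, d].Perm [x, y, z, s] ∧
    ((f a ≠ f b ∧ f a ≠ f c ∧ f b ≠ f c ∧ f a ≠ f d ∧ f b ≠ f d ∧ f c ≠ f d) ∨
     (f a = f b ∧ f a ≠ f c ∧ f a ≠ f d ∧ f c ≠ f d) ∨
     (f a = f b ∧ f c = f d ∧ f a ≠ f c) ∨
     (f a = f b ∧ f a = f c ∧ f a ≠ f d) ∨
     (f a = f b ∧ f a = f c ∧ f a = f d)) := by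
  classical
  obtain ⟨a, b, c, hp, h⟩ := pattern_three f x y z
  have hp : ([a, b, c, s] : List α).Perm [x, y, z, s] := hp.append_right [s]
  have hc : ∀ {l : List α}, (∀ p, l.count p = [a, b, c, s].count p) → l.Perm [x, y, z, s] :=
    fun h => (perm_of_count h).trans hp
  rcases h with ⟨h1, h2, h3⟩ | ⟨h1, h2⟩ | ⟨h1, h2⟩
  · by_cases ha : f a = f s
    · exact ⟨a, s, b, c, hc (by intro p; simp only [List.count_cons]; ring),
        .inr (.inl ⟨ha, h1, h2, h3⟩)⟩
    by_cases hb : f b = f s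
    · exact ⟨b, s, a, c, hc (by intro p; simp only [List.count_cons]; ring),
        .inr (.inl ⟨hb, h1.symm, h3, h2⟩)⟩
    by_cases hcc : f c = f s
    · exact ⟨c, s, a, b, hc (by intro p; simp only [List.count_cons]; ring),
        .inr (.inl ⟨hcc, h2.symm, h3.symm, h1⟩)⟩
    exact ⟨a, b, c, s, hp, .inl ⟨h1, h2, h3, ha, hb, hcc⟩⟩
  · by_cases ha : f a = f s
    · exact ⟨a, b, s, c, hc (by intro p; simp only [List.count_cons]; ring),
        .inr (.inr (.inr (.inl ⟨h1, ha, h2⟩)))⟩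
    by_cases hcc : f c = f s
    · exact ⟨a, b, c, s, hp, .inr (.inr (.inl ⟨h1, hcc, h2⟩))⟩
    exact ⟨a, b, c, s, hp, .inr (.inl ⟨h1, h2, ha, hcc⟩)⟩
  · by_cases ha : f a = f s
    · exact ⟨a, b, c, s, hp, .inr (.inr (.inr (.inr ⟨h1, h2, ha⟩)))⟩
    · exact ⟨a, b, c, s, hp, .inr (.inr (.inr (.inl ⟨h1, h2, ha⟩)))⟩

/-- Up to order, five objects are distributed over the values of `f` according to one of the seven
partitions of `5`. -/
theorem pattern_five {α β : Type*} (f : α → β) (x y z s t : α) :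
    ∃ a b c d e, [a, b, c, d, e].Perm [x, y, z, s, t] ∧
    ((f a ≠ f b ∧ f a ≠ f c ∧ f b ≠ f c ∧ f a ≠ f d ∧ f b ≠ f d ∧ f c ≠ f d ∧
        f a ≠ f e ∧ f b ≠ f e ∧ f c ≠ f e ∧ f d ≠ f e) ∨
     (f a = f b ∧ f a ≠ f c ∧ f a ≠ f d ∧ f c ≠ f d ∧ f a ≠ f e ∧ f c ≠ f e ∧ f d ≠ f e) ∨
     (f a = f b ∧ f c = f d ∧ f a ≠ f c ∧ f a ≠ f e ∧ f c ≠ f e) ∨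
     (f a = f b ∧ f a = f c ∧ f a ≠ f d ∧ f a ≠ f e ∧ f d ≠ f e) ∨
     (f a = f b ∧ f a = f c ∧ f a ≠ f d ∧ f d = f e) ∨
     (f a = f b ∧ f a = f c ∧ f a = f d ∧ f a ≠ f e) ∨
     (f a = f b ∧ f a = f c ∧ f a = f d ∧ f a = f e)) := by
  classical
  obtain ⟨a, b, c, d, hp, h⟩ := pattern_four f x y z s
  have hp : ([a, b, c, d, t] : List α).Perm [x, y, z, s, t] := hp.append_right [t]
  have hc : ∀ {l : List α}, (∀ p, l.count p = [a, b, c, d, t].count p) →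
      l.Perm [x, y, z, s, t] := fun h => (perm_of_count h).trans hp
  rcases h with ⟨h1, h2, h3, h4, h5, h6⟩ | ⟨h1, h2, h3, h4⟩ | ⟨h1, h2, h3⟩ | ⟨h1, h2, h3⟩ |
    ⟨h1, h2, h3⟩
  · by_cases ha : f a = f t
    · exact ⟨a, t, b, c, d, hc (by intro p; simp only [List.count_cons]; ring),
        .inr (.inl ⟨ha, h1, h2, h3, h4, h5, h6⟩)⟩
    by_cases hb : f b = f t
    · exact ⟨b, t, a, c, d, hc (by intro p; simp only [List.count_cons]; ring),
        .inr (.inl ⟨hb, h1.symm, h3, h2, h5, h4, h6⟩)⟩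
    by_cases hcc : f c = f t
    · exact ⟨c, t, a, b, d, hc (by intro p; simp only [List.count_cons]; ring),
        .inr (.inl ⟨hcc, h2.symm, h3.symm, h1, h6, h4, h5⟩)⟩
    by_cases hd : f d = f t
    · exact ⟨d, t, a, b, c, hc (by intro p; simp only [List.count_cons]; ring),
        .inr (.inl ⟨hd, h4.symm, h5.symm, h1, h6.symm, h2, h3⟩)⟩
    exact ⟨a, b, c, d, t, hp, .inl ⟨h1, h2, h3, h4, h5, h6, ha, hb, hcc, hd⟩⟩
  · by_cases ha : f a = f t
    · exact ⟨a, b, t, c, d, hc (by intro p; simp only [List.count_cons]; ring),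
        .inr (.inr (.inr (.inl ⟨h1, ha, h2, h3, h4⟩)))⟩
    by_cases hcc : f c = f t
    · exact ⟨a, b, c, t, d, hc (by intro p; simp only [List.count_cons]; ring),
        .inr (.inr (.inl ⟨h1, hcc, h2, h3, h4⟩))⟩
    by_cases hd : f d = f t
    · exact ⟨a, b, d, t, c, hc (by intro p; simp only [List.count_cons]; ring),
        .inr (.inr (.inl ⟨h1, hd, h3, h2, h4.symm⟩))⟩
    exact ⟨a, b, c, d, t, hp, .inr (.inl ⟨h1, h2, h3, h4, ha, hcc, hd⟩)⟩
  · by_cases ha : f a = f t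
    · exact ⟨a, b, t, c, d, hc (by intro p; simp only [List.count_cons]; ring),
        .inr (.inr (.inr (.inr (.inl ⟨h1, ha, h3, h2⟩))))⟩
    by_cases hcc : f c = f t
    · exact ⟨c, d, t, a, b, hc (by intro p; simp only [List.count_cons]; ring),
        .inr (.inr (.inr (.inr (.inl ⟨h2, hcc, h3.symm, h1⟩))))⟩
    exact ⟨a, b, c, d, t, hp, .inr (.inr (.inl ⟨h1, h2, h3, ha, hcc⟩))⟩
  · by_cases ha : f a = f t
    · exact ⟨a, b, c, t, d, hc (by intro p; simp only [List.count_cons]; ring),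
        .inr (.inr (.inr (.inr (.inr (.inl ⟨h1, h2, ha, h3⟩)))))⟩
    by_cases hd : f d = f t
    · exact ⟨a, b, c, d, t, hp, .inr (.inr (.inr (.inr (.inl ⟨h1, h2, h3, hd⟩))))⟩
    exact ⟨a, b, c, d, t, hp, .inr (.inr (.inr (.inl ⟨h1, h2, h3, ha, hd⟩)))⟩
  · by_cases ha : f a = f t
    · exact ⟨a, b, c, d, t, hp, .inr (.inr (.inr (.inr (.inr (.inr ⟨h1, h2, h3, ha⟩)))))⟩
    · exact ⟨a, b, c, d, t, hp, .inr (.inr (.inr (.inr (.inr (.inl ⟨h1, h2, h3, ha⟩)))))⟩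

/-- The least valuation of a difference. -/
theorem exists_min_level {l : List ℤ} {n : ℕ} (h : ¬ ∀ p ∈ l, ∀ q ∈ l, (7 : ℤ) ^ (n + 1) ∣ p - q) :
    ∃ v ≤ n, (∀ p ∈ l, ∀ q ∈ l, (7 : ℤ) ^ v ∣ p - q) ∧
      ¬ ∀ p ∈ l, ∀ q ∈ l, (7 : ℤ) ^ (v + 1) ∣ p - q := by
  induction n with
  | zero => exact ⟨0, le_rfl, by simp, h⟩
  | succ n ih =>
    by_cases h' : ∀ p ∈ l, ∀ q ∈ l, (7 : ℤ) ^ (n + 1) ∣ p - q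
    · exact ⟨n + 1, le_rfl, h', h⟩
    · obtain ⟨v, hv, h⟩ := ih h'
      exact ⟨v, by omega, h⟩

theorem emod_eq_iff {n : ℕ} {x y : ℤ} : x % 7 ^ n = y % 7 ^ n ↔ (7 : ℤ) ^ n ∣ x - y := by
  rw [Int.emod_eq_emod_iff_emod_sub_eq_zero, Int.dvd_iff_emod_eq_zero]

theorem lev_of_emod_ne {v : ℕ} {x y : ℤ} (h : (7 : ℤ) ^ v ∣ x - y)
    (hne : x % 7 ^ (v + 1) ≠ y % 7 ^ (v + 1)) : Lev v (x - y) :=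
  Lev.of_dvd h (mt emod_eq_iff.2 hne)

/-- Points close after the points of an arc lie on a longer arc. -/
theorem Arc.ride {w w' : ℤ} {l l' : List ℤ} (h : Arc m w l) (hw : 0 ≤ w')
    (h' : ∀ x ∈ l', ∃ c ∈ l, (x - c) % 7 ^ (m + 1) ≤ w' * 7 ^ m) : Arc m (w + w') (l' ++ l) := by
  obtain ⟨c, hc, hl⟩ := h
  have hr := pow_pos_seven m
  refine ⟨c, by simp [hc], fun x hx => ?_⟩
  rcases List.mem_append.1 hx with hx | hx
  · obtain ⟨b, hb, hxb⟩ := h' x hx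
    have := emod_add_le (x - b) (b - c) (pow_pos_seven (m + 1))
    rw [sub_add_sub_cancel] at this
    have := hl b hb
    linarith
  · have := hl x hx
    nlinarith

/-- Two arcs can be joined to one of length `W` if the distance of their bases has leading digit
`t`. -/
def joinOk (w₁ w₂ W : ℕ) (t : ZMod 7) : Prop :=
  (w₁ ≤ W ∧ t.val + 1 + w₂ ≤ W) ∨ (w₂ ≤ W ∧ 7 + w₁ ≤ t.val + W)

instance (w₁ w₂ W : ℕ) (t : ZMod 7) : Decidable (joinOk w₁ w₂ W t) := by
  unfold joinOk; infer_instance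

theorem arc_of_joinOk {w₁ w₂ W : ℕ} {c₁ c₂ : ℤ} {l₁ l₂ : List ℤ} (h₁ : c₁ ∈ l₁) (h₂ : c₂ ∈ l₂)
    (hl₁ : ∀ x ∈ l₁, (x - c₁) % 7 ^ (m + 1) ≤ w₁ * 7 ^ m)
    (hl₂ : ∀ x ∈ l₂, (x - c₂) % 7 ^ (m + 1) ≤ w₂ * 7 ^ m)
    (h : joinOk w₁ w₂ W (dig m (c₂ - c₁))) : Arc m W (l₁ ++ l₂) := by
  have hr := pow_pos_seven m
  rcases h with ⟨hw, h⟩ | ⟨hw, h⟩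
  · have hd : (c₂ - c₁) % 7 ^ (m + 1) < ((dig m (c₂ - c₁)).val + 1 : ℕ) * 7 ^ m :=
      emod_lt_of_dig (Nat.lt_succ_self _)
    refine ⟨c₁, by simp [h₁], fun x hx => ?_⟩
    rcases List.mem_append.1 hx with hx | hx
    · exact (hl₁ x hx).trans (by gcongr)
    · have := emod_add_le (x - c₂) (c₂ - c₁) (pow_pos_seven (m + 1))
      rw [sub_add_sub_cancel] at this
      have h2 := hl₂ x hx
      have h3 : (((dig m (c₂ - c₁)).val + 1 : ℕ) : ℤ) + w₂ ≤ W := by exact_mod_cast h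
      nlinarith
  · have hd : (c₁ - c₂) % 7 ^ (m + 1) ≤ ((7 - (dig m (c₂ - c₁)).val : ℕ) : ℤ) * 7 ^ m := by
      rw [← neg_sub]; exact neg_emod_le_of_dig (by omega)
    have hlt := ZMod.val_lt (dig m (c₂ - c₁))
    refine ⟨c₂, by simp [h₂], fun x hx => ?_⟩
    rcases List.mem_append.1 hx with hx | hx
    · have := emod_add_le (x - c₁) (c₁ - c₂) (pow_pos_seven (m + 1))
      rw [sub_add_sub_cancel] at this
      have h2 := hl₁ x hx
      have h3 : ((7 - (dig m (c₂ - c₁)).val : ℕ) : ℤ) + w₁ ≤ W := by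
        have : (7 - (dig m (c₂ - c₁)).val : ℕ) + w₁ ≤ W := by omega
        exact_mod_cast this
      nlinarith
    · exact (hl₂ x hx).trans (by gcongr)

/-- A step at the level `v` of the distance of two arcs joins them, and at the same time avoids
forbidden digits of other numbers of valuation `v`. -/
theorem exists_join {v w₁ w₂ : ℕ} (W : ℕ) (hv : v < m) {l₁ l₂ : List ℤ} (h₁ : Arc m w₁ l₁)
    (h₂ : Arc m w₂ l₂) (d₁ : ∀ p ∈ l₁, ∀ q ∈ l₁, (7 : ℤ) ^ (v + 1) ∣ p - q)
    (d₂ : ∀ p ∈ l₂, ∀ q ∈ l₂, (7 : ℤ) ^ (v + 1) ∣ p - q)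
    (d : ∀ p ∈ l₁, ∀ q ∈ l₂, Lev v (p - q)) (E : List (ℤ × Finset (ZMod 7)))
    (hE : ∀ p ∈ E, Lev v p.1)
    (hc : (Finset.univ.filter fun t => ¬ joinOk w₁ w₂ W t).card +
      (E.map fun p => p.2.card).sum < 7) :
    ∃ k : ℤ, Arc m W ((l₁ ++ l₂).map (step m v k * ·)) ∧
      ∀ p ∈ E, dig m (step m v k * p.1) ∉ p.2 := by
  obtain ⟨c₁, hc₁, hl₁⟩ := h₁
  obtain ⟨c₂, hc₂, hl₂⟩ := h₂
  obtain ⟨k, hk⟩ := exists_step_avoid hv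
    ((c₂ - c₁, Finset.univ.filter fun t => ¬ joinOk w₁ w₂ W t) :: E)
    (by
      simp only [List.mem_cons, forall_eq_or_imp]
      exact ⟨(d _ hc₁ _ hc₂).sub_comm, hE⟩) (by simpa using hc)
  simp only [List.mem_cons, forall_eq_or_imp, Finset.mem_filter, Finset.mem_univ, true_and,
    not_not] at hk
  refine ⟨k, ?_, hk.2⟩
  rw [List.map_append]
  refine arc_of_joinOk (List.mem_map_of_mem hc₁) (List.mem_map_of_mem hc₂) ?_ ?_
    (by rw [← mul_sub]; exact hk.1)
  · intro y hy
    obtain ⟨x, hx, rfl⟩ := List.mem_map.1 hy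
    rw [emod_congr_mul (step_frozen hv.le k (d₁ x hx c₁ hc₁))]
    exact hl₁ x hx
  · intro y hy
    obtain ⟨x, hx, rfl⟩ := List.mem_map.1 hy
    rw [emod_congr_mul (step_frozen hv.le k (d₂ x hx c₂ hc₂))]
    exact hl₂ x hx

/-! ### Gathering one class -/

/-- Some multiplier prime to `7` moves the list onto an arc of length `w 7 ^ m`. -/
def Gather (m : ℕ) (w : ℤ) (l : List ℤ) : Prop :=
  ∃ μ : ℤ, ¬ (7 : ℤ) ∣ μ ∧ Arc m w (l.map (μ * ·))

/-- The members of the list are pairwise incongruent modulo `7 ^ (m + 1)`. -/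
def Distinct (m : ℕ) (l : List ℤ) : Prop := l.Pairwise fun p q => ¬ (7 : ℤ) ^ (m + 1) ∣ p - q

theorem Distinct.perm {l l' : List ℤ} (h : Distinct m l) (hp : l'.Perm l) : Distinct m l' :=
  hp.symm.pairwise h fun h h' => h (by rw [← neg_sub]; exact (dvd_neg).2 h')

theorem Gather.perm {w : ℤ} {l l' : List ℤ} (h : Gather m w l) (hp : l'.Perm l) :
    Gather m w l' := by
  obtain ⟨μ, hμ, h⟩ := h
  exact ⟨μ, hμ, h.perm fun x => (hp.map _).mem_iff⟩

theorem Gather.mono {w w' : ℤ} {l : List ℤ} (hw : w ≤ w') (h : Gather m w l) : Gather m w' l := by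
  obtain ⟨μ, hμ, h⟩ := h
  exact ⟨μ, hμ, h.mono hw⟩

theorem Gather.smul {w : ℤ} {l : List ℤ} {μ : ℤ} (hμ : ¬ (7 : ℤ) ∣ μ)
    (h : Gather m w (l.map (μ * ·))) : Gather m w l := by
  obtain ⟨ν, hν, h⟩ := h
  refine ⟨ν * μ, not_seven_dvd_mul hν hμ, ?_⟩
  simpa [List.map_map, Function.comp_def, mul_assoc] using h

theorem dvd_sub_of_emod_eq {M c : ℤ} {l : List ℤ} (h : ∀ p ∈ l, p % M = c) :
    ∀ p ∈ l, ∀ q ∈ l, M ∣ p - q := fun p hp q hq => by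
  rw [Int.dvd_iff_emod_eq_zero, ← Int.emod_eq_emod_iff_emod_sub_eq_zero, h p hp, h q hq]

theorem dvd_sub_map {M μ : ℤ} {l : List ℤ} (h : ∀ p ∈ l, ∀ q ∈ l, M ∣ p - q) :
    ∀ p ∈ l.map (μ * ·), ∀ q ∈ l.map (μ * ·), M ∣ p - q := by
  intro p hp q hq
  obtain ⟨x, hx, rfl⟩ := List.mem_map.1 hp
  obtain ⟨y, hy, rfl⟩ := List.mem_map.1 hq
  exact dvd_mul_sub (h x hx y hy)

theorem Arc.singleton (x : ℤ) : Arc m (0 : ℕ) [x] := ⟨x, by simp, by simp⟩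

theorem exists_small_pair : ∀ g g' : ZMod 7, ∃ k : ZMod 7, k ≠ 0 ∧
    ((k * g).val ≤ 2 ∨ 7 ≤ (k * g).val + 2) ∧ ((k * g').val ≤ 2 ∨ 7 ≤ (k * g').val + 2) := by
  decide +kernel

theorem exists_cast_eq (k : ZMod 7) : ((k.val : ℤ) : ZMod 7) = k := by simp

theorem near_two_of_dig {q : ℤ} (h : dig m q ∉ ({2, 3, 4} : Finset (ZMod 7))) : Near m 2 q := by
  refine Near.of_dig (w := 2) ?_
  generalize dig m q = d at h
  revert d; decide

/-- Two differences can be brought within `2 / 7` of `0` simultaneously. -/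
theorem exists_near_two_pair {q q' : ℤ} {v v' : ℕ} (hv : v ≤ m) (hv' : v' ≤ m) (hq : Lev v q)
    (hq' : Lev v' q') : ∃ μ : ℤ, ¬ (7 : ℤ) ∣ μ ∧ Near m 2 (μ * q) ∧ Near m 2 (μ * q') := by
  have main : ∀ {q q' : ℤ} {v' : ℕ}, v' < m → Lev m q → Lev v' q' →
      ∃ μ : ℤ, ¬ (7 : ℤ) ∣ μ ∧ Near m 2 (μ * q) ∧ Near m 2 (μ * q') := by
    intro q q' v' hv' hq hq'
    obtain ⟨μ, hμ, h⟩ := exists_scale hq (t := 1) (by decide)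
    obtain ⟨ν, hν, h1, h2⟩ := exists_avoid_one le_rfl hv' (hq'.mul hμ) ({2, 3, 4} : Finset (ZMod 7))
      (by decide)
    refine ⟨ν * μ, not_seven_dvd_mul hν hμ, ?_, ?_⟩
    · rw [mul_assoc]
      exact (Near.of_exact (w := 2) ((hq.mul hμ).dvd le_rfl) (by rw [h]; decide)).congr
        (h2 _ ((hq.mul hμ).dvd le_rfl))
    · rw [mul_assoc]; exact near_two_of_dig h1
  rcases hv.lt_or_eq with hv | rfl
  · rcases hv'.lt_or_eq with hv' | rfl
    · obtain ⟨μ, hμ, h1, h2, -⟩ := exists_avoid_two le_rfl hv hv' hq hq'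
        ({2, 3, 4} : Finset (ZMod 7)) ({2, 3, 4} : Finset (ZMod 7)) (by decide) (by decide)
        (fun _ => by decide)
      exact ⟨μ, hμ, near_two_of_dig h1, near_two_of_dig h2⟩
    · obtain ⟨μ, hμ, h1, h2⟩ := main hv hq' hq
      exact ⟨μ, hμ, h2, h1⟩
  · rcases hv'.lt_or_eq with hv' | rfl
    · exact main hv' hq hq'
    · obtain ⟨k, hk, h1, h2⟩ := exists_small_pair (dig v' q) (dig v' q')
      refine ⟨k.val, zmod_seven_ne_zero.1 (by rwa [exists_cast_eq]), ?_, ?_⟩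
      · refine Near.of_exact (w := 2) (Dvd.dvd.mul_left (hq.dvd le_rfl) _) ?_
        rwa [dig_exact_mul (hq.dvd le_rfl), exists_cast_eq]
      · refine Near.of_exact (w := 2) (Dvd.dvd.mul_left (hq'.dvd le_rfl) _) ?_
        rwa [dig_exact_mul (hq'.dvd le_rfl), exists_cast_eq]

/-- Two differences can be brought within `3 / 7` of `0` while a third number becomes safe. -/
theorem exists_near_three_pair {q q' e : ℤ} {v v' j : ℕ} (hv : v ≤ m) (hv' : v' ≤ m)
    (hq : Lev v q) (hq' : Lev v' q') (hj : j < m) (he : Lev j e) : ∃ μ : ℤ, ¬ (7 : ℤ) ∣ μ ∧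
    Near m 3 (μ * q) ∧ Near m 3 (μ * q') ∧ dig m (μ * e) ∉ ({0, 6} : Finset (ZMod 7)) := by
  have near : ∀ {q : ℤ}, dig m q ∉ ({3} : Finset (ZMod 7)) → Near m 3 q := fun {q} h => by
    refine Near.of_dig (w := 3) ?_
    generalize dig m q = d at h
    revert d; decide
  have cond : ∀ {q : ℤ} {v : ℕ}, v ≤ m → Lev v q → ∃ l : List (ℕ × ℤ × Finset (ZMod 7)),
      (∀ p ∈ l, p.1 < m ∧ Lev p.1 p.2.1) ∧
      (∀ w, ((l.filter fun p => p.1 = w).map fun p => p.2.2.card).sum ≤ 1) ∧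
      ∀ μ : ℤ, (∀ p ∈ l, dig m (μ * p.2.1) ∉ p.2.2) → Near m 3 (μ * q) := by
    intro q v hv hq
    rcases hv.lt_or_eq with hv | rfl
    · refine ⟨[(v, q, {3})], by simpa using ⟨hv, hq⟩, fun w => ?_, fun μ h => near ?_⟩
      · simp only [List.filter_cons, List.filter_nil]
        split_ifs <;> simp
      · simpa using h
    · exact ⟨[], by simp, by simp, fun μ _ =>
        Near.three_of_exact (Dvd.dvd.mul_left (hq.dvd le_rfl) μ)⟩
  obtain ⟨l, hl, hls, hln⟩ := cond hv hq
  obtain ⟨l', hl', hls', hln'⟩ := cond hv' hq'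
  obtain ⟨μ, hμ, h, -⟩ := exists_avoid (m := m) le_rfl ((j, e, {0, 6}) :: (l ++ l'))
    (by
      intro p hp
      rcases List.mem_cons.1 hp with rfl | hp
      · exact ⟨hj, he⟩
      · exact (List.mem_append.1 hp).elim (hl p) (hl' p))
    (by
      intro w
      have h1 := hls w
      have h2 := hls' w
      have h3 : ({0, 6} : Finset (ZMod 7)).card = 2 := by decide
      rw [List.filter_cons]
      split_ifs <;>
        simp only [List.map_cons, List.sum_cons, List.filter_append, List.map_append,
          List.sum_append, h3] <;> omega)
  exact ⟨μ, hμ, hln μ fun p hp => h p (by simp [hp]), hln' μ fun p hp => h p (by simp [hp]),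
    h (j, e, {0, 6}) (by simp)⟩

/-- The levels of a four-element list that is split by a power of `7`, up to order. -/
theorem exists_level_pattern_four {x y z s : ℤ} {v : ℕ}
    (hd : ∀ p ∈ [x, y, z, s], ∀ q ∈ [x, y, z, s], (7 : ℤ) ^ v ∣ p - q)
    (hn : ¬ ∀ p ∈ [x, y, z, s], ∀ q ∈ [x, y, z, s], (7 : ℤ) ^ (v + 1) ∣ p - q) :
    ∃ a b c d, [a, b, c, d].Perm [x, y, z, s] ∧
    ((Lev v (a - b) ∧ Lev v (a - c) ∧ Lev v (b - c) ∧ Lev v (a - d) ∧ Lev v (b - d) ∧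
        Lev v (c - d)) ∨
     ((7 : ℤ) ^ (v + 1) ∣ a - b ∧ Lev v (b - c) ∧ Lev v (b - d) ∧ Lev v (c - d)) ∨
     ((∀ p ∈ [a, b], ∀ q ∈ [a, b], (7 : ℤ) ^ (v + 1) ∣ p - q) ∧
      (∀ p ∈ [c, d], ∀ q ∈ [c, d], (7 : ℤ) ^ (v + 1) ∣ p - q) ∧
      ∀ p ∈ [a, b], ∀ q ∈ [c, d], Lev v (p - q)) ∨
     ((∀ p ∈ [a, b, c], ∀ q ∈ [a, b, c], (7 : ℤ) ^ (v + 1) ∣ p - q) ∧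
      ∀ p ∈ [a, b, c], Lev v (p - d))) := by
  obtain ⟨a, b, c, d, hp, h⟩ := pattern_four (fun x : ℤ => x % 7 ^ (v + 1)) x y z s
  have hd' : ∀ p ∈ [a, b, c, d], ∀ q ∈ [a, b, c, d], (7 : ℤ) ^ v ∣ p - q :=
    fun p h q h' => hd p (hp.mem_iff.1 h) q (hp.mem_iff.1 h')
  have L : ∀ {p q : ℤ}, p ∈ [a, b, c, d] → q ∈ [a, b, c, d] →
      p % 7 ^ (v + 1) ≠ q % 7 ^ (v + 1) → Lev v (p - q) :=
    fun h h' hne => lev_of_emod_ne (hd' _ h _ h') hne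
  refine ⟨a, b, c, d, hp, ?_⟩
  rcases h with ⟨h1, h2, h3, h4, h5, h6⟩ | ⟨h1, h2, h3, h4⟩ | ⟨h1, h2, h3⟩ | ⟨h1, h2, h3⟩ |
    ⟨h1, h2, h3⟩
  · exact .inl ⟨L (by simp) (by simp) h1, L (by simp) (by simp) h2, L (by simp) (by simp) h3,
      L (by simp) (by simp) h4, L (by simp) (by simp) h5, L (by simp) (by simp) h6⟩
  · exact .inr (.inl ⟨emod_eq_iff.1 h1, L (by simp) (by simp) (h1 ▸ h2),
      L (by simp) (by simp) (h1 ▸ h3), L (by simp) (by simp) h4⟩)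
  · refine .inr (.inr (.inl ⟨dvd_sub_of_emod_eq (c := a % 7 ^ (v + 1)) (by simp [h1]),
      dvd_sub_of_emod_eq (c := c % 7 ^ (v + 1)) (by simp [h2]), ?_⟩))
    simp only [List.mem_cons, List.not_mem_nil, or_false, forall_eq_or_imp, forall_eq]
    exact ⟨⟨L (by simp) (by simp) h3, L (by simp) (by simp) (h2 ▸ h3)⟩,
      L (by simp) (by simp) (h1 ▸ h3), L (by simp) (by simp) (h1 ▸ h2 ▸ h3)⟩
  · refine .inr (.inr (.inr ⟨dvd_sub_of_emod_eq (c := a % 7 ^ (v + 1)) (by simp [← h1, ← h2]), ?_⟩))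
    simp only [List.mem_cons, List.not_mem_nil, or_false, forall_eq_or_imp, forall_eq]
    exact ⟨L (by simp) (by simp) h3, L (by simp) (by simp) (h1 ▸ h3),
      L (by simp) (by simp) (h2 ▸ h3)⟩
  · refine absurd (fun p h q h' => ?_) hn
    exact dvd_sub_of_emod_eq (l := [a, b, c, d]) (c := a % 7 ^ (v + 1)) (by simp [← h1, ← h2, ← h3])
      p (hp.mem_iff.2 h) q (hp.mem_iff.2 h')

theorem Distinct.four {a b c d : ℤ} (h : Distinct m [a, b, c, d]) :
    ¬ (7 : ℤ) ^ (m + 1) ∣ a - b ∧ ¬ (7 : ℤ) ^ (m + 1) ∣ a - c ∧ ¬ (7 : ℤ) ^ (m + 1) ∣ b - c ∧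
    ¬ (7 : ℤ) ^ (m + 1) ∣ c - d := by
  simp only [Distinct, List.pairwise_cons, List.mem_cons, List.not_mem_nil, or_false,
    forall_eq_or_imp, forall_eq] at h
  exact ⟨h.1.1, h.1.2.1, h.2.1.1, h.2.2.1⟩

theorem Lev.not_pow_dvd {v : ℕ} {q : ℤ} (h : Lev v q) (hv : v ≤ m) : ¬ (7 : ℤ) ^ (m + 1) ∣ q :=
  fun h' => h.not_dvd ((pow_dvd_pow 7 (by omega)).trans h')

theorem lev_map {v : ℕ} {μ : ℤ} (hμ : ¬ (7 : ℤ) ∣ μ) {l l' : List ℤ}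
    (h : ∀ p ∈ l, ∀ q ∈ l', Lev v (p - q)) :
    ∀ p ∈ l.map (μ * ·), ∀ q ∈ l'.map (μ * ·), Lev v (p - q) := by
  intro p hp q hq
  obtain ⟨x, hx, rfl⟩ := List.mem_map.1 hp
  obtain ⟨y, hy, rfl⟩ := List.mem_map.1 hq
  exact (h x hx y hy).mul_sub hμ

/-- Four numbers whose least valuation of a difference is less than `m` fit on an arc of length
`3 / 7`. -/
theorem gather_four {x y z s : ℤ} {v : ℕ} (hv : v < m)
    (hd : ∀ p ∈ [x, y, z, s], ∀ q ∈ [x, y, z, s], (7 : ℤ) ^ v ∣ p - q)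
    (hn : ¬ ∀ p ∈ [x, y, z, s], ∀ q ∈ [x, y, z, s], (7 : ℤ) ^ (v + 1) ∣ p - q)
    (hP : Distinct m [x, y, z, s]) : Gather m 3 [x, y, z, s] := by
  obtain ⟨a, b, c, d, hp, h⟩ := exists_level_pattern_four hd hn
  obtain ⟨n1, n2, n3, n4⟩ := (hP.perm hp).four
  refine Gather.perm ?_ hp.symm
  rcases h with ⟨h1, h2, h3, h4, h5, h6⟩ | ⟨h1, h2, h3, h4⟩ | ⟨h1, h2, h3⟩ | ⟨h1, h2⟩
  · obtain ⟨k, -, h⟩ := exists_step_arc_four robust_arc_four_three hv h1 h2 h3 h4 h5 h6 ∅ (by simp)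
    exact ⟨_, step_unit hv _, h⟩
  · obtain ⟨v', hv', hq⟩ := exists_lev n1
    obtain ⟨μ, hμ, hn⟩ := exists_near hv' hq
    obtain ⟨k, -, h⟩ := exists_step_arc_three robust_arc_three_two hv (h2.mul_sub hμ)
      (h3.mul_sub hμ) (h4.mul_sub hμ) ∅ (by simp)
    refine Gather.smul hμ ⟨_, step_unit hv k.val, ?_⟩
    refine h.ride (w' := 1) (l' := [step m v k.val * (μ * a)]) (by norm_num) ?_
    simp only [List.mem_cons, List.not_mem_nil, or_false, forall_eq]
    refine ⟨_, Or.inl rfl, ?_⟩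
    rw [emod_congr_mul (step_frozen hv.le _ (dvd_mul_sub h1)), ← mul_sub, one_mul]
    exact hn
  · obtain ⟨v₁, hv₁, hq₁⟩ := exists_lev n1
    obtain ⟨v₂, hv₂, hq₂⟩ := exists_lev n4
    obtain ⟨μ, hμ, hn₁, hn₂⟩ := exists_near_two_pair hv₁ hv₂ hq₁ hq₂
    rw [mul_sub] at hn₁ hn₂
    obtain ⟨k, hk, -⟩ := exists_join (w₁ := 2) (w₂ := 2) 3 hv (hn₁.arc (by norm_num))
      (hn₂.arc (by norm_num)) (dvd_sub_map h1) (dvd_sub_map h2) (lev_map hμ h3) [] (by simp)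
      (by decide)
    exact Gather.smul hμ ⟨_, step_unit hv k, hk⟩
  · obtain ⟨μ, hμ, hA, -⟩ := exists_triple_arc (e := 1) (j := 0) n1 n2 n3 (by omega)
      ⟨1, by norm_num, by norm_num⟩ (K := ∅) (by simp)
    obtain ⟨k, hk, -⟩ := exists_join (w₁ := 3) (w₂ := 0) 3 hv hA (Arc.singleton (μ * d))
      (dvd_sub_map (l := [a, b, c]) h1) (by simp)
      (lev_map (l := [a, b, c]) (l' := [d]) hμ (by simpa using h2)) [] (by simp) (by decide)
    exact Gather.smul hμ ⟨_, step_unit hv k, hk⟩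

theorem Solvable.of_arc_frozen (hm : 0 < m) {c : ZMod 7} (hc : c ≠ 0) {l : List ℤ}
    (hl : ∀ p ∈ l, (p : ZMod 7) = c) {e μ : ℤ} (he : (7 : ℤ) ∣ e) (hμ : ¬ (7 : ℤ) ∣ μ)
    (hA : Arc m 4 (l.map (μ * ·))) (hs : dig m (μ * e) ∉ ({0, 6} : Finset (ZMod 7))) :
    Solvable m (e :: l) := by
  refine Solvable.smul hμ (Solvable.of_arc_four hm (c := μ * c)
    (mul_ne_zero (zmod_seven_ne_zero.2 hμ) hc) hA ?_ ?_)
  · intro p hp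
    obtain ⟨x, hx, rfl⟩ := List.mem_map.1 hp
    rw [Int.cast_mul, hl x hx]
  · simp only [List.map_cons, List.mem_cons, forall_eq_or_imp]
    exact ⟨Or.inl ⟨he.mul_left μ, Safe.of_not_mem hs⟩, fun x hx => Or.inr hx⟩

theorem Distinct.not_forall_dvd {x y : ℤ} {l : List ℤ} (hP : Distinct m (x :: y :: l)) :
    ¬ ∀ p ∈ x :: y :: l, ∀ q ∈ x :: y :: l, (7 : ℤ) ^ (m + 1) ∣ p - q := by
  intro h
  simp only [Distinct, List.pairwise_cons] at hP
  exact hP.1 y (by simp) (h x (by simp) y (by simp))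

/-- Four numbers of one class and a number divisible by `7`. -/
theorem Solvable.four_equal {e x y z s : ℤ} {j : ℕ} (hj1 : 1 ≤ j) (hj : j < m) (he : Lev j e)
    {c : ZMod 7} (hc : c ≠ 0) (hl : ∀ p ∈ [x, y, z, s], (p : ZMod 7) = c)
    (hP : Distinct m [x, y, z, s]) : Solvable m [e, x, y, z, s] := by
  have hm : 0 < m := by omega
  have h7e : (7 : ℤ) ∣ e := by simpa using he.dvd hj1
  obtain ⟨v, hv, hd, hn⟩ := exists_min_level hP.not_forall_dvd
  rcases lt_or_ge j v with hjv | hjv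
  · obtain ⟨μ, hμ, hA⟩ : Gather m 4 [x, y, z, s] := by
      rcases hv.lt_or_eq with hv | rfl
      · exact (gather_four hv hd hn hP).mono (by norm_num)
      · exact exists_arc_of_exact (w := 4) (x₀ := x) (by simp)
          (fun p hp => hd p hp x (by simp))
          (fun S hS => exists_scale_digits_four S (hS.trans (by simp)))
    obtain ⟨ν, hν, h1, h2⟩ := exists_avoid_one hv hjv (he.mul hμ) ({0, 6} : Finset (ZMod 7))
      (by decide)
    refine Solvable.of_arc_frozen hm hc hl h7e (not_seven_dvd_mul hν hμ) ?_
      (by rwa [mul_assoc])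
    have := hA.fixed (μ := ν) fun p hp q hq => h2 _ (dvd_sub_map hd p hp q hq)
    simpa [List.map_map, Function.comp_def, mul_assoc] using this
  have hvm : v < m := by omega
  obtain ⟨a, b, c', d, hp, h⟩ := exists_level_pattern_four hd hn
  obtain ⟨n1, n2, n3, n4⟩ := (hP.perm hp).four
  have hl' : ∀ p ∈ [a, b, c', d], (p : ZMod 7) = c := fun p h => hl p (hp.mem_iff.1 h)
  refine Solvable.mono (l' := e :: [a, b, c', d]) (fun p h => ((hp.cons e).mem_iff).2 h) ?_
  have hfin : ∀ {μ : ℤ}, ¬ (7 : ℤ) ∣ μ → ∀ k : ℤ,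
      Arc m 4 (([a, b, c', d].map (μ * ·)).map (step m v k * ·)) →
      dig m (step m v k * (μ * e)) ∉ ({0, 6} : Finset (ZMod 7)) →
      Solvable m (e :: [a, b, c', d]) := by
    intro μ hμ k hA hs
    refine Solvable.of_arc_frozen hm hc hl' h7e (not_seven_dvd_mul (step_unit hvm k) hμ) ?_
      (by rwa [mul_assoc])
    simpa [List.map_map, Function.comp_def, mul_assoc] using hA
  have hfr : ∀ {μ : ℤ}, ¬ (7 : ℤ) ∣ μ → v < j → dig m (μ * e) ∉ ({0, 6} : Finset (ZMod 7)) →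
      ∀ k : ℤ, dig m (step m v k * (μ * e)) ∉ ({0, 6} : Finset (ZMod 7)) := by
    intro μ hμ hvj hs k
    rwa [dig_congr (step_frozen hvm.le k ((he.mul hμ).dvd hvj))]
  rcases h with ⟨h1, h2, h3, h4, h5, h6⟩ | ⟨h1, h2, h3, h4⟩ | ⟨h1, h2, h3⟩ | ⟨h1, h2⟩
  · obtain ⟨μ, hμ, k, hs, u, hu⟩ : ∃ μ : ℤ, ¬ (7 : ℤ) ∣ μ ∧ ∃ k : ZMod 7,
        dig m (step m v k.val * (μ * e)) ∉ ({0, 6} : Finset (ZMod 7)) ∧ ∃ u : ZMod 7,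
        ∀ p ∈ [μ * a, μ * b, μ * c', μ * d], dig m (step m v k.val * p) ≠ u ∧
          dig m (step m v k.val * p) ≠ u + 1 := by
      rcases hjv.lt_or_eq with hvj | rfl
      · obtain ⟨μ, hμ, hs, -⟩ := exists_avoid_one (m := m) le_rfl hj he
          ({0, 6} : Finset (ZMod 7)) (by decide)
        obtain ⟨k, -, h⟩ := exists_step_gap_four hvm (h1.mul_sub hμ) (h2.mul_sub hμ)
          (h3.mul_sub hμ) (h4.mul_sub hμ) (h5.mul_sub hμ) (h6.mul_sub hμ) ∅ (by simp)
        exact ⟨μ, hμ, k, hfr hμ hvj hs _, h⟩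
      · obtain ⟨K, hK, hK'⟩ := exists_bad_shifts hj he ({0, 6} : Finset (ZMod 7))
        obtain ⟨k, hk, h⟩ := exists_step_gap_four hvm h1 h2 h3 h4 h5 h6 K hK
        exact ⟨1, by norm_num, k, by simpa using hK' k hk, by simpa using h⟩
    have hu' := step_unit hvm k.val
    refine Solvable.smul hμ (Solvable.smul hu' (Solvable.of_gap hm
      (A := ([a, b, c', d].map (μ * ·)).map (step m v k.val * ·))
      (c := (step m v k.val : ℤ) * (μ * c))
      (mul_ne_zero (zmod_seven_ne_zero.2 hu') (mul_ne_zero (zmod_seven_ne_zero.2 hμ) hc))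
      (u := u) ?_ ?_ ?_))
    · intro p hp
      simp only [List.map_map, List.mem_map, Function.comp_apply] at hp
      obtain ⟨x, hx, rfl⟩ := hp
      push_cast; rw [hl' x hx]
    · intro p hp
      obtain ⟨x, hx, rfl⟩ := List.mem_map.1 hp
      exact hu x hx
    · simp only [List.map_cons, List.mem_cons, forall_eq_or_imp]
      refine ⟨Or.inl ⟨(h7e.mul_left _).mul_left _, Safe.of_not_mem hs⟩, ?_, ?_, ?_, ?_, ?_⟩ <;> simp
  · obtain ⟨v', hv', hq⟩ := exists_lev n1
    have hvv : v < v' := by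
      by_contra hlt
      exact hq.not_dvd ((pow_dvd_pow 7 (by omega)).trans h1)
    obtain ⟨μ, hμ, hn, hs⟩ := exists_near_avoid hv' hq hj he
      (by decide : ({0, 6} : Finset (ZMod 7)).card ≤ 2)
    rw [mul_sub] at hn
    have key : ∀ {a b : ℤ}, (7 : ℤ) ^ (v + 1) ∣ a - b → Lev v (b - c') → Lev v (b - d) →
        (μ * a - μ * b) % 7 ^ (m + 1) ≤ (if j = v' then 2 else 1) * 7 ^ m →
        ∃ k : ℤ, Arc m 4 (([a, b, c', d].map (μ * ·)).map (step m v k * ·)) ∧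
          dig m (step m v k * (μ * e)) ∉ ({0, 6} : Finset (ZMod 7)) := by
      intro a b h1 h2 h3 hab
      have hride : ∀ (k : ℤ), (step m v k * (μ * a) - step m v k * (μ * b)) % 7 ^ (m + 1) ≤
          (if j = v' then 2 else 1) * 7 ^ m := fun k => by
        rwa [emod_congr_mul (step_frozen hvm.le _ (dvd_mul_sub h1))]
      rcases hjv.lt_or_eq with hvj | rfl
      · obtain ⟨k, -, h⟩ := exists_step_arc_three robust_arc_three_two hvm (h2.mul_sub hμ)
          (h3.mul_sub hμ) (h4.mul_sub hμ) ∅ (by simp)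
        refine ⟨k.val, (h.ride (w' := 2) (l' := [step m v k.val * (μ * a)]) (by norm_num) ?_),
          hfr hμ hvj hs _⟩
        simp only [List.mem_cons, List.not_mem_nil, or_false, forall_eq]
        refine ⟨_, Or.inl rfl, (hride k.val).trans ?_⟩
        have := pow_pos_seven m
        split_ifs <;> linarith
      · rw [if_neg hvv.ne] at hride
        obtain ⟨K, hK, hK'⟩ := exists_bad_shifts hvm (he.mul hμ) ({0, 6} : Finset (ZMod 7))
        obtain ⟨k, hk, h⟩ := exists_step_arc_three robust_arc_three_three hvm (h2.mul_sub hμ)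
          (h3.mul_sub hμ) (h4.mul_sub hμ) K hK
        refine ⟨k.val, (h.ride (w' := 1) (l' := [step m v k.val * (μ * a)]) (by norm_num) ?_),
          hK' k hk⟩
        simp only [List.mem_cons, List.not_mem_nil, or_false, forall_eq]
        exact ⟨_, Or.inl rfl, hride k.val⟩
    rcases hn with hn | hn
    · obtain ⟨k, hA, hs⟩ := key h1 h2 h3 hn
      exact hfin hμ k hA hs
    · rw [neg_sub] at hn
      have g : ∀ {q : ℤ}, Lev v (b - q) → Lev v (a - q) := fun {q} hbq => by
        have := Lev.sub_of_lt hbq hq.sub_comm hvv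
        rwa [sub_sub_sub_cancel_left, ] at this
      obtain ⟨k, hA, hs⟩ := key (a := b) (b := a) (by rwa [← dvd_neg, neg_sub]) (g h2) (g h3) hn
      exact hfin hμ k (hA.perm fun p => by simp only [List.map_cons, List.mem_cons]; tauto) hs
  · obtain ⟨v₁, hv₁, hq₁⟩ := exists_lev n1
    obtain ⟨v₂, hv₂, hq₂⟩ := exists_lev n4
    rcases hjv.lt_or_eq with hvj | rfl
    · obtain ⟨μ, hμ, hn₁, hn₂, hs⟩ := exists_near_three_pair hv₁ hv₂ hq₁ hq₂ hj he
      rw [mul_sub] at hn₁ hn₂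
      obtain ⟨k, hk, -⟩ := exists_join (w₁ := 3) (w₂ := 3) 4 hvm (hn₁.arc (by norm_num))
        (hn₂.arc (by norm_num)) (dvd_sub_map h1) (dvd_sub_map h2) (lev_map hμ h3) [] (by simp)
        (by decide)
      exact hfin hμ k hk (hfr hμ hvj hs _)
    · obtain ⟨μ, hμ, hn₁, hn₂⟩ := exists_near_two_pair hv₁ hv₂ hq₁ hq₂
      rw [mul_sub] at hn₁ hn₂
      obtain ⟨k, hk, hs⟩ := exists_join (w₁ := 2) (w₂ := 2) 4 hvm (hn₁.arc (by norm_num))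
        (hn₂.arc (by norm_num)) (dvd_sub_map h1) (dvd_sub_map h2) (lev_map hμ h3)
        [(μ * e, {0, 6})] (by simpa using he.mul hμ)
        (by simp only [List.map_cons, List.map_nil]; decide)
      exact hfin hμ k hk (by simpa using hs)
  · obtain ⟨μ, hμ, hA, hs⟩ := exists_triple_arc n1 n2 n3 hj he
      (by decide : ({0, 6} : Finset (ZMod 7)).card ≤ 2)
    have hLs := lev_map (l := [a, b, c']) (l' := [d]) hμ (by simpa using h2)
    have hD := dvd_sub_map (μ := μ) (l := [a, b, c']) h1
    rcases hjv.lt_or_eq with hvj | rfl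
    · obtain ⟨k, hk, -⟩ := exists_join (w₁ := 3) (w₂ := 0) 4 hvm hA (Arc.singleton (μ * d))
        hD (by simp) hLs [] (by simp) (by decide)
      exact hfin hμ k hk (hfr hμ hvj hs _)
    · obtain ⟨k, hk, hs⟩ := exists_join (w₁ := 3) (w₂ := 0) 4 hvm hA (Arc.singleton (μ * d))
        hD (by simp) hLs [(μ * e, {0, 6})] (by simpa using he.mul hμ)
        (by simp only [List.map_cons, List.map_nil]; decide)
      exact hfin hμ k hk (by simpa using hs)

/-! ### Five numbers of one class -/

/-- The levels of a five-element list that is split by a power of `7`, up to order. -/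
theorem exists_level_pattern_five {x y z s t : ℤ} {v : ℕ}
    (hd : ∀ p ∈ [x, y, z, s, t], ∀ q ∈ [x, y, z, s, t], (7 : ℤ) ^ v ∣ p - q)
    (hn : ¬ ∀ p ∈ [x, y, z, s, t], ∀ q ∈ [x, y, z, s, t], (7 : ℤ) ^ (v + 1) ∣ p - q) :
    ∃ a b c d e, [a, b, c, d, e].Perm [x, y, z, s, t] ∧
    ((Lev v (a - b) ∧ Lev v (a - c) ∧ Lev v (b - c) ∧ Lev v (a - d) ∧ Lev v (b - d) ∧
        Lev v (c - d) ∧ Lev v (a - e) ∧ Lev v (b - e) ∧ Lev v (c - e) ∧ Lev v (d - e)) ∨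
     ((∀ p ∈ [a, b], ∀ q ∈ [a, b], (7 : ℤ) ^ (v + 1) ∣ p - q) ∧
      (∀ p ∈ [a, b], ∀ q ∈ [c, d, e], Lev v (p - q)) ∧ Lev v (c - d) ∧ Lev v (c - e) ∧
      Lev v (d - e)) ∨
     ((∀ p ∈ [a, b], ∀ q ∈ [a, b], (7 : ℤ) ^ (v + 1) ∣ p - q) ∧
      (∀ p ∈ [c, d], ∀ q ∈ [c, d], (7 : ℤ) ^ (v + 1) ∣ p - q) ∧
      (∀ p ∈ [a, b], ∀ q ∈ [c, d], Lev v (p - q)) ∧ (∀ p ∈ [a, b], Lev v (p - e)) ∧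
      ∀ p ∈ [c, d], Lev v (p - e)) ∨
     ((∀ p ∈ [a, b, c], ∀ q ∈ [a, b, c], (7 : ℤ) ^ (v + 1) ∣ p - q) ∧
      ∀ p ∈ [a, b, c], ∀ q ∈ [d, e], Lev v (p - q)) ∨
     ((∀ p ∈ [a, b, c, d], ∀ q ∈ [a, b, c, d], (7 : ℤ) ^ (v + 1) ∣ p - q) ∧
      ∀ p ∈ [a, b, c, d], ∀ q ∈ [e], Lev v (p - q))) := by
  obtain ⟨a, b, c, d, e, hp, h⟩ := pattern_five (fun x : ℤ => x % 7 ^ (v + 1)) x y z s t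
  have hd' : ∀ p ∈ [a, b, c, d, e], ∀ q ∈ [a, b, c, d, e], (7 : ℤ) ^ v ∣ p - q :=
    fun p h q h' => hd p (hp.mem_iff.1 h) q (hp.mem_iff.1 h')
  have L : ∀ {l l' : List ℤ} {u w : ℤ}, (∀ p ∈ l, p % 7 ^ (v + 1) = u) →
      (∀ p ∈ l', p % 7 ^ (v + 1) = w) → u ≠ w → (∀ p ∈ l, p ∈ [a, b, c, d, e]) →
      (∀ p ∈ l', p ∈ [a, b, c, d, e]) → ∀ p ∈ l, ∀ q ∈ l', Lev v (p - q) :=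
    fun h1 h2 h3 h4 h5 p hp q hq =>
      lev_of_emod_ne (hd' _ (h4 p hp) _ (h5 q hq)) (by rw [h1 p hp, h2 q hq]; exact h3)
  have M : ∀ {p q : ℤ}, p % 7 ^ (v + 1) ≠ q % 7 ^ (v + 1) → p ∈ [a, b, c, d, e] →
      q ∈ [a, b, c, d, e] → Lev v (p - q) :=
    fun h h1 h2 => lev_of_emod_ne (hd' _ h1 _ h2) h
  refine ⟨a, b, c, d, e, hp, ?_⟩
  rcases h with ⟨h1, h2, h3, h4, h5, h6, h7, h8, h9, h10⟩ | ⟨h1, h2, h3, h4, h5, h6, h7⟩ |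
    ⟨h1, h2, h3, h4, h5⟩ | ⟨h1, h2, h3, h4, h5⟩ | ⟨h1, h2, h3, h4⟩ | ⟨h1, h2, h3, h4⟩ |
    ⟨h1, h2, h3, h4⟩
  · refine .inl ⟨M h1 ?_ ?_, M h2 ?_ ?_, M h3 ?_ ?_, M h4 ?_ ?_, M h5 ?_ ?_, M h6 ?_ ?_,
      M h7 ?_ ?_, M h8 ?_ ?_, M h9 ?_ ?_, M h10 ?_ ?_⟩ <;> simp
  · refine .inr (.inl ⟨dvd_sub_of_emod_eq (c := a % 7 ^ (v + 1)) (by simp [← h1]), ?_,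
      M h4 ?_ ?_, M h6 ?_ ?_, M h7 ?_ ?_⟩)
    · intro p hp q hq
      have e1 : p % 7 ^ (v + 1) = a % 7 ^ (v + 1) := by
        simp only [List.mem_cons, List.not_mem_nil, or_false] at hp
        rcases hp with rfl | rfl <;> simp [h1]
      refine M ?_ (by simp at hp ⊢; tauto) (by simp at hq ⊢; tauto)
      rw [e1]
      simp only [List.mem_cons, List.not_mem_nil, or_false] at hq
      rcases hq with rfl | rfl | rfl <;> assumption
    all_goals simp
  · refine .inr (.inr (.inl ⟨dvd_sub_of_emod_eq (c := a % 7 ^ (v + 1)) (by simp [← h1]),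
      dvd_sub_of_emod_eq (c := c % 7 ^ (v + 1)) (by simp [← h2]),
      L (u := a % 7 ^ (v + 1)) (w := c % 7 ^ (v + 1)) (by simp [← h1]) (by simp [← h2]) h3
        (by simp) (by simp), ?_, ?_⟩))
    · have := L (l := [a, b]) (l' := [e]) (u := a % 7 ^ (v + 1)) (w := e % 7 ^ (v + 1))
        (by simp [← h1]) (by simp) h4 (by simp) (by simp)
      simpa using this
    · have := L (l := [c, d]) (l' := [e]) (u := c % 7 ^ (v + 1)) (w := e % 7 ^ (v + 1))
        (by simp [← h2]) (by simp) h5 (by simp) (by simp)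
      simpa using this
  · refine .inr (.inr (.inr (.inl ⟨dvd_sub_of_emod_eq (c := a % 7 ^ (v + 1))
      (by simp [← h1, ← h2]), ?_⟩)))
    intro p hp q hq
    have e1 : p % 7 ^ (v + 1) = a % 7 ^ (v + 1) := by
      simp only [List.mem_cons, List.not_mem_nil, or_false] at hp
      rcases hp with rfl | rfl | rfl <;> simp [← h1, ← h2]
    refine M ?_ (by simp at hp ⊢; tauto) (by simp at hq ⊢; tauto)
    rw [e1]
    simp only [List.mem_cons, List.not_mem_nil, or_false] at hq
    rcases hq with rfl | rfl <;> assumption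
  · exact .inr (.inr (.inr (.inl ⟨dvd_sub_of_emod_eq (c := a % 7 ^ (v + 1))
      (by simp [← h1, ← h2]), L (u := a % 7 ^ (v + 1)) (w := d % 7 ^ (v + 1))
      (by simp [← h1, ← h2]) (by simp [← h4]) h3 (by simp) (by simp)⟩)))
  · exact .inr (.inr (.inr (.inr ⟨dvd_sub_of_emod_eq (c := a % 7 ^ (v + 1))
      (by simp [← h1, ← h2, ← h3]), L (u := a % 7 ^ (v + 1)) (w := e % 7 ^ (v + 1))
      (by simp [← h1, ← h2, ← h3]) (by simp) h4 (by simp) (by simp)⟩)))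
  · refine absurd (fun p h q h' => ?_) hn
    exact dvd_sub_of_emod_eq (l := [a, b, c, d, e]) (c := a % 7 ^ (v + 1))
      (by simp [← h1, ← h2, ← h3, ← h4]) p (hp.mem_iff.2 h) q (hp.mem_iff.2 h')

/-- Four incongruent numbers fit on an arc of length `4 / 7`. -/
theorem gather_four_four {x y z s : ℤ} (hP : Distinct m [x, y, z, s]) :
    Gather m 4 [x, y, z, s] := by
  obtain ⟨v, hv, hd, hn⟩ := exists_min_level hP.not_forall_dvd
  rcases hv.lt_or_eq with hv | rfl
  · exact (gather_four hv hd hn hP).mono (by norm_num)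
  · exact exists_arc_of_exact (w := 4) (x₀ := x) (by simp) (fun p hp => hd p hp x (by simp))
      (fun S hS => exists_scale_digits_four S (hS.trans (by simp)))

/-- A triple on an arc of length `3 / 7` and a pair within the same distance. -/
theorem exists_triple_arc_near {x y z q : ℤ} (h1 : ¬ (7 : ℤ) ^ (m + 1) ∣ x - y)
    (h2 : ¬ (7 : ℤ) ^ (m + 1) ∣ x - z) (h3 : ¬ (7 : ℤ) ^ (m + 1) ∣ y - z)
    (hm : 0 < m) (hq : ¬ (7 : ℤ) ^ (m + 1) ∣ q) :
    ∃ μ : ℤ, ¬ (7 : ℤ) ∣ μ ∧ Arc m 3 [μ * x, μ * y, μ * z] ∧ Near m 3 (μ * q) := by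
  obtain ⟨j, hj, hqj⟩ := exists_lev hq
  rcases hj.lt_or_eq with hj | rfl
  · obtain ⟨μ, hμ, hA, hs⟩ := exists_triple_arc h1 h2 h3 hj hqj
      (by decide : ({3} : Finset (ZMod 7)).card ≤ 2)
    refine ⟨μ, hμ, hA, Near.of_dig (w := 3) ?_⟩
    generalize dig m (μ * q) = d at hs
    revert d; decide
  · obtain ⟨μ, hμ, hA, -⟩ := exists_triple_arc (e := 1) (j := 0) h1 h2 h3 hm
      ⟨1, by norm_num, by norm_num⟩ (K := ∅) (by simp)
    exact ⟨μ, hμ, hA, Near.three_of_exact (Dvd.dvd.mul_left (hqj.dvd le_rfl) μ)⟩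

/-- Five incongruent numbers fit on an arc of length `4 / 7`. The proof goes through the ways in
which the numbers split at the least valuation of a difference. -/
theorem gather_five {x y z s t : ℤ} (hm : 0 < m) (hP : Distinct m [x, y, z, s, t]) :
    Gather m 4 [x, y, z, s, t] := by
  obtain ⟨v, hv, hd, hn⟩ := exists_min_level hP.not_forall_dvd
  rcases hv.lt_or_eq with hv | rfl
  swap
  · exact exists_arc_of_exact (w := 4) (x₀ := x) (by simp) (fun p hp => hd p hp x (by simp))
      (fun S hS => exists_scale_digits_four S (hS.trans (by simp)))
  obtain ⟨a, b, c, d, e, hp, h⟩ := exists_level_pattern_five hd hn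
  have hP' := hP.perm hp
  refine Gather.perm ?_ hp.symm
  rcases h with ⟨h1, h2, h3, h4, h5, h6, h7, h8, h9, h10⟩ | ⟨h1, h2, h3, h4, h5⟩ |
    ⟨h1, h2, h3, h4, h5⟩ | ⟨h1, h2⟩ | ⟨h1, h2⟩
  · obtain ⟨k, -, h⟩ := exists_step_arc_five robust_arc_five_four hv h1 h2 h3 h4 h5 h6 h7 h8 h9 h10
      ∅ (by simp)
    exact ⟨_, step_unit hv _, h⟩
  · simp only [Distinct, List.pairwise_cons, List.mem_cons, List.not_mem_nil, or_false,
      forall_eq_or_imp, forall_eq] at hP' h2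
    obtain ⟨v', hv', hq⟩ := exists_lev hP'.1.1
    obtain ⟨μ, hμ, hn⟩ := exists_near hv' hq
    obtain ⟨-, b1, b2, b3⟩ := h2
    obtain ⟨k, -, h⟩ := exists_step_arc_four robust_arc_four_three hv (b1.mul_sub hμ)
      (b2.mul_sub hμ) (h3.mul_sub hμ) (b3.mul_sub hμ) (h4.mul_sub hμ) (h5.mul_sub hμ) ∅ (by simp)
    refine Gather.smul hμ ⟨_, step_unit hv k.val, ?_⟩
    refine h.ride (w' := 1) (l' := [step m v k.val * (μ * a)]) (by norm_num) ?_
    simp only [List.mem_cons, List.not_mem_nil, or_false, forall_eq]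
    refine ⟨_, Or.inl rfl, ?_⟩
    rw [emod_congr_mul (step_frozen hv.le _ (dvd_mul_sub (h1 a (by simp) b (by simp)))), ← mul_sub,
      one_mul]
    exact hn
  · obtain ⟨v₁, hv₁, hq₁⟩ := exists_lev (show ¬ (7 : ℤ) ^ (m + 1) ∣ a - b by
      simp only [Distinct, List.pairwise_cons, List.mem_cons, forall_eq_or_imp] at hP'
      exact hP'.1.1)
    obtain ⟨v₂, hv₂, hq₂⟩ := exists_lev (show ¬ (7 : ℤ) ^ (m + 1) ∣ c - d by
      simp only [Distinct, List.pairwise_cons, List.mem_cons, forall_eq_or_imp] at hP'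
      exact hP'.2.2.1.1)
    obtain ⟨μ, hμ, hn₁, hn₂⟩ := exists_near_two_pair hv₁ hv₂ hq₁ hq₂
    rw [mul_sub] at hn₁ hn₂
    obtain ⟨c₁, hc₁, hl₁⟩ : Arc m 2 ([a, b].map (μ * ·)) := hn₁.arc (by norm_num)
    obtain ⟨c₂, hc₂, hl₂⟩ : Arc m 2 ([c, d].map (μ * ·)) := hn₂.arc (by norm_num)
    obtain ⟨b₁, hb₁, rfl⟩ := List.mem_map.1 hc₁
    obtain ⟨b₂, hb₂, rfl⟩ := List.mem_map.1 hc₂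
    obtain ⟨k, -, h⟩ := exists_step_arc_three robust_arc_three_two hv
      ((h3 b₁ hb₁ b₂ hb₂).mul_sub hμ) ((h4 b₁ hb₁).mul_sub hμ) ((h5 b₂ hb₂).mul_sub hμ) ∅ (by simp)
    refine Gather.smul hμ ⟨_, step_unit hv k.val, ?_⟩
    have := h.ride (w' := 2) (l' := (([a, b] ++ [c, d]).map (μ * ·)).map (step m v k.val * ·))
      (by norm_num) ?_
    · refine this.perm fun p => ?_
      have i₁ : step m v k.val * (μ * b₁) ∈
          (([a, b] ++ [c, d]).map (μ * ·)).map (step m v k.val * ·) :=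
        List.mem_map_of_mem (List.mem_map_of_mem (by simp at hb₁ ⊢; tauto))
      have i₂ : step m v k.val * (μ * b₂) ∈
          (([a, b] ++ [c, d]).map (μ * ·)).map (step m v k.val * ·) :=
        List.mem_map_of_mem (List.mem_map_of_mem (by simp at hb₂ ⊢; tauto))
      have e1 : (([a, b, c, d, e].map (μ * ·)).map (step m v k.val * ·)) =
        (([a, b] ++ [c, d]).map (μ * ·)).map (step m v k.val * ·) ++
          [step m v k.val * (μ * e)] := rfl
      rw [e1]
      simp only [List.mem_append, List.mem_cons, List.not_mem_nil, or_false]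
      constructor
      · rintro (h | h)
        · exact Or.inl h
        · exact Or.inr (Or.inr (Or.inr h))
      · rintro (h | rfl | rfl | h)
        · exact Or.inl h
        · exact Or.inl i₁
        · exact Or.inl i₂
        · exact Or.inr h
    · intro p hp
      obtain ⟨q, hq, rfl⟩ := List.mem_map.1 hp
      obtain ⟨x, hx, rfl⟩ := List.mem_map.1 hq
      rcases List.mem_append.1 hx with hx | hx
      · refine ⟨_, List.mem_cons_self, ?_⟩
        rw [emod_congr_mul (step_frozen hv.le _ (dvd_mul_sub (h1 x hx b₁ hb₁)))]
        exact hl₁ _ (List.mem_map_of_mem hx)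
      · refine ⟨_, List.mem_cons_of_mem _ List.mem_cons_self, ?_⟩
        rw [emod_congr_mul (step_frozen hv.le _ (dvd_mul_sub (h2 x hx b₂ hb₂)))]
        exact hl₂ _ (List.mem_map_of_mem hx)
  · simp only [Distinct, List.pairwise_cons, List.mem_cons, List.not_mem_nil, or_false,
      forall_eq_or_imp, forall_eq] at hP'
    obtain ⟨⟨n1, n2, -⟩, ⟨n3, -⟩, -, n4, -⟩ := hP'
    by_cases hde : d % 7 ^ (v + 1) = e % 7 ^ (v + 1)
    · obtain ⟨μ, hμ, hA, hn⟩ := exists_triple_arc_near n1 n2 n3 hm n4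
      rw [mul_sub] at hn
      obtain ⟨k, hk, -⟩ := exists_join (w₁ := 3) (w₂ := 3) 4 hv hA (hn.arc (by norm_num))
        (dvd_sub_map (l := [a, b, c]) h1)
        (dvd_sub_map (l := [d, e]) (dvd_sub_of_emod_eq (c := d % 7 ^ (v + 1)) (by simp [← hde])))
        (lev_map (l := [a, b, c]) (l' := [d, e]) hμ h2) [] (by simp) (by decide)
      exact Gather.smul hμ ⟨_, step_unit hv k, hk⟩
    · obtain ⟨μ, hμ, hA, -⟩ := exists_triple_arc (e := 1) (j := 0) n1 n2 n3 hm
        ⟨1, by norm_num, by norm_num⟩ (K := ∅) (by simp)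
      obtain ⟨b₁, hb₁, hl⟩ : Arc m 3 ([a, b, c].map (μ * ·)) := hA
      obtain ⟨o, ho, rfl⟩ := List.mem_map.1 hb₁
      obtain ⟨k, hk⟩ := exists_step_avoid hv
        [(μ * d - μ * o, ({4, 5, 6} : Finset (ZMod 7))), (μ * e - μ * o, {4, 5, 6})]
        (by
          simp only [List.mem_cons, List.not_mem_nil, or_false, forall_eq_or_imp, forall_eq]
          exact ⟨((h2 o ho d (by simp)).sub_comm).mul_sub hμ,
            ((h2 o ho e (by simp)).sub_comm).mul_sub hμ⟩)
        (by simp only [List.map_cons, List.map_nil]; decide)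
      simp only [List.mem_cons, List.not_mem_nil, or_false, forall_eq_or_imp, forall_eq] at hk
      refine Gather.smul hμ ⟨_, step_unit hv k, step m v k * (μ * o),
        List.mem_map_of_mem (List.mem_map_of_mem (by simp at ho ⊢; tauto)), ?_⟩
      have far : ∀ {q : ℤ}, dig m q ∉ ({4, 5, 6} : Finset (ZMod 7)) →
          q % 7 ^ (m + 1) ≤ 4 * 7 ^ m := fun {q} h => by
        refine (emod_lt_of_dig (w := 4) ?_).le
        generalize dig m q = d at h
        revert d; decide
      intro p hp
      rw [List.map_map, List.mem_map] at hp
      obtain ⟨x, hx, rfl⟩ := hp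
      simp only [Function.comp_apply]
      by_cases hx3 : x ∈ [a, b, c]
      · rw [emod_congr_mul (step_frozen hv.le _ (dvd_mul_sub (h1 x hx3 o ho)))]
        refine (hl _ (List.mem_map_of_mem hx3)).trans ?_
        have := pow_pos_seven m
        linarith
      · rw [← mul_sub]
        have : x = d ∨ x = e := by simp at hx hx3; tauto
        rcases this with rfl | rfl
        · exact far hk.1
        · exact far hk.2
  · obtain ⟨μ, hμ, hA⟩ := gather_four_four (x := a) (y := b) (z := c) (s := d)
      (hP'.sublist (by simp))
    obtain ⟨k, hk, -⟩ := exists_join (w₁ := 4) (w₂ := 0) 4 hv hA (Arc.singleton (μ * e))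
      (dvd_sub_map h1) (by simp) (lev_map (l' := [e]) hμ h2) [] (by simp) (by decide)
    exact Gather.smul hμ ⟨_, step_unit hv k, hk⟩

theorem Solvable.of_gather_four (hm : 0 < m) {c : ZMod 7} (hc : c ≠ 0) {l : List ℤ}
    (hl : ∀ p ∈ l, (p : ZMod 7) = c) (h : Gather m 4 l) : Solvable m l := by
  obtain ⟨μ, hμ, hA⟩ := h
  refine Solvable.smul hμ (Solvable.of_arc_four hm (c := μ * c)
    (mul_ne_zero (zmod_seven_ne_zero.2 hμ) hc) hA ?_ fun x hx => Or.inr hx)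
  intro p hp
  obtain ⟨x, hx, rfl⟩ := List.mem_map.1 hp
  rw [Int.cast_mul, hl x hx]

/-! ### Four units -/

/-- Representatives of the residue classes modulo `7` prime to `7`, up to sign. -/
def Canonical (x : ℤ) : Prop := (x : ZMod 7) = 1 ∨ (x : ZMod 7) = 2 ∨ (x : ZMod 7) = 3

theorem Canonical.ne_zero {x : ℤ} (h : Canonical x) : (x : ZMod 7) ≠ 0 := by
  rcases h with h | h | h <;> rw [h] <;> decide

theorem Canonical.not_dvd {x : ℤ} (h : Canonical x) : ¬ (7 : ℤ) ∣ x :=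
  zmod_seven_ne_zero.1 h.ne_zero

theorem Sep.of_canonical {x y : ℤ} (hx : Canonical x) (hy : Canonical y)
    (h : (x : ZMod 7) ≠ y) : Sep x y := by
  constructor
  · rw [← zmod_seven_eq_zero]
    push_cast
    rw [sub_eq_zero]; exact h.symm
  · rw [← zmod_seven_eq_zero]
    push_cast
    rcases hx with hx | hx | hx <;> rcases hy with hy | hy | hy <;> rw [hx, hy] <;> decide

theorem dvd_of_cast_eq {x y : ℤ} (h : (x : ZMod 7) = y) : (7 : ℤ) ∣ y - x := by
  rw [← zmod_seven_eq_zero]; push_cast; rw [h, sub_self]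

theorem three_canonical_classes : ∀ a b c d : ZMod 7,
    ¬ ((a = 1 ∨ a = 2 ∨ a = 3) ∧ (b = 1 ∨ b = 2 ∨ b = 3) ∧ (c = 1 ∨ c = 2 ∨ c = 3) ∧
      (d = 1 ∨ d = 2 ∨ d = 3) ∧ a ≠ b ∧ a ≠ c ∧ b ≠ c ∧ a ≠ d ∧ b ≠ d ∧ c ≠ d) := by
  decide +kernel

/-- Four units representing distinct classes up to sign, and a number divisible by `7`. -/
theorem Solvable.four_canonical {e x y z s : ℤ} {j : ℕ} (hj1 : 1 ≤ j) (hj : j < m) (he : Lev j e)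
    (hl : ∀ p ∈ [x, y, z, s], Canonical p) (hP : Distinct m [x, y, z, s]) :
    Solvable m [e, x, y, z, s] := by
  obtain ⟨a, b, c, d, hp, h⟩ := pattern_four (fun x : ℤ => (x : ZMod 7)) x y z s
  have hl' : ∀ p ∈ [a, b, c, d], Canonical p := fun p h => hl p (hp.mem_iff.1 h)
  have hP' := hP.perm hp
  refine Solvable.mono (l' := e :: [a, b, c, d]) (fun p h => ((hp.cons e).mem_iff).2 h) ?_
  have hP2 := hP'
  simp only [Distinct, List.pairwise_cons, List.mem_cons, List.not_mem_nil, or_false,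
      forall_eq_or_imp, forall_eq] at hl' hP2
  obtain ⟨la, lb, lc, ld⟩ := hl'
  obtain ⟨⟨n1, n2, n3⟩, ⟨n4, n5⟩, n6, -⟩ := hP2
  rcases h with ⟨h1, h2, h3, h4, h5, h6⟩ | ⟨h1, h2, h3, h4⟩ | ⟨h1, h2, h3⟩ | ⟨h1, h2, h3⟩ |
    ⟨h1, h2, h3⟩
  · exact absurd ⟨la, lb, lc, ld, h1, h2, h3, h4, h5, h6⟩ (three_canonical_classes a b c d)
  · exact Solvable.two_one_one hj1 hj he la.not_dvd lc.not_dvd ld.not_dvd (dvd_of_cast_eq h1)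
      (fun h => n1 ((dvd_sub_comm).1 h)) (.of_canonical la lc h2) (.of_canonical la ld h3)
      (.of_canonical lc ld h4)
  · exact Solvable.two_two hj1 hj he la.not_dvd lc.not_dvd (dvd_of_cast_eq h1) (dvd_of_cast_eq h2)
      (fun h => n1 ((dvd_sub_comm).1 h)) (fun h => n6 ((dvd_sub_comm).1 h))
      (.of_canonical la lc h3)
  · exact Solvable.three_one hj1 hj he la.not_dvd ld.not_dvd (dvd_of_cast_eq h1)
      (dvd_of_cast_eq h2) n1 n2 n4 (.of_canonical la ld h3)
  · exact Solvable.four_equal hj1 hj he la.ne_zero (c := a) (by simp [← h1, ← h2, ← h3]) hP'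

/-- Units are, up to sign and modulo `7 ^ (m + 1)`, among `n` incongruent canonical numbers. -/
theorem exists_canonical (hm : 0 < m) {n : ℕ} (hn : n ≤ 5) {l : List ℤ} (hl : l.length ≤ n)
    (hu : ∀ x ∈ l, ¬ (7 : ℤ) ∣ x) : ∃ l' : List ℤ, l'.length = n ∧ (∀ p ∈ l', Canonical p) ∧
      Distinct m l' ∧ ∀ x ∈ l, ∃ y ∈ l', y ≡ x [ZMOD 7 ^ (m + 1)] ∨ y ≡ -x [ZMOD 7 ^ (m + 1)] := by
  classical
  have hN := pow_pos_seven (m + 1)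
  set C := (Finset.Ico (0 : ℤ) (7 ^ (m + 1))).filter Canonical with hC
  have emod_cast : ∀ x : ℤ, ((x % 7 ^ (m + 1) : ℤ) : ZMod 7) = x := fun x => by
    rw [← sub_eq_zero, ← Int.cast_sub, zmod_seven_eq_zero]
    exact (dvd_pow_self 7 (Nat.succ_ne_zero m)).trans (Int.mod_modEq x _).symm.dvd
  have rep : ∀ x : ℤ, ¬ (7 : ℤ) ∣ x → ∃ y ∈ C, y ≡ x [ZMOD 7 ^ (m + 1)] ∨
      y ≡ -x [ZMOD 7 ^ (m + 1)] := by
    intro x hx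
    have key : ∀ u : ZMod 7, u ≠ 0 → (u = 1 ∨ u = 2 ∨ u = 3) ∨ (-u = 1 ∨ -u = 2 ∨ -u = 3) := by
      decide
    rcases key x (zmod_seven_ne_zero.2 hx) with h | h
    · refine ⟨x % 7 ^ (m + 1), ?_, Or.inl (Int.mod_modEq _ _)⟩
      simp only [hC, Finset.mem_filter, Finset.mem_Ico]
      refine ⟨⟨Int.emod_nonneg _ hN.ne', Int.emod_lt_of_pos _ hN⟩, ?_⟩
      rwa [Canonical, emod_cast]
    · refine ⟨(-x) % 7 ^ (m + 1), ?_, Or.inr (Int.mod_modEq _ _)⟩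
      simp only [hC, Finset.mem_filter, Finset.mem_Ico]
      refine ⟨⟨Int.emod_nonneg _ hN.ne', Int.emod_lt_of_pos _ hN⟩, ?_⟩
      rw [Canonical, emod_cast]; push_cast; exact h
  choose! g hgC hg using rep
  have h49 : (49 : ℤ) ≤ 7 ^ (m + 1) := by
    calc (49 : ℤ) = 7 ^ 2 := by norm_num
      _ ≤ 7 ^ (m + 1) := pow_le_pow_right₀ (by norm_num) (by omega)
  have hcard : n ≤ C.card := by
    have hsub : ({1, 2, 3, 8, 9} : Finset ℤ) ⊆ C := by
      intro x hx
      simp only [Finset.mem_insert, Finset.mem_singleton] at hx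
      simp only [hC, Finset.mem_filter, Finset.mem_Ico]
      rcases hx with rfl | rfl | rfl | rfl | rfl <;>
        exact ⟨⟨by norm_num, by linarith⟩, by unfold Canonical; decide⟩
    exact hn.trans (by simpa using Finset.card_le_card hsub)
  have hsub : l.toFinset.image g ⊆ C := by
    intro y hy
    obtain ⟨x, hx, rfl⟩ := Finset.mem_image.1 hy
    exact hgC x (hu x (List.mem_toFinset.1 hx))
  obtain ⟨T, hT1, hT2, hT3⟩ := Finset.exists_subsuperset_card_eq hsub
    (Finset.card_image_le.trans ((List.toFinset_card_le l).trans hl)) hcard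
  refine ⟨T.toList, by simp [hT3], fun p hp => ?_, ?_, fun x hx => ⟨g x, ?_, hg x (hu x hx)⟩⟩
  · exact (Finset.mem_filter.1 (hT2 (Finset.mem_toList.1 hp))).2
  · refine (List.Nodup.pairwise_of_forall_ne T.nodup_toList) fun p hp q hq hne hdvd => hne ?_
    obtain ⟨⟨p0, p1⟩, -⟩ := by simpa [hC] using hT2 (Finset.mem_toList.1 hp)
    obtain ⟨⟨q0, q1⟩, -⟩ := by simpa [hC] using hT2 (Finset.mem_toList.1 hq)
    have := Int.emod_emod_of_dvd p (dvd_refl ((7 : ℤ) ^ (m + 1)))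
    have h := emod_eq_iff.2 hdvd
    rwa [Int.emod_eq_of_lt p0 p1, Int.emod_eq_of_lt q0 q1] at h
  · exact Finset.mem_toList.2 (hT1 (Finset.mem_image_of_mem g (List.mem_toFinset.2 hx)))

/-- Units may be replaced by canonical representatives, pairwise distinct and of any number up to
five. -/
theorem Solvable.of_canonical (hm : 0 < m) {n : ℕ} (hn : n ≤ 5) {E l : List ℤ}
    (hl : l.length ≤ n) (hu : ∀ x ∈ l, ¬ (7 : ℤ) ∣ x)
    (h : ∀ l' : List ℤ, l'.length = n → (∀ p ∈ l', Canonical p) → Distinct m l' →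
      Solvable m (E ++ l')) : Solvable m (E ++ l) := by
  obtain ⟨l', h1, h2, h3, h4⟩ := exists_canonical hm hn hl hu
  obtain ⟨μ, hμ, hs⟩ := h l' h1 h2 h3
  refine ⟨μ, hμ, fun x hx => ?_⟩
  rcases List.mem_append.1 hx with hx | hx
  · exact hs x (by simp [hx])
  · obtain ⟨y, hy, hxy⟩ := h4 x hx
    have hsy := hs y (by simp [hy])
    rcases hxy with hxy | hxy
    · unfold Safe at hsy ⊢
      rwa [← dig_congr (hxy.mul_left μ)]
    · refine Safe.neg (not_pow_dvd_mul hμ fun hd => hu x hx ((dvd_pow_self 7 hm.ne').trans hd)) ?_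
      unfold Safe at hsy ⊢
      rwa [← mul_neg, ← dig_congr (hxy.mul_left μ)]

/-- Four units and a number of valuation strictly between `0` and `m`. -/
theorem Solvable.four_units_of_lev {e : ℤ} {l : List ℤ} {j : ℕ} (hj1 : 1 ≤ j) (hj : j < m)
    (he : Lev j e) (hl : l.length ≤ 4) (hu : ∀ x ∈ l, ¬ (7 : ℤ) ∣ x) : Solvable m (e :: l) := by
  refine Solvable.of_canonical (E := [e]) (by omega) (by norm_num) hl hu fun l' h1 h2 h3 => ?_
  obtain ⟨x, y, z, s, rfl⟩ : ∃ x y z s, l' = [x, y, z, s] := by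
    match l', h1 with
    | [x, y, z, s], _ => exact ⟨x, y, z, s, rfl⟩
  exact Solvable.four_canonical hj1 hj he h2 h3

/-- The set of `k < n` with `p k`, as a bit mask. -/
def maskOf (p : ℕ → Bool) : ℕ → ℕ
  | 0 => 0
  | n + 1 => Nat.lor (maskOf p n) (if p n then Nat.shiftLeft 1 n else 0)

theorem testBit_maskOf {p : ℕ → Bool} {n i : ℕ} (h : (maskOf p n).testBit i = true) :
    i < n ∧ p i = true := by
  induction n with
  | zero => simp [maskOf] at h
  | succ n ih =>
    have e : maskOf p (n + 1) = maskOf p n ||| (if p n then 1 <<< n else 0) := rfl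
    rw [e, Nat.testBit_or, Bool.or_eq_true] at h
    rcases h with h | h
    · exact ⟨(ih h).1.trans (Nat.lt_succ_self n), (ih h).2⟩
    · split_ifs at h with hp
      · rw [Nat.testBit_shiftLeft, Bool.and_eq_true, decide_eq_true_eq] at h
        have : i = n := by
          by_contra hne
          have h2 := h.2
          rw [Nat.testBit_one_eq_true_iff_self_eq_zero] at h2
          omega
        rw [this]
        exact ⟨Nat.lt_succ_self n, hp⟩
      · simp at h

/-- The units `k` modulo `49` for which `k x` is safe. -/
def unitMask (x : ℕ) : ℕ := maskOf (fun k => good (k * x % 49) && !Nat.beq (k % 7) 0) 49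

theorem unitMask_spec {x k : ℕ} (h : (unitMask x).testBit k = true) :
    ¬ (7 : ℤ) ∣ (k : ℤ) ∧ good (k * x % 49) = true := by
  have h2 := (testBit_maskOf h).2
  simp only [Bool.and_eq_true, Bool.not_eq_true'] at h2
  refine ⟨fun hd => ?_, h2.1⟩
  have : k % 7 = 0 := by omega
  rw [this] at h2
  simp at h2

/-- Every three of the masks share a bit with the mask `u`. -/
def meetThree (u : ℕ) (M : List ℕ) : Bool :=
  M.all fun a => M.all fun b => M.all fun c => Nat.blt 0 (Nat.land (Nat.land u a) (Nat.land b c))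

/-- Modulo `49` four units, the first of which is `1`, have a common good multiplier. -/
theorem meetThree_unitMask :
    meetThree (unitMask 1) (((List.range 49).filter fun k => Nat.blt 0 (k % 7)).map unitMask) =
      true := by
  decide +kernel

theorem safe_one_of_good {k : ℕ} {x : ℤ} (h : good (k * (x : ZMod 49).val % 49) = true) :
    Safe 1 (k * x) := by
  refine safe_of_good (n := 0) ?_
  have : pos 0 (k * x) = (k : ZMod 49) * (x : ZMod 49) := by simp [pos]
  rw [this, ZMod.val_mul, ZMod.val_natCast]
  rwa [Nat.mod_mul_mod]

theorem Solvable.four_units_one {x y z s : ℤ} (hx : ¬ (7 : ℤ) ∣ x) (hy : ¬ (7 : ℤ) ∣ y)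
    (hz : ¬ (7 : ℤ) ∣ z) (hs : ¬ (7 : ℤ) ∣ s) : Solvable 1 [x, y, z, s] := by
  obtain ⟨μ, hμ, h1⟩ := exists_inverse 1 hx
  refine Solvable.smul hμ ?_
  have hmem : ∀ {y : ℤ}, ¬ (7 : ℤ) ∣ y → unitMask ((μ * y : ℤ) : ZMod 49).val ∈
      ((List.range 49).filter fun k => Nat.blt 0 (k % 7)).map unitMask := by
    intro y hy
    refine List.mem_map_of_mem (List.mem_filter.2 ⟨List.mem_range.2 (ZMod.val_lt _), ?_⟩)
    rw [zmod_fortynine_val_mod]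
    have : ((μ * y : ℤ) : ZMod 7).val ≠ 0 := by
      rw [Ne, ZMod.val_eq_zero]
      exact zmod_seven_ne_zero.2 (not_seven_dvd_mul hμ hy)
    simpa [Nat.blt_eq, Nat.pos_iff_ne_zero] using this
  have h := meetThree_unitMask
  simp only [meetThree, List.all_eq_true, Nat.blt_eq] at h
  have hb := h _ (hmem hy) _ (hmem hz) _ (hmem hs)
  obtain ⟨k, hk⟩ := Nat.exists_testBit_of_ne_zero hb.ne'
  have hk' : (((unitMask 1).testBit k && (unitMask ((μ * y : ℤ) : ZMod 49).val).testBit k) &&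
      ((unitMask ((μ * z : ℤ) : ZMod 49).val).testBit k &&
        (unitMask ((μ * s : ℤ) : ZMod 49).val).testBit k)) = true := by
    rw [← Nat.testBit_and, ← Nat.testBit_and, ← Nat.testBit_and]; exact hk
  simp only [Bool.and_eq_true] at hk'
  obtain ⟨⟨g1, g2⟩, g3, g4⟩ := hk'
  refine ⟨k, (unitMask_spec g1).1, ?_⟩
  have e1 : ((μ * x : ℤ) : ZMod 49) = 1 := by
    have : ((μ * x : ℤ) : ZMod 49) = ((1 : ℤ) : ZMod 49) := by
      rw [zmod_fortynine_eq]
      simpa using h1.symm.dvd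
    simpa using this
  simp only [List.map_cons, List.map_nil, List.mem_cons, List.not_mem_nil, or_false,
    forall_eq_or_imp, forall_eq]
  refine ⟨safe_one_of_good ?_, safe_one_of_good (unitMask_spec g2).2,
    safe_one_of_good (unitMask_spec g3).2, safe_one_of_good (unitMask_spec g4).2⟩
  rw [e1]
  exact (unitMask_spec g1).2

/-- Four units. For `m > 1`, the number `7` may be added to them. -/
theorem Solvable.four_units (hm : 0 < m) {l : List ℤ} (hl : l.length ≤ 4)
    (hu : ∀ x ∈ l, ¬ (7 : ℤ) ∣ x) : Solvable m l := by
  rcases (show m = 1 ∨ 1 < m by omega) with rfl | hm1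
  · refine Solvable.of_canonical (E := []) (by omega) (by norm_num) hl hu fun l' h1 h2 h3 => ?_
    obtain ⟨x, y, z, s, rfl⟩ : ∃ x y z s, l' = [x, y, z, s] := by
      match l', h1 with
      | [x, y, z, s], _ => exact ⟨x, y, z, s, rfl⟩
    exact Solvable.four_units_one (h2 x (by simp)).not_dvd (h2 y (by simp)).not_dvd
      (h2 z (by simp)).not_dvd (h2 s (by simp)).not_dvd
  · exact (Solvable.four_units_of_lev le_rfl hm1 ⟨1, by norm_num, by norm_num⟩ hl hu).mono
      fun x hx => List.mem_cons_of_mem 7 hx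

/-! ### Classes of four and one -/

/-- Four exact points either scale into an arc of length `3 / 7`, or they and a point `q`, whose
distance to the base counts double, can be placed suitably. -/
theorem exists_scale_four_digits : ∀ S : Finset (ZMod 7), S.card ≤ 4 → S.Nonempty →
    (∃ l : ZMod 7, l ≠ 0 ∧ ∃ t ∈ S, ∀ s ∈ S, (l * (s - t)).val ≤ 3) ∨
    ∀ q : ZMod 7, ∃ l β : ZMod 7, l ≠ 0 ∧ (∀ s ∈ S, (l * (s - β)).val ≤ 4) ∧
      l * (q - 2 * β) ∈ ({6, 0, 1} : Finset (ZMod 7)) := by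
  decide +kernel

/-- Seven consecutive shifts cannot all be bad, unless the speed is `± 2`. -/
theorem badCount_seven : ∀ b < 49, b % 7 ≠ 0 → b % 7 ≠ 1 → b % 7 ≠ 6 → b ≠ 2 → b ≠ 47 →
    ∀ p < 49, badCount 7 b p < 7 := by
  have h : ((List.range 49).all fun b => (List.range 49).all fun p =>
      Nat.beq (b % 7) 0 || Nat.beq (b % 7) 1 || Nat.beq (b % 7) 6 || Nat.beq b 2 || Nat.beq b 47 ||
        Nat.blt (badCount 7 b p) 7) = true := by
    decide +kernel
  intro b hb h0 h1 h6 h2 h47 p hp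
  have := allRange (allRange h hb) hp
  simp only [Bool.or_eq_true, Nat.beq_eq, Nat.blt_eq] at this
  omega

theorem exists_of_badCount_one {len b p : ℕ} (h : badCount len b p < len) :
    ∃ i < len, good ((p + i * b) % 49) = true := by
  by_contra hcon
  push Not at hcon
  have : badCount len b p = (List.range len).length := by
    unfold badCount
    rw [List.countP_eq_length]
    intro i hi
    have := hcon i (List.mem_range.1 hi)
    simpa using this
  rw [List.length_range] at this
  omega

/-- An arc of points congruent modulo `49` and one more number. -/
theorem Solvable.of_arc_badCount_one {n w : ℕ} (hn : 0 < n) {A L : List ℤ} {a b : ℤ}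
    (ha : ¬ (7 : ℤ) ∣ a) (hA : Arc (n + 1) w A) (hA' : ∀ x ∈ A, (49 : ℤ) ∣ x - a)
    (h : ∀ a' : ℤ, (a' : ZMod 49) * a = 1 → ∀ p < 49,
      badCount (35 - 7 * w) ((a' * b : ℤ) : ZMod 49).val p < 35 - 7 * w)
    (hL : ∀ x ∈ L, x ∈ A ∨ x = b) : Solvable (n + 1) L := by
  refine Solvable.of_arc_pos (P := fun x => x = b) hn ha hA hA' (fun t a' ha' => ?_)
    fun x hx => Or.inr (hL x hx)
  have e : (((a'.val : ℕ) : ℤ) : ZMod 49) = a' := by simp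
  have h := h a'.val (by rw [e]; exact ha')
  obtain ⟨i, hi, h1⟩ := exists_of_badCount_one (h (pos n b + (t + 7) * (a' * b)).val (ZMod.val_lt _))
  rw [← zmod_val_add_mul'] at h1
  push_cast at h1
  simp only [ZMod.natCast_val, ZMod.cast_id', id_eq] at h1
  refine ⟨i, hi, ?_⟩
  rintro x rfl
  convert h1 using 3; push_cast; ring

/-- Exact points on an arc of length `4 / 7` with virtual base `c`, and a number close to `2 c`. -/
theorem Solvable.of_exact_double (hm : 0 < m) {l : List ℤ} {c b : ℤ} (hc : ¬ (7 : ℤ) ∣ c)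
    (hl : ∀ x ∈ l, (7 : ℤ) ^ m ∣ x - c ∧ (dig m (x - c)).val ≤ 4) (hb : (7 : ℤ) ∣ b - 2 * c)
    (hd : dig m (b - 2 * c) ∈ ({6, 0, 1} : Finset (ZMod 7))) : Solvable m (l ++ [b]) := by
  have hc' := zmod_seven_ne_zero.2 hc
  refine Solvable.of_shift hm ((1 - dig m c) / (c : ZMod 7)) fun x hx => ?_
  rcases List.mem_append.1 hx with hx | hx
  · obtain ⟨⟨g, hg⟩, h2⟩ := hl x hx
    have e1 : (x : ZMod 7) = c := by
      rw [← sub_eq_zero, ← Int.cast_sub, hg, zmod_seven_eq_zero]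
      exact Dvd.dvd.mul_right (dvd_pow_self 7 hm.ne') g
    rw [hg, dig_mul_pow] at h2
    have e2 : dig m x = dig m c + g := by
      rw [← dig_add_mul, ← hg]; congr 1; ring
    rw [e1, e2, div_mul_cancel₀ _ hc']
    have key : ∀ g c : ZMod 7, g.val ≤ 4 → c + g + (1 - c) ≠ 0 ∧ c + g + (1 - c) ≠ 6 := by
      decide +kernel
    exact key _ _ h2
  · rw [List.mem_singleton] at hx
    subst hx
    have e1 : (x : ZMod 7) = 2 * c := by
      have := (zmod_seven_eq_zero _).2 hb
      push_cast at this
      exact sub_eq_zero.1 this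
    have e2 : x = c + c + (x - 2 * c) := by ring
    have e3 : (1 - dig m c) / (c : ZMod 7) * x = 2 * (1 - dig m c) := by
      rw [e1]; field_simp
    rw [e3, e2, dig_add, dig_add]
    generalize dig m (x - 2 * c) = δ at hd
    generalize dig m c = u
    have key : ∀ u : ZMod 7, ∀ δ ∈ ({6, 0, 1} : Finset (ZMod 7)), ∀ i ∈ ({0, 1} : Finset (ZMod 7)),
        ∀ j ∈ ({0, 1} : Finset (ZMod 7)),
        u + u + i + δ + j + 2 * (1 - u) ≠ 0 ∧ u + u + i + δ + j + 2 * (1 - u) ≠ 6 := by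
      decide +kernel
    refine key u δ hd _ ?_ _ ?_ <;> split_ifs <;> decide

theorem dig_exact_sub {p q : ℤ} (hp : (7 : ℤ) ^ m ∣ p) : dig m (p + q) = dig m p + dig m q := by
  obtain ⟨g, rfl⟩ := hp
  rw [add_comm, dig_add_mul, dig_mul_pow, add_comm]

/-- Four exact points and a number congruent to their double modulo `49`. -/
theorem Solvable.of_exact_four_double (hm : 2 ≤ m) {x b : ℤ} {l : List ℤ} (hx : ¬ (7 : ℤ) ∣ x)
    (hl : ∀ p ∈ l, (7 : ℤ) ^ m ∣ p - x)
    (hS : ∀ q : ZMod 7, ∃ a β : ZMod 7, a ≠ 0 ∧ (∀ p ∈ l, (a * (dig m (p - x) - β)).val ≤ 4) ∧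
      a * (q - 2 * β) ∈ ({6, 0, 1} : Finset (ZMod 7))) (hb : (49 : ℤ) ∣ b - 2 * x) :
    Solvable m (l ++ [b]) := by
  have h7 : (7 : ℤ) ∣ b - 2 * x := (by norm_num : (7 : ℤ) ∣ 49).trans hb
  -- after scaling, the base `c` of the arc need not be a member of the list
  have main : ∀ a β : ZMod 7, a ≠ 0 → (∀ p ∈ l, (a * (dig m (p - x) - β)).val ≤ 4) →
      (∃ ν : ℤ, ¬ (7 : ℤ) ∣ ν ∧ (∀ q : ℤ, (7 : ℤ) ^ m ∣ q → ν * q ≡ q [ZMOD 7 ^ (m + 1)]) ∧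
        dig m (ν * (a.val * (b - 2 * (x + 7 ^ m * β.val)))) ∈ ({6, 0, 1} : Finset (ZMod 7))) →
      Solvable m (l ++ [b]) := by
    rintro a β ha hp ⟨ν, hν, hf, hd⟩
    have hae : ((a.val : ℤ) : ZMod 7) = a := by simp
    have ha7 : ¬ (7 : ℤ) ∣ (a.val : ℤ) := zmod_seven_ne_zero.1 (by rwa [hae])
    have h7m : (7 : ℤ) ∣ 7 ^ m * (β.val : ℤ) :=
      Dvd.dvd.mul_right (dvd_pow_self 7 (by omega)) _
    refine Solvable.smul ha7 (Solvable.smul hν ?_)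
    rw [List.map_append, List.map_append]
    refine Solvable.of_exact_double (by omega) (c := ν * (a.val * (x + 7 ^ m * β.val))) ?_ ?_ ?_ ?_
    · refine not_seven_dvd_mul hν (not_seven_dvd_mul ha7 fun h => hx ?_)
      exact (Int.dvd_add_left h7m).1 h
    · intro y hy
      rw [List.map_map, List.mem_map] at hy
      obtain ⟨p, hpl, rfl⟩ := hy
      simp only [Function.comp_apply]
      rw [← mul_sub, ← mul_sub]
      have e1 : p - (x + 7 ^ m * (β.val : ℤ)) = 7 ^ m * (-(β.val : ℤ)) + (p - x) := by ring
      have e2 : (7 : ℤ) ^ m ∣ p - (x + 7 ^ m * (β.val : ℤ)) := by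
        rw [e1]; exact dvd_add (Dvd.intro _ rfl) (hl p hpl)
      have e3 : (7 : ℤ) ^ m ∣ (a.val : ℤ) * (p - (x + 7 ^ m * (β.val : ℤ))) := e2.mul_left _
      refine ⟨e3.mul_left _, ?_⟩
      rw [dig_congr (hf _ e3), dig_exact_mul e2, e1, dig_exact_sub (Dvd.intro _ rfl), dig_mul_pow,
        hae]
      have := hp p hpl
      convert this using 2
      push_cast
      rw [ZMod.natCast_val, ZMod.cast_id', id_eq]; ring
    · rw [show ν * (a.val * b) - 2 * (ν * (a.val * (x + 7 ^ m * β.val))) =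
        ν * (a.val * ((b - 2 * x) - 2 * (7 ^ m * β.val))) by ring]
      exact ((dvd_sub h7 (h7m.mul_left 2)).mul_left _).mul_left _
    · rwa [show ν * (a.val * b) - 2 * (ν * (a.val * (x + 7 ^ m * β.val))) =
        ν * (a.val * (b - 2 * (x + 7 ^ m * β.val))) by ring]
  by_cases hq : (7 : ℤ) ^ m ∣ b - 2 * x
  · obtain ⟨a, β, ha, hp, hd⟩ := hS (dig m (b - 2 * x))
    refine main a β ha hp ⟨1, by norm_num, fun q _ => by simp, ?_⟩
    have e1 : b - 2 * (x + 7 ^ m * (β.val : ℤ)) = 7 ^ m * (-2 * (β.val : ℤ)) + (b - 2 * x) := by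
      ring
    have e2 : (7 : ℤ) ^ m ∣ b - 2 * (x + 7 ^ m * (β.val : ℤ)) := by
      rw [e1]; exact dvd_add (Dvd.intro _ rfl) hq
    rw [one_mul, dig_exact_mul e2, e1, dig_exact_sub (Dvd.intro _ rfl), dig_mul_pow]
    convert hd using 1
    push_cast
    simp only [ZMod.natCast_val, ZMod.cast_id', id_eq]; ring
  · obtain ⟨n, rfl⟩ : ∃ n, m = n + 1 := ⟨m - 1, by omega⟩
    obtain ⟨a, β, ha, hp, -⟩ := hS 0
    refine main a β ha hp ?_
    obtain ⟨w, hw, hqw⟩ := exists_lev hq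
    have ha7 : ¬ (7 : ℤ) ∣ (a.val : ℤ) := zmod_seven_ne_zero.1 (by simpa using ha)
    have hlev : Lev w (b - 2 * (x + 7 ^ (n + 1) * (β.val : ℤ))) := by
      refine Lev.of_dvd ?_ fun h => hqw.not_dvd ?_
      · have := dvd_sub (hqw.dvd le_rfl) (Dvd.dvd.mul_right (pow_dvd_pow (7 : ℤ) (by omega : w ≤ n + 1))
          (2 * (β.val : ℤ)))
        rwa [show b - 2 * (x + 7 ^ (n + 1) * (β.val : ℤ)) =
          b - 2 * x - 7 ^ (n + 1) * (2 * (β.val : ℤ)) by ring]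
      · have := dvd_add h (Dvd.dvd.mul_right (pow_dvd_pow (7 : ℤ) (by omega : w + 1 ≤ n + 1))
          (2 * (β.val : ℤ)))
        rwa [show b - 2 * (x + 7 ^ (n + 1) * (β.val : ℤ)) + 7 ^ (n + 1) * (2 * (β.val : ℤ)) =
          b - 2 * x by ring] at this
    obtain ⟨ν, hν, h1, h2⟩ := exists_avoid_one (m := n + 1) le_rfl (by omega) (hlev.mul ha7)
      ({0}ᶜ : Finset (ZMod 7)) (by decide)
    refine ⟨ν, hν, h2, ?_⟩
    simp only [Finset.mem_compl, Finset.mem_singleton, not_not] at h1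
    rw [h1]; decide

/-- Classes of four and one. The four fit on an arc of length `3 / 7`, or their differences are
exact; then an arc of length `4 / 7` suffices unless the ratio to the fifth is `± 2` modulo `49`. -/
theorem Solvable.four_one (hm : 2 ≤ m) {x y z s b : ℤ} {c : ZMod 7} (hc : c ≠ 0)
    (hl : ∀ p ∈ [x, y, z, s], (p : ZMod 7) = c) (hP : Distinct m [x, y, z, s])
    (hb : ¬ (7 : ℤ) ∣ b) (hab : Sep x b) : Solvable m [x, y, z, s, b] := by
  have hx : (x : ZMod 7) = c := hl x (by simp)
  have hx7 : ¬ (7 : ℤ) ∣ x := zmod_seven_ne_zero.1 (by rwa [hx])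
  have key : Gather m 3 [x, y, z, s] → Solvable m [x, y, z, s, b] := by
    rintro ⟨μ, hμ, hA⟩
    obtain ⟨g1, g2⟩ := (hab.mul hμ).cast
    refine Solvable.smul hμ (Solvable.of_arc_three (c := ((μ * x : ℤ) : ZMod 7)) (by omega)
      (zmod_seven_ne_zero.2 (not_seven_dvd_mul hμ hx7))
      (zmod_seven_ne_zero.2 (not_seven_dvd_mul hμ hb)) g1 g2 hA ?_ rfl ?_)
    · intro p hp
      obtain ⟨q, hq, rfl⟩ := List.mem_map.1 hp
      push_cast; rw [hl q hq, hx]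
    · simp
  obtain ⟨v, hv, hd, hn⟩ := exists_min_level hP.not_forall_dvd
  rcases hv.lt_or_eq with hv | rfl
  · exact key (gather_four hv hd hn hP)
  have hd0 : ∀ p ∈ [x, y, z, s], (7 : ℤ) ^ v ∣ p - x := fun p hp => hd p hp x (by simp)
  rcases exists_scale_four_digits (([x, y, z, s].map fun p => dig v (p - x)).toFinset)
    ((List.toFinset_card_le _).trans (by simp)) ⟨dig v (x - x), by simp⟩ with h | h
  · refine key (exists_arc_of_exact_digits (w := 3) hd0 ?_)
    obtain ⟨a, ha, t, ht, h⟩ := h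
    exact ⟨a, ha, t, List.mem_toFinset.1 ht, fun s hs => h s (List.mem_toFinset.2 hs)⟩
  replace h : ∀ q : ZMod 7, ∃ a β : ZMod 7, a ≠ 0 ∧
      (∀ p ∈ [x, y, z, s], (a * (dig v (p - x) - β)).val ≤ 4) ∧
      a * (q - 2 * β) ∈ ({6, 0, 1} : Finset (ZMod 7)) := fun q => by
    obtain ⟨a, β, ha, h1, h2⟩ := h q
    exact ⟨a, β, ha, fun p hp => h1 _ (List.mem_toFinset.2 (List.mem_map_of_mem hp)), h2⟩
  by_cases h2 : (49 : ℤ) ∣ b - 2 * x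
  · exact Solvable.of_exact_four_double hm hx7 hd0 h h2
  by_cases h3 : (49 : ℤ) ∣ -b - 2 * x
  · refine Solvable.of_sign (l' := [x, y, z, s] ++ [-b]) ?_ ?_
      (Solvable.of_exact_four_double hm hx7 hd0 h h3)
    · intro p hp hpd
      have h7 : (7 : ℤ) ∣ p := (dvd_pow_self 7 (by omega)).trans hpd
      have : p ∈ [x, y, z, s] ∨ p = b := by simp at hp ⊢; tauto
      rcases this with h | rfl
      · exact hc (by rw [← hl p h, zmod_seven_eq_zero]; exact h7)
      · exact hb h7
    · intro p hp
      simp at hp ⊢; tauto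
  obtain ⟨n, rfl⟩ : ∃ n, v = n + 1 := ⟨v - 1, by omega⟩
  obtain ⟨μ, hμ, hA⟩ := gather_four_four hP
  refine Solvable.smul hμ (Solvable.of_arc_badCount_one (w := 4) (a := μ * x) (b := μ * b)
    (by omega) (not_seven_dvd_mul hμ hx7) hA ?_ ?_ (by simp))
  · intro p hp
    obtain ⟨q, hq, rfl⟩ := List.mem_map.1 hp
    refine dvd_mul_sub (Dvd.dvd.trans ?_ (hd0 q hq))
    exact pow_dvd_pow 7 (show 2 ≤ n + 1 by omega)
  · intro u hu p hp
    have e1 := ratio_mod_seven (b := μ * b) hu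
    obtain ⟨g1, g2⟩ := (hab.mul hμ).cast
    obtain ⟨k0, k1, k6⟩ := zmod_div_ne (zmod_seven_ne_zero.2 (not_seven_dvd_mul hμ hx7))
      (zmod_seven_ne_zero.2 (not_seven_dvd_mul hμ hb)) g1 g2
    have hu1 : ((u * (μ * x) : ℤ) : ZMod 49) = ((1 : ℤ) : ZMod 49) := by push_cast at hu ⊢; exact hu
    rw [zmod_fortynine_eq] at hu1
    have hne : ∀ t : ℤ, ((u * (μ * b) : ℤ) : ZMod 49) = ((t : ℤ) : ZMod 49) →
        (49 : ℤ) ∣ b - t * x := by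
      intro t ht
      rw [zmod_fortynine_eq] at ht
      have hun : ¬ (7 : ℤ) ∣ u * μ := fun h => by
        have h1 := dvd_sub (h.mul_right x) ((by norm_num : (7 : ℤ) ∣ 49).trans hu1)
        norm_num [mul_assoc] at h1
      by_contra hnd
      refine not_pow_dvd_mul (n := 2) hun (x := b - t * x) (by norm_num; exact hnd) ?_
      have := dvd_sub ht (hu1.mul_left t)
      norm_num
      rwa [show u * (μ * b) - t - t * (u * (μ * x) - 1) = u * μ * (b - t * x) by ring] at this
    generalize hρ : ((u * (μ * b) : ℤ) : ZMod 49) = ρ at e1 hne ⊢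
    have hval : ∀ t : ℕ, ρ.val = t → (49 : ℤ) ∣ b - t * x := fun t ht => hne t (by
      rw [← ht]; simp)
    refine badCount_seven _ (ZMod.val_lt _) ?_ ?_ ?_ ?_ ?_ p hp
    · rw [e1, Ne, ZMod.val_eq_zero]; exact k0
    · rw [e1]; exact fun h => k1 (ZMod.val_injective 7 (by rw [h]; rfl))
    · rw [e1]; exact fun h => k6 (ZMod.val_injective 7 (by rw [h]; rfl))
    · exact fun h => h2 (by simpa using hval 2 h)
    · intro h
      refine h3 ?_
      have := hval 47 h
      have h4 : -b - 2 * x = -(b - (47 : ℕ) * x) - 49 * x := by push_cast; ring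
      rw [h4]
      exact dvd_sub ((dvd_neg).2 this) (Dvd.intro _ rfl)

/-! ### Exact arcs and the two leading digits -/

theorem exists_ratio_mul {a : ℤ} (ha : ¬ (7 : ℤ) ∣ a) (b : ℤ) :
    ∃ ρ : ZMod 49, (b : ZMod 49) = ρ * a := by
  obtain ⟨u, hu, -⟩ := exists_ratio ha
  exact ⟨u * b, by rw [mul_right_comm, hu, one_mul]⟩

theorem ratio_mul {a b μ : ℤ} {ρ : ZMod 49} (h : (b : ZMod 49) = ρ * a) :
    ((μ * b : ℤ) : ZMod 49) = ρ * ((μ * a : ℤ) : ZMod 49) := by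
  push_cast; rw [h]; ring

theorem ratio_val_mod {a b : ℤ} {ρ : ZMod 49} (ha : ¬ (7 : ℤ) ∣ a) (h : (b : ZMod 49) = ρ * a) :
    ρ.val % 7 = ((b : ZMod 7) / a).val := by
  obtain ⟨u, hu, -⟩ := exists_ratio ha
  rw [← ratio_mod_seven (b := b) hu]
  congr 2
  push_cast
  rw [h, mul_left_comm, hu, mul_one]

theorem ratio_val_ne {a b : ℤ} {ρ : ZMod 49} (ha : ¬ (7 : ℤ) ∣ a) (hb : ¬ (7 : ℤ) ∣ b)
    (hab : Sep a b) (h : (b : ZMod 49) = ρ * a) :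
    ρ.val % 7 ≠ 0 ∧ ρ.val % 7 ≠ 1 ∧ ρ.val % 7 ≠ 6 := by
  obtain ⟨k0, k1, k6⟩ := zmod_div_ne (zmod_seven_ne_zero.2 ha) (zmod_seven_ne_zero.2 hb)
    hab.cast.1 hab.cast.2
  rw [ratio_val_mod ha h]
  exact ⟨by rwa [Ne, ZMod.val_eq_zero], fun h => k1 (ZMod.val_injective 7 (by rw [h]; rfl)),
    fun h => k6 (ZMod.val_injective 7 (by rw [h]; rfl))⟩

/-- `Solvable.of_arc_pos` with the speeds of the other numbers measured relative to the arc. -/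
theorem Solvable.of_arc_ratio {n w : ℕ} (hn : 0 < n) {A L : List ℤ} {a b c : ℤ} {ρ σ : ZMod 49}
    (ha : ¬ (7 : ℤ) ∣ a) (hA : Arc (n + 1) w A) (hA' : ∀ x ∈ A, (49 : ℤ) ∣ x - a)
    (hb : (b : ZMod 49) = ρ * a) (hc : (c : ZMod 49) = σ * a)
    (h : ∀ p < 49, ∀ q < 49, ∃ i < 35 - 7 * w, good ((p + i * ρ.val) % 49) = true ∧
      good ((q + i * σ.val) % 49) = true)
    (hL : ∀ x ∈ L, ((49 : ℤ) ∣ x ∧ Safe (n + 1) x) ∨ x ∈ A ∨ x = b ∨ x = c) :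
    Solvable (n + 1) L := by
  refine Solvable.of_arc_pos (P := fun x => x = b ∨ x = c) hn ha hA hA' (fun t u hu => ?_) hL
  obtain ⟨i, hi, h1, h2⟩ := h (pos n b + (t + 7) * ρ).val (ZMod.val_lt _)
    (pos n c + (t + 7) * σ).val (ZMod.val_lt _)
  rw [← zmod_val_add_mul'] at h1 h2
  have eb : u * b = ρ := by rw [hb, mul_left_comm, hu, mul_one]
  have ec : u * c = σ := by rw [hc, mul_left_comm, hu, mul_one]
  refine ⟨i, hi, ?_⟩
  rintro x (rfl | rfl)
  · rw [eb]; convert h1 using 3; push_cast; ring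
  · rw [ec]; convert h2 using 3; push_cast; ring

/-- An arc and a second arc of length `1 / 7`, both of points congruent modulo `49`. -/
theorem Solvable.of_arc_arc_ratio {n w : ℕ} (hn : 0 < n) {A B L : List ℤ} {a b : ℤ} {ρ : ZMod 49}
    (ha : ¬ (7 : ℤ) ∣ a) (hA : Arc (n + 1) w A) (hA' : ∀ x ∈ A, (49 : ℤ) ∣ x - a)
    (hB : Arc (n + 1) 1 B) (hB' : ∀ x ∈ B, (49 : ℤ) ∣ x - b)
    (hb : (b : ZMod 49) = ρ * a)
    (h : ∀ p < 49, ∃ i < 35 - 7 * w, 7 ≤ (p + i * ρ.val) % 49 ∧ (p + i * ρ.val) % 49 < 35)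
    (hL : ∀ x ∈ L, x ∈ A ∨ x ∈ B) : Solvable (n + 1) L := by
  have hB : Arc (n + 1) (1 : ℕ) B := hB
  obtain ⟨s, hs⟩ := hB.positions
  refine Solvable.of_arc_pos (P := fun x => x ∈ B) hn ha hA hA' (fun t u hu => ?_)
    fun x hx => Or.inr (hL x hx)
  obtain ⟨i, hi, h1, h2⟩ := h (s + (t + 7) * ρ).val (ZMod.val_lt _)
  rw [← zmod_val_add_mul'] at h1 h2
  refine ⟨i, hi, fun x hx => ?_⟩
  obtain ⟨j, hj, e⟩ := hs x hx
  have ex : u * x = ρ := by rw [zmod_fortynine_eq.2 (hB' x hx), hb, mul_left_comm, hu, mul_one]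
  have e2 : pos n x + (t + ((7 + i : ℕ) : ZMod 49)) * (u * x) =
      (((s + (t + 7) * ρ + i * ρ).val + j : ℕ) : ZMod 49) := by
    rw [ex, e]; push_cast; rw [ZMod.natCast_val, ZMod.cast_id', id_eq]; ring
  rw [e2, ZMod.val_natCast_of_lt (by omega)]
  unfold good
  simp only [Bool.and_eq_true, Nat.ble_eq, Nat.blt_eq]
  omega

/-- The speeds for which seven of fourteen consecutive shifts can be bad. -/
def Special (b : ℕ) : Prop := b = 2 ∨ b = 47 ∨ b = 24 ∨ b = 25

instance (b : ℕ) : Decidable (Special b) := by unfold Special; infer_instance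

/-- At most seven of fourteen consecutive shifts are bad, and seven only for special speeds. -/
theorem badCount_fourteen {b : ℕ} (hb : b < 49) (h : b % 7 ≠ 0 ∧ b % 7 ≠ 1 ∧ b % 7 ≠ 6) {p : ℕ}
    (hp : p < 49) : badCount 14 b p ≤ 7 ∧ (¬ Special b → badCount 14 b p ≤ 6) := by
  have key : ((List.range 49).all fun b => (List.range 49).all fun p =>
      Nat.beq (b % 7) 0 || Nat.beq (b % 7) 1 || Nat.beq (b % 7) 6 || Nat.blt (badCount 14 b p) 7 ||
        (Nat.blt (badCount 14 b p) 8 && decide (Special b))) = true := by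
    decide +kernel
  have := allRange (allRange key hb) hp
  simp only [Bool.or_eq_true, Nat.beq_eq, Nat.blt_eq, Bool.and_eq_true, decide_eq_true_eq] at this
  rcases this with h' | h'
  · exact ⟨by omega, fun _ => by omega⟩
  · exact ⟨by omega, fun hs => absurd h'.2 hs⟩

theorem exists_good_of_not_special {ρ σ : ZMod 49}
    (hρ : ρ.val % 7 ≠ 0 ∧ ρ.val % 7 ≠ 1 ∧ ρ.val % 7 ≠ 6)
    (hσ : σ.val % 7 ≠ 0 ∧ σ.val % 7 ≠ 1 ∧ σ.val % 7 ≠ 6) (h : ¬ (Special ρ.val ∧ Special σ.val)) :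
    ∀ p < 49, ∀ q < 49, ∃ i < 35 - 7 * 3, good ((p + i * ρ.val) % 49) = true ∧
      good ((q + i * σ.val) % 49) = true := by
  intro p hp q hq
  refine exists_of_badCount (len := 14) ?_
  obtain ⟨h1, h2⟩ := badCount_fourteen (ZMod.val_lt ρ) hρ hp
  obtain ⟨h3, h4⟩ := badCount_fourteen (ZMod.val_lt σ) hσ hq
  by_cases hs : Special ρ.val
  · have := h4 fun h' => h ⟨hs, h'⟩
    omega
  · have := h2 hs
    omega

/-- For special speeds a whole arc of length `1 / 7` can be brought to the middle. -/
theorem exists_good_of_special : ∀ b, Special b → ∀ p < 49,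
    ∃ i < 35 - 7 * 3, 7 ≤ (p + i * b) % 49 ∧ (p + i * b) % 49 < 35 := by
  rintro b (rfl | rfl | rfl | rfl) <;> decide +kernel

theorem exists_good_of_special_seven : ∀ b, b = 24 ∨ b = 25 → ∀ p < 49,
    ∃ i < 35 - 7 * 4, 7 ≤ (p + i * b) % 49 ∧ (p + i * b) % 49 < 35 := by
  rintro b (rfl | rfl) <;> decide +kernel

/-- Three exact points either scale into an arc of length `2 / 7`, or lie on an arc of length
`3 / 7` after any scaling. -/
theorem exists_scale_three_digits : ∀ S : Finset (ZMod 7), S.card ≤ 3 → S.Nonempty →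
    (∃ l : ZMod 7, l ≠ 0 ∧ ∃ t ∈ S, ∀ s ∈ S, (l * (s - t)).val ≤ 2) ∨
    ∀ l : ZMod 7, l ≠ 0 → ∃ t ∈ S, ∀ s ∈ S, (l * (s - t)).val ≤ 3 := by
  decide +kernel

theorem exists_arc_three_digits : ∀ S : Finset (ZMod 7), S.card ≤ 3 → S.Nonempty →
    ∀ l : ZMod 7, l ≠ 0 → ∃ t ∈ S, ∀ s ∈ S, (l * (s - t)).val ≤ 4 := by
  decide +kernel

theorem Special.eq_of_mod {b c : ℕ} (hb : Special b) (hc : Special c) (h : b % 7 = c % 7) :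
    b = c := by
  rcases hb with rfl | rfl | rfl | rfl <;> rcases hc with rfl | rfl | rfl | rfl <;> simp_all

/-- A class of three exact points and a class of two. -/
theorem Solvable.three_two_of_exact (hm : 2 ≤ m) {a b c p q : ℤ} (ha : ¬ (7 : ℤ) ∣ a)
    (hp : ¬ (7 : ℤ) ∣ p) (hA : ∀ x ∈ [a, b, c], (7 : ℤ) ^ m ∣ x - a) (hq : (7 : ℤ) ∣ q - p)
    (hne : ¬ (7 : ℤ) ^ (m + 1) ∣ q - p) (hap : Sep a p) : Solvable m [a, b, c, p, q] := by
  have hq7 : ¬ (7 : ℤ) ∣ q := fun h => hp (by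
    have := dvd_sub h hq
    rwa [sub_sub_cancel] at this)
  have hqp : (q : ZMod 7) = p := cast_eq_of_dvd hq
  have haq : Sep a q := by
    obtain ⟨g1, g2⟩ := hap.cast
    constructor
    · rw [← zmod_seven_eq_zero]; push_cast; rw [hqp, sub_eq_zero]; exact g1
    · rw [← zmod_seven_eq_zero]; push_cast; rw [hqp, add_eq_zero_iff_eq_neg]; exact g2
  have hA7 : ∀ x ∈ [a, b, c], (x : ZMod 7) = a := fun x hx =>
    cast_eq_of_dvd ((dvd_pow_self 7 (by omega)).trans (hA x hx))
  have hA49 : ∀ x ∈ [a, b, c], (49 : ℤ) ∣ x - a := fun x hx => by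
    have : (7 : ℤ) ^ 2 ∣ x - a := (pow_dvd_pow 7 hm).trans (hA x hx)
    simpa using this
  set S := ([a, b, c].map fun x => dig m (x - a)).toFinset with hS
  have hSc : S.card ≤ 3 := (List.toFinset_card_le _).trans (by simp)
  have hSn : S.Nonempty := ⟨dig m (a - a), by simp [hS]⟩
  have arc : ∀ {w : ℕ} {l : ZMod 7}, l ≠ 0 → (∃ t ∈ S, ∀ s ∈ S, (l * (s - t)).val ≤ w) →
      ∀ μ : ℤ, (μ : ZMod 7) = l → Arc m w ([a, b, c].map (μ * ·)) := by
    rintro w l hl ⟨t, ht, h⟩ μ hμ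
    obtain ⟨y, hy, hyt⟩ := List.mem_map.1 (List.mem_toFinset.1 ht)
    refine ⟨μ * y, List.mem_map_of_mem hy, fun z hz => ?_⟩
    obtain ⟨x, hx, rfl⟩ := List.mem_map.1 hz
    have h1 := h _ (List.mem_toFinset.2 (List.mem_map_of_mem hx))
    have hxa := hA x hx
    have e : x - y = -(y - a) + (x - a) := by ring
    have hyx : (7 : ℤ) ^ m ∣ x - y := by
      rw [e]; exact dvd_add ((dvd_neg).2 (hA y hy)) hxa
    have h2 : dig m (x - y) = dig m (x - a) - t := by
      obtain ⟨g, hg⟩ := hA y hy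
      rw [e, ← hyt, hg, ← mul_neg, dig_exact_sub (Dvd.intro _ rfl), dig_mul_pow, dig_mul_pow]
      push_cast; ring
    rw [← mul_sub, emod_of_exact (Dvd.dvd.mul_left hyx _), dig_exact_mul hyx, hμ, h2]
    have : (((l * (dig m (x - a) - t)).val : ℕ) : ℤ) ≤ w := by exact_mod_cast h1
    nlinarith [pow_pos_seven m]
  have unit : ∀ {μ : ℤ} {l : ZMod 7}, l ≠ 0 → (μ : ZMod 7) = l → ¬ (7 : ℤ) ∣ μ :=
    fun hl h => zmod_seven_ne_zero.1 (by rwa [h])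
  have ratio : (p : ZMod 7) = 2 * a ∨ (p : ZMod 7) = 5 * a ∨ (p : ZMod 7) = 3 * a ∨
      (p : ZMod 7) = 4 * a := by
    have key : ∀ x y : ZMod 7, x ≠ 0 → y ≠ 0 → y ≠ x → y ≠ -x →
      y = 2 * x ∨ y = 5 * x ∨ y = 3 * x ∨ y = 4 * x := by decide
    exact key a p (zmod_seven_ne_zero.2 ha) (zmod_seven_ne_zero.2 hp) hap.cast.1 hap.cast.2
  have cl : ∀ μ : ℤ, ∀ x ∈ [a, b, c].map (μ * ·), (x : ZMod 7) = ((μ * a : ℤ) : ZMod 7) := by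
    intro μ x hx
    obtain ⟨y, hy, rfl⟩ := List.mem_map.1 hx
    push_cast; rw [hA7 y hy]
  obtain ⟨n, rfl⟩ : ∃ n, m = n + 1 := ⟨m - 1, by omega⟩
  by_cases hfree : ((p : ZMod 7) = 2 * a ∨ (p : ZMod 7) = 5 * a) ∧
      ∃ l : ZMod 7, l ≠ 0 ∧ ∃ t ∈ S, ∀ s ∈ S, (l * (s - t)).val ≤ 2
  · obtain ⟨hr, l, hl, h⟩ := hfree
    have hμ := unit hl (exists_cast_eq l)
    refine Solvable.smul hμ (Solvable.of_arc_two_free (c := ((l.val * a : ℤ) : ZMod 7))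
      (d := ((l.val * p : ℤ) : ZMod 7)) (b := l.val * p) (b' := l.val * q) (by omega)
      (zmod_seven_ne_zero.2 (not_seven_dvd_mul hμ ha)) ?_ (arc hl h _ (exists_cast_eq l)) (cl _) rfl
      (by push_cast; rw [hqp]) (by simp))
    push_cast
    rcases hr with hr | hr <;> rw [hr]
    · left; ring
    · right; ring
  obtain ⟨ρ, hρ⟩ := exists_ratio_mul ha p
  obtain ⟨σ, hσ⟩ := exists_ratio_mul ha q
  obtain ⟨l₃, hl₃, t₃, ht₃, h₃⟩ := exists_scale_digits_three S hSc hSn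
  have hA3 := arc (w := 3) hl₃ ⟨t₃, ht₃, h₃⟩ _ (exists_cast_eq l₃)
  have hμ₃ := unit hl₃ (exists_cast_eq l₃)
  have hA49' : ∀ μ : ℤ, ∀ x ∈ [a, b, c].map (μ * ·), (49 : ℤ) ∣ x - μ * a := by
    intro μ x hx
    obtain ⟨y, hy, rfl⟩ := List.mem_map.1 hx
    exact dvd_mul_sub (hA49 y hy)
  by_cases hsp : Special ρ.val ∧ Special σ.val
  swap
  · refine Solvable.smul hμ₃ (Solvable.of_arc_ratio (w := 3) (by omega)
      (not_seven_dvd_mul hμ₃ ha) hA3 (hA49' _) (ratio_mul (μ := l₃.val) hρ) (ratio_mul hσ)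
      (exists_good_of_not_special (ratio_val_ne ha hp hap hρ) (ratio_val_ne ha hq7 haq hσ) hsp)
      (by simp))
  have hρσ : ρ = σ := ZMod.val_injective 49 (hsp.1.eq_of_mod hsp.2 (by
    rw [ratio_val_mod ha hρ, ratio_val_mod ha hσ, hqp]))
  have hpq : (49 : ℤ) ∣ q - p := by rw [← zmod_fortynine_eq, hσ, hρ, hρσ]
  have final : ∀ {μ : ℤ} {w : ℕ}, ¬ (7 : ℤ) ∣ μ → Arc (n + 1) w ([a, b, c].map (μ * ·)) →
      Near (n + 1) 1 (μ * (q - p)) →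
      (∀ s < 49, ∃ i < 35 - 7 * w, 7 ≤ (s + i * ρ.val) % 49 ∧ (s + i * ρ.val) % 49 < 35) →
      Solvable (n + 1) [a, b, c, p, q] := by
    intro μ w hμ hA hB hi
    rw [mul_sub] at hB
    refine Solvable.smul hμ (Solvable.of_arc_arc_ratio (B := [μ * q, μ * p]) (by omega)
      (not_seven_dvd_mul hμ ha) hA (hA49' _) (hB.arc (by norm_num)) ?_ (ratio_mul hρ) hi (by simp))
    simpa using dvd_mul_sub hpq
  obtain ⟨w, hw, hqw⟩ := exists_lev hne
  rcases hw.lt_or_eq with hw | rfl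
  · obtain ⟨ν, hν, h1, h2⟩ := exists_avoid_one le_rfl hw (hqw.mul hμ₃) ({0, 6}ᶜ : Finset (ZMod 7))
      (by decide)
    refine final (w := 3) (not_seven_dvd_mul hν hμ₃) ?_ ?_ (exists_good_of_special _ hsp.1)
    · have := hA3.fixed (μ := ν) fun x hx y hy => h2 _ (dvd_sub_map (M := 7 ^ (n + 1))
        (fun x hx y hy => by
          have := dvd_sub (hA x hx) (hA y hy)
          rwa [sub_sub_sub_cancel_right] at this) x hx y hy)
      simpa [List.map_map, Function.comp_def, mul_assoc] using this
    · rw [mul_assoc]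
      refine near_one_of_dig ?_
      simpa [or_iff_not_imp_left] using h1
  · obtain ⟨ν, hν, hd⟩ := exists_scale hqw (t := 1) (by decide)
    have hB : Near (n + 1) 1 (ν * (q - p)) :=
      Near.of_exact (w := 1) (Dvd.dvd.mul_left (hqw.dvd le_rfl) ν) (by rw [hd]; decide)
    have hνl := zmod_seven_ne_zero.2 hν
    by_cases hr : (p : ZMod 7) = 2 * a ∨ (p : ZMod 7) = 5 * a
    · have h := (exists_scale_three_digits S hSc hSn).resolve_left fun h => hfree ⟨hr, h⟩
      exact final (w := 3) hν (arc hνl (h _ hνl) ν rfl) hB (exists_good_of_special _ hsp.1)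
    · refine final (w := 4) hν (arc hνl (exists_arc_three_digits S hSc hSn _ hνl) ν rfl) hB
        (exists_good_of_special_seven _ ?_)
      have hv := ratio_val_mod ha hρ
      have h34 : (p : ZMod 7) / a = 3 ∨ (p : ZMod 7) / a = 4 := by
        have ha' := zmod_seven_ne_zero.2 ha
        rcases ratio with h | h | h | h
        · exact absurd (Or.inl h) hr
        · exact absurd (Or.inr h) hr
        · left; rw [h, mul_div_assoc, div_self ha', mul_one]
        · right; rw [h, mul_div_assoc, div_self ha', mul_one]
      have h34' : ρ.val % 7 = 3 ∨ ρ.val % 7 = 4 := by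
        rw [hv]
        rcases h34 with h | h <;> rw [h]
        · left; rfl
        · right; rfl
      rcases hsp.1 with h | h | h | h
      · omega
      · omega
      · exact Or.inl h
      · exact Or.inr h

/-! ### Classes of three and two -/

theorem emod_le_of_rep {N q t : ℤ} (h : q ≡ t [ZMOD N]) (ht : 0 ≤ t) (hN : 0 < N) :
    q % N ≤ t := by
  rw [h.eq]
  have := Int.mul_ediv_add_emod t N
  have h2 : 0 ≤ t / N := Int.ediv_nonneg ht hN.le
  nlinarith

theorem Near.of_rep {w q t : ℤ} (h : q ≡ t [ZMOD 7 ^ (m + 1)]) (h1 : t ≤ w * 7 ^ m)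
    (h2 : -t ≤ w * 7 ^ m) : Near m w q := by
  rcases le_total 0 t with ht | ht
  · exact Or.inl ((emod_le_of_rep h ht (pow_pos_seven _)).trans h1)
  · exact Or.inr ((emod_le_of_rep h.neg (by linarith) (pow_pos_seven _)).trans h2)

/-- Dirichlet's approximation theorem. -/
theorem exists_mul_sub_le (r : ℕ) (x : ℤ) : ∃ i j : ℤ, 0 < j ∧ j ≤ 6 ∧
    |j * x - 7 ^ (r + 1) * i| ≤ 7 ^ r := by
  have hR : (0 : ℝ) < 7 ^ (r + 1) := by positivity
  obtain ⟨i, j, hj, hj6, h⟩ := Real.exists_int_int_abs_mul_sub_le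
    (x / 7 ^ (r + 1) : ℝ) (n := 6) (by norm_num)
  refine ⟨i, j, hj, by exact_mod_cast hj6, ?_⟩
  have h1 : |((j * x - 7 ^ (r + 1) * i : ℤ) : ℝ)| ≤ 7 ^ r := by
    have e : ((j * x - 7 ^ (r + 1) * i : ℤ) : ℝ) = (j * (x / 7 ^ (r + 1)) - i) * 7 ^ (r + 1) := by
      push_cast; field_simp
    rw [e, abs_mul, abs_of_pos hR]
    calc _ ≤ 1 / (6 + 1) * (7 : ℝ) ^ (r + 1) := by gcongr; exact_mod_cast h
      _ = 7 ^ r := by rw [pow_succ]; ring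
  exact_mod_cast h1

theorem not_seven_dvd_of_le_six {j : ℤ} (h : 0 < j) (h6 : j ≤ 6) : ¬ (7 : ℤ) ∣ j := fun hd => by
  have := Int.le_of_dvd h hd
  linarith

theorem pow_mul_pow_sub {v n : ℕ} (h : v ≤ n) : (7 : ℤ) ^ v * 7 ^ (n - v) = 7 ^ n := by
  rw [← pow_add]; congr 1; omega

/-- Two numbers of the same valuation can be brought near `0` simultaneously. -/
theorem exists_near_one_pair_of_eq {q q' : ℤ} {v : ℕ} (hv : v < m) (hq : Lev v q)
    (hq' : Lev v q') : ∃ μ : ℤ, ¬ (7 : ℤ) ∣ μ ∧ Near m 1 (μ * q) ∧ Near m 1 (μ * q') := by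
  obtain ⟨g, hg, rfl⟩ := hq
  obtain ⟨g', -, rfl⟩ := hq'
  obtain ⟨ν, hν, hνg⟩ := exists_inverse m hg
  obtain ⟨i, j, hj, hj6, hint⟩ := exists_mul_sub_le (m - v) (ν * g')
  have hpow : (7 : ℤ) ^ v * 7 ^ (m - v + 1) = 7 ^ (m + 1) := by
    rw [← pow_mul_pow_sub (show v ≤ m + 1 by omega)]; congr 2; omega
  have hpow2 := pow_mul_pow_sub hv.le
  have hvpos := pow_pos_seven v
  have h6 : (7 : ℤ) ≤ 7 ^ (m - v) := by
    calc (7 : ℤ) = 7 ^ 1 := by norm_num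
      _ ≤ 7 ^ (m - v) := pow_le_pow_right₀ (by norm_num) (by omega)
  refine ⟨j * ν, not_seven_dvd_mul (not_seven_dvd_of_le_six hj hj6) hν, ?_, ?_⟩
  · refine Near.of_rep (t := j * 7 ^ v) ?_ ?_ ?_
    · have := hνg.mul_left (j * 7 ^ v)
      rw [mul_one] at this
      convert this using 1; ring
    · nlinarith
    · nlinarith
  · obtain ⟨h1, h2⟩ := abs_le.1 hint
    refine Near.of_rep (t := 7 ^ v * (j * (ν * g') - 7 ^ (m - v + 1) * i)) ?_ ?_ ?_
    · refine (Int.modEq_iff_dvd.2 ⟨-i, ?_⟩)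
      rw [← hpow]; ring
    · rw [one_mul, ← hpow2]; nlinarith
    · rw [one_mul, ← hpow2]; nlinarith

theorem near_one_of_not_mem {q : ℤ} (h : dig m q ∉ ({0, 6}ᶜ : Finset (ZMod 7))) : Near m 1 q := by
  refine near_one_of_dig ?_
  simpa [or_iff_not_imp_left] using h

/-- Two numbers, not both exact, can be brought near `0` simultaneously. -/
theorem exists_near_one_pair {q q' : ℤ} {v v' : ℕ} (hv : v ≤ m) (hv' : v' ≤ m) (hq : Lev v q)
    (hq' : Lev v' q') (h : ¬ (v = m ∧ v' = m)) :
    ∃ μ : ℤ, ¬ (7 : ℤ) ∣ μ ∧ Near m 1 (μ * q) ∧ Near m 1 (μ * q') := by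
  have main : ∀ {q q' : ℤ} {v v' : ℕ}, v ≤ m → v' < v → Lev v q → Lev v' q' →
      ∃ μ : ℤ, ¬ (7 : ℤ) ∣ μ ∧ Near m 1 (μ * q) ∧ Near m 1 (μ * q') := by
    intro q q' v v' hv hvv hq hq'
    obtain ⟨μ, hμ, h1⟩ := exists_near hv hq
    obtain ⟨ν, hν, h2, h3⟩ := exists_avoid_one (m := m) hv hvv (hq'.mul hμ)
      ({0, 6}ᶜ : Finset (ZMod 7)) (by decide)
    refine ⟨ν * μ, not_seven_dvd_mul hν hμ, ?_, ?_⟩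
    · rw [mul_assoc]
      have : Near m 1 (μ * q) := Or.inl (by rwa [one_mul])
      exact this.congr (h3 _ ((hq.mul hμ).dvd le_rfl))
    · rw [mul_assoc]; exact near_one_of_not_mem h2
  rcases lt_trichotomy v v' with hlt | rfl | hlt
  · obtain ⟨μ, hμ, h1, h2⟩ := main hv' hlt hq' hq
    exact ⟨μ, hμ, h2, h1⟩
  · exact exists_near_one_pair_of_eq (by omega) hq hq'
  · exact main hv hlt hq hq'

/-- Three numbers with a difference of valuation less than `m` fit on an arc of length `2 / 7`. -/
theorem gather_three {a b c : ℤ} {v v' : ℕ} (hv : v < m) (hvv : v ≤ v') (hv' : v' ≤ m)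
    (hab : Lev v' (a - b)) (hac : Lev v (a - c)) (hbc : Lev v (b - c)) : Gather m 2 [a, b, c] := by
  rcases hvv.lt_or_eq with hvv | rfl
  · obtain ⟨μ, hμ, hn⟩ := exists_near hv' hab
    have hn : Near m 1 (μ * a - μ * b) := Or.inl (by rwa [← mul_sub, one_mul])
    have hd : (7 : ℤ) ^ (v + 1) ∣ a - b := hab.dvd hvv
    obtain ⟨k, hk, -⟩ := exists_join (w₁ := 1) (w₂ := 0) 2 hv (hn.arc (by norm_num))
      (Arc.singleton (μ * c))
      (by
        have := dvd_sub_map (M := 7 ^ (v + 1)) (μ := μ) (l := [a, b]) (by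
          simp only [List.mem_cons, List.not_mem_nil, or_false, forall_eq_or_imp, forall_eq,
            sub_self, dvd_zero, true_and, and_true]
          exact ⟨hd, (dvd_sub_comm).1 hd⟩)
        exact this)
      (by simp) (lev_map (l := [a, b]) (l' := [c]) hμ (by simpa using ⟨hac, hbc⟩)) [] (by simp)
      (by decide)
    exact Gather.smul hμ ⟨_, step_unit hv k, hk⟩
  · obtain ⟨k, -, h⟩ := exists_step_arc_three robust_arc_three_two hv hab hac hbc ∅ (by simp)
    exact ⟨_, step_unit hv _, h⟩

theorem exists_two_shift : ∀ g f : ZMod 7, g ≠ 0 → f ≠ 0 → f ≠ g → f ≠ -g → ∀ s t : ZMod 7,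
    ∃ k : ZMod 7, s + k * g ∈ ({6, 0, 1} : Finset (ZMod 7)) ∧
      t + k * f ∉ ({2, 3, 4} : Finset (ZMod 7)) := by
  decide +kernel

/-- A perturbation by at most one unit changes the top digit by at most one. -/
theorem dig_add_near_sub (q : ℤ) {D : ℤ} (hD : Near m 1 D) :
    dig m (q + D) - dig m q ∈ ({6, 0, 1} : Finset (ZMod 7)) := by
  have hr := pow_pos_seven m
  have e := emod_eq_dig m D
  have h0 := Int.emod_nonneg D hr.ne'
  have h1 := Int.emod_lt_of_pos D hr
  have hq1 := Int.emod_lt_of_pos q hr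
  have hlt : ((dig m D).val : ℤ) ≤ 6 := by exact_mod_cast Nat.lt_succ_iff.1 (ZMod.val_lt (dig m D))
  rw [dig_add, add_assoc, add_sub_cancel_left]
  rcases hD with h | h
  · rcases eq_or_ne (dig m D) 0 with hd | hd
    · rw [hd]; split_ifs <;> decide
    · have hpos : (1 : ℤ) ≤ (dig m D).val := by
        have : (dig m D).val ≠ 0 := by rwa [Ne, ZMod.val_eq_zero]
        exact_mod_cast Nat.one_le_iff_ne_zero.2 this
      have hv : ((dig m D).val : ℤ) = 1 := by nlinarith
      have hz : D % 7 ^ m = 0 := by nlinarith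
      have hd1 : dig m D = 1 := ZMod.val_injective 7 (by
        have : (dig m D).val = 1 := by exact_mod_cast hv
        rw [this]; rfl)
      rw [hd1, hz, add_zero, if_neg (by linarith)]
      decide
  · by_cases hz : D % 7 ^ (m + 1) = 0
    · have hz' : dig m D = 0 := by
        have : dig m D = dig m 0 := dig_congr (by simpa [Int.ModEq] using hz)
        rw [this]; simp [dig]
      rw [hz']; split_ifs <;> decide
    · rw [neg_emod _ (pow_pos_seven _) hz, e, pow_succ] at h
      have hv : ((dig m D).val : ℤ) = 6 := by
        have : ((dig m D).val : ℤ) + 1 > 6 := by nlinarith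
        linarith
      have hd6 : dig m D = 6 := ZMod.val_injective 7 (by
        have : (dig m D).val = 6 := by exact_mod_cast hv
        rw [this]; rfl)
      rw [hd6]; split_ifs <;> decide

theorem dig_add_near {q D : ℤ} (hq : dig m q = 0) (hD : Near m 1 D) :
    dig m (q + D) ∈ ({6, 0, 1} : Finset (ZMod 7)) := by
  simpa only [hq, sub_zero] using dig_add_near_sub q hD

theorem arc_three_of_dig {a b c : ℤ} {w W : ℕ} (h : (a - b) % 7 ^ (m + 1) ≤ w * 7 ^ m)
    (hd : joinOk w 0 W (dig m (c - b))) : Arc m W [a, b, c] := by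
  refine arc_of_joinOk (l₁ := [a, b]) (l₂ := [c]) (c₁ := b) (c₂ := c) (by simp) (by simp) ?_
    (by simp) hd
  have := pow_pos_seven m
  simp only [List.mem_cons, List.not_mem_nil, or_false, forall_eq_or_imp, forall_eq, sub_self,
    Int.zero_emod]
  exact ⟨h, by positivity⟩

theorem joinOk_of_mem {t : ZMod 7} (h : t ∈ ({6, 0, 1} : Finset (ZMod 7))) : joinOk 1 0 2 t := by
  revert t; decide

/-- An isosceles triple and a pair on the same level, whose distance agrees with the leg of the
triple to a higher power of `7`. -/
theorem gather_isosceles_of_congr {a b c q : ℤ} {v v' : ℕ} (hvv : v < v') (hv' : v' ≤ m)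
    (hab : Lev v' (a - b)) (hq : Lev v q)
    (hD : (7 : ℤ) ^ (v + 1) ∣ (c - b) - q) :
    ∃ μ : ℤ, ¬ (7 : ℤ) ∣ μ ∧ Arc m 2 [μ * a, μ * b, μ * c] ∧ Near m 2 (μ * q) := by
  have hv : v < m := by omega
  -- once `a - b` and `D` are placed, the distance `q` may be moved
  have fin : ∀ {μ : ℤ} {w : ℕ} (t : ZMod 7), ¬ (7 : ℤ) ∣ μ →
      (μ * (a - b)) % 7 ^ (m + 1) ≤ w * 7 ^ m → t ∉ ({2, 3, 4} : Finset (ZMod 7)) →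
      (∀ x, dig m x = t → joinOk w 0 2 (dig m (x + μ * ((c - b) - q)))) →
      ∃ μ : ℤ, ¬ (7 : ℤ) ∣ μ ∧ Arc m 2 [μ * a, μ * b, μ * c] ∧ Near m 2 (μ * q) := by
    intro μ w t hμ h1 ht h2
    obtain ⟨k, hk⟩ := exists_step_dig hv (hq.mul hμ) t
    have hf : ∀ {y : ℤ}, (7 : ℤ) ^ (v + 1) ∣ y →
        step m v k * (μ * y) ≡ μ * y [ZMOD 7 ^ (m + 1)] :=
      fun hy => step_frozen hv.le k (hy.mul_left μ)
    refine ⟨step m v k * μ, not_seven_dvd_mul (step_unit hv k) hμ,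
      arc_three_of_dig (w := w) ?_ ?_, near_two_of_dig (by rwa [mul_assoc, hk])⟩
    · rw [← mul_sub, mul_assoc, (hf (hab.dvd hvv)).eq]
      exact h1
    · have e : step m v k * μ * c - step m v k * μ * b =
          step m v k * (μ * q) + step m v k * (μ * ((c - b) - q)) := by ring
      rw [e, dig_congr ((hf hD).add_left _)]
      exact h2 _ hk
  by_cases hD0 : (7 : ℤ) ^ (m + 1) ∣ (c - b) - q
  · obtain ⟨μ, hμ, h⟩ := exists_near hv' hab
    refine fin (w := 1) 0 hμ (by simpa using h) (by decide) fun x hx => ?_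
    rw [dig_congr (y := x) (by
      rw [Int.modEq_comm]
      exact Int.modEq_iff_dvd.2 (by rw [add_sub_cancel_left]; exact hD0.mul_left μ)), hx]
    decide
  obtain ⟨u, hu, hDu⟩ := exists_lev hD0
  by_cases hex : v' = m ∧ u = m
  · obtain ⟨rfl, rfl⟩ := hex
    obtain ⟨μ, hμ, h1⟩ := exists_scale hab (t := 1) (by decide)
    have hab' := hab.mul hμ
    have hD' := hDu.mul hμ
    have key : ∀ δ : ZMod 7, δ ≠ 0 → δ = 4 ∨ ∃ t : ZMod 7, t ∉ ({2, 3, 4} : Finset (ZMod 7)) ∧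
        t + δ ∈ ({6, 0, 1} : Finset (ZMod 7)) := by decide
    rcases key _ (dig_exact_ne_zero hD') with h4 | ⟨t, ht, ht'⟩
    · refine fin (μ := 2 * μ) (w := 2) 0 (not_seven_dvd_mul (by norm_num) hμ) ?_ (by decide)
        fun x hx => ?_
      · rw [mul_assoc, emod_of_exact (Dvd.dvd.mul_left (hab'.dvd le_rfl) 2),
          dig_exact_mul (hab'.dvd le_rfl), h1]
        have : ((2 : ℤ) * (1 : ZMod 7)).val = 2 := by decide
        rw [this]; push_cast; linarith
      · rw [add_comm, mul_assoc, dig_exact_sub (Dvd.dvd.mul_left (hD'.dvd le_rfl) 2),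
          dig_exact_mul (hD'.dvd le_rfl), h4, hx]
        decide
    · refine fin (w := 1) t hμ ?_ ht fun x hx => joinOk_of_mem ?_
      · rw [emod_of_exact (hab'.dvd le_rfl), h1]
        have : (1 : ZMod 7).val = 1 := by decide
        rw [this]; push_cast; linarith
      · rw [add_comm, dig_exact_sub (hD'.dvd le_rfl), hx, add_comm]; exact ht'
  · obtain ⟨μ, hμ, h1, h2⟩ := exists_near_one_pair hv' hu hab hDu hex
    rcases h1 with h1 | h1
    · exact fin (w := 1) 0 hμ (by simpa using h1) (by decide) fun x hx =>
        joinOk_of_mem (dig_add_near hx h2)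
    · refine fin (μ := -μ) (w := 1) 0 (by rwa [Int.dvd_neg]) (by simpa using h1) (by decide)
        fun x hx => joinOk_of_mem (dig_add_near hx ?_)
      rw [neg_mul]; exact h2.neg

theorem gather_isosceles {a b c q : ℤ} {v v' : ℕ} (hvv : v < v') (hv' : v' ≤ m)
    (hab : Lev v' (a - b)) (hbc : Lev v (b - c)) (hq : Lev v q) :
    ∃ μ : ℤ, ¬ (7 : ℤ) ∣ μ ∧ Arc m 2 [μ * a, μ * b, μ * c] ∧ Near m 2 (μ * q) := by
  have hv : v < m := by omega
  obtain ⟨μ, hμ, hn⟩ := exists_near hv' hab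
  obtain ⟨g, hg, hgc⟩ := (hbc.sub_comm).mul hμ
  obtain ⟨f, hf, hfq⟩ := hq.mul hμ
  by_cases h1 : (f : ZMod 7) = g
  · refine gather_isosceles_of_congr hvv hv' hab hq ?_
    refine by_contra fun h => not_pow_dvd_mul hμ h ?_
    rw [mul_sub, hgc, hfq, ← mul_sub, pow_succ]
    exact mul_dvd_mul_left _ ((zmod_seven_eq_zero _).1 (by push_cast; rw [h1, sub_self]))
  by_cases h2 : (f : ZMod 7) = -g
  · obtain ⟨ν, hν, hA, hB⟩ := gather_isosceles_of_congr (c := c) hvv hv' hab hq.neg (by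
      refine by_contra fun h => not_pow_dvd_mul hμ h ?_
      rw [mul_sub, hgc, mul_neg, hfq, sub_neg_eq_add, ← mul_add, pow_succ]
      exact mul_dvd_mul_left _ ((zmod_seven_eq_zero _).1 (by push_cast; rw [h2, add_neg_cancel])))
    refine ⟨ν, hν, hA, ?_⟩
    rw [mul_neg] at hB
    simpa using hB.neg
  obtain ⟨k, h3, h4⟩ := exists_two_shift g f (zmod_seven_ne_zero.2 hg) (zmod_seven_ne_zero.2 hf)
    h1 h2 (dig m (μ * (c - b))) (dig m (μ * q))
  refine ⟨step m v k.val * μ, not_seven_dvd_mul (step_unit hv _) hμ,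
    arc_three_of_dig (w := 1) ?_ (joinOk_of_mem ?_), near_two_of_dig ?_⟩
  · rw [← mul_sub, mul_assoc, (step_frozen hv.le _ (Dvd.dvd.mul_left (hab.dvd hvv) μ)).eq]
    simpa using hn
  · rw [← mul_sub, mul_assoc]
    rw [hgc] at h3 ⊢
    rwa [step_dig_zmod hv.le]
  · rw [mul_assoc]
    rw [hfq] at h4 ⊢
    rwa [step_dig_zmod hv.le]

/-! ### Three residues and a distance on a common level -/

set_option synthInstance.maxSize 1000 in
set_option synthInstance.maxHeartbeats 400000 in
set_option maxRecDepth 100000 in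
/-- The triple has digits `0, 0, t` and speeds `0, 1, r`; the distance has digit `u` and speed `f`.
Either `f` is not the speed of a side of the triple, or the distance nearly equals that side. -/
theorem exists_tripleNear_normalized : ∀ t r u f : ZMod 7, r ≠ 0 → r ≠ 1 → f ≠ 0 →
    ((f ≠ 1 ∧ f ≠ -1 ∧ f ≠ r ∧ f ≠ -r ∧ f ≠ r - 1 ∧ f ≠ 1 - r) ∨
      (f = 1 ∧ u ∈ ({6, 0, 1} : Finset (ZMod 7))) ∨
      (f = r ∧ u - t ∈ ({6, 0, 1} : Finset (ZMod 7))) ∨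
      (f = r - 1 ∧ u - t ∈ ({6, 0, 1} : Finset (ZMod 7)))) →
    ∃ k : ZMod 7,
      (arcTest 2 [0, k.val, (t + k * r).val] = true ∧
        u + k * f ∉ ({2, 3, 4} : Finset (ZMod 7))) ∨
      (arcTest 3 [0, k.val, (t + k * r).val] = true ∧ (u + k * f = 0 ∨ u + k * f = 6)) := by
  decide +kernel

/-- `exists_tripleNear_normalized` for arbitrary initial digits and distinct speeds. -/
theorem exists_shift_triple_near {t g : Fin 3 → ZMod 7} (hg : Function.Injective g) {u f : ZMod 7}
    (hf : f ≠ 0)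
    (h : (∀ i j, i < j → f ≠ g j - g i ∧ -f ≠ g j - g i) ∨
      ∃ i j, i < j ∧ f = g j - g i ∧ u - (t j - t i) ∈ ({6, 0, 1} : Finset (ZMod 7))) :
    ∃ k : ZMod 7,
      (ArcPattern 3 2 (fun i => t i + k * g i) ∧ u + k * f ∉ ({2, 3, 4} : Finset (ZMod 7))) ∨
      (ArcPattern 3 3 (fun i => t i + k * g i) ∧ (u + k * f = 0 ∨ u + k * f = 6)) := by
  have hd : g 1 - g 0 ≠ 0 := sub_ne_zero.2 fun h => by simpa using hg h
  have h2 : g 2 - g 0 ≠ 0 := sub_ne_zero.2 fun h => by simpa using hg h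
  have h3 : g 2 - g 1 ≠ 0 := sub_ne_zero.2 fun h => by simpa using hg h
  obtain ⟨k, hk⟩ := exists_tripleNear_normalized
    (t 2 - t 0 - (t 1 - t 0) * ((g 2 - g 0) / (g 1 - g 0))) ((g 2 - g 0) / (g 1 - g 0))
    (u - (t 1 - t 0) * (f / (g 1 - g 0))) (f / (g 1 - g 0)) (div_ne_zero h2 hd)
    (by rw [Ne, div_eq_one_iff_eq hd]; simpa using fun h => h3 (sub_eq_zero.2 h))
    (div_ne_zero hf hd) (by
      rcases h with h | ⟨i, j, hij, h1, h4⟩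
      · left
        obtain ⟨a1, a2⟩ := h 0 1 (by decide)
        obtain ⟨b1, b2⟩ := h 0 2 (by decide)
        obtain ⟨c1, c2⟩ := h 1 2 (by decide)
        refine ⟨fun e => a1 ?_, fun e => a2 ?_, fun e => b1 ?_, fun e => b2 ?_, fun e => c1 ?_,
          fun e => c2 ?_⟩ <;> field_simp at e <;>
            first | linear_combination e | linear_combination -e
      · right
        fin_cases i <;> fin_cases j <;> simp at hij h1 h4
        · left
          subst h1
          rw [div_self hd]
          exact ⟨rfl, by simpa using h4⟩
        · right; left
          subst h1
          refine ⟨rfl, ?_⟩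
          ring_nf at h4 ⊢
          simpa using h4
        · right; right
          subst h1
          refine ⟨by field_simp; ring, ?_⟩
          convert (show u - (t 2 - t 1) ∈ ({6, 0, 1} : Finset (ZMod 7)) by simpa using h4) using 1
          field_simp; ring)
  have key : ∀ i, t i + (k - (t 1 - t 0)) / (g 1 - g 0) * g i =
      ![0, k, t 2 - t 0 - (t 1 - t 0) * ((g 2 - g 0) / (g 1 - g 0)) +
        k * ((g 2 - g 0) / (g 1 - g 0))] i + (t 0 + (k - (t 1 - t 0)) / (g 1 - g 0) * g 0) := by
    intro i
    fin_cases i <;> simp <;> field_simp <;> ring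
  have key' : u + (k - (t 1 - t 0)) / (g 1 - g 0) * f =
      u - (t 1 - t 0) * (f / (g 1 - g 0)) + k * (f / (g 1 - g 0)) := by ring
  refine ⟨(k - (t 1 - t 0)) / (g 1 - g 0), ?_⟩
  rw [funext key, key']
  refine hk.imp (fun h => ⟨?_, h.2⟩) (fun h => ⟨?_, h.2⟩) <;>
    exact ArcPattern.shift _ (arcPattern_of_test (by simpa [List.ofFn_succ] using h.1))

/-- Differences of sorted points and their digits. -/
theorem dig_sub_of_sorted {v : ℕ} (hv : v < m) {x : Fin 3 → ℤ} {σ : Equiv.Perm (Fin 3)}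
    {t g : Fin 3 → ZMod 7}
    (hd : ∀ (k : ZMod 7) i, dig m (step m v k.val * (x (σ i) - x 0)) = t i + k * g i)
    (hl : ∀ (k : ZMod 7) i j, i ≤ j → (step m v k.val * (x (σ i) - x 0)) % 7 ^ m ≤
        (step m v k.val * (x (σ j) - x 0)) % 7 ^ m) {i j : Fin 3} (hij : i ≤ j) {h : ℤ}
    (he : x (σ j) - x (σ i) = 7 ^ v * h) :
    dig m (x (σ j) - x (σ i)) = t j - t i ∧ (h : ZMod 7) = g j - g i := by
  have main : ∀ k : ZMod 7, dig m (x (σ j) - x (σ i)) + k * h = (t j + k * g j) - (t i + k * g i) := by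
    intro k
    rw [← hd, ← hd, ← dig_sub_of_le (hl k _ _ hij), ← mul_sub, sub_sub_sub_cancel_right, he,
      step_dig_zmod hv.le]
  have h0 := main 0
  have h1 := main 1
  simp only [zero_mul, add_zero, one_mul] at h0 h1
  exact ⟨h0, by rw [h0] at h1; linear_combination h1⟩

/-- An equilateral triple and a distance, all on one level. If the distance agrees with a
side of the triple modulo a higher power of `7`, it has to be nearly equal to that side first. -/
theorem exists_step_triple_near {v : ℕ} (hv : v < m) {x : Fin 3 → ℤ}
    (hx : ∀ i j, i ≠ j → Lev v (x i - x j)) {q : ℤ} (hq : Lev v q)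
    (h : (∀ i j, i ≠ j → ¬ (7 : ℤ) ^ (v + 1) ∣ (x i - x j) - q) ∨
      ∃ i j, i ≠ j ∧ (7 : ℤ) ^ (v + 1) ∣ (x i - x j) - q ∧ Near m 1 ((x i - x j) - q)) :
    ∃ k : ZMod 7,
      (Arc m 2 (List.ofFn fun i => step m v k.val * x i) ∧ Near m 2 (step m v k.val * q)) ∨
      (Arc m 3 (List.ofFn fun i => step m v k.val * x i) ∧ Near m 1 (step m v k.val * q)) := by
  obtain ⟨σ, t, g, hg, hd, hl⟩ := exists_sorted_step hv hx
  have fin : ∀ q, Lev v q → ((∀ i j, i < j → ¬ (7 : ℤ) ^ (v + 1) ∣ (x (σ j) - x (σ i)) - q ∧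
      ¬ (7 : ℤ) ^ (v + 1) ∣ (x (σ j) - x (σ i)) + q) ∨
      ∃ i j, i < j ∧ (7 : ℤ) ^ (v + 1) ∣ (x (σ j) - x (σ i)) - q ∧
        Near m 1 ((x (σ j) - x (σ i)) - q)) → ∃ k : ZMod 7,
      (Arc m 2 (List.ofFn fun i => step m v k.val * x i) ∧ Near m 2 (step m v k.val * q)) ∨
      (Arc m 3 (List.ofFn fun i => step m v k.val * x i) ∧ Near m 1 (step m v k.val * q)) := by
    clear h hq q
    intro q ⟨f, hf, hqf⟩ h
    obtain ⟨k, hk⟩ := exists_shift_triple_near (t := t) (u := dig m q) hg (zmod_seven_ne_zero.2 hf) (by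
      refine h.imp (fun h i j hij => ?_) ?_
      · obtain ⟨e, -, he⟩ := hx (σ j) (σ i) (σ.injective.ne hij.ne')
        obtain ⟨-, h1⟩ := dig_sub_of_sorted hv hd hl hij.le he
        obtain ⟨h2, h3⟩ := h i j hij
        rw [he, hqf, ← mul_sub, pow_succ, mul_dvd_mul_iff_left (by positivity),
          ← zmod_seven_eq_zero] at h2
        rw [he, hqf, ← mul_add, pow_succ, mul_dvd_mul_iff_left (by positivity),
          ← zmod_seven_eq_zero] at h3
        push_cast at h2 h3
        rw [← h1]
        exact ⟨fun e => h2 (by rw [e, sub_self]), fun e => h3 (by rw [← e, neg_add_cancel])⟩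
      · rintro ⟨i, j, hij, h1, h2⟩
        obtain ⟨e, -, he⟩ := hx (σ j) (σ i) (σ.injective.ne hij.ne')
        obtain ⟨h3, h4⟩ := dig_sub_of_sorted hv hd hl hij.le he
        refine ⟨i, j, hij, ?_, ?_⟩
        · rw [he, hqf, ← mul_sub, pow_succ, mul_dvd_mul_iff_left (by positivity),
            ← zmod_seven_eq_zero] at h1
          push_cast at h1
          rw [← h4, sub_eq_zero.1 h1]
        · have := dig_add_near_sub (x (σ j) - x (σ i)) h2.neg
          rw [neg_sub, add_sub_cancel] at this
          rwa [← h3])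
    refine ⟨k, hk.imp (fun h => ⟨arc_of_sorted (hd k) (hl k) h.1, near_two_of_dig ?_⟩)
      (fun h => ⟨arc_of_sorted (hd k) (hl k) h.1, near_one_of_dig ?_⟩)⟩
    · rw [hqf] at h ⊢
      rw [step_dig_zmod hv.le]; exact h.2
    · rw [hqf] at h ⊢
      rw [step_dig_zmod hv.le]; exact h.2
  rcases h with h | ⟨i, j, hij, h1, h2⟩
  · refine fin q hq (Or.inl fun i j hij => ⟨h _ _ (σ.injective.ne hij.ne'), fun hh => ?_⟩)
    refine h _ _ (σ.injective.ne hij.ne) ?_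
    rw [← dvd_neg, show -(x (σ i) - x (σ j) - q) = x (σ j) - x (σ i) + q by ring]
    exact hh
  obtain ⟨i, rfl⟩ := σ.surjective i
  obtain ⟨j, rfl⟩ := σ.surjective j
  rcases lt_or_gt_of_ne (fun e => hij (congrArg σ e)) with hlt | hlt
  · have e : x (σ j) - x (σ i) - -q = -(x (σ i) - x (σ j) - q) := by ring
    obtain ⟨k, hk⟩ := fin (-q) hq.neg (Or.inr ⟨i, j, hlt, by
      rw [e]; exact h1.neg_right, by rw [e]; exact h2.neg⟩)
    refine ⟨k, hk.imp (fun h => ⟨h.1, ?_⟩) (fun h => ⟨h.1, ?_⟩)⟩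
    · have := h.2.neg; rwa [mul_neg, neg_neg] at this
    · have := h.2.neg; rwa [mul_neg, neg_neg] at this
  · exact fin q hq (Or.inr ⟨j, i, hlt, h1, h2⟩)

/-- A triple, two sides of which have the least valuation `v < m`, and a distance `q`: arcs of
lengths `2 / 7` and `2 / 7`, or `3 / 7` and `1 / 7`, are possible at the same time. -/
theorem gather_three_two {a b c q : ℤ} {v v' : ℕ} (hv : v < m) (hvv : v ≤ v') (hv' : v' ≤ m)
    (hab : Lev v' (a - b)) (hac : Lev v (a - c)) (hbc : Lev v (b - c))
    (hq : ¬ (7 : ℤ) ^ (m + 1) ∣ q) :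
    ∃ μ : ℤ, ¬ (7 : ℤ) ∣ μ ∧ ((Arc m 2 [μ * a, μ * b, μ * c] ∧ Near m 2 (μ * q)) ∨
      (Arc m 3 [μ * a, μ * b, μ * c] ∧ Near m 1 (μ * q))) := by
  obtain ⟨u, hu, hqu⟩ := exists_lev hq
  rcases lt_trichotomy u v with h | rfl | h
  · obtain ⟨μ, hμ, hA⟩ := gather_three hv hvv hv' hab hac hbc
    obtain ⟨ν, hν, hd, hf⟩ := exists_avoid_one hv.le h (hqu.mul hμ) {2, 3, 4} (by decide)
    have hd3 : ∀ p ∈ [a, b, c], ∀ q ∈ [a, b, c], (7 : ℤ) ^ v ∣ p - q := by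
      have := dvd_sub_of_three (hab.dvd hvv) (hac.dvd le_rfl)
      exact this
    refine ⟨ν * μ, not_seven_dvd_mul hν hμ, Or.inl ⟨?_, ?_⟩⟩
    · have := hA.fixed (μ := ν) fun x hx y hy => hf _ (dvd_sub_map hd3 x hx y hy)
      simpa [mul_assoc] using this
    · rw [mul_assoc]; exact near_two_of_dig hd
  · rcases hvv.lt_or_eq with hlt | rfl
    · obtain ⟨μ, hμ, h⟩ := gather_isosceles hlt hv' hab hbc hqu
      exact ⟨μ, hμ, Or.inl h⟩
    -- the equilateral case
    have main : ∀ μ : ℤ, ¬ (7 : ℤ) ∣ μ →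
        ((∀ i j, i ≠ j → ¬ (7 : ℤ) ^ (u + 1) ∣ (![a, b, c] i - ![a, b, c] j) - q) ∨
        ∃ i j, i ≠ j ∧ (7 : ℤ) ^ (u + 1) ∣ (![a, b, c] i - ![a, b, c] j) - q ∧
          Near m 1 (μ * ((![a, b, c] i - ![a, b, c] j) - q))) →
        ∃ μ : ℤ, ¬ (7 : ℤ) ∣ μ ∧ ((Arc m 2 [μ * a, μ * b, μ * c] ∧ Near m 2 (μ * q)) ∨
          (Arc m 3 [μ * a, μ * b, μ * c] ∧ Near m 1 (μ * q))) := by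
      intro μ hμ h
      obtain ⟨k, hk⟩ := exists_step_triple_near (x := fun i => μ * ![a, b, c] i) hv (by
        intro i j hij
        rw [← mul_sub]
        refine Lev.mul hμ ?_
        fin_cases i <;> fin_cases j <;>
          first | exact absurd rfl hij | assumption | (apply Lev.sub_comm; assumption))
        (hqu.mul hμ) (by
          refine h.imp (fun h i j hij => ?_) (fun ⟨i, j, hij, h1, h2⟩ => ⟨i, j, hij, ?_, ?_⟩)
          · rw [← mul_sub, ← mul_sub]; exact not_pow_dvd_mul hμ (h i j hij)
          · rw [← mul_sub, ← mul_sub]; exact h1.mul_left μ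
          · rw [← mul_sub, ← mul_sub]; exact h2)
      refine ⟨step m u k.val * μ, not_seven_dvd_mul (step_unit hv _) hμ, ?_⟩
      simpa [List.ofFn_succ, mul_assoc] using hk
    by_cases h : ∀ i j, i ≠ j → ¬ (7 : ℤ) ^ (u + 1) ∣ (![a, b, c] i - ![a, b, c] j) - q
    · exact main 1 (by norm_num) (Or.inl h)
    push Not at h
    obtain ⟨i, j, hij, hd⟩ := h
    by_cases h0 : (7 : ℤ) ^ (m + 1) ∣ (![a, b, c] i - ![a, b, c] j) - q
    · refine main 1 (by norm_num) (Or.inr ⟨i, j, hij, hd, Or.inl ?_⟩)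
      rw [one_mul, Int.emod_eq_zero_of_dvd h0]
      positivity
    · obtain ⟨w, hw, hD⟩ := exists_lev h0
      obtain ⟨μ, hμ, hn⟩ := exists_near hw hD
      exact main μ hμ (Or.inr ⟨i, j, hij, hd, Or.inl (by rwa [one_mul])⟩)
  · rcases hvv.lt_or_eq with hlt | rfl
    · obtain ⟨μ, hμ, h1, h2⟩ := exists_near_two_pair hv' hu hab hqu
      rw [mul_sub] at h1
      have hA : Arc m (2 : ℕ) [μ * a, μ * b] := h1.arc (by norm_num)
      have hab' : (7 : ℤ) ^ (v + 1) ∣ μ * a - μ * b := dvd_mul_sub (hab.dvd hlt)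
      obtain ⟨k, hk, -⟩ := exists_join 2 hv hA (Arc.singleton (μ * c)) (by
          simp only [List.mem_cons, List.not_mem_nil, or_false, forall_eq_or_imp, forall_eq,
            sub_self, dvd_zero, true_and, and_true]
          exact ⟨hab', by rw [← dvd_neg, neg_sub]; exact hab'⟩)
        (by simp) (by
          simp only [List.mem_cons, List.not_mem_nil, or_false, forall_eq_or_imp, forall_eq]
          exact ⟨hac.mul_sub hμ, hbc.mul_sub hμ⟩) [] (by simp) (by decide)
      refine ⟨step m v k * μ, not_seven_dvd_mul (step_unit hv _) hμ, Or.inl ⟨?_, ?_⟩⟩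
      · simpa [mul_assoc] using hk
      · rw [mul_assoc]
        exact h2.congr (step_frozen hv.le k ((hqu.dvd h).mul_left μ))
    · obtain ⟨μ, hμ, hn⟩ := exists_near hu hqu
      obtain ⟨k, -, hA⟩ := exists_step_arc_three robust_arc_three_two hv (hab.mul_sub hμ)
        (hac.mul_sub hμ) (hbc.mul_sub hμ) ∅ (by simp)
      refine ⟨step m v k.val * μ, not_seven_dvd_mul (step_unit hv _) hμ, Or.inl ⟨?_, ?_⟩⟩
      · simpa [mul_assoc] using hA
      · rw [mul_assoc]
        have hn1 : Near m 1 (μ * q) := Or.inl (by simpa using hn)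
        exact (hn1.mono (by norm_num)).congr
          (step_frozen hv.le k.val ((hqu.dvd h).mul_left μ))

theorem Sep.of_cast {a b : ℤ} (h : (b : ZMod 7) ≠ a) (h' : (b : ZMod 7) ≠ -(a : ZMod 7)) :
    Sep a b := by
  constructor
  · rw [← zmod_seven_eq_zero]; push_cast; rwa [sub_eq_zero]
  · rw [← zmod_seven_eq_zero]; push_cast; rwa [add_eq_zero_iff_eq_neg]

theorem Sep.congr {a a' b b' : ℤ} (h : Sep a b) (ha : (a' : ZMod 7) = a)
    (hb : (b' : ZMod 7) = b) : Sep a' b' :=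
  Sep.of_cast (by rw [ha, hb]; exact h.cast.1) (by rw [ha, hb]; exact h.cast.2)

theorem ratio_two_or_three : ∀ a p : ZMod 7, a ≠ 0 → p ≠ 0 → p ≠ a → p ≠ -a →
    (p = 2 * a ∨ p = 5 * a) ∨ (p = 3 * a ∨ p = 4 * a) := by decide

/-- Three residues of one class and two of another. -/
theorem Solvable.three_two (hm : 2 ≤ m) {a b c p q : ℤ} (ha : ¬ (7 : ℤ) ∣ a) (hp : ¬ (7 : ℤ) ∣ p)
    (hb : (7 : ℤ) ∣ b - a) (hc : (7 : ℤ) ∣ c - a) (hq : (7 : ℤ) ∣ q - p)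
    (h1 : ¬ (7 : ℤ) ^ (m + 1) ∣ a - b) (h2 : ¬ (7 : ℤ) ^ (m + 1) ∣ a - c)
    (h3 : ¬ (7 : ℤ) ^ (m + 1) ∣ b - c) (hne : ¬ (7 : ℤ) ^ (m + 1) ∣ q - p) (hap : Sep a p) :
    Solvable m [a, b, c, p, q] := by
  have hm0 : 0 < m := by omega
  obtain ⟨x, y, z, v, v', hvv, hv', hxy, hxz, hyz, hmem⟩ := exists_isosceles h1 h2 h3
  have hcl : ∀ s ∈ [x, y, z], (s : ZMod 7) = a := by
    intro s hs
    have hs := (hmem s).1 hs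
    simp only [List.mem_cons, List.not_mem_nil, or_false] at hs
    rcases hs with rfl | rfl | rfl
    · rfl
    · exact cast_eq_of_dvd hb
    · exact cast_eq_of_dvd hc
  have ha' : (a : ZMod 7) ≠ 0 := zmod_seven_ne_zero.2 ha
  have hp' : (p : ZMod 7) ≠ 0 := zmod_seven_ne_zero.2 hp
  have hqp : (q : ZMod 7) = p := cast_eq_of_dvd hq
  have hsub : ∀ s ∈ [a, b, c, p, q], s ∈ [x, y, z] ∨ s = p ∨ s = q := by
    intro s hs
    by_cases h : s ∈ [x, y, z]
    · exact Or.inl h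
    · rw [hmem] at h
      simp only [List.mem_cons, List.not_mem_nil, or_false, not_or] at hs h ⊢
      tauto
  rcases (hvv.trans hv').lt_or_eq with hv | rfl
  swap
  · obtain rfl : v = v' := le_antisymm hvv hv'
    have hx : ¬ (7 : ℤ) ∣ x := zmod_seven_ne_zero.1 (by rw [hcl x (by simp)]; exact ha')
    refine (Solvable.three_two_of_exact (a := x) (b := y) (c := z) hm hx hp ?_ hq hne ?_).mono
      fun s hs => ?_
    · intro s hs
      exact dvd_sub_of_three (hxy.dvd le_rfl) (hxz.dvd le_rfl) s hs x (by simp)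
    · exact hap.congr (hcl x (by simp)) rfl
    · have := hsub s hs
      simp only [List.mem_cons, List.not_mem_nil, or_false] at this ⊢
      tauto
  have cl : ∀ μ : ℤ, ∀ s ∈ [μ * x, μ * y, μ * z], (s : ZMod 7) = ((μ * a : ℤ) : ZMod 7) := by
    intro μ s hs
    obtain ⟨s, hs', rfl⟩ := List.mem_map.1 (show s ∈ [x, y, z].map (μ * ·) from hs)
    push_cast
    rw [hcl s hs']
  have sub' : ∀ μ : ℤ, ∀ s ∈ [a, b, c, p, q].map (μ * ·),
      s ∈ [μ * x, μ * y, μ * z] ∨ s = μ * p ∨ s = μ * q := by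
    intro μ s hs
    obtain ⟨s, hs', rfl⟩ := List.mem_map.1 hs
    refine (hsub s hs').imp (fun h => ?_) (Or.imp (congrArg _) (congrArg _))
    exact List.mem_map.2 ⟨s, h, rfl⟩
  have clp : ∀ μ : ℤ, ((μ * q : ℤ) : ZMod 7) = ((μ * p : ℤ) : ZMod 7) := by
    intro μ; push_cast; rw [hqp]
  rcases ratio_two_or_three _ _ ha' hp' hap.cast.1 hap.cast.2 with h23 | h23
  · obtain ⟨μ, hμ, hA⟩ := gather_three hv hvv hv' hxy hxz hyz
    have hμa : ((μ * a : ℤ) : ZMod 7) ≠ 0 := zmod_seven_ne_zero.2 (not_seven_dvd_mul hμ ha)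
    refine Solvable.smul hμ (Solvable.of_arc_two_free hm0 hμa (d := ((μ * p : ℤ) : ZMod 7)) ?_ hA
      (cl μ) rfl (clp μ) fun s hs => Or.inr (sub' μ s hs))
    push_cast
    refine h23.imp (fun h => ?_) (fun h => ?_) <;> rw [h] <;> ring
  · obtain ⟨μ, hμ, hA⟩ := gather_three_two hv hvv hv' hxy hxz hyz hne
    have hμa : ((μ * a : ℤ) : ZMod 7) ≠ 0 := zmod_seven_ne_zero.2 (not_seven_dvd_mul hμ ha)
    have hμp : ((μ * p : ℤ) : ZMod 7) ≠ 0 := zmod_seven_ne_zero.2 (not_seven_dvd_mul hμ hp)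
    obtain ⟨n1, n2⟩ := (hap.mul hμ).cast
    have hB : ∀ s ∈ [μ * q, μ * p], (s : ZMod 7) = ((μ * p : ℤ) : ZMod 7) := by
      intro s hs
      simp only [List.mem_cons, List.not_mem_nil, or_false] at hs
      rcases hs with rfl | rfl
      · exact clp μ
      · rfl
    have hL : ∀ s ∈ [a, b, c, p, q].map (μ * ·),
        Frozen m s ∨ s ∈ [μ * x, μ * y, μ * z] ∨ s ∈ [μ * q, μ * p] := fun s hs =>
      Or.inr ((sub' μ s hs).imp_right fun h => by
        simp only [List.mem_cons, List.not_mem_nil, or_false]; tauto)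
    rcases hA with ⟨hA, hn⟩ | ⟨hA, hn⟩
    · rw [mul_sub] at hn
      exact Solvable.smul hμ (Solvable.of_arc_two_two hm0 hμa hμp n1 n2 hA (cl μ)
        (hn.arc (by norm_num)) hB hL)
    · rw [mul_sub] at hn
      refine Solvable.smul hμ (Solvable.of_arc_three_one hm0 hμa ?_ hA (cl μ)
        (hn.arc (by norm_num)) hB hL)
      push_cast
      refine h23.imp (fun h => ?_) (fun h => ?_) <;> rw [h] <;> ring

/-! ### Classes of three, one and one -/

/-- Modulo a power of `7` that is at least `343`, the triple `0, 1, ρ` can be multiplied into an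
interval of a seventh of the circle. -/
theorem exists_small_spread {r : ℕ} (hr : 2 ≤ r) {ρ : ℤ} (h0 : ¬ (7 : ℤ) ∣ ρ) :
    ∃ t y : ℤ, ¬ (7 : ℤ) ∣ t ∧ t * ρ ≡ y [ZMOD 7 ^ (r + 1)] ∧ 0 ≤ t ∧ t ≤ 7 ^ r ∧
      ((0 ≤ y ∧ y ≤ 7 ^ r) ∨ (y ≤ 0 ∧ t - y ≤ 7 ^ r)) := by
  obtain ⟨i, j, hj, hj6, hs⟩ := exists_mul_sub_le r ρ
  obtain ⟨hs1, hs2⟩ := abs_le.1 hs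
  have h49 : (49 : ℤ) ≤ 7 ^ r := by
    calc (49 : ℤ) = 7 ^ 2 := by norm_num
      _ ≤ 7 ^ r := pow_le_pow_right₀ (by norm_num) hr
  have h7 : (7 : ℤ) ∣ 7 ^ r := dvd_pow_self 7 (by omega)
  have hj7 := not_seven_dvd_of_le_six hj hj6
  have hcong : j * ρ ≡ j * ρ - 7 ^ (r + 1) * i [ZMOD 7 ^ (r + 1)] :=
    Int.modEq_iff_dvd.2 ⟨-i, by ring⟩
  rcases le_or_gt 0 (j * ρ - 7 ^ (r + 1) * i) with hpos | hneg
  · exact ⟨j, _, hj7, hcong, hj.le, by linarith, Or.inl ⟨hpos, hs2⟩⟩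
  by_cases hsp : j - (j * ρ - 7 ^ (r + 1) * i) ≤ 7 ^ r
  · exact ⟨j, _, hj7, hcong, hj.le, by linarith, Or.inr ⟨hneg.le, hsp⟩⟩
  -- `j ρ` is slightly above `-7 ^ r`; pass to a denominator of `(7 i - 1) / j`
  obtain ⟨e, he⟩ : ∃ e, e = j * ρ - 7 ^ (r + 1) * i + 7 ^ r := ⟨_, rfl⟩
  have hjρ : j * ρ = e + 7 ^ r * (7 * i - 1) := by rw [he, pow_succ]; ring
  have he0 : 0 ≤ e := by linarith
  have hej : e < j := by linarith
  have hepos : 0 < e := by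
    refine lt_of_le_of_ne he0 fun h => not_seven_dvd_mul hj7 h0 ?_
    rw [hjρ, ← h, zero_add]
    exact h7.mul_right _
  obtain ⟨d, hd, n', j', hcop, hn, hj'⟩ : ∃ d : ℤ, 0 < d ∧ ∃ n' j' : ℤ, IsCoprime n' j' ∧
      7 * i - 1 = d * n' ∧ j = d * j' := by
    have hg : 0 < Int.gcd (7 * i - 1) j := Int.gcd_pos_of_ne_zero_right _ hj.ne'
    obtain ⟨n', j', hc, h2, h3⟩ := Int.exists_gcd_one hg
    exact ⟨Int.gcd (7 * i - 1) j, by exact_mod_cast hg, n', j', Int.isCoprime_iff_gcd_eq_one.2 hc,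
      h2.trans (mul_comm _ _), h3.trans (mul_comm _ _)⟩
  have hj'0 : 0 < j' := (mul_pos_iff_of_pos_left hd).1 (by rw [← hj']; exact hj)
  have hj'1 : j' ≠ 1 := by
    rintro rfl
    have : j ∣ e := by
      have h : j ∣ j * ρ - 7 ^ r * (7 * i - 1) :=
        dvd_sub (dvd_mul_right _ _)
          (Dvd.dvd.mul_left (by rw [hn, hj', mul_one]; exact dvd_mul_right _ _) _)
      rwa [hjρ, add_sub_cancel_right] at h
    have := Int.le_of_dvd hepos this
    linarith
  have hn7 : IsCoprime n' 7 := by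
    refine IsCoprime.symm ((Int.prime_iff_natAbs_prime.2 (by norm_num)).coprime_iff_not_dvd.2 ?_)
    intro h
    have : (7 : ℤ) ∣ 7 * i - 1 := by rw [hn]; exact h.mul_left d
    omega
  obtain ⟨p, w₀, hpw⟩ := hn7.mul_right hcop
  have hM : 0 < 7 * j' := by linarith
  obtain ⟨t, ht0, htM, w, htw⟩ : ∃ t, 0 ≤ t ∧ t < 7 * j' ∧ ∃ w, t * n' = 1 + 7 * j' * w := by
    refine ⟨p % (7 * j'), Int.emod_nonneg _ hM.ne', Int.emod_lt_of_pos _ hM,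
      - w₀ - (p / (7 * j')) * n', ?_⟩
    have := Int.mul_ediv_add_emod p (7 * j')
    linear_combination hpw + n' * this
  have hy : j * (t * ρ - 7 ^ (r + 1) * w) = t * e + 7 ^ r * d := by
    rw [pow_succ]
    linear_combination t * hjρ + 7 ^ r * t * hn + 7 ^ r * d * htw - 7 ^ (r + 1) * w * hj'
  have hte : t * e ≤ 7 ^ r * (j - d) := by
    have hd6 : d ≤ 6 := by nlinarith
    have hj'6 : j' ≤ 6 := by nlinarith
    have hj'2 : 2 ≤ j' := by omega
    subst hj'
    have h2 : t * e ≤ (7 * j' - 1) * (d * j' - 1) :=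
      mul_le_mul (by linarith) (by linarith) he0 (by linarith)
    have h3 : 49 * (d * j' - d) ≤ 7 ^ r * (d * j' - d) :=
      mul_le_mul_of_nonneg_right h49 (by nlinarith)
    refine h2.trans (le_trans ?_ h3)
    clear h2 h3 hy htw htM hM hpw hcop hjρ he hsp hneg hcong hs1 hs2 hs hj hej hj7
    interval_cases d <;> interval_cases j' <;> omega
  refine ⟨t, t * ρ - 7 ^ (r + 1) * w, ?_, Int.modEq_iff_dvd.2 ⟨-w, by ring⟩, ht0, ?_, Or.inl ⟨?_, ?_⟩⟩
  · rintro ⟨z, rfl⟩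
    have : (7 : ℤ) ∣ 1 := ⟨z * n' - j' * w, by linear_combination -htw⟩
    norm_num at this
  · nlinarith
  · have : 0 ≤ j * (t * ρ - 7 ^ (r + 1) * w) := by rw [hy]; positivity
    exact nonneg_of_mul_nonneg_right this hj
  · refine le_of_mul_le_mul_left ?_ hj
    rw [hy]; nlinarith

/-- A triple with two sides on one level, which is not one of the two highest. -/
theorem gather_one_of_legs {a b c : ℤ} {v : ℕ} (hv : v + 2 ≤ m) (hab : Lev v (b - a))
    (hac : Lev v (c - a)) : Gather m 1 [a, b, c] := by
  obtain ⟨g, hg, hga⟩ := hab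
  obtain ⟨h, hh, hha⟩ := hac
  obtain ⟨ν, hν, hνg⟩ := exists_inverse m hg
  obtain ⟨t, y, ht, hty, ht0, htr, hy⟩ := exists_small_spread (r := m - v) (ρ := ν * h) (by omega)
    (not_seven_dvd_mul hν hh)
  have hpow : (7 : ℤ) ^ v * 7 ^ (m - v + 1) = 7 ^ (m + 1) := by
    rw [← pow_mul_pow_sub (show v ≤ m + 1 by omega)]; congr 2; omega
  have hpow2 := pow_mul_pow_sub (show v ≤ m by omega)
  have hvpos := pow_pos_seven v
  have hN := pow_pos_seven (m + 1)
  have e1 : t * ν * b - t * ν * a ≡ 7 ^ v * t [ZMOD 7 ^ (m + 1)] := by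
    have := hνg.mul_left (7 ^ v * t)
    rw [mul_one] at this
    rw [← mul_sub, hga]
    convert this using 1; ring
  have e2 : t * ν * c - t * ν * a ≡ 7 ^ v * y [ZMOD 7 ^ (m + 1)] := by
    have := hty.mul_left' (c := 7 ^ v)
    rw [hpow] at this
    rw [← mul_sub, hha]
    convert this using 1; ring
  have le : ∀ {x z : ℤ}, x ≡ 7 ^ v * z [ZMOD 7 ^ (m + 1)] → 0 ≤ z → z ≤ 7 ^ (m - v) →
      x % 7 ^ (m + 1) ≤ 1 * 7 ^ m := fun hx hz hz' =>
    (emod_le_of_rep hx (by positivity) hN).trans (by rw [one_mul, ← hpow2]; gcongr)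
  refine ⟨t * ν, not_seven_dvd_mul ht hν, ?_⟩
  rcases hy with ⟨h0, h1⟩ | ⟨h0, h1⟩
  · refine ⟨t * ν * a, by simp, ?_⟩
    simp only [List.map_cons, List.map_nil, List.mem_cons, List.not_mem_nil, or_false,
      forall_eq_or_imp, forall_eq, sub_self, Int.zero_emod]
    exact ⟨by positivity, le e1 ht0 htr, le e2 h0 h1⟩
  · refine ⟨t * ν * c, by simp, ?_⟩
    simp only [List.map_cons, List.map_nil, List.mem_cons, List.not_mem_nil, or_false,
      forall_eq_or_imp, forall_eq, sub_self, Int.zero_emod]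
    refine ⟨le (z := -y) ?_ (by linarith) (by linarith), le (z := t - y) ?_ (by linarith) h1,
      by positivity⟩
    · have := e2.neg
      rwa [neg_sub, ← mul_neg] at this
    · have := e1.sub e2
      rw [sub_sub_sub_cancel_right] at this
      rwa [mul_sub]

/-- A triple with a pair that is closer than the others. -/
theorem gather_one_of_isosceles {a b c : ℤ} {v v' : ℕ} (hvv : v < v') (hv' : v' ≤ m)
    (hab : Lev v' (a - b)) (hbc : Lev v (b - c)) : Gather m 1 [a, b, c] := by
  have hv : v < m := by omega
  obtain ⟨μ, hμ, hn⟩ := exists_near hv' hab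
  obtain ⟨k, hk⟩ := exists_step_dig hv ((hbc.sub_comm).mul hμ) 0
  refine Gather.smul hμ ⟨step m v k, step_unit hv k, ?_⟩
  refine arc_three_of_dig (w := 1) (W := 1) ?_ ?_
  · rw [← mul_sub, ← mul_sub, (step_frozen hv.le k ((hab.dvd hvv).mul_left μ)).eq]
    simpa using hn
  · rw [← mul_sub, ← mul_sub, hk]; decide

/-- The digits of `1`, `1 + 7 u`, `1 + 7 w` modulo `343` lie in two consecutive classes. -/
def windowTest (u w l : ℕ) : Bool :=
  (List.range 7).any fun d =>
    [1, 1 + 7 * u, 1 + 7 * w].all fun x => Nat.blt ((l * x / 49 + (7 - d)) % 7) 2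

theorem exists_windowTest : (List.range 49).all (fun u => (List.range 49).all fun w =>
    Nat.beq (u % 7) 0 || Nat.beq (w % 7) 0 || Nat.beq (u % 7) (w % 7) ||
      (List.range 28).any fun l => !Nat.beq (l % 7) 0 && windowTest u w l) = true := by
  decide +kernel

theorem exists_window_triple {u w : ℤ} (hu : ¬ (7 : ℤ) ∣ u) (hw : ¬ (7 : ℤ) ∣ w)
    (huw : ¬ (7 : ℤ) ∣ u - w) : ∃ μ : ℤ, ¬ (7 : ℤ) ∣ μ ∧
      Window 2 1 [μ * 1, μ * (1 + 7 * u), μ * (1 + 7 * w)] := by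
  have red : ∀ x : ℤ, ∃ n : ℕ, n < 49 ∧ ∃ s, x = n + 49 * s := fun x =>
    ⟨(x % 49).toNat, by omega, x / 49, by omega⟩
  obtain ⟨n, hn, s, rfl⟩ := red u
  obtain ⟨p, hp, t, rfl⟩ := red w
  have h := exists_windowTest
  simp only [List.all_eq_true, List.mem_range] at h
  have h := h n hn p hp
  simp only [Bool.or_eq_true, Nat.beq_eq, List.any_eq_true, Bool.and_eq_true, Bool.not_eq_true',
    List.mem_range, windowTest, List.all_eq_true] at h
  rcases h with ((h | h) | h) | ⟨l, -, hl, d, hd, hx⟩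
  · exact absurd (show (7 : ℤ) ∣ n + 49 * s by omega) hu
  · exact absurd (show (7 : ℤ) ∣ p + 49 * t by omega) hw
  · exact absurd (show (7 : ℤ) ∣ n + 49 * s - (p + 49 * t) by omega) huw
  have hl' : l % 7 ≠ 0 := fun h => by rw [h] at hl; simp at hl
  have key : ∀ (x : ℕ) (y : ℤ), (y : ℤ) ≡ x [ZMOD 343] → x ∈ [1, 1 + 7 * n, 1 + 7 * p] →
      ∃ s : ℕ, s ≤ 1 ∧ dig 2 (l * y) = (d : ZMod 7) + s := by
    intro x y hxy hmem
    have h1 := hx x hmem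
    rw [Nat.blt_eq] at h1
    refine ⟨(l * x / 49 + (7 - d)) % 7, by omega, ?_⟩
    have e : dig 2 (l * y) = ((l * x / 49 : ℕ) : ZMod 7) := by
      rw [show (49 : ℕ) = 7 ^ 2 by norm_num, ← dig_natCast]
      exact dig_congr (by push_cast; exact hxy.mul_left l)
    rw [e]
    have : ((l * x / 49 : ℕ) : ZMod 7) = ((d + (l * x / 49 + (7 - d)) % 7 : ℕ) : ZMod 7) := by
      rw [ZMod.natCast_eq_natCast_iff]
      unfold Nat.ModEq
      omega
    rw [this]; push_cast; rfl
  refine ⟨l, by omega, d, ?_⟩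
  simp only [List.mem_cons, List.not_mem_nil, or_false, forall_eq_or_imp, forall_eq]
  exact ⟨key 1 1 (by norm_num) (by simp),
    key (1 + 7 * n) _ (Int.modEq_iff_dvd.2 ⟨-s, by push_cast; ring⟩) (by simp),
    key (1 + 7 * p) _ (Int.modEq_iff_dvd.2 ⟨-t, by push_cast; ring⟩) (by simp)⟩

/-- It suffices to give the class of three adjacent digits. -/
theorem Solvable.three_one_one_of_window (hm : 0 < m) {A L : List ℤ} {a y z μ : ℤ}
    (ha : ¬ (7 : ℤ) ∣ a) (hy : ¬ (7 : ℤ) ∣ y) (hz : ¬ (7 : ℤ) ∣ z)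
    (hA : ∀ s ∈ A, (s : ZMod 7) = a) (hay : Sep a y) (haz : Sep a z) (hyz : Sep y z)
    (hμ : ¬ (7 : ℤ) ∣ μ) (hW : Window m 1 (A.map (μ * ·)))
    (hL : ∀ s ∈ L, s ∈ A ∨ s = y ∨ s = z) : Solvable m L := by
  have u : ∀ {x : ℤ}, ¬ (7 : ℤ) ∣ x → ((μ * x : ℤ) : ZMod 7) ≠ 0 := fun hx =>
    zmod_seven_ne_zero.2 (not_seven_dvd_mul hμ hx)
  refine Solvable.smul hμ (Solvable.of_arc_one_one hm (u ha) (u hy) (u hz)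
    (hay.mul hμ).cast.1 (hay.mul hμ).cast.2 (haz.mul hμ).cast.1 (haz.mul hμ).cast.2
    (hyz.mul hμ).cast.1 (hyz.mul hμ).cast.2 hW (fun s hs => ?_)
    ((Arc.singleton (μ * y)).mono (by norm_num)) (by simp) rfl fun s hs => Or.inr ?_)
  · obtain ⟨s, hs', rfl⟩ := List.mem_map.1 hs
    push_cast
    rw [hA s hs']
  · obtain ⟨s, hs', rfl⟩ := List.mem_map.1 hs
    simp only [List.mem_cons, List.not_mem_nil, or_false]
    refine (hL s hs').imp (fun h => List.mem_map_of_mem h) (Or.imp (congrArg _) (congrArg _))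

/-- Modulo `343`, three units with differences of valuation `1` can be given adjacent digits. -/
theorem exists_window_of_level_one {x y z : ℤ} (hx : ¬ (7 : ℤ) ∣ x) (hxy : Lev 1 (x - y))
    (hxz : Lev 1 (x - z)) (hyz : Lev 1 (y - z)) :
    ∃ μ : ℤ, ¬ (7 : ℤ) ∣ μ ∧ Window 2 1 ([x, y, z].map (μ * ·)) := by
  obtain ⟨ν, hν, hνx⟩ := exists_inverse 2 hx
  obtain ⟨g, hg, hgy⟩ := hxy
  obtain ⟨h, hh, hhz⟩ := hxz
  obtain ⟨f, hf, hfz⟩ := hyz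
  have key : ∀ {w e : ℤ}, x - w = 7 ^ 1 * e → ν * w ≡ 1 + 7 * (ν * -e) [ZMOD 7 ^ (2 + 1)] := by
    intro w e he
    have := hνx.add_right (7 * (ν * -e))
    convert this using 1
    linear_combination (-ν) * he
  obtain ⟨μ, hμ, t, ht⟩ := exists_window_triple (u := ν * -g) (w := ν * -h)
    (not_seven_dvd_mul hν (by rwa [Int.dvd_neg])) (not_seven_dvd_mul hν (by rwa [Int.dvd_neg])) (by
      rw [show ν * -g - ν * -h = ν * f by
        have : 7 * (ν * -g - ν * -h) = 7 * (ν * f) := by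
          linear_combination ν * (hfz - hhz + hgy)
        linarith]
      exact not_seven_dvd_mul hν hf)
  simp only [List.mem_cons, List.not_mem_nil, or_false, forall_eq_or_imp, forall_eq] at ht
  refine ⟨μ * ν, not_seven_dvd_mul hμ hν, t, ?_⟩
  simp only [List.map_cons, List.map_nil, List.mem_cons, List.not_mem_nil, or_false,
    forall_eq_or_imp, forall_eq, mul_assoc]
  rw [dig_congr (hνx.mul_left μ), dig_congr ((key hgy).mul_left μ),
    dig_congr ((key hhz).mul_left μ)]
  exact ht

theorem exists_good_of_special_pair : ∀ b c, b = 2 ∨ b = 47 → c = 24 ∨ c = 25 →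
    ∀ p < 49, ∀ q < 49, ∃ i < 35 - 7 * 3, good ((p + i * b) % 49) = true ∧
      good ((q + i * c) % 49) = true := by
  rintro b c (rfl | rfl) (rfl | rfl) <;> decide +kernel

/-- Three residues of one class and two further ones of different classes. -/
theorem Solvable.three_one_one (hm : 2 ≤ m) {a b c y z : ℤ} (ha : ¬ (7 : ℤ) ∣ a)
    (hy : ¬ (7 : ℤ) ∣ y) (hz : ¬ (7 : ℤ) ∣ z) (hb : (7 : ℤ) ∣ b - a) (hc : (7 : ℤ) ∣ c - a)
    (h1 : ¬ (7 : ℤ) ^ (m + 1) ∣ a - b) (h2 : ¬ (7 : ℤ) ^ (m + 1) ∣ a - c)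
    (h3 : ¬ (7 : ℤ) ^ (m + 1) ∣ b - c) (hay : Sep a y) (haz : Sep a z) (hyz : Sep y z) :
    Solvable m [a, b, c, y, z] := by
  have hm0 : 0 < m := by omega
  obtain ⟨p, q, s, v, v', hvv, hv', hpq, hps, hqs, hmem⟩ := exists_isosceles h1 h2 h3
  have hcl : ∀ t ∈ [p, q, s], (t : ZMod 7) = a := by
    intro t ht
    have ht := (hmem t).1 ht
    simp only [List.mem_cons, List.not_mem_nil, or_false] at ht
    rcases ht with rfl | rfl | rfl
    · rfl
    · exact cast_eq_of_dvd hb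
    · exact cast_eq_of_dvd hc
  have hL : ∀ t ∈ [a, b, c, y, z], t ∈ [p, q, s] ∨ t = y ∨ t = z := by
    intro t ht
    by_cases h : t ∈ [p, q, s]
    · exact Or.inl h
    · rw [hmem] at h
      simp only [List.mem_cons, List.not_mem_nil, or_false, not_or] at ht h ⊢
      tauto
  have hp : ¬ (7 : ℤ) ∣ p :=
    zmod_seven_ne_zero.1 (by rw [hcl p (by simp)]; exact zmod_seven_ne_zero.2 ha)
  have fin : ∀ {μ : ℤ}, ¬ (7 : ℤ) ∣ μ → Window m 1 ([p, q, s].map (μ * ·)) →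
      Solvable m [a, b, c, y, z] := fun hμ hW =>
    Solvable.three_one_one_of_window hm0 ha hy hz hcl hay haz hyz hμ hW hL
  rcases hvv.lt_or_eq with hvv | rfl
  · obtain ⟨μ, hμ, hA⟩ := gather_one_of_isosceles hvv hv' hpq hqs
    exact fin hμ (Arc.window (w := 1) (by exact_mod_cast hA))
  by_cases hvm : v + 2 ≤ m
  · obtain ⟨μ, hμ, hA⟩ := gather_one_of_legs hvm hpq.sub_comm hps.sub_comm
    exact fin hμ (Arc.window (w := 1) (by exact_mod_cast hA))
  have hv1 : v ≠ 0 := by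
    rintro rfl
    exact hpq.not_dvd
      (by simpa using dvd_of_cast_eq ((hcl q (by simp)).trans (hcl p (by simp)).symm))
  by_cases hv2 : v = 1
  · subst hv2
    obtain rfl : m = 2 := by omega
    obtain ⟨μ, hμ, hW⟩ := exists_window_of_level_one hp hpq hps hqs
    exact fin hμ hW
  -- now the three residues agree modulo `49`
  obtain ⟨n, rfl⟩ : ∃ n, m = n + 1 := ⟨m - 1, by omega⟩
  have hd : ∀ x ∈ [p, q, s], ∀ x' ∈ [p, q, s], (7 : ℤ) ^ 2 ∣ x - x' :=
    dvd_sub_of_three (hpq.dvd (by omega)) (hps.dvd (by omega))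
  obtain ⟨μ, hμ, hA, -⟩ := exists_triple_arc (e := 1) (j := 0) (m := n + 1) (hpq.not_pow_dvd hv')
    (hps.not_pow_dvd hv') (hqs.not_pow_dvd hv') hm0 ⟨1, by norm_num, by norm_num⟩
    (K := ∅) (by simp)
  obtain ⟨ρ, hρ⟩ := exists_ratio_mul hp y
  obtain ⟨σ, hσ⟩ := exists_ratio_mul hp z
  have hpa := hcl p (by simp)
  have hpy := hay.congr hpa rfl
  have hpz := haz.congr hpa rfl
  have nρ := ratio_val_ne hp hy hpy hρ
  have nσ := ratio_val_ne hp hz hpz hσ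
  refine Solvable.smul hμ (Solvable.of_arc_ratio (w := 3) (by omega) (not_seven_dvd_mul hμ hp) hA ?_
    (ratio_mul (μ := μ) hρ) (ratio_mul (μ := μ) hσ) ?_ ?_)
  · intro x hx
    obtain ⟨x, hx', rfl⟩ := List.mem_map.1 (show x ∈ [p, q, s].map (μ * ·) from hx)
    have := dvd_mul_sub (μ := μ) (hd x hx' p (by simp))
    simpa using this
  · by_cases hsp : Special ρ.val ∧ Special σ.val
    swap
    · exact exists_good_of_not_special nρ nσ hsp
    have hne : ρ.val % 7 ≠ σ.val % 7 ∧ ρ.val % 7 ≠ 7 - σ.val % 7 := by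
      have hp0 := zmod_seven_ne_zero.2 hp
      rw [ratio_val_mod hp hρ, ratio_val_mod hp hσ]
      constructor
      · intro h
        exact hyz.cast.1 ((div_left_inj' hp0).1 (ZMod.val_injective 7 h)).symm
      · intro h
        have neg : ∀ s t : ZMod 7, s.val = 7 - t.val → t = -s := by decide
        have := neg _ _ h
        rw [← neg_div] at this
        exact hyz.cast.2 ((div_left_inj' hp0).1 this)
    obtain ⟨hs1, hs2⟩ := hsp
    have : (ρ.val = 2 ∨ ρ.val = 47) ∧ (σ.val = 24 ∨ σ.val = 25) ∨
        (σ.val = 2 ∨ σ.val = 47) ∧ (ρ.val = 24 ∨ ρ.val = 25) := by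
      unfold Special at hs1 hs2
      omega
    rcases this with ⟨h, h'⟩ | ⟨h, h'⟩
    · exact exists_good_of_special_pair _ _ h h'
    · intro x hx x' hx'
      obtain ⟨i, hi, g1, g2⟩ := exists_good_of_special_pair _ _ h h' x' hx' x hx
      exact ⟨i, hi, g2, g1⟩
  · intro x hx
    obtain ⟨x, hx', rfl⟩ := List.mem_map.1 hx
    exact Or.inr ((hL x hx').imp (fun h => List.mem_map.2 ⟨x, h, rfl⟩)
      (Or.imp (congrArg _) (congrArg _)))

/-! ### Classes of two, two and one -/

/-- Whatever their positions modulo `49`, two pairs at distances `7 f` and `7 g` and a single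
number, moving at speeds `1`, `ρ` and `σ`, are at some moment all in the middle. -/
def PairOk (f g ρ σ : ℕ) : Prop :=
  ∀ q < 49, ∀ s < 49, ∃ k, good (k % 49) = true ∧ good ((k + 7 * f) % 49) = true ∧
    good ((q + k * ρ) % 49) = true ∧ good ((q + k * ρ + 7 * g) % 49) = true ∧
    good ((s + k * σ) % 49) = true

/-- The shifts which are good for the first pair. -/
def pairBase (f : ℕ) : List ℕ :=
  (List.range 49).filter fun k => good k && good ((k + 7 * f) % 49)

/-- The shifts good for the first pair and bad for the second one, which starts at position `q`. -/
def pairBad (f g ρ q : ℕ) : List ℕ :=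
  (pairBase f).filter fun k => !(good ((q + k * ρ) % 49) && good ((q + k * ρ + 7 * g) % 49))

/-- The shifts good for the first pair and bad for the single number, which starts at `s`. -/
def singleBad (f σ s : ℕ) : List ℕ := (pairBase f).filter fun k => !good ((s + k * σ) % 49)

/-- The maximal length of the lists `h i`, `i < n`. -/
def maxLength (h : ℕ → List ℕ) : ℕ → ℕ
  | 0 => 0
  | n + 1 => max (maxLength h n) (h n).length

/-- The first pair has more good shifts than the second pair and the single number can spoil. -/
def countTest (f g ρ σ : ℕ) : Bool :=
  Nat.blt (Nat.add (maxLength (pairBad f g ρ) 49) (maxLength (singleBad f σ) 49))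
    (pairBase f).length

/-- The exhaustive test, with counting first. -/
def searchTest (f g ρ σ : ℕ) : Bool :=
  (List.range 49).all fun q =>
    Nat.blt (Nat.add (pairBad f g ρ q).length (maxLength (singleBad f σ) 49)) (pairBase f).length ||
    (List.range 49).all fun s =>
      Nat.blt (Nat.add (pairBad f g ρ q).length (singleBad f σ s).length) (pairBase f).length ||
      (pairBase f).any fun k =>
        good ((q + k * ρ) % 49) && good ((q + k * ρ + 7 * g) % 49) && good ((s + k * σ) % 49)

/-- Boolean form of `Sep`. -/
def sepTest (x y : ℕ) : Bool := !Nat.beq (x % 7) (y % 7) && !Nat.beq ((x + y) % 7) 0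

theorem pairTest : (List.range 49).all (fun ρ => Nat.beq (ρ % 7) 0 || !sepTest 1 ρ ||
    (List.range 49).all fun σ => Nat.beq (σ % 7) 0 || !sepTest 1 σ || !sepTest ρ σ ||
      (countTest 3 1 ρ σ || searchTest 1 2 ρ σ)) = true := by
  decide +kernel

theorem length_le_maxLength (h : ℕ → List ℕ) {n i : ℕ} (hi : i < n) :
    (h i).length ≤ maxLength h n := by
  induction n with
  | zero => omega
  | succ n ih =>
    rcases Nat.lt_succ_iff_lt_or_eq.1 hi with hi | rfl
    · exact (ih hi).trans (le_max_left _ _)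
    · exact le_max_right _ _

theorem pairOk_of_mem {f g ρ σ q s k : ℕ} (hk : k ∈ pairBase f)
    (h1 : good ((q + k * ρ) % 49) = true) (h2 : good ((q + k * ρ + 7 * g) % 49) = true)
    (h3 : good ((s + k * σ) % 49) = true) : ∃ k, good (k % 49) = true ∧
    good ((k + 7 * f) % 49) = true ∧ good ((q + k * ρ) % 49) = true ∧
    good ((q + k * ρ + 7 * g) % 49) = true ∧ good ((s + k * σ) % 49) = true := by
  simp only [pairBase, List.mem_filter, List.mem_range, Bool.and_eq_true] at hk
  exact ⟨k, by rw [Nat.mod_eq_of_lt hk.1]; exact hk.2.1, hk.2.2, h1, h2, h3⟩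

theorem exists_of_length_lt {f g ρ σ q s : ℕ}
    (h : (pairBad f g ρ q).length + (singleBad f σ s).length < (pairBase f).length) :
    ∃ k, good (k % 49) = true ∧ good ((k + 7 * f) % 49) = true ∧ good ((q + k * ρ) % 49) = true ∧
      good ((q + k * ρ + 7 * g) % 49) = true ∧ good ((s + k * σ) % 49) = true := by
  by_contra hn
  have hsub : pairBase f ⊆ pairBad f g ρ q ++ singleBad f σ s := by
    intro k hk
    rw [List.mem_append, pairBad, singleBad, List.mem_filter, List.mem_filter]
    by_contra hc
    simp only [hk, true_and, not_or, Bool.not_eq_true, Bool.not_eq_false', Bool.and_eq_true] at hc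
    exact hn (pairOk_of_mem hk hc.1.1 hc.1.2 hc.2)
  have hnd : (pairBase f).Nodup := List.nodup_range.filter _
  have := (List.subperm_of_subset hnd hsub).length_le
  rw [List.length_append] at this
  omega

theorem pairOk_of_countTest {f g ρ σ : ℕ} (h : countTest f g ρ σ = true) : PairOk f g ρ σ := by
  intro q hq s hs
  have h1 := length_le_maxLength (pairBad f g ρ) hq
  have h2 := length_le_maxLength (singleBad f σ) hs
  rw [countTest, Nat.blt_eq, Nat.add_eq] at h
  exact exists_of_length_lt (by omega)

theorem pairOk_of_searchTest {f g ρ σ : ℕ} (h : searchTest f g ρ σ = true) : PairOk f g ρ σ := by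
  intro q hq s hs
  simp only [searchTest, List.all_eq_true, List.mem_range, List.any_eq_true, Bool.and_eq_true,
    Bool.or_eq_true, Nat.blt_eq, Nat.add_eq] at h
  have h2 := length_le_maxLength (singleBad f σ) hs
  rcases h q hq with h | h
  · exact exists_of_length_lt (by omega)
  rcases h s hs with h | ⟨k, hk, ⟨h1, h2⟩, h3⟩
  · exact exists_of_length_lt h
  · exact pairOk_of_mem hk h1 h2 h3

/-- The distances of two exact pairs, one twice as far apart as the other, scale to `(3, 1)` up to
sign as well as to `(1, 2)`; one of the two suits. -/
theorem pairOk_or_pairOk {ρ σ : ℕ} (hρ : ρ < 49) (hσ : σ < 49)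
    (h1 : ρ % 7 ≠ 0 ∧ ρ % 7 ≠ 1 ∧ ρ % 7 ≠ 6) (h2 : σ % 7 ≠ 0 ∧ σ % 7 ≠ 1 ∧ σ % 7 ≠ 6)
    (h3 : ρ % 7 ≠ σ % 7) (h4 : (ρ + σ) % 7 ≠ 0) : PairOk 3 1 ρ σ ∨ PairOk 1 2 ρ σ := by
  have h := pairTest
  simp only [List.all_eq_true, List.mem_range, Bool.or_eq_true, sepTest, Bool.not_eq_true',
    Bool.and_eq_false_iff, Bool.not_eq_false', Nat.beq_eq] at h
  have := (h ρ hρ).resolve_left (by omega) σ hσ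
  rcases this with ((this | this) | this) | this
  · omega
  · omega
  · omega
  · exact this.imp pairOk_of_countTest pairOk_of_searchTest

theorem pos_add_exact {n : ℕ} (x : ℤ) {d : ℤ} (hd : (7 : ℤ) ^ (n + 1) ∣ d) {f : ℕ}
    (hf : dig (n + 1) d = f) : pos n (x + d) = pos n x + 7 * f := by
  obtain ⟨e, rfl⟩ := hd
  rw [dig_mul_pow] at hf
  have h1 : pos n (x + 7 ^ (n + 1) * e) = pos n x + ((7 * e : ℤ) : ZMod 49) := by
    unfold pos
    rw [pow_succ, mul_assoc, Int.add_mul_ediv_left _ _ (by positivity), Int.cast_add]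
  have h2 : ((7 * e : ℤ) : ZMod 49) = ((7 * f : ℤ) : ZMod 49) := by
    rw [zmod_fortynine_eq, ← mul_sub, show (49 : ℤ) = 7 * 7 by norm_num,
      mul_dvd_mul_iff_left (by norm_num), ← zmod_seven_eq_zero]
    push_cast
    rw [hf, sub_self]
  rw [h1, h2]; push_cast; rfl

/-- `PairOk` for the relative speeds `ρ` and `σ` solves two exact pairs and a single number. -/
theorem Solvable.of_pairOk {n f g : ℕ} (hn : 0 < n) {a a' b b' c : ℤ} {ρ σ : ZMod 49}
    (ha : ¬ (7 : ℤ) ∣ a) (haa : (7 : ℤ) ^ (n + 1) ∣ a' - a) (hbb : (7 : ℤ) ^ (n + 1) ∣ b' - b)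
    (hf : dig (n + 1) (a' - a) = f) (hg : dig (n + 1) (b' - b) = g)
    (hb : (b : ZMod 49) = ρ * a) (hc : (c : ZMod 49) = σ * a) (h : PairOk f g ρ.val σ.val) :
    Solvable (n + 1) [a, a', b, b', c] := by
  obtain ⟨α, hα, -⟩ := exists_ratio ha
  obtain ⟨k, h1, h2, h3, h4, h5⟩ := h (pos n b - pos n a * ρ).val (ZMod.val_lt _)
    (pos n c - pos n a * σ).val (ZMod.val_lt _)
  have h49 : (49 : ℤ) ∣ 7 ^ (n + 1) := by
    have : (7 : ℤ) ^ 2 ∣ 7 ^ (n + 1) := pow_dvd_pow 7 (by omega)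
    simpa using this
  have ca : (a' : ZMod 49) = a := zmod_fortynine_eq.2 (h49.trans haa)
  have cb : (b' : ZMod 49) = b := zmod_fortynine_eq.2 (h49.trans hbb)
  have pa : pos n a' = pos n a + 7 * f := by
    have := pos_add_exact a haa hf
    rwa [add_sub_cancel] at this
  have pb : pos n b' = pos n b + 7 * g := by
    have := pos_add_exact b hbb hg
    rwa [add_sub_cancel] at this
  have val : ∀ p : ℕ, ((p : ℕ) : ZMod 49).val = p % 49 := fun p => ZMod.val_natCast 49 p
  have ea : pos n a + (((k : ℕ) : ZMod 49) - pos n a) * α * a = (k : ℕ) := by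
    linear_combination (((k : ℕ) : ZMod 49) - pos n a) * hα
  have eb : pos n b + (((k : ℕ) : ZMod 49) - pos n a) * α * b =
      (((pos n b - pos n a * ρ).val + k * ρ.val : ℕ) : ZMod 49) := by
    push_cast
    rw [ZMod.natCast_zmod_val, ZMod.natCast_zmod_val, hb]
    linear_combination (((k : ℕ) : ZMod 49) - pos n a) * ρ * hα
  have ec : pos n c + (((k : ℕ) : ZMod 49) - pos n a) * α * c =
      (((pos n c - pos n a * σ).val + k * σ.val : ℕ) : ZMod 49) := by
    push_cast
    rw [ZMod.natCast_zmod_val, ZMod.natCast_zmod_val, hc]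
    linear_combination (((k : ℕ) : ZMod 49) - pos n a) * σ * hα
  refine Solvable.of_pos_shift hn ((((k : ℕ) : ZMod 49) - pos n a) * α) ?_
  simp only [List.mem_cons, List.not_mem_nil, or_false, forall_eq_or_imp, forall_eq]
  refine ⟨Or.inr ?_, Or.inr ?_, Or.inr ?_, Or.inr ?_, Or.inr ?_⟩
  · rwa [ea, val]
  · rw [pa, ca, add_right_comm, ea]
    have := val (k + 7 * f)
    push_cast at this
    rwa [this]
  · rwa [eb, val]
  · rw [pb, cb, add_right_comm, eb]
    have := val ((pos n b - pos n a * ρ).val + k * ρ.val + 7 * g)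
    push_cast at this ⊢
    rwa [this]
  · rwa [ec, val]

/-- Exact pairs, one of which is twice as far apart as the other. -/
theorem Solvable.two_two_one_double (hm : 2 ≤ m) {a a' b b' c : ℤ} (ha : ¬ (7 : ℤ) ∣ a)
    (hb : ¬ (7 : ℤ) ∣ b) (hc : ¬ (7 : ℤ) ∣ c) (haa : Lev m (a' - a)) (hbb : Lev m (b' - b))
    (hd : dig m (b' - b) = 2 * dig m (a' - a)) (hab : Sep a b) (hac : Sep a c) (hbc : Sep b c) :
    Solvable m [a, a', b, b', c] := by
  obtain ⟨n, rfl⟩ : ∃ n, m = n + 1 := ⟨m - 1, by omega⟩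
  have h7 : (7 : ℤ) ∣ 7 ^ (n + 1) := dvd_pow_self 7 (by omega)
  have ea := haa.dvd le_rfl
  have eb := hbb.dvd le_rfl
  have h49 : (49 : ℤ) ∣ 7 ^ (n + 1) := by
    have : (7 : ℤ) ^ 2 ∣ 7 ^ (n + 1) := pow_dvd_pow 7 (by omega)
    simpa using this
  obtain ⟨ρ, hρ⟩ := exists_ratio_mul ha b
  obtain ⟨σ, hσ⟩ := exists_ratio_mul ha c
  have hne : ρ.val % 7 ≠ σ.val % 7 ∧ (ρ.val + σ.val) % 7 ≠ 0 := by
    have ha0 := zmod_seven_ne_zero.2 ha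
    have e1 := ratio_val_mod ha hρ
    have e2 := ratio_val_mod ha hσ
    rw [Nat.add_mod, e1, e2]
    constructor
    · intro h
      exact hbc.cast.1 ((div_left_inj' ha0).1 (ZMod.val_injective 7 h)).symm
    · intro h
      have neg : ∀ s t : ZMod 7, (s.val + t.val) % 7 = 0 → t = -s := by decide
      have := neg _ _ h
      rw [← neg_div] at this
      exact hbc.cast.2 ((div_left_inj' ha0).1 this)
  rcases pairOk_or_pairOk (ZMod.val_lt ρ) (ZMod.val_lt σ) (ratio_val_ne ha hb hab hρ)
    (ratio_val_ne ha hc hac hσ) hne.1 hne.2 with h | h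
  · obtain ⟨μ, hμ, ht⟩ := exists_scale haa (t := 3) (by decide)
    have ht' : dig (n + 1) (μ * b - μ * b') = 1 := by
      rw [← mul_sub, ← neg_sub, mul_neg, ← neg_mul, dig_exact_mul eb, hd]
      rw [dig_exact_mul ea] at ht
      push_cast
      linear_combination (-2) * ht + (by decide : (-7 : ZMod 7) = 0)
    refine Solvable.smul hμ ((Solvable.of_pairOk (f := 3) (g := 1) (a' := μ * a') (b := μ * b')
      (b' := μ * b)
      (c := μ * c) (by omega) (not_seven_dvd_mul hμ ha) ?_ ?_ ?_ ?_ ?_ (ratio_mul hσ) h).mono ?_)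
    · exact dvd_mul_sub ea
    · exact dvd_mul_sub ((dvd_sub_comm).1 eb)
    · rw [← mul_sub, ht]; rfl
    · rw [ht']; rfl
    · rw [← ratio_mul hρ, zmod_fortynine_eq]
      exact dvd_mul_sub (h49.trans eb)
    · intro x hx
      simp only [List.map_cons, List.map_nil, List.mem_cons, List.not_mem_nil, or_false] at hx ⊢
      tauto
  · obtain ⟨μ, hμ, ht⟩ := exists_scale haa (t := 1) (by decide)
    refine Solvable.smul hμ (Solvable.of_pairOk (f := 1) (g := 2) (by omega)
      (not_seven_dvd_mul hμ ha) (dvd_mul_sub ea) (dvd_mul_sub eb) ?_ ?_ (ratio_mul hρ)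
      (ratio_mul hσ) h)
    · rw [← mul_sub, ht]; rfl
    · rw [← mul_sub, dig_exact_mul eb, hd]
      rw [dig_exact_mul ea] at ht
      push_cast
      linear_combination 2 * ht

/-- Two pairs and a single residue. -/
theorem Solvable.two_two_one (hm : 2 ≤ m) {a a' b b' c : ℤ} (ha : ¬ (7 : ℤ) ∣ a)
    (hb : ¬ (7 : ℤ) ∣ b) (hc : ¬ (7 : ℤ) ∣ c) (haa : (7 : ℤ) ∣ a' - a) (hbb : (7 : ℤ) ∣ b' - b)
    (hna : ¬ (7 : ℤ) ^ (m + 1) ∣ a' - a) (hnb : ¬ (7 : ℤ) ^ (m + 1) ∣ b' - b)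
    (hab : Sep a b) (hac : Sep a c) (hbc : Sep b c) : Solvable m [a, a', b, b', c] := by
  have hm0 : 0 < m := by omega
  obtain ⟨v, hv, hva⟩ := exists_lev hna
  obtain ⟨w, hw, hwb⟩ := exists_lev hnb
  have ca : (a' : ZMod 7) = a := cast_eq_of_dvd haa
  have cb : (b' : ZMod 7) = b := cast_eq_of_dvd hbb
  have near : ∀ {μ : ℤ}, ¬ (7 : ℤ) ∣ μ → Near m 1 (μ * (a' - a)) → Near m 1 (μ * (b' - b)) →
      Solvable m [a, a', b, b', c] := by
    intro μ hμ h1 h2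
    have u : ∀ {x : ℤ}, ¬ (7 : ℤ) ∣ x → ((μ * x : ℤ) : ZMod 7) ≠ 0 := fun hx =>
      zmod_seven_ne_zero.2 (not_seven_dvd_mul hμ hx)
    rw [mul_sub] at h1 h2
    refine Solvable.smul hμ (Solvable.of_arc_one_one hm0 (u ha) (u hb) (u hc)
      (hab.mul hμ).cast.1 (hab.mul hμ).cast.2 (hac.mul hμ).cast.1 (hac.mul hμ).cast.2
      (hbc.mul hμ).cast.1 (hbc.mul hμ).cast.2 h1.window ?_ (h2.arc (by norm_num)) ?_ rfl ?_)
    · simp only [List.mem_cons, List.not_mem_nil, or_false, forall_eq_or_imp, forall_eq]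
      exact ⟨trivial, by push_cast; rw [ca]⟩
    · simp only [List.mem_cons, List.not_mem_nil, or_false, forall_eq_or_imp, forall_eq]
      exact ⟨by push_cast; rw [cb], trivial⟩
    · simp
  by_cases hex : v = m ∧ w = m
  swap
  · obtain ⟨μ, hμ, h1, h2⟩ := exists_near_one_pair hv hw hva hwb hex
    exact near hμ h1 h2
  obtain ⟨rfl, rfl⟩ := hex
  have hfa := dig_exact_ne_zero hva
  have hfb := dig_exact_ne_zero hwb
  have ea := hva.dvd le_rfl
  have eb := hwb.dvd le_rfl
  have neg : ∀ {x y : ℤ}, (7 : ℤ) ^ w ∣ x - y → dig w (y - x) = -dig w (x - y) := by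
    intro x y h
    have := dig_exact_mul h (-1)
    rw [neg_one_mul, neg_sub] at this
    rw [this]; push_cast; ring
  have key : ∀ f g : ZMod 7, f ≠ 0 → g ≠ 0 → (g = f ∨ g = -f) ∨ g = 2 * f ∨ -g = 2 * f ∨
      f = 2 * g ∨ -f = 2 * g := by decide
  have hb' : ¬ (7 : ℤ) ∣ b' := zmod_seven_ne_zero.1 (by rw [cb]; exact zmod_seven_ne_zero.2 hb)
  have ha' : ¬ (7 : ℤ) ∣ a' := zmod_seven_ne_zero.1 (by rw [ca]; exact zmod_seven_ne_zero.2 ha)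
  rcases key _ _ hfa hfb with h | h | h | h | h
  · obtain ⟨μ, hμ, ht⟩ := exists_scale hva (t := 1) (by decide)
    refine near hμ (Near.of_exact (w := 1) (Dvd.dvd.mul_left ea μ) (by rw [ht]; decide))
      (Near.of_exact (w := 1) (Dvd.dvd.mul_left eb μ) ?_)
    rw [dig_exact_mul ea] at ht
    rw [dig_exact_mul eb]
    rcases h with h | h <;> rw [h]
    · rw [ht]; decide
    · rw [mul_neg, ht]; decide
  · exact Solvable.two_two_one_double hm ha hb hc hva hwb h hab hac hbc
  · refine (Solvable.two_two_one_double hm ha hb' hc hva hwb.sub_comm ?_ (hab.congr rfl cb) hac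
      (hbc.congr cb rfl)).mono ?_
    · rw [neg eb]; exact h
    · intro x hx
      simp only [List.mem_cons, List.not_mem_nil, or_false] at hx ⊢
      tauto
  · refine (Solvable.two_two_one_double hm hb ha hc hwb hva h hab.symm hbc hac).mono ?_
    intro x hx
    simp only [List.mem_cons, List.not_mem_nil, or_false] at hx ⊢
    tauto
  · refine (Solvable.two_two_one_double hm hb ha' hc hwb hva.sub_comm ?_ (hab.symm.congr rfl ca) hbc
      (hac.congr ca rfl)).mono ?_
    · rw [neg ea]; exact h
    · intro x hx
      simp only [List.mem_cons, List.not_mem_nil, or_false] at hx ⊢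
      tauto

/-! ### Five units -/

/-- Five distinct residues of the classes `1`, `2`, `3`: the sizes of the classes are
`2, 2, 1` or `3, 1, 1` or `3, 2` or `4, 1` or `5`. -/
theorem Solvable.five_canonical (hm : 2 ≤ m) {x y z s t : ℤ}
    (hl : ∀ p ∈ [x, y, z, s, t], Canonical p) (hP : Distinct m [x, y, z, s, t]) :
    Solvable m [x, y, z, s, t] := by
  have hm0 : 0 < m := by omega
  obtain ⟨a, b, c, d, e, hp, h⟩ := pattern_five (fun p : ℤ => (p : ZMod 7)) x y z s t
  have hl' : ∀ p ∈ [a, b, c, d, e], Canonical p := fun p hq => hl p (hp.mem_iff.1 hq)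
  have hP' := hP.perm hp
  refine Solvable.mono (l' := [a, b, c, d, e]) (fun p hq => hp.mem_iff.2 hq) ?_
  have ca := hl' a (by simp)
  have cb := hl' b (by simp)
  have cc := hl' c (by simp)
  have cd := hl' d (by simp)
  have ce := hl' e (by simp)
  have hD := hP'
  simp only [Distinct, List.pairwise_cons, List.mem_cons, List.not_mem_nil, or_false,
    forall_eq_or_imp, forall_eq, IsEmpty.forall_iff, implies_true, List.Pairwise.nil, and_true]
    at hP'
  obtain ⟨⟨ab, ac, ad, ae⟩, ⟨bc, bd, be⟩, ⟨cd', ce'⟩, de⟩ := hP'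
  have sw : ∀ {u w : ℤ}, ¬ (7 : ℤ) ^ (m + 1) ∣ u - w → ¬ (7 : ℤ) ^ (m + 1) ∣ w - u := fun h h' =>
    h ((dvd_sub_comm).1 h')
  rcases h with ⟨h1, h2, h3, h4, h5, h6, -⟩ | ⟨-, h1, h2, h3, h4, h5, h6⟩ | ⟨h1, h2, h3, h4, h5⟩ |
    ⟨h1, h2, h3, h4, h5⟩ | ⟨h1, h2, h3, h4⟩ | ⟨h1, h2, h3, h4⟩ | ⟨h1, h2, h3, h4⟩
  · exact absurd ⟨ca, cb, cc, cd, h1, h2, h3, h4, h5, h6⟩ (three_canonical_classes _ _ _ _)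
  · exact absurd ⟨ca, cc, cd, ce, h1, h2, h3, h4, h5, h6⟩ (three_canonical_classes _ _ _ _)
  · exact Solvable.two_two_one hm ca.not_dvd cc.not_dvd ce.not_dvd (dvd_of_cast_eq h1)
      (dvd_of_cast_eq h2) (sw ab) (sw cd') (Sep.of_canonical ca cc h3) (Sep.of_canonical ca ce h4)
      (Sep.of_canonical cc ce h5)
  · exact Solvable.three_one_one hm ca.not_dvd cd.not_dvd ce.not_dvd (dvd_of_cast_eq h1)
      (dvd_of_cast_eq h2) ab ac bc (Sep.of_canonical ca cd h3) (Sep.of_canonical ca ce h4)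
      (Sep.of_canonical cd ce h5)
  · exact Solvable.three_two hm ca.not_dvd cd.not_dvd (dvd_of_cast_eq h1) (dvd_of_cast_eq h2)
      (dvd_of_cast_eq h4) ab ac bc (sw de) (Sep.of_canonical ca cd h3)
  · refine Solvable.four_one hm ca.ne_zero ?_ ?_ ce.not_dvd (Sep.of_canonical ca ce h4)
    · simp only [List.mem_cons, List.not_mem_nil, or_false, forall_eq_or_imp, forall_eq, true_and]
      exact ⟨h1.symm, h2.symm, h3.symm⟩
    · exact hD.sublist (List.sublist_append_left [a, b, c, d] [e])
  · refine Solvable.of_gather_four hm0 ca.ne_zero ?_ (gather_five hm0 hD)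
    simp only [List.mem_cons, List.not_mem_nil, or_false, forall_eq_or_imp, forall_eq, true_and]
    exact ⟨h1.symm, h2.symm, h3.symm, h4.symm⟩

/-- Five units. For `m = 1` this fails, which is the reason for the modulus `98`. -/
theorem Solvable.five_units (hm : 2 ≤ m) {l : List ℤ} (hl : l.length ≤ 5)
    (hu : ∀ x ∈ l, ¬ (7 : ℤ) ∣ x) : Solvable m l := by
  refine Solvable.of_canonical (E := []) (by omega) le_rfl hl hu fun l' hl' hc hP => ?_
  match l', hl' with
  | [x, y, z, s, t], _ => exact Solvable.five_canonical hm hc hP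

/-! ### Five units and a multiple of `7` modulo `98` -/

/-- `p` lies in the middle `[14, 84]` of the residues modulo `98`. -/
def mid (p : ℕ) : Bool := Nat.ble 14 p && Nat.ble p 84

/-- An enumeration of the residues modulo `98` in which the multiples of `7` come last. -/
def enumMul (i : ℕ) : ℕ := 7 * (i % 14) + (i / 14 + 1) % 7

/-- The multipliers modulo `98` that bring `x` to the middle. -/
def midMask (x : ℕ) : ℕ := maskOf (fun i => mid (enumMul i * x % 98)) 98

/-- Any `n` masks in `M` share a bit with `u`. If they do not share the highest bit of `u`, one of
them omits it, and it suffices to treat the others with `u` restricted to that one. -/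
def noCover : ℕ → List ℕ → ℕ → Bool
  | 0, _, u => !Nat.beq u 0
  | n + 1, M, u => !Nat.beq u 0 &&
      M.all fun b => Nat.beq (Nat.land (Nat.shiftRight b (Nat.log2 u)) 1) 1 ||
        noCover n M (Nat.land u b)

theorem noCover_spec {M : List ℕ} : ∀ {n u : ℕ}, noCover n M u = true → ∀ l : List ℕ,
    l.length ≤ n → (∀ b ∈ l, b ∈ M) → ∃ i, u.testBit i = true ∧ ∀ b ∈ l, b.testBit i = true := by
  intro n
  induction n with
  | zero =>
    intro u h l hl _
    have hu : u ≠ 0 := by rintro rfl; simp [noCover] at h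
    obtain rfl : l = [] := List.eq_nil_of_length_eq_zero (by omega)
    exact ⟨u.log2, Nat.testBit_log2 hu, by simp⟩
  | succ n ih =>
    intro u h l hl hM
    rw [noCover, Bool.and_eq_true, List.all_eq_true] at h
    have hu : u ≠ 0 := by rintro rfl; simp at h
    by_cases hall : ∀ b ∈ l, b.testBit u.log2 = true
    · exact ⟨u.log2, Nat.testBit_log2 hu, hall⟩
    push Not at hall
    obtain ⟨b, hb, hbt⟩ := hall
    have h2 := h.2 b (hM b hb)
    rw [Bool.or_eq_true, Nat.beq_eq] at h2
    obtain ⟨i, hi, hi'⟩ := ih (h2.resolve_left fun h => hbt (by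
      rw [Nat.testBit_eq_decide_div_mod_eq, decide_eq_true_eq, ← Nat.shiftRight_eq_div_pow,
        ← Nat.and_one_is_mod]
      exact h)) (l.erase b)
      (by rw [List.length_erase_of_mem hb]; omega) fun c hc => hM c (List.mem_of_mem_erase hc)
    have hi : (u &&& b).testBit i = true := hi
    rw [Nat.testBit_and, Bool.and_eq_true] at hi
    refine ⟨i, hi.1, fun c hc => ?_⟩
    by_cases hcb : c = b
    · rw [hcb]; exact hi.2
    · exact hi' c ((List.mem_erase_of_ne hcb).2 hc)

/-- The masks of the residues prime to `7`, up to sign. -/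
def unitMasks : List ℕ := ((List.range 49).filter fun k => Nat.blt 0 (k % 7)).map midMask

/-- A common good multiplier for `7`, one of the units `2`, `4`, `6`, and any four units. -/
theorem noCover_seven : ([2, 4, 6].all fun d =>
    noCover 4 unitMasks (Nat.land (midMask 7) (midMask d))) = true := by
  decide +kernel

/-- A common good multiplier for `14`, one of the units `1`, `3`, `5`, and any four units. -/
theorem noCover_fourteen : ([1, 3, 5].all fun d =>
    noCover 4 unitMasks (Nat.land (midMask 14) (midMask d))) = true := by
  decide +kernel

theorem mid_sub {k x : ℕ} (hx : x ≤ 98) : mid (k * (98 - x) % 98) = mid (k * x % 98) := by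
  have h : (k * (98 - x) + k * x) % 98 = 0 := by
    rw [← mul_add, Nat.sub_add_cancel hx, Nat.mul_mod_left]
  unfold mid
  rw [Bool.eq_iff_iff, Bool.and_eq_true, Bool.and_eq_true, Nat.ble_eq, Nat.ble_eq, Nat.ble_eq,
    Nat.ble_eq]
  omega

theorem midMask_sub {x : ℕ} (hx : x ≤ 98) : midMask (98 - x) = midMask x := by
  unfold midMask
  congr 1
  funext i
  exact mid_sub hx

theorem midMask_mem {x : ℕ} (hx : x < 98) (h7 : x % 7 ≠ 0) : midMask x ∈ unitMasks := by
  have main : ∀ x, x < 49 → x % 7 ≠ 0 → midMask x ∈ unitMasks := fun x hx h7 =>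
    List.mem_map_of_mem (List.mem_filter.2 ⟨List.mem_range.2 hx,
      by simpa [Nat.blt_eq, Nat.pos_iff_ne_zero] using h7⟩)
  rcases lt_or_ge x 49 with h | h
  · exact main x h h7
  · rw [← midMask_sub hx.le]
    exact main _ (by omega) (by omega)

/-- The multiplier `u` brings `e` to `± 7` and `d` to `2, 4, 6`, or `e` to `± 14` and `d` to `1, 3,
5`. -/
def scaleTest (e d u : ℕ) : Bool :=
  Nat.blt 0 (u % 7) &&
    (((Nat.beq (u * e % 98) 7 || Nat.beq (u * e % 98) 91) && [2, 4, 6].contains (u * d % 98)) ||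
      ((Nat.beq (u * e % 98) 14 || Nat.beq (u * e % 98) 84) && [1, 3, 5].contains (u * d % 98)))

theorem exists_scaleTest : ((List.range 98).all fun e => (List.range 98).all fun d =>
    Nat.blt 0 (e % 7) || Nat.beq (e % 49) 0 || Nat.beq (d % 7) 0 || Nat.beq ((e + d) % 2) 0 ||
      (List.range 98).any (scaleTest e d)) = true := by
  decide +kernel

theorem exists_scale_pair {e d : ℕ} (he : e < 98) (hd : d < 98) (h1 : e % 7 = 0) (h2 : e % 49 ≠ 0)
    (h3 : d % 7 ≠ 0) (h4 : (e + d) % 2 = 1) : ∃ u, u % 7 ≠ 0 ∧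
      (((u * e % 98 = 7 ∨ u * e % 98 = 91) ∧ u * d % 98 ∈ [2, 4, 6]) ∨
        ((u * e % 98 = 14 ∨ u * e % 98 = 84) ∧ u * d % 98 ∈ [1, 3, 5])) := by
  have h := exists_scaleTest
  simp only [List.all_eq_true, List.mem_range, Bool.or_eq_true, Nat.blt_eq, Nat.beq_eq,
    List.any_eq_true] at h
  obtain ⟨u, -, h⟩ := (h e he d hd).resolve_left (by omega)
  simp only [scaleTest, Bool.and_eq_true, Bool.or_eq_true, Nat.beq_eq, Nat.blt_eq,
    List.contains_iff_mem] at h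
  exact ⟨u, h.1.ne', h.2⟩

/-- Five units and a number divisible by `7` but not by `49`, if it is not of the same parity as
all of the units. -/
theorem exists_mid {e d : ℤ} {l : List ℤ} (he : (7 : ℤ) ∣ e) (he' : ¬ (49 : ℤ) ∣ e)
    (hd : ¬ (7 : ℤ) ∣ d) (hl : l.length ≤ 4) (hu : ∀ x ∈ l, ¬ (7 : ℤ) ∣ x)
    (hpar : ¬ (2 : ℤ) ∣ e + d) :
    ∃ k : ℤ, ∀ x ∈ e :: d :: l, 14 ≤ (k * x) % 98 ∧ (k * x) % 98 ≤ 84 := by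
  have red : ∀ x : ℤ, ∃ n : ℕ, n < 98 ∧ x % 98 = n := fun x => ⟨(x % 98).toNat, by omega, by omega⟩
  obtain ⟨E, hE, hE'⟩ := red e
  obtain ⟨F, hF, hF'⟩ := red d
  obtain ⟨u, hu7, h⟩ := exists_scale_pair hE hF (by omega) (by omega) (by omega)
    (by omega)
  have hmul : ∀ {x : ℤ} {n : ℕ}, x % 98 = n → (u * x) % 98 = (u * n % 98 : ℕ) := by
    intro x n hx
    have h : (u : ℤ) * x ≡ u * n [ZMOD 98] :=
      Int.ModEq.mul_left _ (by rw [← hx]; exact (Int.mod_modEq x 98).symm)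
    rw [h.eq]; push_cast; rfl
  have spec : ∀ {x : ℤ} {n i : ℕ}, (u * x) % 98 = n → (midMask n).testBit i = true →
      14 ≤ ((enumMul i : ℤ) * u * x) % 98 ∧ ((enumMul i : ℤ) * u * x) % 98 ≤ 84 := by
    intro x n i hx hi
    have h2 := (testBit_maskOf hi).2
    rw [mid, Bool.and_eq_true, Nat.ble_eq, Nat.ble_eq] at h2
    have h : (enumMul i : ℤ) * (u * x) ≡ enumMul i * n [ZMOD 98] :=
      Int.ModEq.mul_left _ (by rw [← hx]; exact (Int.mod_modEq _ 98).symm)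
    have h3 : ((enumMul i : ℤ) * n) % 98 = (enumMul i * n % 98 : ℕ) := by push_cast; rfl
    rw [mul_assoc, h.eq, h3]
    exact ⟨by exact_mod_cast h2.1, by exact_mod_cast h2.2⟩
  have key : noCover 4 unitMasks (Nat.land (midMask (u * E % 98)) (midMask (u * F % 98))) = true := by
    have h7 := noCover_seven
    have h14 := noCover_fourteen
    rw [List.all_eq_true] at h7 h14
    rcases h with ⟨h1, h2⟩ | ⟨h1, h2⟩
    · have : midMask (u * E % 98) = midMask 7 := by
        rcases h1 with h1 | h1 <;> rw [h1]
        exact midMask_sub (x := 7) (by norm_num)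
      rw [this]; exact h7 _ h2
    · have : midMask (u * E % 98) = midMask 14 := by
        rcases h1 with h1 | h1 <;> rw [h1]
        exact midMask_sub (x := 14) (by norm_num)
      rw [this]; exact h14 _ h2
  have hmod : ∀ x : ℤ, (u * x) % 98 = (((u * x) % 98).toNat : ℤ) := fun x => by omega
  obtain ⟨i, hi, hi'⟩ := noCover_spec key (l.map fun x => midMask ((u * x : ℤ) % 98).toNat)
    (by simpa)
    (by
      intro b hb
      obtain ⟨x, hx, rfl⟩ := List.mem_map.1 hb
      have := not_seven_dvd_mul (a := (u : ℤ)) (by omega) (hu x hx)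
      exact midMask_mem (by omega) (by omega))
  have hi : (midMask (u * E % 98) &&& midMask (u * F % 98)).testBit i = true := hi
  rw [Nat.testBit_and, Bool.and_eq_true] at hi
  refine ⟨enumMul i * u, ?_⟩
  simp only [List.mem_cons, forall_eq_or_imp]
  exact ⟨spec (hmul hE') hi.1, spec (hmul hF') hi.2,
    fun x hx => spec (hmod x) (hi' _ (List.mem_map_of_mem hx))⟩

/-! ### From lists of units to sets of integers -/

/-- `x` is at least a seventh of the circle away from `0` modulo `7 ^ (m + 1)`. -/
def Mid (m : ℕ) (x : ℤ) : Prop := 7 ^ m ≤ x % 7 ^ (m + 1) ∧ x % 7 ^ (m + 1) ≤ 6 * 7 ^ m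

theorem Mid.congr {x y : ℤ} (h : x ≡ y [ZMOD 7 ^ (m + 1)]) (hy : Mid m y) : Mid m x := by
  unfold Mid
  rw [h.eq]
  exact hy

/-- Multiples of the highest power of `7` need no attention. -/
theorem Lev.mid {x : ℤ} (h : Lev m x) : Mid m x := by
  have hd := dig_exact_ne_zero h
  have h0 : 1 ≤ (dig m x).val := Nat.one_le_iff_ne_zero.2 (by rwa [Ne, ZMod.val_eq_zero])
  have h6 : (dig m x).val ≤ 6 := Nat.lt_succ_iff.1 (ZMod.val_lt _)
  have h0' : (1 : ℤ) ≤ (dig m x).val := by exact_mod_cast h0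
  have h6' : ((dig m x).val : ℤ) ≤ 6 := by exact_mod_cast h6
  have hr := pow_pos_seven m
  unfold Mid
  rw [emod_of_exact (h.dvd le_rfl)]
  constructor <;> nlinarith

theorem dig_pow_mul {k : ℕ} (hk : k ≤ m) (x : ℤ) : dig m (7 ^ k * x) = dig (m - k) x := by
  unfold dig
  rw [← pow_mul_pow_sub hk, Int.mul_ediv_mul_of_pos _ _ (pow_pos_seven k)]

theorem lev_natCast {d : ℕ} (hd : 0 < d) : Lev (padicValNat 7 d) (d : ℤ) := by
  refine Lev.of_dvd ?_ ?_
  · exact_mod_cast pow_padicValNat_dvd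
  · exact_mod_cast pow_succ_padicValNat_not_dvd hd.ne'

/-- A level with at most three elements: each of them forbids two of seven digits, so some step
makes all of them safe, and it does not move the higher levels. -/
theorem exists_mid_step {D : Finset ℕ} (hpos : ∀ d ∈ D, 0 < d) {k : ℕ} (hk : k < m)
    (hc : (level 7 D k).card ≤ 3)
    (h : ∃ μ : ℤ, ¬ (7 : ℤ) ∣ μ ∧ ∀ d ∈ D, k + 1 ≤ padicValNat 7 d → Mid m (μ * d)) :
    ∃ μ : ℤ, ¬ (7 : ℤ) ∣ μ ∧ ∀ d ∈ D, k ≤ padicValNat 7 d → Mid m (μ * d) := by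
  obtain ⟨μ, hμ, h⟩ := h
  obtain ⟨κ, hκ⟩ := exists_step_avoid hk
    ((level 7 D k).toList.map fun d : ℕ => (μ * (d : ℤ), ({0, 6} : Finset (ZMod 7)))) (by
      intro p hp
      obtain ⟨d, hd, rfl⟩ := List.mem_map.1 hp
      obtain ⟨hd, hv⟩ := Finset.mem_filter.1 (Finset.mem_toList.1 hd)
      have := lev_natCast (hpos d hd)
      rw [hv] at this
      exact this.mul hμ) (by
      have h2 : ({0, 6} : Finset (ZMod 7)).card = 2 := by decide
      simp only [List.map_map, Function.comp_def, h2, List.map_const', List.sum_replicate,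
        Finset.length_toList, smul_eq_mul]
      omega)
  refine ⟨step m k κ * μ, not_seven_dvd_mul (step_unit hk κ) hμ, fun d hd hv => ?_⟩
  rw [mul_assoc]
  rcases hv.lt_or_eq with hv | hv
  · exact (h d hd hv).congr
      (step_frozen hk.le κ (((lev_natCast (hpos d hd)).dvd hv).mul_left μ))
  · exact (Safe.of_not_mem (hκ _ (List.mem_map.2
      ⟨d, Finset.mem_toList.2 (Finset.mem_filter.2 ⟨hd, hv.symm⟩), rfl⟩))).bounds

/-- Descent through levels with at most three elements. -/
theorem exists_mid_descend {D : Finset ℕ} (hpos : ∀ d ∈ D, 0 < d) {k : ℕ} (hk : k ≤ m)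
    (hc : ∀ j < k, (level 7 D j).card ≤ 3)
    (h : ∃ μ : ℤ, ¬ (7 : ℤ) ∣ μ ∧ ∀ d ∈ D, k ≤ padicValNat 7 d → Mid m (μ * d)) :
    ∃ μ : ℤ, ¬ (7 : ℤ) ∣ μ ∧ ∀ d ∈ D, Mid m (μ * d) := by
  induction k with
  | zero =>
    obtain ⟨μ, hμ, h⟩ := h
    exact ⟨μ, hμ, fun d hd => h d hd (Nat.zero_le _)⟩
  | succ k ih =>
    exact ih (by omega) (fun j hj => hc j (by omega))
      (exists_mid_step hpos (by omega) (hc k (by omega)) h)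

/-- A level `k < m` with at least four elements. At most two elements lie on other levels, one of
them on the level `m`, which needs no attention. So at most one further element comes in, above the
level `k` only if `k = 0`; five elements on the level `k` force `k = 0` and leave only the level
`m`. -/
theorem exists_mid_of_four_le {D : Finset ℕ} (hpos : ∀ d ∈ D, 0 < d) (hcard : D.card = 6)
    {t z k : ℕ} (ht : t ∈ D) (htm : padicValNat 7 t = m) (hz : z ∈ D) (hz0 : padicValNat 7 z = 0)
    (hk : k < m) (hc : 4 ≤ (level 7 D k).card) (hex : ¬ (m = 1 ∧ (level 7 D 0).card = 5))
    (hm : ∀ d ∈ D, padicValNat 7 d ≤ m) :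
    ∃ μ : ℤ, ¬ (7 : ℤ) ∣ μ ∧ ∀ d ∈ D, k ≤ padicValNat 7 d → Mid m (μ * d) := by
  set B := D.filter fun d => ¬ padicValNat 7 d = k with hB
  have hAB : (level 7 D k).card + B.card = 6 := by
    rw [← hcard]; exact Finset.card_filter_add_card_filter_not _
  have memB : ∀ {d}, d ∈ D → padicValNat 7 d ≠ k → d ∈ B := fun hd h =>
    Finset.mem_filter.2 ⟨hd, h⟩
  have htB : t ∈ B := memB ht (by omega)
  have two : ∀ {d e}, d ∈ B → e ∈ B → d ≠ t → e ≠ t → d = e := by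
    intro d e hd he h1 h2
    by_contra hne
    have : 2 < B.card := Finset.two_lt_card.2 ⟨d, hd, e, he, t, htB, hne, h1, h2⟩
    omega
  have htop : ∀ μ : ℤ, ¬ (7 : ℤ) ∣ μ → ∀ {d}, d ∈ D → padicValNat 7 d = m → Mid m (μ * d) := by
    intro μ hμ d hd hv
    have := lev_natCast (hpos d hd)
    rw [hv] at this
    exact (this.mul hμ).mid
  have hzt : z ≠ t := by rintro rfl; omega
  by_cases hE : ∃ e ∈ D, k < padicValNat 7 e ∧ padicValNat 7 e < m
  · obtain ⟨e, he, hke, hem⟩ := hE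
    have het : e ≠ t := by rintro rfl; omega
    have heB : e ∈ B := memB he (by omega)
    obtain rfl : k = 0 := by
      by_contra hk0
      have := two (memB hz (by omega)) heB hzt het
      rw [this] at hz0
      omega
    have hB2 : 1 < B.card := Finset.one_lt_card.2 ⟨e, heB, t, htB, het⟩
    obtain ⟨μ, hμ, h⟩ := Solvable.four_units_of_lev (m := m) hke hem (lev_natCast (hpos e he))
      (l := (level 7 D 0).toList.map fun d : ℕ => (d : ℤ))
      (by rw [List.length_map, Finset.length_toList]; omega) (by
        intro x hx
        obtain ⟨d, hd, rfl⟩ := List.mem_map.1 hx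
        obtain ⟨hd, hv⟩ := Finset.mem_filter.1 (Finset.mem_toList.1 hd)
        have := (lev_natCast (hpos d hd)).not_dvd
        rwa [hv, zero_add, pow_one] at this)
    refine ⟨μ, hμ, fun d hd _ => ?_⟩
    by_cases hv : padicValNat 7 d = 0
    · exact (h _ (List.mem_cons_of_mem _ (List.mem_map.2
        ⟨d, Finset.mem_toList.2 (Finset.mem_filter.2 ⟨hd, hv⟩), rfl⟩))).bounds
    · by_cases hdt : d = t
      · exact htop μ hμ hd (by rw [hdt, htm])
      · rw [two (memB hd hv) heB hdt het]
        exact (h _ (by simp)).bounds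
  push Not at hE
  obtain ⟨μ, hμ, h⟩ : Solvable (m - k) ((level 7 D k).toList.map fun d : ℕ => (d : ℤ) / 7 ^ k) := by
    have hu : ∀ x ∈ (level 7 D k).toList.map fun d : ℕ => (d : ℤ) / 7 ^ k, ¬ (7 : ℤ) ∣ x := by
      intro x hx
      obtain ⟨d, hd, rfl⟩ := List.mem_map.1 hx
      obtain ⟨hd, hv⟩ := Finset.mem_filter.1 (Finset.mem_toList.1 hd)
      obtain ⟨g, hg, hdg⟩ := lev_natCast (hpos d hd)
      rw [hdg, hv, Int.mul_ediv_cancel_left _ (pow_pos_seven k).ne']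
      exact hg
    have hl : ((level 7 D k).toList.map fun d : ℕ => (d : ℤ) / 7 ^ k).length =
        (level 7 D k).card := by
      rw [List.length_map, Finset.length_toList]
    by_cases h4 : (level 7 D k).card ≤ 4
    · exact Solvable.four_units (by omega) (by omega) hu
    have hB1 : ∀ d ∈ B, d = t := by
      have : B.card ≤ 1 := by omega
      exact fun d hd => Finset.card_le_one.1 this d hd t htB
    have hBpos : 0 < B.card := Finset.card_pos.2 ⟨t, htB⟩
    obtain rfl : k = 0 := by
      by_contra hk0
      exact hzt (hB1 z (memB hz (by omega)))
    exact Solvable.five_units (by omega) (by omega) hu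
  refine ⟨μ, hμ, fun d hd hkd => ?_⟩
  rcases hkd.lt_or_eq with hlt | heq
  · exact htop μ hμ hd (le_antisymm (hm d hd) (hE d hd hlt))
  · have h2 := h _ (List.mem_map.2
      ⟨d, Finset.mem_toList.2 (Finset.mem_filter.2 ⟨hd, heq.symm⟩), rfl⟩)
    have hdk : (7 : ℤ) ^ k ∣ d := (lev_natCast (hpos d hd)).dvd hkd
    have h3 : Safe m (μ * d) := by
      unfold Safe at h2 ⊢
      rw [← dig_pow_mul hk.le, mul_left_comm, Int.mul_ediv_cancel' hdk] at h2
      exact h2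
    exact h3.bounds

theorem exists_not_dvd {D : Finset ℕ} {p : ℕ} (hp : p ≠ 1) (hgcd : D.gcd id = 1) :
    ∃ d ∈ D, ¬ p ∣ d := by
  by_contra h
  push Not at h
  have := Finset.dvd_gcd (f := id) h
  rw [hgcd] at this
  exact hp (Nat.dvd_one.1 this)

/-- A multiplier modulo `7 ^ (m + 1)`: one level may have four or five elements and is treated
together with the levels above; the levels below it are reached by `exists_mid_descend`. -/
theorem exists_mid_of_six {D : Finset ℕ} (hcard : D.card = 6) (hpos : ∀ d ∈ D, 0 < d)
    (hgcd : D.gcd id = 1) (hex : ¬ (maxVal 7 D = 1 ∧ (level 7 D 0).card = 5)) :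
    ∃ μ : ℤ, ¬ (7 : ℤ) ∣ μ ∧ ∀ d ∈ D, Mid (maxVal 7 D) (μ * d) := by
  have hm : ∀ d ∈ D, padicValNat 7 d ≤ maxVal 7 D := fun d hd => Finset.le_sup hd
  have hne : D.Nonempty := Finset.card_pos.1 (by omega)
  obtain ⟨t, ht, htm⟩ := Finset.exists_mem_eq_sup D hne (padicValNat 7)
  obtain ⟨z, hz, hz7⟩ := exists_not_dvd (p := 7) (by norm_num) hgcd
  have hz0 : padicValNat 7 z = 0 := padicValNat.eq_zero_of_not_dvd hz7
  by_cases hall : ∀ j < maxVal 7 D, (level 7 D j).card ≤ 3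
  · refine exists_mid_descend hpos le_rfl hall ⟨1, by norm_num, fun d hd hv => ?_⟩
    have := lev_natCast (hpos d hd)
    rw [le_antisymm (hm d hd) hv] at this
    rw [one_mul]
    exact this.mid
  push Not at hall
  obtain ⟨k, hk, hc⟩ := hall
  refine exists_mid_descend hpos hk.le (fun j hj => ?_)
    (exists_mid_of_four_le hpos hcard ht htm.symm hz hz0 hk hc hex hm)
  have hdis : Disjoint (level 7 D j) (level 7 D k) := by
    refine Finset.disjoint_filter.2 fun d _ h1 h2 => ?_
    omega
  have hle : (level 7 D j ∪ level 7 D k).card ≤ D.card :=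
    Finset.card_le_card (Finset.union_subset (Finset.filter_subset _ _) (Finset.filter_subset _ _))
  rw [Finset.card_union_of_disjoint hdis] at hle
  omega

/-! ### Absolute residues and the regular chromatic number -/

theorem le_absMod {N r : ℕ} (hN : 0 < N) {x : ℤ} (h1 : (r : ℤ) ≤ x % N) (h2 : x % N ≤ N - r) :
    r ≤ absMod N (x : ZMod N) := by
  have : NeZero N := ⟨hN.ne'⟩
  unfold absMod
  rw [ZMod.valMinAbs_natAbs_eq_min, le_min_iff]
  have hv : (((x : ZMod N).val : ℕ) : ℤ) = x % N := ZMod.val_intCast x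
  have hlt := ZMod.val_lt (x : ZMod N)
  omega

/-- A multiplier `k` for `D` modulo `7 * r` serves, as `t * k`, modulo `7 * r * t` as well. -/
theorem regularChromaticMod_le {D : Finset ℕ} {r t : ℕ} (hr : 0 < r) (ht : 0 < t) {k : ℤ}
    (h : ∀ d ∈ D, (r : ℤ) ≤ k * d % (7 * r : ℕ) ∧ k * d % (7 * r : ℕ) ≤ 6 * r)
    (hD : ∀ d ∈ D, ¬ 7 * r * t ∣ d) : regularChromaticMod (7 * r * t) D ≤ 7 := by
  unfold regularChromaticMod
  rw [if_neg (by push Not; exact hD)]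
  refine iInf₂_le 7 ⟨by norm_num, ((t * k : ℤ) : ZMod (7 * r * t)), fun d hd => ?_⟩
  obtain ⟨h1, h2⟩ := h d hd
  have hmod : t * k * d % ((7 * r * t : ℕ) : ℤ) = t * (k * d % (7 * r : ℕ)) := by
    rw [mul_assoc, mul_comm (7 * r) t, Nat.cast_mul,
      Int.mul_emod_mul_of_pos _ _ (by exact_mod_cast ht)]
  have ht' : (0 : ℤ) ≤ t := Int.natCast_nonneg t
  have h3 : r * t ≤ absMod (7 * r * t) ((t * k * d : ℤ) : ZMod (7 * r * t)) := by
    have h5 := mul_le_mul_of_nonneg_left h1 ht'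
    have h6 := mul_le_mul_of_nonneg_left h2 ht'
    refine le_absMod (by positivity) ?_ ?_
    · rw [hmod, Nat.cast_mul]
      linarith
    · rw [hmod, Nat.cast_mul, Nat.cast_mul, Nat.cast_mul]
      push_cast at h6 ⊢
      linarith
  have h4 : ((7 * r * t : ℕ) : ℝ) / (7 : ℕ) = (r * t : ℕ) := by push_cast; ring
  rw [h4]
  push_cast at h3 ⊢
  exact_mod_cast h3

/-- A multiplier for one modulus `7 * r` gives multipliers for arbitrarily large moduli, which
suffices for the lower limit. -/
theorem regularChromatic_le {D : Finset ℕ} (hpos : ∀ d ∈ D, 0 < d) {r : ℕ} (hr : 0 < r) {k : ℤ}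
    (h : ∀ d ∈ D, (r : ℤ) ≤ k * d % (7 * r : ℕ) ∧ k * d % (7 * r : ℕ) ≤ 6 * r) :
    regularChromatic D ≤ 7 := by
  refine liminf_le_of_frequently_le' (frequently_atTop.2 fun n => ?_)
  -- a multiple of `7 * r` beyond `n` and beyond every element of `D`
  set t := n + D.sup id + 1 with ht
  have hle : t ≤ 7 * r * t := Nat.le_mul_of_pos_left _ (by positivity)
  refine ⟨7 * r * t, by omega, regularChromaticMod_le hr (by omega) h fun d hd hdvd => ?_⟩
  have h1 := Nat.le_of_dvd (hpos d hd) hdvd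
  have h2 : d ≤ D.sup id := Finset.le_sup (f := id) hd
  omega

/-- For `max ν_7 = 1` the modulus `98 = 2 * 49` works. Only the case of exactly five elements prime
to `7` is not inherited from the modulus `49`. -/
theorem exists_fourteen_le {D : Finset ℕ} (hcard : D.card = 6) (hpos : ∀ d ∈ D, 0 < d)
    (hgcd : D.gcd id = 1) (hm : maxVal 7 D = 1) :
    ∃ k : ℤ, ∀ d ∈ D, 14 ≤ k * d % 98 ∧ k * d % 98 ≤ 84 := by
  by_cases h5 : (level 7 D 0).card = 5
  swap
  · obtain ⟨μ, -, h⟩ := exists_mid_of_six hcard hpos hgcd fun h => h5 h.2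
    refine ⟨2 * μ, fun d hd => ?_⟩
    have := h d hd
    rw [hm] at this
    unfold Mid at this
    rw [mul_assoc]
    omega
  obtain ⟨e, heD, he1⟩ := Finset.exists_mem_eq_sup D (Finset.card_pos.1 (by omega)) (padicValNat 7)
  replace he1 : padicValNat 7 e = 1 := he1.symm.trans hm
  have heL := lev_natCast (hpos e heD)
  rw [he1] at heL
  have he49 : ¬ (49 : ℤ) ∣ e := by have := heL.not_dvd; norm_num at this; exact this
  have he7 : (7 : ℤ) ∣ e := by have := heL.dvd le_rfl; rwa [pow_one] at this
  have hnot : ∀ d ∈ level 7 D 0, ¬ (7 : ℤ) ∣ d := fun d hd => by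
    obtain ⟨hd, hv⟩ := Finset.mem_filter.1 hd
    have := (lev_natCast (hpos d hd)).not_dvd
    rwa [hv, zero_add, pow_one] at this
  have hsplit : ∀ d ∈ D, d = e ∨ d ∈ level 7 D 0 := by
    have hcomp : (D.filter fun d => ¬ padicValNat 7 d = 0).card = 1 := by
      have : (level 7 D 0).card + (D.filter fun d => ¬ padicValNat 7 d = 0).card = 6 := by
        rw [← hcard]; exact Finset.card_filter_add_card_filter_not _
      omega
    intro d hd
    by_cases hv : padicValNat 7 d = 0
    · exact .inr (Finset.mem_filter.2 ⟨hd, hv⟩)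
    · exact .inl (Finset.card_le_one.1 hcomp.le d (Finset.mem_filter.2 ⟨hd, hv⟩) e
        (Finset.mem_filter.2 ⟨heD, by omega⟩))
  by_cases hpar : ∃ d ∈ level 7 D 0, ¬ (2 : ℤ) ∣ e + d
  · obtain ⟨d, hd, hed⟩ := hpar
    obtain ⟨k, hk⟩ := exists_mid (l := ((level 7 D 0).erase d).toList.map fun x : ℕ => (x : ℤ))
      he7 he49 (hnot d hd)
      (by rw [List.length_map, Finset.length_toList, Finset.card_erase_of_mem hd, h5]) (by
        intro x hx
        obtain ⟨y, hy, rfl⟩ := List.mem_map.1 hx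
        exact hnot y (Finset.mem_of_mem_erase (Finset.mem_toList.1 hy))) hed
    refine ⟨k, fun x hx => hk x ?_⟩
    rcases hsplit x hx with rfl | hx
    · simp
    · by_cases hxd : x = d
      · simp [hxd]
      · exact List.mem_cons_of_mem _ (List.mem_cons_of_mem _ (List.mem_map.2
          ⟨x, Finset.mem_toList.2 (Finset.mem_erase.2 ⟨hxd, hx⟩), rfl⟩))
  · -- all elements have the same parity, hence are odd, and `49` sends each of them to `49`
    push Not at hpar
    have hsame : ∀ d ∈ D, (2 : ℤ) ∣ e + d := fun d hd => by
      rcases hsplit d hd with rfl | hd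
      · omega
      · exact hpar d hd
    obtain ⟨z, hz, hz2⟩ := exists_not_dvd (p := 2) (by norm_num) hgcd
    refine ⟨49, fun d hd => ?_⟩
    have h1 := hsame d hd
    have h2 := hsame z hz
    omega

theorem Mid.le {m : ℕ} {x : ℤ} (h : Mid m x) :
    ((7 ^ m : ℕ) : ℤ) ≤ x % (7 * 7 ^ m : ℕ) ∧ x % (7 * 7 ^ m : ℕ) ≤ 6 * (7 ^ m : ℕ) := by
  unfold Mid at h
  push_cast
  rwa [← pow_succ']

end LonelyRunner

theorem mainTheorem1 (D : Finset ℕ) (hcard : D.card = 6) (hpos : ∀ d ∈ D, 0 < d)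
    (hgcd : D.gcd id = 1) :
    LonelyRunner.regularChromatic D ≤ 7 ∧
    (¬ (LonelyRunner.maxVal 7 D = 1 ∧ (LonelyRunner.level 7 D 0).card = 5) →
      ∃ l : (ZMod (7 ^ (LonelyRunner.maxVal 7 D + 1)))ˣ, ∀ d ∈ D,
        ((7 ^ (LonelyRunner.maxVal 7 D + 1) : ℕ) : ℝ) / 7 ≤
          (LonelyRunner.absMod (7 ^ (LonelyRunner.maxVal 7 D + 1))
            ((l : ZMod (7 ^ (LonelyRunner.maxVal 7 D + 1))) * (d : ZMod _)) : ℝ)) ∧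
    (LonelyRunner.maxVal 7 D = 1 →
      ∃ l : ZMod 98, ∀ d ∈ D,
        (98 : ℝ) / 7 ≤ (LonelyRunner.absMod 98 (l * (d : ZMod 98)) : ℝ)) := by
  refine ⟨?_, fun hex => ?_, fun hm => ?_⟩
  · by_cases hm : LonelyRunner.maxVal 7 D = 1
    · obtain ⟨k, hk⟩ := LonelyRunner.exists_fourteen_le hcard hpos hgcd hm
      exact LonelyRunner.regularChromatic_le hpos (r := 14) (by norm_num) (k := k) hk
    · obtain ⟨μ, -, h⟩ := LonelyRunner.exists_mid_of_six hcard hpos hgcd fun h => hm h.1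
      exact LonelyRunner.regularChromatic_le hpos (pow_pos (by norm_num) _)
        fun d hd => (h d hd).le
  · obtain ⟨μ, hμ, h⟩ := LonelyRunner.exists_mid_of_six hcard hpos hgcd hex
    have hu : IsUnit (μ : ZMod (7 ^ (LonelyRunner.maxVal 7 D + 1))) := by
      rw [ZMod.coe_int_isUnit_iff_isCoprime]
      push_cast
      exact (((Nat.prime_iff_prime_int.1 (by norm_num : Nat.Prime 7)).coprime_iff_not_dvd).2
        hμ).pow_left
    refine ⟨hu.unit, fun d hd => ?_⟩
    obtain ⟨h1, h2⟩ := (h d hd).le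
    rw [← pow_succ'] at h1 h2
    have h3 := LonelyRunner.le_absMod (by positivity) h1 (by
      rw [pow_succ] at h2 ⊢; push_cast at h2 ⊢; linarith)
    have h4 : ((7 ^ (LonelyRunner.maxVal 7 D + 1) : ℕ) : ℝ) / 7 =
        (7 ^ LonelyRunner.maxVal 7 D : ℕ) := by push_cast; ring
    rw [h4, IsUnit.unit_spec]
    push_cast at h3 ⊢
    exact_mod_cast h3
  · obtain ⟨k, hk⟩ := LonelyRunner.exists_fourteen_le hcard hpos hgcd hm
    refine ⟨k, fun d hd => ?_⟩
    obtain ⟨h1, h2⟩ := hk d hd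
    have h3 := LonelyRunner.le_absMod (N := 98) (r := 14) (by norm_num) h1 (by push_cast; linarith)
    have h4 : (98 : ℝ) / 7 = (14 : ℕ) := by norm_num
    rw [h4]
    push_cast at h3 ⊢
    exact_mod_cast h3
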